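/- **Theorem 1.1 (Global approximate diagonalization).** *Conventions.* Let $-\infty\le a<b\le+\infty$, let $I=[a,b]\cap\mathbb R$, $h_0>0$, $N=n_1+n_2$ and $r\in\mathbb N$. "Of class $C^m$ on $S\times[0,h_*]$" ($S\subseteq\mathbb R$ or $S\subseteq\mathbb C\cong\mathbb R^2$) means of class $C^m$ jointly in $(x,h)$, with all derivatives of total order $\le m$ bounded on $S\times[0,h_*]$. For $F=F(x,h)$ with $h\in[0,h_*]$, "$F$ converges exponentially in $m$ derivatives as $x\to\pm\infty$" means that there are $F_\pm(h)$ and $C,\eta>0$ with $|\partial_x^j(F(x,h)-F_\pm(h))|\le Ce^{-\eta|x|}$ for all $0\le j\le m$, all $h\in[0,h_*]$ and all $x\in I$ with $\pm x\ge 0$; "decays exponentially" means the same with $F_\pm=0$. For $\delta,\beta>0$ and $M\in\mathbb R$ let $\Omega_{\delta,\beta,M}\subset\mathbb C$ be the union of the strip $\{z:|z-x|<\delta\text{ for some }x\in I\}$ with the wedge $\{|\operatorname{Im}z|<\beta(\operatorname{Re}z-M)\}$ if $b=+\infty$, and with the wedge $\{|\operatorname{Im}z|<\beta(-\operatorname{Re}z-M)\}$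 if $a=-\infty$. A function $F$ on $I\times[0,h_*]$ "has the analyticity property of order $m$ on $\Omega$" if it has an extension to $\Omega\times[0,h_*]$ that is of class $C^m$ there, analytic in $z\in\Omega$ for each $h$, and satisfies $|F(z,h)-F_\pm(h)|\le Ce^{-\eta|\operatorname{Re}z|}$ for $z\in\Omega$, $\pm\operatorname{Re}z\ge0$, at each infinite end $\pm\infty$ of $I$, for some limits $F_\pm(h)$ and some $C,\eta>0$ independent of $h$. *Statement.* Consider $hW'=A(x,h)W$, $W\in\mathbb C^N$, $x\in I$, with $A$ of class $C^r$ on $I\times[0,h_0]$. Suppose that the eigenvalues of $A(x,0)$, repeated according to algebraic multiplicity, can be listed as continuous functions $\lambda_1,\dots,\lambda_{n_1},\mu_1,\dots,\mu_{n_2}$ of $x\in I$ with $|\lambda_i(x)-\mu_j(x)|\ge d$ for all $i,j,x$ and some constant $d>0$. Then there are $h_1\in(0,h_0]$ and, for each $1\le k\le r$, matrix functions $\mathcal T^k$, $A^k_{11}$, $A^k_{22}$, $\theta^k_1$, $\theta^k_2$ on $I\times[0,h_1]$ (of sizes $N\times N$, $n_1\times n_1$, $n_2\times n_2$, $n_1\times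 n_2$, $n_2\times n_1$) such that the following hold. 1. $\mathcal T^k$ is of class $C^r$ on $I\times[0,h_1]$ and invertible with $(\mathcal T^k)^{-1}$ uniformly bounded; $A^k_{jj}$ and $\theta^k_j$ are of class $C^{r-k}$ on $I\times[0,h_1]$; and, for each $h\in(0,h_1]$, $W=\mathcal T^kW_k$ solves $hW'=AW$ on $I$ if and only if $$hW_k'=\begin{pmatrix}A^k_{11}&0\\0&A^k_{22}\end{pmatrix}W_k+h^k\begin{pmatrix}0&\theta^k_1\\\theta^k_2&0\end{pmatrix}W_k\quad\text{on }I.$$ 2. $\mathcal T^{s+1}=\mathcal T^s+O(h^{s+1})$ uniformly on $I\times[0,h_1]$, for $1\le s<r$. 3. If $b=+\infty$ and $A$ converges exponentially in $r$ derivatives as $x\to+\infty$, then, as $x\to+\infty$, each $A^k_{jj}$ converges exponentially and each $\theta^k_j$ decays exponentially in $r-k$ derivatives. If $a=-\infty$, the same holds with $-\infty$ in place of $+\infty$. 4. If $A$ has the analyticity property of order $r$ on some $\Omega_{\delta,\beta,M}$, then there is $\Omega_{\delta',\beta',M'}\subseteq\Omega_{\delta,\beta,M}$ with $\delta',\beta'>0$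 such that, for all $1\le k\le r$, $\mathcal T^k$ has the analyticity property of order $r$ on $\Omega_{\delta',\beta',M'}$, by an extension that is invertible with uniformly bounded inverse there, $A^k_{jj}$ has that property of order $r-k$, and $\theta^k_j$ has that property of order $r-k$ with limits $0$. -/

import Mathlib

open scoped Matrix.Norms.Operator

noncomputable section

/-- The closed interval `[a, b] ∩ ℝ`, where `a = -∞` and `b = +∞` are allowed. -/
def realInterval (a b : EReal) : Set ℝ :=
  {x : ℝ | a ≤ (x : EReal) ∧ (x : EReal) ≤ b}

/-- `f(x, h)` is of class `C^n` jointly in `(x, h) ∈ S × [0, h₀]`, with all derivatives of total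
order at most `n` bounded uniformly on `S × [0, h₀]`. (For `V = ℂ` differentiability is
understood over `ℝ`.) -/
def UniformCOn {V E : Type*} [NormedAddCommGroup V] [NormedSpace ℝ V]
    [NormedAddCommGroup E] [NormedSpace ℝ E]
    (n : ℕ) (f : V → ℝ → E) (S : Set V) (h₀ : ℝ) : Prop :=
  ContDiffOn ℝ n (Function.uncurry f) (S ×ˢ Set.Icc 0 h₀) ∧
    ∃ C : ℝ, ∀ j ≤ n, ∀ p ∈ S ×ˢ Set.Icc (0 : ℝ) h₀,
      ‖iteratedFDerivWithin ℝ j (Function.uncurry f) (S ×ˢ Set.Icc 0 h₀) p‖ ≤ C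

/-- `M(x, h)` is invertible with a uniformly bounded inverse for `(x, h) ∈ S × [0, h₀]`. -/
def UniformlyInvertibleOn {V ι : Type*} [Fintype ι] [DecidableEq ι]
    (M : V → ℝ → Matrix ι ι ℂ) (S : Set V) (h₀ : ℝ) : Prop :=
  ∃ C : ℝ, ∀ x ∈ S, ∀ h ∈ Set.Icc (0 : ℝ) h₀, IsUnit (M x h) ∧ ‖(M x h)⁻¹‖ ≤ C

/-- `W` solves `h W' = B(x) W` on `I`. -/
def SolvesOn {ι : Type*} [Fintype ι] (I : Set ℝ) (h : ℝ) (B : ℝ → Matrix ι ι ℂ)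
    (W : ℝ → ι → ℂ) : Prop :=
  ∀ x ∈ I, ∃ W' : ι → ℂ, HasDerivWithinAt W W' I x ∧ (h : ℂ) • W' = (B x).mulVec (W x)

/-- The coefficient matrix with diagonal blocks `P`, `Q` and off-diagonal blocks `h^k R`,
`h^k S`. -/
def blockSystem {n₁ n₂ : ℕ} (k : ℕ) (h : ℝ) (P : Matrix (Fin n₁) (Fin n₁) ℂ)
    (Q : Matrix (Fin n₂) (Fin n₂) ℂ) (R : Matrix (Fin n₁) (Fin n₂) ℂ)
    (S : Matrix (Fin n₂) (Fin n₁) ℂ) : Matrix (Fin n₁ ⊕ Fin n₂) (Fin n₁ ⊕ Fin n₂) ℂ :=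
  Matrix.fromBlocks P 0 0 Q + ((h : ℂ) ^ k) • Matrix.fromBlocks 0 R S 0

/-- `F(x, h) - L(h)` and its `x`-derivatives up to order `m` are `O(e^{-η x})` for some `η > 0`,
as `x → +∞` in `I`, uniformly in `h ∈ [0, h₀]`. -/
def ExpConvTop {E : Type*} [NormedAddCommGroup E] [NormedSpace ℝ E] (m : ℕ) (F : ℝ → ℝ → E)
    (L : ℝ → E) (I : Set ℝ) (h₀ : ℝ) : Prop :=
  ∃ C η : ℝ, 0 < η ∧ ∀ h ∈ Set.Icc (0 : ℝ) h₀, ∀ x ∈ I, 0 ≤ x → ∀ j ≤ m,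
    ‖iteratedDerivWithin j (fun y => F y h - L h) I x‖ ≤ C * Real.exp (-η * x)

/-- `F(x, h) - L(h)` and its `x`-derivatives up to order `m` are `O(e^{-η |x|})` for some `η > 0`,
as `x → -∞` in `I`, uniformly in `h ∈ [0, h₀]`. -/
def ExpConvBot {E : Type*} [NormedAddCommGroup E] [NormedSpace ℝ E] (m : ℕ) (F : ℝ → ℝ → E)
    (L : ℝ → E) (I : Set ℝ) (h₀ : ℝ) : Prop :=
  ∃ C η : ℝ, 0 < η ∧ ∀ h ∈ Set.Icc (0 : ℝ) h₀, ∀ x ∈ I, x ≤ 0 → ∀ j ≤ m,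
    ‖iteratedDerivWithin j (fun y => F y h - L h) I x‖ ≤ C * Real.exp (η * x)

/-- The strip of half-width `δ` around `[a, b]`, together with a wedge
`|Im z| < β (Re z - M)` around `+∞` if `b = +∞` and a wedge `|Im z| < β (-Re z - M)` around `-∞`
if `a = -∞`. For `a = -∞`, `b = +∞` the first set is `{|Im z| < δ}`. -/
def stripWedge (a b : EReal) (δ β M : ℝ) : Set ℂ :=
  {z : ℂ | ∃ x ∈ realInterval a b, ‖z - (x : ℂ)‖ < δ} ∪
    {z : ℂ | b = ⊤ ∧ |z.im| < β * (z.re - M)} ∪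
    {z : ℂ | a = ⊥ ∧ |z.im| < β * (-z.re - M)}

/-- `G` is an extension of `F` from `[a, b]` to `Ω ⊆ ℂ` that is analytic in `z ∈ Ω` for each
`h ∈ [0, h₀]`, of class `C^n` in `(z, h)` uniformly on `Ω × [0, h₀]`, and exponentially converging
to `Lp(h)` as `Re z → +∞` (if `b = +∞`) and to `Lm(h)` as `Re z → -∞` (if `a = -∞`), uniformly
in `Im z` and `h`. -/
def IsAnalyticExtension {E : Type*} [NormedAddCommGroup E] [NormedSpace ℝ E] [NormedSpace ℂ E]
    (n : ℕ) (a b : EReal) (Ω : Set ℂ) (h₀ : ℝ) (F : ℝ → ℝ → E) (G : ℂ → ℝ → E)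
    (Lp Lm : ℝ → E) : Prop :=
  (∀ x ∈ realInterval a b, ∀ h ∈ Set.Icc (0 : ℝ) h₀, G (x : ℂ) h = F x h) ∧
  (∀ h ∈ Set.Icc (0 : ℝ) h₀, DifferentiableOn ℂ (fun z => G z h) Ω) ∧
  UniformCOn n G Ω h₀ ∧
  ∃ C η : ℝ, 0 < η ∧ ∀ h ∈ Set.Icc (0 : ℝ) h₀, ∀ z ∈ Ω,
    (b = ⊤ → 0 ≤ z.re → ‖G z h - Lp h‖ ≤ C * Real.exp (-η * z.re)) ∧
    (a = ⊥ → z.re ≤ 0 → ‖G z h - Lm h‖ ≤ C * Real.exp (η * z.re))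

end

open scoped Matrix.Norms.Operator

noncomputable section

set_option linter.unusedSectionVars false

open Set Filter Topology

universe u

/-! The usual construction block-diagonalizes one order in `h` at a time and pays a derivative of
the transformation for each order. Here a single transformation `T` of class `C^r` serves all `k`.
Its off-diagonal remainder `O` can be written, for every `1 ≤ k ≤ r` at once, as `h ^ k` times a
function of class `C^{r-k}`. Consequently consecutive transformations coincide, and the comparison
`T^{s+1} = T^s + O(h^{s+1})` is trivial.

The transformation is a product `S L U` with `L` unipotent lower and `U` unipotent upper
block-triangular. After conjugation by `S`, with conjugated coefficient `M`, the lower block `Z` of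
`L` should solve the Riccati equation `h Z' = M₂₁ + M₂₂ Z - Z M₁₁ - Z M₁₂ Z`, and the upper block
`X` of `U` a linear equation of the same shape (`Frame.exists_blockDiag`, `Frame.exists_transform`).
Formal iteration of these equations loses derivatives because of the term `h Z'`. So `h ∂` is
replaced by an operator `diffOp` that maps `C^r` to `C^r`. For a flow with generator `Y`, let `avg`
be the mean over times in `[0, h]`, let `osc = 1 - avg`, and let `inc f` be the increment over time
`h`. Then `inc f = h avg (Y f)`, and `∑_{i<r} osc^i avg = 1 - osc^r`, so `∑_{i<r} osc^i (inc f) = h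
(Y f - osc^r (Y f))`. Integration by parts shows that `osc` turns one derivative into one factor
`h`. Hence `diffOp f - h ∂f` is of the form `h ^ k C^{r-k}` for every `1 ≤ k ≤ r`
(`Frame.Small.diffOp_sub`). With `diffOp` in place of `h ∂`, each correction by a Sylvester equation
gains one order and keeps `C^r` (`Frame.exists_approx_riccati`). The spectral gap bounds the inverse
Sylvester operators uniformly, by compactness (`Matrix.exists_sylBound`).

The iteration starts from a small root of the algebraic Riccati equation, which exists once `S`
nearly block-triangularizes `A(x, 0)`. Such an `S` comes from unitary triangularizers at grid
points: neighbouring ones can be taken close to each other (`Matrix.exists_isTriangularizer_near`),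
and a smooth interpolation then stays close to them. The term `h S'` is harmless for small `h`.

All of this takes place in a `Frame`, which is either a real interval or a shrinking chain of
complex regions, with flows that map each domain into the previous one. The class `Frame.Cls`
records joint smoothness in `(v, h)`, smoothness in `v` over the field, and exponential convergence
at the ends. Since every operation above respects it, exponential convergence and analyticity come
along with the construction. In the complex case `S` is replaced by a polynomial in the sigmoid
function, and Cauchy estimates supply the bounds on the derivatives of `A`. -/

/-- The maps `F i`, for `i` in an index type, are `C^n` over `𝕂` on `K`, and all their derivatives
of order at most `n` are bounded by a multiple of the weight `w` that does not depend on `i`. -/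
def BddSmooth (𝕂 : Type*) [NontriviallyNormedField 𝕂] {ι X E : Type*} [NormedAddCommGroup X]
    [NormedSpace 𝕂 X] [NormedAddCommGroup E] [NormedSpace 𝕂 E]
    (n : ℕ) (w : X → ℝ) (K : Set X) (F : ι → X → E) : Prop :=
  (∀ i, ContDiffOn 𝕂 n (F i) K) ∧
    ∃ C : ℝ, ∀ i, ∀ j ≤ n, ∀ p ∈ K, ‖iteratedFDerivWithin 𝕂 j (F i) K p‖ ≤ C * w p

/-! ### Calculus of families of maps with uniformly bounded derivatives -/

namespace BddSmooth

section Basic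

variable {𝕂 : Type*} [NontriviallyNormedField 𝕂] {ι ι' X Y E E₁ E₂ E₃ : Type*}
  [NormedAddCommGroup X] [NormedSpace 𝕂 X] [NormedAddCommGroup Y] [NormedSpace 𝕂 Y]
  [NormedAddCommGroup E] [NormedSpace 𝕂 E]
  [NormedAddCommGroup E₁] [NormedSpace 𝕂 E₁] [NormedAddCommGroup E₂] [NormedSpace 𝕂 E₂]
  [NormedAddCommGroup E₃] [NormedSpace 𝕂 E₃]
  {n m : ℕ} {w : X → ℝ} {K : Set X} {F G : ι → X → E}

theorem bound (h : BddSmooth 𝕂 n w K F) : ∃ C : ℝ, ∀ i, ∀ p ∈ K, ‖F i p‖ ≤ C * w p := by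
  obtain ⟨C, hC⟩ := h.2
  exact ⟨C, fun i p hp => by simpa using hC i 0 (Nat.zero_le _) p hp⟩

theorem bound_one (h : BddSmooth 𝕂 n (fun _ => 1) K F) :
    ∃ C : ℝ, 0 ≤ C ∧ ∀ i, ∀ p ∈ K, ‖F i p‖ ≤ C := by
  obtain ⟨C, hC⟩ := h.bound
  exact ⟨max C 0, le_max_right _ _, fun i p hp =>
    (hC i p hp).trans (by rw [mul_one]; exact le_max_left _ _)⟩

theorem continuousOn (h : BddSmooth 𝕂 n w K F) (i : ι) : ContinuousOn (F i) K :=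
  (h.1 i).continuousOn

theorem zero_iff : BddSmooth 𝕂 0 w K F ↔
    (∀ i, ContinuousOn (F i) K) ∧ ∃ C : ℝ, ∀ i, ∀ p ∈ K, ‖F i p‖ ≤ C * w p := by
  refine ⟨fun h => ⟨h.continuousOn, h.bound⟩, fun ⟨h, C, hC⟩ => ⟨fun i => ?_, C, ?_⟩⟩
  · exact contDiffOn_zero.2 (h i)
  · intro i j hj p hp
    obtain rfl : j = 0 := by omega
    simpa using hC i p hp

theorem fderivWithin (hK : UniqueDiffOn 𝕂 K) (h : BddSmooth 𝕂 (n + 1) w K F) :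
    BddSmooth 𝕂 n w K (fun i => fderivWithin 𝕂 (F i) K) := by
  refine ⟨fun i => ((contDiffOn_succ_iff_fderivWithin (n := n) hK).1
    (by exact_mod_cast h.1 i)).2.2, ?_⟩
  obtain ⟨C, hC⟩ := h.2
  refine ⟨C, fun i j hj p hp => ?_⟩
  rw [norm_iteratedFDerivWithin_fderivWithin hK hp]
  exact hC i (j + 1) (by omega) p hp

theorem hasFDerivWithinAt (hF : BddSmooth 𝕂 n w K F) (hn : n ≠ 0) (i : ι) {p : X} (hp : p ∈ K) :
    HasFDerivWithinAt (F i) (_root_.fderivWithin 𝕂 (F i) K p) K p :=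
  (((hF.1 i).differentiableOn (by exact_mod_cast hn)) p hp).hasFDerivWithinAt

/-- The inductive step of most smoothness proofs below: it suffices to exhibit a derivative that is
one order less smooth. -/
theorem succ_of_hasFDerivWithinAt (hK : UniqueDiffOn 𝕂 K) {F' : ι → X → X →L[𝕂] E}
    (hw : ∀ p ∈ K, 0 ≤ w p) (hb : ∃ C : ℝ, ∀ i, ∀ p ∈ K, ‖F i p‖ ≤ C * w p)
    (hd : ∀ i, ∀ p ∈ K, HasFDerivWithinAt (F i) (F' i p) K p) (h : BddSmooth 𝕂 n w K F') :
    BddSmooth 𝕂 (n + 1) w K F := by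
  obtain ⟨C, hC⟩ := hb
  obtain ⟨C', hC'⟩ := h.2
  have hF' : ∀ i, EqOn (_root_.fderivWithin 𝕂 (F i) K) (F' i) K :=
    fun i p hp => (hd i p hp).fderivWithin (hK p hp)
  refine ⟨fun i => ?_, max C C', fun i j hj p hp => ?_⟩
  · have := (contDiffOn_succ_iff_fderivWithin (n := n) (f := F i) hK).2
      ⟨fun p hp => (hd i p hp).differentiableWithinAt, by simp, (h.1 i).congr (hF' i)⟩
    exact_mod_cast this
  · rcases j with _ | j
    · rw [norm_iteratedFDerivWithin_zero]
      exact (hC i p hp).trans (mul_le_mul_of_nonneg_right (le_max_left _ _) (hw p hp))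
    · rw [← norm_iteratedFDerivWithin_fderivWithin hK hp, iteratedFDerivWithin_congr (hF' i) hp]
      exact (hC' i j (by omega) p hp).trans
        (mul_le_mul_of_nonneg_right (le_max_right _ _) (hw p hp))

theorem of_le (h : BddSmooth 𝕂 n w K F) (hmn : m ≤ n) : BddSmooth 𝕂 m w K F := by
  obtain ⟨C, hC⟩ := h.2
  exact ⟨fun i => (h.1 i).of_le (by exact_mod_cast hmn), C,
    fun i j hj p hp => hC i j (hj.trans hmn) p hp⟩

theorem mono_set {K' : Set X} (h : BddSmooth 𝕂 n w K F) (hK : UniqueDiffOn 𝕂 K)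
    (hK' : UniqueDiffOn 𝕂 K') (hs : K' ⊆ K) : BddSmooth 𝕂 n w K' F := by
  obtain ⟨C, hC⟩ := h.2
  refine ⟨fun i => (h.1 i).mono hs, C, fun i j hj p hp => ?_⟩
  rw [iteratedFDerivWithin_subset hs hK' hK ((h.1 i).of_le (by exact_mod_cast hj)) hp]
  exact hC i j hj p (hs hp)

theorem congr (h : BddSmooth 𝕂 n w K F) (hFG : ∀ i, ∀ p ∈ K, G i p = F i p) :
    BddSmooth 𝕂 n w K G := by
  obtain ⟨C, hC⟩ := h.2
  refine ⟨fun i => (h.1 i).congr (hFG i), C, fun i j hj p hp => ?_⟩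
  rw [iteratedFDerivWithin_congr (fun q hq => hFG i q hq) hp]
  exact hC i j hj p hp

theorem reindex (h : BddSmooth 𝕂 n w K F) (e : ι' → ι) :
    BddSmooth 𝕂 n w K (fun i => F (e i)) := by
  obtain ⟨C, hC⟩ := h.2
  exact ⟨fun i => h.1 (e i), C, fun i => hC (e i)⟩

theorem zero : BddSmooth 𝕂 n w K (fun (_ : ι) (_ : X) => (0 : E)) := by
  refine ⟨fun i => contDiffOn_const, 0, fun i j hj p hp => ?_⟩
  have : iteratedFDerivWithin 𝕂 j (fun _ : X => (0 : E)) K = 0 := by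
    simp
  simp [this]

theorem const (hK : UniqueDiffOn 𝕂 K) {c : ι → E} {C : ℝ} (hc : ∀ i, ‖c i‖ ≤ C) :
    BddSmooth 𝕂 n (fun _ => 1) K (fun i _ => c i) := by
  have h0 : ∃ C : ℝ, ∀ i, ∀ p ∈ K, ‖c i‖ ≤ C * 1 := ⟨C, fun i p _ => by simpa using hc i⟩
  rcases n with _ | n
  · exact zero_iff.2 ⟨fun i => continuousOn_const, h0⟩
  · exact succ_of_hasFDerivWithinAt hK (fun _ _ => zero_le_one) h0
      (fun i p _ => hasFDerivWithinAt_const (c i) p K) zero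

theorem add (hK : UniqueDiffOn 𝕂 K) (hF : BddSmooth 𝕂 n w K F) (hG : BddSmooth 𝕂 n w K G) :
    BddSmooth 𝕂 n w K (fun i p => F i p + G i p) := by
  obtain ⟨C, hC⟩ := hF.2
  obtain ⟨C', hC'⟩ := hG.2
  refine ⟨fun i => (hF.1 i).add (hG.1 i), C + C', fun i j hj p hp => ?_⟩
  have h1 : iteratedFDerivWithin 𝕂 j (fun p => F i p + G i p) K p
      = iteratedFDerivWithin 𝕂 j (F i) K p + iteratedFDerivWithin 𝕂 j (G i) K p :=
    iteratedFDerivWithin_add_apply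
      (((hF.1 i).of_le (by exact_mod_cast hj)).contDiffWithinAt hp)
      (((hG.1 i).of_le (by exact_mod_cast hj)).contDiffWithinAt hp) hK hp
  rw [h1, add_mul]
  exact (norm_add_le _ _).trans (add_le_add (hC i j hj p hp) (hC' i j hj p hp))

theorem clm (hK : UniqueDiffOn 𝕂 K) (L : E →L[𝕂] E₁) (hF : BddSmooth 𝕂 n w K F) :
    BddSmooth 𝕂 n w K (fun i p => L (F i p)) := by
  obtain ⟨C, hC⟩ := hF.2
  refine ⟨fun i => L.contDiff.comp_contDiffOn (hF.1 i), ‖L‖ * C, fun i j hj p hp => ?_⟩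
  have h1 := L.norm_iteratedFDerivWithin_comp_left
    (((hF.1 i).of_le (by exact_mod_cast hj)).contDiffWithinAt hp) hK hp le_rfl
  refine h1.trans ?_
  rw [mul_assoc]
  exact mul_le_mul_of_nonneg_left (hC i j hj p hp) (norm_nonneg L)

theorem neg (hK : UniqueDiffOn 𝕂 K) (hF : BddSmooth 𝕂 n w K F) :
    BddSmooth 𝕂 n w K (fun i p => -F i p) := by
  simpa using hF.clm hK (-ContinuousLinearMap.id 𝕂 E)

theorem sub (hK : UniqueDiffOn 𝕂 K) (hF : BddSmooth 𝕂 n w K F) (hG : BddSmooth 𝕂 n w K G) :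
    BddSmooth 𝕂 n w K (fun i p => F i p - G i p) := by
  simpa [sub_eq_add_neg] using hF.add hK (hG.neg hK)

/-- Leibniz rule; the constant `2 ^ n` bounds the sum of binomial coefficients. Only one factor
carries the weight, so a product decays as soon as one factor does and the other is bounded. -/
theorem bilin (hK : UniqueDiffOn 𝕂 K) (B : E₁ →L[𝕂] E₂ →L[𝕂] E₃) {F : ι → X → E₁}
    {G : ι → X → E₂} (hF : BddSmooth 𝕂 n w K F) (hG : BddSmooth 𝕂 n (fun _ => 1) K G) :
    BddSmooth 𝕂 n w K (fun i p => B (F i p) (G i p)) := by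
  obtain ⟨C, hC⟩ := hF.2
  obtain ⟨C', hC'⟩ := hG.2
  refine ⟨fun i => (B.contDiff.comp_contDiffOn (hF.1 i)).clm_apply (hG.1 i),
    ‖B‖ * (2 ^ n * (C * |C'|)), fun i j hj p hp => ?_⟩
  refine (B.norm_iteratedFDerivWithin_le_of_bilinear (hF.1 i) (hG.1 i) hK hp
    (by exact_mod_cast hj)).trans ?_
  rw [mul_assoc]
  refine mul_le_mul_of_nonneg_left ?_ (norm_nonneg B)
  have hCw : 0 ≤ C * w p := (norm_nonneg _).trans (hC i 0 (Nat.zero_le _) p hp)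
  calc ∑ a ∈ Finset.range (j + 1), (j.choose a : ℝ) * ‖iteratedFDerivWithin 𝕂 a (F i) K p‖ *
          ‖iteratedFDerivWithin 𝕂 (j - a) (G i) K p‖
      ≤ ∑ a ∈ Finset.range (j + 1), (j.choose a : ℝ) * (C * w p) * |C'| := by
        refine Finset.sum_le_sum fun a ha => ?_
        have ha' : a ≤ j := by simpa [Nat.lt_succ_iff] using ha
        gcongr
        · exact hC i a (ha'.trans hj) p hp
        · refine (hC' i (j - a) ((Nat.sub_le _ _).trans hj) p hp).trans ?_
          rw [mul_one]; exact le_abs_self _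
    _ = 2 ^ j * (C * w p) * |C'| := by
        rw [← Finset.sum_mul, ← Finset.sum_mul]
        congr 2
        exact_mod_cast Nat.sum_range_choose j
    _ ≤ 2 ^ n * (C * w p) * |C'| := by
        gcongr
        norm_num
    _ = 2 ^ n * (C * |C'|) * w p := by ring

theorem bilin' (hK : UniqueDiffOn 𝕂 K) (B : E₁ →L[𝕂] E₂ →L[𝕂] E₃) {F : ι → X → E₁}
    {G : ι → X → E₂} (hF : BddSmooth 𝕂 n (fun _ => 1) K F) (hG : BddSmooth 𝕂 n w K G) :
    BddSmooth 𝕂 n w K (fun i p => B (F i p) (G i p)) := by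
  simpa using bilin hK B.flip hG hF

end Basic

section Induction

variable {𝕂 : Type*} [NontriviallyNormedField 𝕂] {ι : Type*} {X : Type u}
  [NormedAddCommGroup X] [NormedSpace 𝕂 X] {n : ℕ} {K : Set X}

/-- The identity `G q - G p = -G q (F q - F p) G p` yields continuity from mere boundedness of `G`,
and then the derivative `-G (DF) G`. The latter involves `G` only at the order already reached, so
induction on `n` applies. -/
theorem inverse {R : Type*} [NormedRing R] [NormedAlgebra 𝕂 R] {F G : ι → X → R} {C : ℝ}
    (hK : UniqueDiffOn 𝕂 K) (hF : BddSmooth 𝕂 n (fun _ => 1) K F)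
    (hG : ∀ i, ∀ p ∈ K, ‖G i p‖ ≤ C) (hFG : ∀ i, ∀ p ∈ K, F i p * G i p = 1)
    (hGF : ∀ i, ∀ p ∈ K, G i p * F i p = 1) :
    BddSmooth 𝕂 n (fun _ => 1) K G := by
  have hb : ∃ C : ℝ, ∀ i, ∀ p ∈ K, ‖G i p‖ ≤ C * 1 := ⟨C, by simpa using hG⟩
  have hdiff : ∀ i, ∀ p ∈ K, ∀ q ∈ K, G i q - G i p = -(G i q * (F i q - F i p) * G i p) := by
    intro i p hp q hq
    rw [mul_sub, sub_mul, hGF i q hq, one_mul, mul_assoc, hFG i p hp, mul_one]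
    abel
  have hcont : ∀ i, ContinuousOn (G i) K := by
    intro i p hp
    have h1 : Tendsto (fun q => C * ‖F i q - F i p‖ * ‖G i p‖) (𝓝[K] p) (𝓝 0) := by
      have h2 : Tendsto (fun q => ‖F i q - F i p‖) (𝓝[K] p) (𝓝 0) :=
        tendsto_iff_norm_sub_tendsto_zero.1 (hF.continuousOn i p hp)
      simpa using (h2.const_mul C).mul_const ‖G i p‖
    refine tendsto_iff_norm_sub_tendsto_zero.2 (squeeze_zero' ?_ ?_ h1)
    · exact Eventually.of_forall fun _ => norm_nonneg _
    · filter_upwards [self_mem_nhdsWithin] with q hq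
      rw [hdiff i p hp q hq, norm_neg]
      refine (norm_mul_le _ _).trans (mul_le_mul_of_nonneg_right ?_ (norm_nonneg _))
      exact (norm_mul_le _ _).trans (mul_le_mul_of_nonneg_right (hG i q hq) (norm_nonneg _))
  induction n with
  | zero => exact zero_iff.2 ⟨hcont, hb⟩
  | succ n ih =>
    have hGn := ih (hF.of_le (Nat.le_succ n))
    have hF' := hF.fderivWithin hK
    -- the derivative is `-G (DF) G`
    let ml : R →L[𝕂] R →L[𝕂] R := ContinuousLinearMap.mul 𝕂 R
    have hd : ∀ i, ∀ p ∈ K, HasFDerivWithinAt (G i)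
        (-(((ContinuousLinearMap.compL 𝕂 X R R) ((ml.flip) (G i p)))
          (((ContinuousLinearMap.compL 𝕂 X R R) (ml (G i p)))
            (_root_.fderivWithin 𝕂 (F i) K p)))) K p := by
      intro i p hp
      have h1 := hF.hasFDerivWithinAt (Nat.succ_ne_zero n) i hp
      rw [hasFDerivWithinAt_iff_isLittleO]
      have h2 := (hasFDerivWithinAt_iff_isLittleO.1 h1)
      have e : ∀ q ∈ K, G i q - G i p - (-(((ContinuousLinearMap.compL 𝕂 X R R) ((ml.flip) (G i p)))
          (((ContinuousLinearMap.compL 𝕂 X R R) (ml (G i p)))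
            (_root_.fderivWithin 𝕂 (F i) K p)))) (q - p) =
          -(G i p * (F i q - F i p - (_root_.fderivWithin 𝕂 (F i) K p) (q - p)) * G i p)
          - (G i q - G i p) * (F i q - F i p) * G i p := by
        intro q hq
        nth_rewrite 1 [hdiff i p hp q hq]
        simp only [ContinuousLinearMap.compL_apply, neg_apply,
          ContinuousLinearMap.coe_comp, Function.comp_apply, ContinuousLinearMap.flip_apply,
          ContinuousLinearMap.mul_apply', ml]
        noncomm_ring
      have h3 : (fun q => -(G i p * (F i q - F i p - (_root_.fderivWithin 𝕂 (F i) K p) (q - p)) * G i p)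
          - (G i q - G i p) * (F i q - F i p) * G i p) =o[𝓝[K] p] fun q => q - p := by
        refine Asymptotics.IsLittleO.sub ?_ ?_
        · refine Asymptotics.IsLittleO.neg_left ?_
          have h4 := ((ml.flip (G i p)).isBigO_comp
            (fun q => G i p * (F i q - F i p - (_root_.fderivWithin 𝕂 (F i) K p) (q - p))) (𝓝[K] p))
          have h5 := ((ml (G i p)).isBigO_comp
            (fun q => (F i q - F i p - (_root_.fderivWithin 𝕂 (F i) K p) (q - p))) (𝓝[K] p))
          exact h4.trans_isLittleO (h5.trans_isLittleO h2)
        · have h4 := ((ml.flip (G i p)).isBigO_comp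
            (fun q => (G i q - G i p) * (F i q - F i p)) (𝓝[K] p))
          refine h4.trans_isLittleO ?_
          have h5 : (fun q => G i q - G i p) =o[𝓝[K] p] (fun _ => (1 : ℝ)) := by
            rw [Asymptotics.isLittleO_one_iff]
            simpa using (hcont i p hp).sub_const (G i p)
          have h6 : (fun q => (G i q - G i p) * (F i q - F i p)) =o[𝓝[K] p]
              fun q => (1 : ℝ) * ‖q - p‖ :=
            h5.mul_isBigO (R := R) h1.isBigO_sub.norm_right
          simpa using h6
      refine h3.congr' ?_ (EventuallyEq.refl _ _)
      filter_upwards [self_mem_nhdsWithin] with q hq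
      rw [e q hq]
    refine succ_of_hasFDerivWithinAt hK (fun _ _ => zero_le_one) hb hd (neg hK ?_)
    exact bilin' hK ((ContinuousLinearMap.compL 𝕂 X R R).comp ml.flip) hGn
      (bilin' hK ((ContinuousLinearMap.compL 𝕂 X R R).comp ml) hGn hF')

end Induction

end BddSmooth

/-! ### Smoothness of bounded solutions of quadratic equations -/

theorem ContinuousLinearMap.exists_inverse_of_bound {𝕂 E : Type*} [RCLike 𝕂]
    [NormedAddCommGroup E] [NormedSpace 𝕂 E] [FiniteDimensional 𝕂 E] (L : E →L[𝕂] E) {κ : ℝ}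
    (hκ : 0 ≤ κ) (h : ∀ Y, ‖Y‖ ≤ κ * ‖L Y‖) :
    ∃ G : E →L[𝕂] E, ‖G‖ ≤ κ ∧ L * G = 1 ∧ G * L = 1 := by
  have hinj : Function.Injective (L : E →ₗ[𝕂] E) := by
    rw [injective_iff_map_eq_zero]
    intro Y hY
    have := h Y
    rw [show L Y = 0 from hY, norm_zero, mul_zero] at this
    exact norm_le_zero_iff.1 this
  let e := LinearEquiv.ofInjectiveEndo _ hinj
  have he : ∀ Y, e Y = L Y := fun Y => rfl
  refine ⟨LinearMap.toContinuousLinearMap (e.symm : E →ₗ[𝕂] E),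
    ContinuousLinearMap.opNorm_le_bound _ hκ fun Y => ?_, ?_, ?_⟩
  · have := h (e.symm Y)
    rwa [← he, e.apply_symm_apply] at this
  · ext1 Y; exact e.apply_symm_apply Y
  · ext1 Y; exact e.symm_apply_apply Y

namespace BddSmooth

section Riccati

variable {𝕂 : Type*} [RCLike 𝕂]
  {ι : Type*} {X : Type*} [NormedAddCommGroup X] [NormedSpace 𝕂 X] {n : ℕ} {K : Set X}
  {E EA EB EQ : Type*} [NormedAddCommGroup E] [NormedSpace 𝕂 E]
  [NormedAddCommGroup EA] [NormedSpace 𝕂 EA] [NormedAddCommGroup EB] [NormedSpace 𝕂 EB]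
  [NormedAddCommGroup EQ] [NormedSpace 𝕂 EQ]

/-- A bounded solution `Z` of a quadratic equation with smooth coefficients is smooth, provided the
linearized operators are uniformly invertible. -/
theorem quadratic [FiniteDimensional 𝕂 E] (hK : UniqueDiffOn 𝕂 K)
    (β : EB →L[𝕂] E →L[𝕂] E) (α : EA →L[𝕂] E →L[𝕂] E) (θ : EQ →L[𝕂] E →L[𝕂] E →L[𝕂] E)
    {c Z : ι → X → E} {B : ι → X → EB} {A : ι → X → EA} {Q : ι → X → EQ} {κ C : ℝ} (hκ : 0 ≤ κ)
    (hc : BddSmooth 𝕂 n (fun _ => 1) K c) (hB : BddSmooth 𝕂 n (fun _ => 1) K B)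
    (hA : BddSmooth 𝕂 n (fun _ => 1) K A) (hQ : BddSmooth 𝕂 n (fun _ => 1) K Q)
    (hZ : ∀ i, ∀ p ∈ K, ‖Z i p‖ ≤ C)
    (heq : ∀ i, ∀ p ∈ K, c i p + β (B i p) (Z i p) - α (A i p) (Z i p)
      - θ (Q i p) (Z i p) (Z i p) = 0)
    (hinv : ∀ i, ∀ p ∈ K, ∀ q ∈ K, ∀ Y : E, ‖Y‖ ≤ κ * ‖β (B i q) Y - α (A i q) Y
      - θ (Q i q) (Z i p) Y - θ (Q i q) Y (Z i q)‖) :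
    BddSmooth 𝕂 n (fun _ => 1) K Z := by
  have hb : ∃ C : ℝ, ∀ i, ∀ p ∈ K, ‖Z i p‖ ≤ C * 1 := ⟨C, by simpa using hZ⟩
  -- Subtracting the equations at `p` and `q` gives exactly `Λ p q (Z q - Z p) = -R p q`, where `R`
  -- is the change of the coefficients with `Z` frozen at `p`. The operator is linearized at two
  -- points at once, so `hinv` controls `Z q - Z p` directly and no implicit function theorem is
  -- needed.
  let Λ : ι → X → X → E →L[𝕂] E := fun i p q =>
    β (B i q) - α (A i q) - θ (Q i q) (Z i p) - (θ (Q i q)).flip (Z i q)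
  have hΛa : ∀ i p q Y, Λ i p q Y = β (B i q) Y - α (A i q) Y
      - θ (Q i q) (Z i p) Y - θ (Q i q) Y (Z i q) := fun i p q Y => rfl
  let R : ι → X → X → E := fun i p q => (c i q - c i p) + β (B i q - B i p) (Z i p)
    - α (A i q - A i p) (Z i p) - θ (Q i q - Q i p) (Z i p) (Z i p)
  have hdiff : ∀ i, ∀ p ∈ K, ∀ q ∈ K, Λ i p q (Z i q - Z i p) = - R i p q := by
    intro i p hp q hq
    have h1 := heq i p hp
    have h2 := heq i q hq
    have h3 : Λ i p q (Z i q - Z i p) + R i p q =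
      (c i q + β (B i q) (Z i q) - α (A i q) (Z i q) - θ (Q i q) (Z i q) (Z i q)) -
      (c i p + β (B i p) (Z i p) - α (A i p) (Z i p) - θ (Q i p) (Z i p) (Z i p)) := by
      simp only [hΛa, R, map_sub, sub_apply]
      abel
    rw [h1, h2, sub_zero] at h3
    exact eq_neg_of_add_eq_zero_left h3
  have hbd : ∀ i, ∀ p ∈ K, ∀ q ∈ K, ‖Z i q - Z i p‖ ≤ κ * ‖R i p q‖ := by
    intro i p hp q hq
    have := hinv i p hp q hq (Z i q - Z i p)
    rwa [← hΛa, hdiff i p hp q hq, norm_neg] at this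
  have hcont : ∀ i, ContinuousOn (Z i) K := by
    intro i p hp
    have h1 : Tendsto (R i p) (𝓝[K] p) (𝓝 0) := by
      have hc' := (hc.continuousOn i p hp).sub_const (c i p)
      have hB' := ((β.flip (Z i p)).continuous.tendsto _).comp
          ((hB.continuousOn i p hp).sub_const (B i p))
      have hA' := ((α.flip (Z i p)).continuous.tendsto _).comp
          ((hA.continuousOn i p hp).sub_const (A i p))
      have hQ' := ((((ContinuousLinearMap.apply 𝕂 E (Z i p)).comp (θ.flip (Z i p))).continuous.tendsto
          _).comp ((hQ.continuousOn i p hp).sub_const (Q i p)))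
      have h := ((hc'.add hB').sub hA').sub hQ'
      simp only [sub_self, map_zero, add_zero] at h
      exact h
    refine tendsto_iff_norm_sub_tendsto_zero.2 (squeeze_zero' ?_ ?_
      (by simpa using h1.norm.const_mul κ))
    · exact Eventually.of_forall fun _ => norm_nonneg _
    · filter_upwards [self_mem_nhdsWithin] with q hq
      exact hbd i p hp q hq
  induction n with
  | zero => exact zero_iff.2 ⟨hcont, hb⟩
  | succ n ih =>
    have hZn := ih (hc.of_le n.le_succ) (hB.of_le n.le_succ) (hA.of_le n.le_succ)
      (hQ.of_le n.le_succ)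
    have hG : ∀ i, ∀ p, ∃ G : E →L[𝕂] E, p ∈ K → (‖G‖ ≤ κ ∧
        Λ i p p * G = 1 ∧ G * Λ i p p = 1) := by
      intro i p
      by_cases hp : p ∈ K
      · obtain ⟨G, hG⟩ := ContinuousLinearMap.exists_inverse_of_bound (Λ i p p) hκ (hinv i p hp p hp)
        exact ⟨G, fun _ => hG⟩
      · exact ⟨0, fun h => absurd h hp⟩
    choose G hG using hG
    have hΛs : BddSmooth 𝕂 n (fun _ => 1) K (fun i p => Λ i p p) :=
      (((clm hK β (hB.of_le n.le_succ)).sub hK (clm hK α (hA.of_le n.le_succ))).sub hK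
        (bilin hK θ (hQ.of_le n.le_succ) hZn)).sub hK
        (bilin hK ((ContinuousLinearMap.flipₗᵢ 𝕂 E E E).toContinuousLinearEquiv.toContinuousLinearMap.comp
          θ) (hQ.of_le n.le_succ) hZn)
    have hGs : BddSmooth 𝕂 n (fun _ => 1) K G :=
      inverse hK hΛs (fun i p hp => (hG i p hp).1) (fun i p hp => (hG i p hp).2.1)
        (fun i p hp => (hG i p hp).2.2)
    -- The derivative of `q ↦ R p q` at `q = p`. The derivative of `Z` will be `-(Λ p p)⁻¹ R'`.
    let R' : ι → X → X →L[𝕂] E := fun i p =>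
      _root_.fderivWithin 𝕂 (c i) K p +
      (β.flip (Z i p)).comp (_root_.fderivWithin 𝕂 (B i) K p) -
      (α.flip (Z i p)).comp (_root_.fderivWithin 𝕂 (A i) K p) -
      (ContinuousLinearMap.apply 𝕂 E (Z i p)).comp
        ((θ.flip (Z i p)).comp (_root_.fderivWithin 𝕂 (Q i) K p))
    have hR' : BddSmooth 𝕂 n (fun _ => 1) K R' := by
      refine (((hc.fderivWithin hK).add hK ?_).sub hK ?_).sub hK ?_
      · exact bilin' hK ((ContinuousLinearMap.compL 𝕂 X _ _).comp β.flip) hZn (hB.fderivWithin hK)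
      · exact bilin' hK ((ContinuousLinearMap.compL 𝕂 X _ _).comp α.flip) hZn (hA.fderivWithin hK)
      · exact bilin' hK ((ContinuousLinearMap.compL 𝕂 X _ _).comp (ContinuousLinearMap.apply 𝕂 E))
          hZn (bilin' (E₂ := X →L[𝕂] EQ) (E₃ := X →L[𝕂] E →L[𝕂] E) hK
            ((ContinuousLinearMap.compL 𝕂 X _ _).comp θ.flip) hZn (hQ.fderivWithin hK))
    refine succ_of_hasFDerivWithinAt (F' := fun i p => -((G i p).comp (R' i p))) hK
      (fun _ _ => zero_le_one) hb ?_ (neg hK (bilin' hK (ContinuousLinearMap.compL 𝕂 X _ _) hGs hR'))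
    intro i p hp
    have hRd : HasFDerivWithinAt (R i p) (R' i p) K p := by
      have hn := n.succ_ne_zero
      have h1 := (hc.hasFDerivWithinAt hn i hp).sub_const (c i p)
      have h2 := (β.flip (Z i p)).hasFDerivAt.comp_hasFDerivWithinAt p
        ((hB.hasFDerivWithinAt hn i hp).sub_const (B i p))
      have h3 := (α.flip (Z i p)).hasFDerivAt.comp_hasFDerivWithinAt p
        ((hA.hasFDerivWithinAt hn i hp).sub_const (A i p))
      have h4 := (ContinuousLinearMap.apply 𝕂 E (Z i p)).hasFDerivAt.comp_hasFDerivWithinAt p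
        ((θ.flip (Z i p)).hasFDerivAt.comp_hasFDerivWithinAt p
        ((hQ.hasFDerivWithinAt hn i hp).sub_const (Q i p)))
      exact ((h1.add h2).sub h3).sub h4
    have hR0 : R i p p = 0 := by simp [R]
    have hRO : R i p =O[𝓝[K] p] fun q => q - p := by
      simpa [hR0] using hRd.isBigO_sub
    have hZO : (fun q => Z i q - Z i p) =O[𝓝[K] p] fun q => q - p := by
      refine Asymptotics.IsBigO.trans (Asymptotics.IsBigO.of_bound κ ?_) hRO
      filter_upwards [self_mem_nhdsWithin] with q hq using hbd i p hp q hq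
    have hΛt : Tendsto (fun q => Λ i p p - Λ i p q) (𝓝[K] p) (𝓝 0) := by
      have h1 := (β.continuous.tendsto _).comp (hB.continuousOn i p hp)
      have h2 := (α.continuous.tendsto _).comp (hA.continuousOn i p hp)
      have h3 := ((θ.flip (Z i p)).continuous.tendsto _).comp (hQ.continuousOn i p hp)
      have h4' : Tendsto (fun q => (ContinuousLinearMap.flipₗᵢ 𝕂 E E E) (θ (Q i q))) (𝓝[K] p)
          (𝓝 ((ContinuousLinearMap.flipₗᵢ 𝕂 E E E) (θ (Q i p)))) :=
        (((ContinuousLinearMap.flipₗᵢ 𝕂 E E E).continuous.comp θ.continuous).tendsto _).comp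
          (hQ.continuousOn i p hp)
      have happ : Continuous (fun q : (E →L[𝕂] E →L[𝕂] E) × E => q.1 q.2) :=
        isBoundedBilinearMap_apply.continuous
      have h4 := (happ.tendsto (_, _)).comp (h4'.prodMk_nhds (hcont i p hp))
      have h := (((h1.sub h2).sub h3).sub h4).const_sub (Λ i p p)
      refine (h.congr fun q => ?_).trans_eq ?_
      · rfl
      · rw [← sub_self (Λ i p p)]
        rfl
    rw [hasFDerivWithinAt_iff_isLittleO]
    -- The bracket equals `Λ p p (Z q - Z p) + R' (q - p)`, so this is the remainder of `Z` at `p`.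
    -- Both summands are negligible: `Λ p q` is continuous and `Z q - Z p = O(q - p)`, and `R` is
    -- differentiable.
    have key : (fun q => G i p ((Λ i p p - Λ i p q) (Z i q - Z i p) -
        (R i p q - R' i p (q - p)))) =o[𝓝[K] p] fun q => q - p := by
      refine ((G i p).isBigO_comp _ _).trans_isLittleO (Asymptotics.IsLittleO.sub ?_ ?_)
      · have h1 : (fun q => ‖Λ i p p - Λ i p q‖ * ‖Z i q - Z i p‖)
            =o[𝓝[K] p] fun q => (1 : ℝ) * ‖q - p‖ :=
          ((Asymptotics.isLittleO_one_iff ℝ).2 hΛt).norm_left.mul_isBigO hZO.norm_norm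
        refine Asymptotics.IsBigO.trans_isLittleO (Asymptotics.IsBigO.of_norm_le fun q => ?_)
          (by simpa using h1)
        exact ContinuousLinearMap.le_opNorm _ _
      · have := hasFDerivWithinAt_iff_isLittleO.1 hRd
        simpa [hR0] using this
    refine key.congr' ?_ (EventuallyEq.refl _ _)
    filter_upwards [self_mem_nhdsWithin] with q hq
    have h1 := hdiff i p hp q hq
    have h3 : ∀ Y, G i p (Λ i p p Y) = Y :=
      fun Y => congrArg (fun L : E →L[𝕂] E => L Y) (hG i p hp).2.2
    generalize R i p q = r at h1 ⊢
    rw [sub_apply, h1, map_sub, map_sub, h3, map_neg, map_sub]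
    simp only [neg_apply, ContinuousLinearMap.comp_apply]
    abel

end Riccati

end BddSmooth

/-! ### Smooth dependence on a parameter, and parameter integrals -/

/-- `G i t p` is, for `t ∈ [0, 1]`, of class `C^n` in `p ∈ K` with derivatives that are jointly
continuous in `(t, p)` and bounded by a multiple of `w p`. -/
def ParamSmooth (𝕂 : Type*) [RCLike 𝕂] {ι : Type*} {X : Type u} [NormedAddCommGroup X]
    [NormedSpace 𝕂 X] (w : X → ℝ) (K : Set X) :
    ℕ → ∀ {E : Type u} [NormedAddCommGroup E] [NormedSpace 𝕂 E], (ι → ℝ → X → E) → Prop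
  | 0, _, _, _, G => (∀ i, ContinuousOn (fun q : ℝ × X => G i q.1 q.2) (Icc 0 1 ×ˢ K)) ∧
      ∃ C : ℝ, ∀ i, ∀ t ∈ Icc (0 : ℝ) 1, ∀ p ∈ K, ‖G i t p‖ ≤ C * w p
  | n + 1, E, _, _, G => ((∀ i, ContinuousOn (fun q : ℝ × X => G i q.1 q.2) (Icc 0 1 ×ˢ K)) ∧
      ∃ C : ℝ, ∀ i, ∀ t ∈ Icc (0 : ℝ) 1, ∀ p ∈ K, ‖G i t p‖ ≤ C * w p) ∧
      ∃ G' : ι → ℝ → X → X →L[𝕂] E, (∀ i, ∀ t ∈ Icc (0 : ℝ) 1, ∀ p ∈ K,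
        HasFDerivWithinAt (G i t) (G' i t p) K p) ∧ ParamSmooth 𝕂 w K n G'

namespace ParamSmooth

variable {𝕂 : Type*} [RCLike 𝕂] {ι ι' : Type*} {X Y E E₁ E₂ E₃ : Type u}
  [NormedAddCommGroup X] [NormedSpace 𝕂 X] [NormedAddCommGroup Y] [NormedSpace 𝕂 Y]
  [NormedAddCommGroup E] [NormedSpace 𝕂 E] [NormedAddCommGroup E₁] [NormedSpace 𝕂 E₁]
  [NormedAddCommGroup E₂] [NormedSpace 𝕂 E₂] [NormedAddCommGroup E₃] [NormedSpace 𝕂 E₃]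
  {n : ℕ} {w : X → ℝ} {K : Set X} {G : ι → ℝ → X → E}

theorem base (h : ParamSmooth 𝕂 w K n G) :
    (∀ i, ContinuousOn (fun q : ℝ × X => G i q.1 q.2) (Icc 0 1 ×ˢ K)) ∧
      ∃ C : ℝ, ∀ i, ∀ t ∈ Icc (0 : ℝ) 1, ∀ p ∈ K, ‖G i t p‖ ≤ C * w p := by
  cases n with
  | zero => exact h
  | succ n => exact h.1

theorem of_succ (h : ParamSmooth 𝕂 w K (n + 1) G) : ParamSmooth 𝕂 w K n G := by
  induction n generalizing E with
  | zero => exact h.1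
  | succ n ih =>
    obtain ⟨h0, G', hG', h⟩ := h
    exact ⟨h0, G', hG', ih h⟩

theorem continuousOn_left (h : ParamSmooth 𝕂 w K n G) (i : ι) {p : X} (hp : p ∈ K) :
    ContinuousOn (fun t => G i t p) (Icc 0 1) :=
  (h.base.1 i).comp (f := fun t => (t, p)) (by fun_prop) (fun _ ht => ⟨ht, hp⟩)

theorem continuousOn_right (h : ParamSmooth 𝕂 w K n G) (i : ι) {t : ℝ} (ht : t ∈ Icc (0 : ℝ) 1) :
    ContinuousOn (G i t) K :=
  (h.base.1 i).comp (f := fun p => (t, p)) (by fun_prop) (fun _ hp => ⟨ht, hp⟩)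

theorem at_param (h : ParamSmooth 𝕂 w K n G) (hK : UniqueDiffOn 𝕂 K) (hw : ∀ p ∈ K, 0 ≤ w p)
    {t : ℝ} (ht : t ∈ Icc (0 : ℝ) 1) : BddSmooth 𝕂 n w K (fun i => G i t) := by
  induction n generalizing E with
  | zero =>
    obtain ⟨C, hC⟩ := h.base.2
    exact BddSmooth.zero_iff.2 ⟨fun i => h.continuousOn_right i ht, C, fun i => hC i t ht⟩
  | succ n ih =>
    obtain ⟨⟨_, C, hC⟩, G', hG', h⟩ := h
    exact BddSmooth.succ_of_hasFDerivWithinAt hK hw ⟨C, fun i => hC i t ht⟩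
      (fun i => hG' i t ht) (ih h)

theorem zero (n : ℕ) : ParamSmooth 𝕂 w K n (fun (_ : ι) (_ : ℝ) (_ : X) => (0 : E)) := by
  have h0 : ∀ {E : Type u} [NormedAddCommGroup E] [NormedSpace 𝕂 E],
      (ι → ContinuousOn (fun _ : ℝ × X => (0 : E)) (Icc 0 1 ×ˢ K)) ∧
      ∃ C : ℝ, ι → ∀ t ∈ Icc (0 : ℝ) 1, ∀ p ∈ K, ‖(0 : E)‖ ≤ C * w p :=
    ⟨fun _ => continuousOn_const, 0, fun _ _ _ _ _ => by simp⟩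
  induction n generalizing E with
  | zero => exact h0
  | succ n ih => exact ⟨h0, fun _ _ _ => 0, fun _ _ _ p _ => hasFDerivWithinAt_const 0 p K, ih⟩

theorem base_add {G' : ι → ℝ → X → E} (h : ParamSmooth 𝕂 w K 0 G) (h' : ParamSmooth 𝕂 w K 0 G') :
    ParamSmooth 𝕂 w K 0 (fun i t p => G i t p + G' i t p) := by
  obtain ⟨C, hC⟩ := h.2
  obtain ⟨C', hC'⟩ := h'.2
  refine ⟨fun i => (h.1 i).add (h'.1 i), C + C', fun i t ht p hp => ?_⟩
  rw [add_mul]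
  exact norm_add_le_of_le (hC i t ht p hp) (hC' i t ht p hp)

theorem add {G' : ι → ℝ → X → E} (h : ParamSmooth 𝕂 w K n G) (h' : ParamSmooth 𝕂 w K n G') :
    ParamSmooth 𝕂 w K n (fun i t p => G i t p + G' i t p) := by
  have h0 := base_add (𝕂 := 𝕂) h.base h'.base
  induction n generalizing E with
  | zero => exact h0
  | succ n ih =>
    obtain ⟨_, D, hD, hDs⟩ := h
    obtain ⟨_, D', hD', hDs'⟩ := h'
    exact ⟨h0, fun i t p => D i t p + D' i t p,
      fun i t ht p hp => (hD i t ht p hp).add (hD' i t ht p hp),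
      ih hDs hDs' (base_add (𝕂 := 𝕂) hDs.base hDs'.base)⟩

theorem base_bilin (B : E₁ →L[𝕂] E₂ →L[𝕂] E₃) {F : ι → ℝ → X → E₁} {G : ι → ℝ → X → E₂}
    (hF : ParamSmooth 𝕂 w K 0 F) (hG : ParamSmooth 𝕂 (fun _ => 1) K 0 G) :
    ParamSmooth 𝕂 w K 0 (fun i t p => B (F i t p) (G i t p)) := by
  obtain ⟨C, hC⟩ := hF.2
  obtain ⟨C', hC'⟩ := hG.2
  refine ⟨fun i => ((B.continuous.comp_continuousOn (hF.1 i)).clm_apply (hG.1 i)),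
    ‖B‖ * C * C', fun i t ht p hp => ?_⟩
  have h0 : 0 ≤ C * w p := (norm_nonneg _).trans (hC i t ht p hp)
  calc ‖B (F i t p) (G i t p)‖ ≤ ‖B‖ * ‖F i t p‖ * ‖G i t p‖ := B.le_opNorm₂ _ _
    _ ≤ ‖B‖ * (C * w p) * (C' * 1) := by
        gcongr
        · exact hC i t ht p hp
        · exact hC' i t ht p hp
    _ = ‖B‖ * C * C' * w p := by ring

theorem bilin (B : E₁ →L[𝕂] E₂ →L[𝕂] E₃) {F : ι → ℝ → X → E₁} {G : ι → ℝ → X → E₂}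
    (hF : ParamSmooth 𝕂 w K n F) (hG : ParamSmooth 𝕂 (fun _ => 1) K n G) :
    ParamSmooth 𝕂 w K n (fun i t p => B (F i t p) (G i t p)) := by
  have h0 := base_bilin (𝕂 := 𝕂) B hF.base hG.base
  induction n generalizing E₁ E₂ E₃ with
  | zero => exact h0
  | succ n ih =>
    have hFn := hF.of_succ
    have hGn := hG.of_succ
    obtain ⟨_, D, hD, hDs⟩ := hF
    obtain ⟨_, D', hD', hDs'⟩ := hG
    refine ⟨h0, fun i t p => B.precompR X (F i t p) (D' i t p) + B.precompL X (D i t p) (G i t p),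
      fun i t ht p hp => ?_, add ?_ ?_⟩
    · exact B.hasFDerivWithinAt_of_bilinear (hD i t ht p hp) (hD' i t ht p hp)
    · exact ih _ hFn hDs' (base_bilin (𝕂 := 𝕂) _ hFn.base hDs'.base)
    · exact ih _ hDs hGn (base_bilin (𝕂 := 𝕂) _ hDs.base hGn.base)

/-- Composition of a smooth function with a family of smooth maps. -/
theorem comp {ι₀ : Type*} {w₀ : Y → ℝ} {K₀ : Set Y} {f : ι₀ → Y → E} (e : ι → ι₀)
    {γ : ι → ℝ → X → Y} {γ' : ι → ℝ → X → X →L[𝕂] Y} {c : ℝ} (hK₀ : UniqueDiffOn 𝕂 K₀)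
    (hf : BddSmooth 𝕂 n w₀ K₀ f) (hγ : ∀ i, ∀ t ∈ Icc (0 : ℝ) 1, ∀ p ∈ K, γ i t p ∈ K₀)
    (hγc : ∀ i, ContinuousOn (fun q : ℝ × X => γ i q.1 q.2) (Icc 0 1 ×ˢ K))
    (hγ' : ∀ i, ∀ t ∈ Icc (0 : ℝ) 1, ∀ p ∈ K, HasFDerivWithinAt (γ i t) (γ' i t p) K p)
    (hγs : ∀ m, ParamSmooth 𝕂 (fun _ => 1) K m γ')
    (hw₀ : ∀ p ∈ K₀, 0 ≤ w₀ p)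
    (hw : ∀ i, ∀ t ∈ Icc (0 : ℝ) 1, ∀ p ∈ K, w₀ (γ i t p) ≤ c * w p) :
    ParamSmooth 𝕂 w K n (fun i t p => f (e i) (γ i t p)) := by
  have h0 : ∀ {F : Type u} [NormedAddCommGroup F] [NormedSpace 𝕂 F] {m : ℕ} {g : ι₀ → Y → F},
      BddSmooth 𝕂 m w₀ K₀ g → ParamSmooth 𝕂 w K 0 (fun i t p => g (e i) (γ i t p)) := by
    intro F _ _ m g hg
    obtain ⟨C, hC⟩ := hg.bound
    refine ⟨fun i => (hg.continuousOn (e i)).comp (hγc i) fun q hq => hγ i q.1 hq.1 q.2 hq.2,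
      |C| * c, fun i t ht p hp => ?_⟩
    calc ‖g (e i) (γ i t p)‖ ≤ C * w₀ (γ i t p) := hC _ _ (hγ i t ht p hp)
      _ ≤ |C| * w₀ (γ i t p) :=
        mul_le_mul_of_nonneg_right (le_abs_self C) (hw₀ _ (hγ i t ht p hp))
      _ ≤ |C| * (c * w p) := mul_le_mul_of_nonneg_left (hw i t ht p hp) (abs_nonneg C)
      _ = |C| * c * w p := by ring
  induction n generalizing E with
  | zero => exact h0 hf
  | succ n ih =>
    refine ⟨(h0 hf).base, fun i t p => (fderivWithin 𝕂 (f (e i)) K₀ (γ i t p)).comp (γ' i t p),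
      fun i t ht p hp => ?_, ?_⟩
    · exact (hf.hasFDerivWithinAt n.succ_ne_zero (e i) (hγ i t ht p hp)).comp p
        (hγ' i t ht p hp) (fun q hq => hγ i t ht q hq)
    · exact bilin (ContinuousLinearMap.compL 𝕂 X Y E) (ih (hf.fderivWithin hK₀)) (hγs n)

theorem tendsto_integral_of_bound {F : Type*} [NormedAddCommGroup F] [NormedSpace ℝ F]
    {g : X → ℝ → F} {g₀ : ℝ → F} {p : X} {C : ℝ}
    (hg : ∀ᶠ q in 𝓝[K] p, ContinuousOn (g q) (Icc 0 1))
    (hb : ∀ᶠ q in 𝓝[K] p, ∀ t ∈ Icc (0 : ℝ) 1, ‖g q t‖ ≤ C)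
    (hl : ∀ t ∈ Icc (0 : ℝ) 1, Tendsto (fun q => g q t) (𝓝[K] p) (𝓝 (g₀ t))) :
    Tendsto (fun q => ∫ t in (0 : ℝ)..1, g q t) (𝓝[K] p) (𝓝 (∫ t in (0 : ℝ)..1, g₀ t)) := by
  have hs : uIoc (0 : ℝ) 1 ⊆ Icc 0 1 := by
    rw [uIoc_of_le zero_le_one]; exact Ioc_subset_Icc_self
  refine intervalIntegral.tendsto_integral_filter_of_dominated_convergence (fun _ => C) ?_ ?_
    intervalIntegrable_const ?_
  · filter_upwards [hg] with q hq
    exact (hq.mono hs).aestronglyMeasurable measurableSet_uIoc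
  · filter_upwards [hb] with q hq
    exact Eventually.of_forall fun t ht => hq t (hs ht)
  · exact Eventually.of_forall fun t ht => hl t (hs ht)

/-- Differentiation under the integral sign within a set. Local convexity provides a mean value
inequality near `p`, hence a Lipschitz bound on `G i t` uniform in `t`, which dominates the
difference quotients. -/
theorem integral [NormedSpace ℝ X] [CompleteSpace E] [NormedSpace ℝ E] [SMulCommClass 𝕂 ℝ E]
    (h : ParamSmooth 𝕂 w K n G) (hK : UniqueDiffOn 𝕂 K) (hw : ∀ p ∈ K, 0 ≤ w p)
    (hwc : ContinuousOn w K) (hconv : ∀ p ∈ K, ∃ ε > 0, Convex ℝ (K ∩ Metric.ball p ε)) :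
    BddSmooth 𝕂 n w K (fun i p => ∫ t in (0 : ℝ)..1, G i t p) := by
  have hwb : ∀ p ∈ K, ∀ᶠ q in 𝓝[K] p, w q ≤ w p + 1 := fun p hp =>
    ((hwc p hp).eventually_lt_const (lt_add_one (w p))).mono fun q hq => hq.le
  have h01 : uIcc (0 : ℝ) 1 = Icc 0 1 := uIcc_of_le zero_le_one
  have hbd : ∃ C : ℝ, ∀ i, ∀ p ∈ K, ‖∫ t in (0 : ℝ)..1, G i t p‖ ≤ C * w p := by
    obtain ⟨C, hC⟩ := h.base.2
    refine ⟨C, fun i p hp => ?_⟩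
    have := intervalIntegral.norm_integral_le_of_norm_le_const (a := 0) (b := 1)
      (f := fun t => G i t p) (C := C * w p) fun t ht => hC i t ?_ p hp
    · simpa using this
    · rw [uIoc_of_le zero_le_one] at ht
      exact Ioc_subset_Icc_self ht
  induction n generalizing E with
  | zero =>
    refine BddSmooth.zero_iff.2 ⟨fun i p hp => ?_, hbd⟩
    obtain ⟨C, hC⟩ := h.base.2
    refine tendsto_integral_of_bound (C := |C| * (w p + 1)) ?_ ?_
      fun t ht => h.continuousOn_right i ht p hp
    · filter_upwards [self_mem_nhdsWithin] with q hq using h.continuousOn_left i hq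
    · filter_upwards [self_mem_nhdsWithin, hwb p hp] with q hq hwq t ht
      calc ‖G i t q‖ ≤ C * w q := hC i t ht q hq
        _ ≤ |C| * w q := mul_le_mul_of_nonneg_right (le_abs_self C) (hw q hq)
        _ ≤ |C| * (w p + 1) := mul_le_mul_of_nonneg_left hwq (abs_nonneg C)
  | succ n ih =>
    have h' := h
    obtain ⟨_, G', hG', hGs⟩ := h
    obtain ⟨C, hC⟩ := hGs.base.2
    have hbd' : ∃ C : ℝ, ∀ i, ∀ p ∈ K, ‖∫ t in (0 : ℝ)..1, G' i t p‖ ≤ C * w p := by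
      refine ⟨C, fun i p hp => ?_⟩
      have := intervalIntegral.norm_integral_le_of_norm_le_const (a := 0) (b := 1)
        (f := fun t => G' i t p) (C := C * w p) fun t ht => hC i t ?_ p hp
      · simpa using this
      · rw [uIoc_of_le zero_le_one] at ht
        exact Ioc_subset_Icc_self ht
    refine BddSmooth.succ_of_hasFDerivWithinAt hK hw hbd (fun i p hp => ?_) (ih hGs hbd')
    obtain ⟨ε, hε, hcv⟩ := hconv p hp
    set C' := |C| * (w p + 1) with hC'
    have hder : ∀ᶠ q in 𝓝[K] p, ∀ t ∈ Icc (0 : ℝ) 1, ‖G' i t q‖ ≤ C' := by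
      filter_upwards [self_mem_nhdsWithin, hwb p hp] with q hq hwq t ht
      calc ‖G' i t q‖ ≤ C * w q := hC i t ht q hq
        _ ≤ |C| * w q := mul_le_mul_of_nonneg_right (le_abs_self C) (hw q hq)
        _ ≤ |C| * (w p + 1) := mul_le_mul_of_nonneg_left hwq (abs_nonneg C)
    obtain ⟨ε', hε', hder'⟩ := Metric.mem_nhdsWithin_iff.1 hder
    have hcv' : Convex ℝ (K ∩ Metric.ball p (min ε ε')) := by
      have : K ∩ Metric.ball p (min ε ε') =
          (K ∩ Metric.ball p ε) ∩ Metric.ball p (min ε ε') := by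
        ext q
        simp only [mem_inter_iff, Metric.mem_ball, lt_min_iff]
        tauto
      rw [this]
      exact hcv.inter (convex_ball p _)
    have hball : Metric.ball p (min ε ε') ∈ 𝓝 p := Metric.ball_mem_nhds p (lt_min hε hε')
    have hlip : ∀ q ∈ K ∩ Metric.ball p (min ε ε'), ∀ t ∈ Icc (0 : ℝ) 1,
        ‖G i t q - G i t p‖ ≤ C' * ‖q - p‖ := by
      intro q hq t ht
      refine hcv'.norm_image_sub_le_of_norm_hasFDerivWithin_le (𝕜 := 𝕂) (f' := G' i t)
        (fun x hx => (hG' i t ht x hx.1).mono inter_subset_left) (fun x hx => ?_)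
        ⟨hp, Metric.mem_ball_self (lt_min hε hε')⟩ hq
      exact hder' ⟨Metric.ball_subset_ball (min_le_right _ _) hx.2, hx.1⟩ t ht
    have hii : ∀ q ∈ K, IntervalIntegrable (fun t => G i t q) MeasureTheory.volume 0 1 :=
      fun q hq => ContinuousOn.intervalIntegrable (by rw [h01]; exact h'.continuousOn_left i hq)
    have hii' : IntervalIntegrable (fun t => G' i t p) MeasureTheory.volume 0 1 :=
      ContinuousOn.intervalIntegrable (by rw [h01]; exact hGs.continuousOn_left i hp)
    rw [hasFDerivWithinAt_iff_tendsto]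
    have hT : Tendsto (fun q => ∫ t in (0 : ℝ)..1, ‖q - p‖⁻¹ * ‖G i t q - G i t p - G' i t p (q - p)‖)
        (𝓝[K] p) (𝓝 (∫ t in (0 : ℝ)..1, (0 : ℝ))) := by
      refine tendsto_integral_of_bound (C := 2 * C') ?_ ?_ fun t ht => ?_
      · filter_upwards [self_mem_nhdsWithin] with q hq
        have h1 := h'.continuousOn_left i hq
        have h2 := h'.continuousOn_left i hp
        have h3 := (hGs.continuousOn_left i hp).clm_apply (continuousOn_const (c := q - p))
        exact continuousOn_const.mul ((h1.sub h2).sub h3).norm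
      · filter_upwards [inter_mem_nhdsWithin K hball, hder, self_mem_nhdsWithin] with q hq hdq hqK t ht
        have h1 := hlip q hq t ht
        have h2 : ‖G' i t p (q - p)‖ ≤ C' * ‖q - p‖ := by
          refine (ContinuousLinearMap.le_opNorm _ _).trans
            (mul_le_mul_of_nonneg_right ?_ (norm_nonneg _))
          exact hder' ⟨Metric.mem_ball_self hε', hp⟩ t ht
        have h3 : ‖G i t q - G i t p - G' i t p (q - p)‖ ≤ 2 * C' * ‖q - p‖ := by
          refine (norm_sub_le _ _).trans ?_
          linarith
        rw [Real.norm_of_nonneg (by positivity)]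
        rcases eq_or_ne (‖q - p‖) 0 with h0 | h0
        · rw [h0]
          simp
          have := (norm_nonneg _).trans (hder' ⟨Metric.mem_ball_self hε', hp⟩ t ht)
          exact this
        · rw [inv_mul_le_iff₀ (by positivity)]
          linarith
      · exact hasFDerivWithinAt_iff_tendsto.1 (hG' i t ht p hp)
    rw [intervalIntegral.integral_zero] at hT
    refine squeeze_zero' (Eventually.of_forall fun q => by positivity) ?_ hT
    filter_upwards [self_mem_nhdsWithin] with q hq
    rw [intervalIntegral.integral_const_mul]
    refine mul_le_mul_of_nonneg_left ?_ (by positivity)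
    rw [ContinuousLinearMap.intervalIntegral_apply hii', ← intervalIntegral.integral_sub (hii q hq)
      (hii p hp), ← intervalIntegral.integral_sub ((hii q hq).sub (hii p hp))]
    · exact intervalIntegral.norm_integral_le_integral_norm zero_le_one
    · refine ContinuousOn.intervalIntegrable ?_
      rw [h01]
      exact (hGs.continuousOn_left i hp).clm_apply continuousOn_const

end ParamSmooth

namespace ParamSmooth

variable {𝕂 : Type*} [RCLike 𝕂] {ι ι' : Type*} {X Y E E₁ E₂ E₃ : Type u}
  [NormedAddCommGroup X] [NormedSpace 𝕂 X] [NormedAddCommGroup Y] [NormedSpace 𝕂 Y]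
  [NormedAddCommGroup E] [NormedSpace 𝕂 E] [NormedAddCommGroup E₁] [NormedSpace 𝕂 E₁]
  {n : ℕ} {w : X → ℝ} {K : Set X} {G : ι → ℝ → X → E}

theorem of_const {c : ι → ℝ → E} {C : ℝ} (hc : ∀ i, ContinuousOn (c i) (Icc 0 1))
    (hC : ∀ i, ∀ t ∈ Icc (0 : ℝ) 1, ‖c i t‖ ≤ C) (n : ℕ) :
    ParamSmooth 𝕂 (fun _ => 1) K n (fun i t (_ : X) => c i t) := by
  have h0 : ParamSmooth 𝕂 (fun _ => 1) K 0 (fun i t (_ : X) => c i t) :=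
    ⟨fun i => (hc i).comp continuousOn_fst fun q hq => hq.1, C,
      fun i t ht p _ => by simpa using hC i t ht⟩
  cases n with
  | zero => exact h0
  | succ n =>
    exact ⟨h0, fun _ _ _ => 0, fun i t _ p _ => hasFDerivWithinAt_const _ _ _, zero n⟩

theorem clm (L : E →L[𝕂] E₁) (h : ParamSmooth 𝕂 w K n G) :
    ParamSmooth 𝕂 w K n (fun i t p => L (G i t p)) := by
  have h1 : ∀ {F F₁ : Type u} [NormedAddCommGroup F] [NormedSpace 𝕂 F] [NormedAddCommGroup F₁]
      [NormedSpace 𝕂 F₁] (L : F →L[𝕂] F₁) {G : ι → ℝ → X → F}, ParamSmooth 𝕂 w K 0 G →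
      ParamSmooth 𝕂 w K 0 (fun i t p => L (G i t p)) := by
    intro F F₁ _ _ _ _ L G h
    obtain ⟨C, hC⟩ := h.2
    refine ⟨fun i => L.continuous.comp_continuousOn (h.1 i), ‖L‖ * C, fun i t ht p hp => ?_⟩
    rw [mul_assoc]
    exact (L.le_opNorm _).trans (mul_le_mul_of_nonneg_left (hC i t ht p hp) (norm_nonneg _))
  induction n generalizing E E₁ with
  | zero => exact h1 L h.base
  | succ n ih =>
    have h0 := h1 L h.base
    obtain ⟨_, D, hD, hDs⟩ := h
    exact ⟨h0, fun i t p => L.comp (D i t p),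
      fun i t ht p hp => L.hasFDerivAt.comp_hasFDerivWithinAt p (hD i t ht p hp),
      ih (ContinuousLinearMap.compL 𝕂 X E E₁ L) hDs⟩

end ParamSmooth

/-! ### Composition, and Riccati and Sylvester equations for matrices -/

namespace BddSmooth

/-- Composition with a smooth map all of whose derivatives are bounded. -/
theorem comp {𝕂 : Type*} [RCLike 𝕂] {ι ι₀ : Type*} {X Y E : Type u}
    [NormedAddCommGroup X] [NormedSpace 𝕂 X] [NormedAddCommGroup Y] [NormedSpace 𝕂 Y]
    [NormedAddCommGroup E] [NormedSpace 𝕂 E] {n : ℕ} {K : Set X} {K₀ : Set Y}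
    {w₀ : Y → ℝ} {w : X → ℝ} {f : ι₀ → Y → E} (e : ι → ι₀)
    {γ : ι → X → Y} {L : X →L[𝕂] Y} {c : ℝ} (hK : UniqueDiffOn 𝕂 K) (hK₀ : UniqueDiffOn 𝕂 K₀)
    (hf : BddSmooth 𝕂 n w₀ K₀ f) (hγ : ∀ i, ∀ p ∈ K, γ i p ∈ K₀)
    (hγ' : ∀ i, ∀ p ∈ K, HasFDerivWithinAt (γ i) L K p)
    (hw₀ : ∀ p ∈ K₀, 0 ≤ w₀ p) (hw' : ∀ p ∈ K, 0 ≤ w p)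
    (hw : ∀ i, ∀ p ∈ K, w₀ (γ i p) ≤ c * w p) :
    BddSmooth 𝕂 n w K (fun i p => f (e i) (γ i p)) := by
  have h := ParamSmooth.comp (K := K) (w := w) (c := c) (γ := fun i _ => γ i)
    (γ' := fun _ _ _ => L) e hK₀ hf
    (fun i t _ => hγ i) (fun i => ?_) (fun i t _ => hγ' i)
    (fun m => ParamSmooth.of_const (c := fun _ _ => L) (C := ‖L‖) (fun _ => continuousOn_const)
      (fun _ _ _ => le_rfl) m) hw₀ (fun i t _ => hw i)
  · exact h.at_param hK hw' (t := 0) (by simp)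
  · have hc : ContinuousOn (γ i) K := fun p hp => (hγ' i p hp).continuousWithinAt
    exact hc.comp continuousOn_snd fun q hq => hq.2

theorem restrictScalars {𝕂 ι X E : Type*} [RCLike 𝕂] [NormedAddCommGroup X] [NormedSpace ℝ X]
    [NormedSpace 𝕂 X] [IsScalarTower ℝ 𝕂 X] [NormedAddCommGroup E] [NormedSpace ℝ E]
    [NormedSpace 𝕂 E] [IsScalarTower ℝ 𝕂 E] {n : ℕ} {K : Set X} {w : X → ℝ} {F : ι → X → E}
    (hK : UniqueDiffOn ℝ K) (h : BddSmooth 𝕂 n w K F) : BddSmooth ℝ n w K F := by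
  obtain ⟨C, hC⟩ := h.2
  refine ⟨fun i => (h.1 i).restrict_scalars ℝ, C, fun i j hj p hp => ?_⟩
  have h1 := (((h.1 i).of_le (by exact_mod_cast hj) :
    ContDiffOn 𝕂 j (F i) K) p hp).restrictScalars_iteratedFDerivWithin_eventuallyEq (𝕜 := ℝ) hK hp
  have h2 := h1.self_of_nhdsWithin hp
  rw [← h2]
  exact (hC i j hj p hp)

section Riccati

variable {𝕂 : Type*} [RCLike 𝕂]
  {ι : Type*} {X : Type*} [NormedAddCommGroup X] [NormedSpace 𝕂 X] {n : ℕ} {K : Set X}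

theorem quadratic' {E EA EB EQ EL : Type*} [NormedAddCommGroup E] [NormedSpace 𝕂 E]
    [NormedAddCommGroup EA] [NormedSpace 𝕂 EA] [NormedAddCommGroup EB] [NormedSpace 𝕂 EB]
    [NormedAddCommGroup EQ] [NormedSpace 𝕂 EQ] [NormedAddCommGroup EL] [NormedSpace 𝕂 EL]
    [FiniteDimensional 𝕂 E] (hK : UniqueDiffOn 𝕂 K)
    (β : EB →L[𝕂] E →L[𝕂] E) (α : E →L[𝕂] EA →L[𝕂] E) (b : E →L[𝕂] EQ →L[𝕂] EL)
    (b' : EL →L[𝕂] E →L[𝕂] E)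
    {c Z : ι → X → E} {B : ι → X → EB} {A : ι → X → EA} {Q : ι → X → EQ} {κ C : ℝ} (hκ : 0 ≤ κ)
    (hc : BddSmooth 𝕂 n (fun _ => 1) K c) (hB : BddSmooth 𝕂 n (fun _ => 1) K B)
    (hA : BddSmooth 𝕂 n (fun _ => 1) K A) (hQ : BddSmooth 𝕂 n (fun _ => 1) K Q)
    (hZ : ∀ i, ∀ p ∈ K, ‖Z i p‖ ≤ C)
    (heq : ∀ i, ∀ p ∈ K, c i p + β (B i p) (Z i p) - α (Z i p) (A i p)
      - b' (b (Z i p) (Q i p)) (Z i p) = 0)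
    (hinv : ∀ i, ∀ p ∈ K, ∀ q ∈ K, ∀ Y : E, ‖Y‖ ≤ κ * ‖β (B i q) Y - α Y (A i q)
      - b' (b (Z i p) (Q i q)) Y - b' (b Y (Q i q)) (Z i q)‖) :
    BddSmooth 𝕂 n (fun _ => 1) K Z :=
  quadratic hK β α.flip ((ContinuousLinearMap.compL 𝕂 E EL (E →L[𝕂] E) b').comp b.flip)
    hκ hc hB hA hQ hZ heq hinv

end Riccati

end BddSmooth

namespace Matrix

/-- Matrix multiplication as a continuous bilinear map. -/
def mulCLM (𝕂 : Type*) [NontriviallyNormedField 𝕂] [NormedAlgebra 𝕂 ℂ] (l m n : Type*)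
    [Fintype l] [Fintype m] [Fintype n] :
    Matrix l m ℂ →L[𝕂] Matrix m n ℂ →L[𝕂] Matrix l n ℂ :=
  LinearMap.mkContinuous₂
    (LinearMap.mk₂ 𝕂 (fun (A : Matrix l m ℂ) (B : Matrix m n ℂ) => A * B)
      (fun A A' B => Matrix.add_mul A A' B) (fun c A B => Matrix.smul_mul c A B)
      (fun A B B' => Matrix.mul_add A B B') (fun c A B => Matrix.mul_smul A c B)) 1
    (fun A B => by simpa using Matrix.linfty_opNorm_mul A B)

end Matrix

namespace BddSmooth

variable {𝕂 : Type*} [RCLike 𝕂] [NormedAlgebra 𝕂 ℂ]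
  {ι : Type*} {X : Type*} [NormedAddCommGroup X] [NormedSpace 𝕂 X] {n : ℕ} {K : Set X}
  {l m k : Type*} [Fintype l] [Fintype m] [Fintype k]

theorem matMul (hK : UniqueDiffOn 𝕂 K) {w : X → ℝ} {F : ι → X → Matrix l m ℂ}
    {G : ι → X → Matrix m k ℂ} (hF : BddSmooth 𝕂 n w K F)
    (hG : BddSmooth 𝕂 n (fun _ => 1) K G) :
    BddSmooth 𝕂 n w K (fun i p => F i p * G i p) :=
  bilin hK (Matrix.mulCLM 𝕂 l m k) hF hG

theorem matMul' (hK : UniqueDiffOn 𝕂 K) {w : X → ℝ} {F : ι → X → Matrix l m ℂ}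
    {G : ι → X → Matrix m k ℂ} (hF : BddSmooth 𝕂 n (fun _ => 1) K F)
    (hG : BddSmooth 𝕂 n w K G) :
    BddSmooth 𝕂 n w K (fun i p => F i p * G i p) :=
  bilin' hK (Matrix.mulCLM 𝕂 l m k) hF hG

/-- A bounded solution `Z` of a Riccati equation with smooth coefficients is smooth, provided the
linearized operators are uniformly invertible. -/
theorem riccati [FiniteDimensional 𝕂 ℂ] (hK : UniqueDiffOn 𝕂 K) {c Z : ι → X → Matrix l m ℂ}
    {B : ι → X → Matrix l l ℂ} {A : ι → X → Matrix m m ℂ} {Q : ι → X → Matrix m l ℂ} {κ C : ℝ}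
    (hκ : 0 ≤ κ)
    (hc : BddSmooth 𝕂 n (fun _ => 1) K c) (hB : BddSmooth 𝕂 n (fun _ => 1) K B)
    (hA : BddSmooth 𝕂 n (fun _ => 1) K A) (hQ : BddSmooth 𝕂 n (fun _ => 1) K Q)
    (hZ : ∀ i, ∀ p ∈ K, ‖Z i p‖ ≤ C)
    (heq : ∀ i, ∀ p ∈ K, c i p + B i p * Z i p - Z i p * A i p - Z i p * Q i p * Z i p = 0)
    (hinv : ∀ i, ∀ p ∈ K, ∀ q ∈ K, ∀ Y : Matrix l m ℂ,
      ‖Y‖ ≤ κ * ‖B i q * Y - Y * A i q - Z i p * Q i q * Y - Y * Q i q * Z i q‖) :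
    BddSmooth 𝕂 n (fun _ => 1) K Z := by
  have : FiniteDimensional 𝕂 (Matrix l m ℂ) := Module.Finite.matrix
  exact quadratic' hK (Matrix.mulCLM 𝕂 l l m) (Matrix.mulCLM 𝕂 l m m) (Matrix.mulCLM 𝕂 l m l)
    (Matrix.mulCLM 𝕂 l l m) hκ hc hB hA hQ hZ heq hinv

end BddSmooth

namespace BddSmooth

/-- The solution is the inverse operator, which is smooth and bounded, applied to the right-hand
side. It therefore inherits the weight of the right-hand side. -/
theorem linear_solve {𝕂 : Type*} [RCLike 𝕂]
    {ι : Type*} {X : Type*} [NormedAddCommGroup X] [NormedSpace 𝕂 X] {n : ℕ} {K : Set X}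
    {E EA EB : Type*} [NormedAddCommGroup E] [NormedSpace 𝕂 E]
    [NormedAddCommGroup EA] [NormedSpace 𝕂 EA] [NormedAddCommGroup EB] [NormedSpace 𝕂 EB]
    [FiniteDimensional 𝕂 E] (hK : UniqueDiffOn 𝕂 K)
    (β : EB →L[𝕂] E →L[𝕂] E) (α : E →L[𝕂] EA →L[𝕂] E) {w : X → ℝ}
    {R Y : ι → X → E} {B : ι → X → EB} {A : ι → X → EA} {κ : ℝ} (hκ : 0 ≤ κ)
    (hR : BddSmooth 𝕂 n w K R) (hB : BddSmooth 𝕂 n (fun _ => 1) K B)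
    (hA : BddSmooth 𝕂 n (fun _ => 1) K A)
    (heq : ∀ i, ∀ p ∈ K, β (B i p) (Y i p) - α (Y i p) (A i p) = R i p)
    (hinv : ∀ i, ∀ p ∈ K, ∀ Y : E, ‖Y‖ ≤ κ * ‖β (B i p) Y - α Y (A i p)‖) :
    BddSmooth 𝕂 n w K Y := by
  let Λ : ι → X → E →L[𝕂] E := fun i p => β (B i p) - α.flip (A i p)
  have hΛ : BddSmooth 𝕂 n (fun _ => 1) K Λ := (clm hK β hB).sub hK (clm hK α.flip hA)
  have hG : ∀ i, ∀ p, ∃ G : E →L[𝕂] E, p ∈ K → (‖G‖ ≤ κ ∧ Λ i p * G = 1 ∧ G * Λ i p = 1) := by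
    intro i p
    by_cases hp : p ∈ K
    · obtain ⟨G, hG⟩ := ContinuousLinearMap.exists_inverse_of_bound (Λ i p) hκ (hinv i p hp)
      exact ⟨G, fun _ => hG⟩
    · exact ⟨0, fun h => absurd h hp⟩
  choose G hG using hG
  have hGs : BddSmooth 𝕂 n (fun _ => 1) K G :=
    inverse hK hΛ (fun i p hp => (hG i p hp).1) (fun i p hp => (hG i p hp).2.1)
      (fun i p hp => (hG i p hp).2.2)
  refine (bilin' hK (ContinuousLinearMap.id 𝕂 (E →L[𝕂] E)) hGs hR).congr fun i p hp => ?_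
  have h := congrArg (fun L : E →L[𝕂] E => L (Y i p)) (hG i p hp).2.2
  have h' : Λ i p (Y i p) = R i p := heq i p hp
  simp only [mul_apply_eq_comp, one_apply_eq_self, h'] at h
  exact h.symm

theorem sylvester {𝕂 : Type*} [RCLike 𝕂] [NormedAlgebra 𝕂 ℂ] [FiniteDimensional 𝕂 ℂ]
    {ι : Type*} {X : Type*} [NormedAddCommGroup X] [NormedSpace 𝕂 X] {n : ℕ} {K : Set X}
    {l m : Type*} [Fintype l] [Fintype m] (hK : UniqueDiffOn 𝕂 K) {w : X → ℝ}
    {R Y : ι → X → Matrix l m ℂ} {B : ι → X → Matrix l l ℂ} {A : ι → X → Matrix m m ℂ} {κ : ℝ}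
    (hκ : 0 ≤ κ) (hR : BddSmooth 𝕂 n w K R) (hB : BddSmooth 𝕂 n (fun _ => 1) K B)
    (hA : BddSmooth 𝕂 n (fun _ => 1) K A)
    (heq : ∀ i, ∀ p ∈ K, B i p * Y i p - Y i p * A i p = R i p)
    (hinv : ∀ i, ∀ p ∈ K, ∀ Y : Matrix l m ℂ, ‖Y‖ ≤ κ * ‖B i p * Y - Y * A i p‖) :
    BddSmooth 𝕂 n w K Y := by
  have : FiniteDimensional 𝕂 (Matrix l m ℂ) := Module.Finite.matrix
  exact linear_solve hK (Matrix.mulCLM 𝕂 l l m) (Matrix.mulCLM 𝕂 l m m) hκ hR hB hA heq hinv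

end BddSmooth

/-! ### Affine flows -/

/-- The flow `v ↦ e^{β τ} v + c(τ)` of the affine vector field `v ↦ α + β v`. -/
structure AffineFlow where
  α : ℝ
  β : ℝ
  c : ℝ → ℝ
  c_zero : c 0 = 0
  hasDerivAt_c : ∀ τ, HasDerivAt c (α * Real.exp (β * τ)) τ
  rate : ∀ τ, α * Real.exp (β * τ) = α + β * c τ

namespace AffineFlow

variable {𝕜 : Type} [RCLike 𝕜] (φ : AffineFlow)

/-- The position at time `τ` of the point that starts at `v`. -/
def flow (τ : ℝ) (v : 𝕜) : 𝕜 := (Real.exp (φ.β * τ) : 𝕜) * v + (φ.c τ : 𝕜)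

/-- The generating vector field. -/
def field (v : 𝕜) : 𝕜 := (φ.α : 𝕜) + (φ.β : 𝕜) * v

@[simp]
theorem flow_zero (v : 𝕜) : φ.flow 0 v = v := by simp [flow, φ.c_zero]

/-- A flow carries its own generating field along; for an affine field this is multiplication by
`e^{β τ}`. It lets the time derivative of the flow be expressed by the field at the starting point,
as in `jointDeriv`. -/
theorem field_flow (τ : ℝ) (v : 𝕜) :
    φ.field (φ.flow τ v) = (Real.exp (φ.β * τ) : 𝕜) * φ.field v := by
  have h : ((φ.α * Real.exp (φ.β * τ) : ℝ) : 𝕜) = ((φ.α + φ.β * φ.c τ : ℝ) : 𝕜) := by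
    rw [φ.rate]
  push_cast at h
  simp only [field, flow]
  linear_combination (-1 : 𝕜) * h

theorem continuous_c : Continuous φ.c :=
  continuous_iff_continuousAt.2 fun τ => (φ.hasDerivAt_c τ).continuousAt

theorem hasDerivAt_flow (τ : ℝ) (v : 𝕜) :
    HasDerivAt (fun τ => φ.flow τ v) (φ.field (φ.flow τ v)) τ := by
  rw [field_flow]
  have h1 : HasDerivAt (fun τ : ℝ => (Real.exp (φ.β * τ) : 𝕜))
      ((Real.exp (φ.β * τ) * φ.β : ℝ) : 𝕜) τ := by
    have h : HasDerivAt (fun τ : ℝ => Real.exp (φ.β * τ)) (Real.exp (φ.β * τ) * φ.β) τ := by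
      simpa using ((hasDerivAt_id τ).const_mul φ.β).exp
    exact (RCLike.ofRealCLM (K := 𝕜)).hasFDerivAt.comp_hasDerivAt τ h
  have h2 : HasDerivAt (fun τ : ℝ => (φ.c τ : 𝕜)) ((φ.α * Real.exp (φ.β * τ) : ℝ) : 𝕜) τ :=
    (RCLike.ofRealCLM (K := 𝕜)).hasFDerivAt.comp_hasDerivAt τ (φ.hasDerivAt_c τ)
  refine ((h1.mul_const v).add h2).congr_deriv ?_
  simp only [field]
  push_cast
  ring

theorem hasFDerivAt_flow (τ : ℝ) (v : 𝕜) : HasFDerivAt (fun v => φ.flow τ v)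
    ((Real.exp (φ.β * τ) : 𝕜) • ContinuousLinearMap.id 𝕜 𝕜) v := by
  simpa [flow] using ((hasFDerivAt_id v).const_mul (Real.exp (φ.β * τ) : 𝕜)).add_const (φ.c τ : 𝕜)

/-- The derivative of `(v, h) ↦ (φ_{h t}(v), h)`. -/
def jointDeriv (t : ℝ) (p : 𝕜 × ℝ) : 𝕜 × ℝ →L[ℝ] 𝕜 × ℝ :=
  Real.exp (φ.β * (p.2 * t)) • (ContinuousLinearMap.inl ℝ 𝕜 ℝ).comp (ContinuousLinearMap.fst ℝ 𝕜 ℝ)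
  + (t * Real.exp (φ.β * (p.2 * t))) • (ContinuousLinearMap.inl ℝ 𝕜 ℝ).comp
      ((ContinuousLinearMap.snd ℝ 𝕜 ℝ).smulRight (φ.field p.1))
  + (ContinuousLinearMap.inr ℝ 𝕜 ℝ).comp (ContinuousLinearMap.snd ℝ 𝕜 ℝ)

theorem hasFDerivAt_joint (t : ℝ) (p : 𝕜 × ℝ) :
    HasFDerivAt (fun p : 𝕜 × ℝ => (φ.flow (p.2 * t) p.1, p.2)) (φ.jointDeriv t p) p := by
  have hs : HasFDerivAt (fun p : 𝕜 × ℝ => p.2 * t) (t • ContinuousLinearMap.snd ℝ 𝕜 ℝ) p :=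
    hasFDerivAt_snd.mul_const t
  have hf : HasFDerivAt (fun p : 𝕜 × ℝ => p.1) (ContinuousLinearMap.fst ℝ 𝕜 ℝ) p := hasFDerivAt_fst
  have h1 : HasFDerivAt (fun p : 𝕜 × ℝ => Real.exp (φ.β * (p.2 * t))) _ p :=
    (hs.const_mul φ.β).exp
  have h2 : HasFDerivAt (fun p : 𝕜 × ℝ => φ.c (p.2 * t)) _ p :=
    (φ.hasDerivAt_c (p.2 * t)).comp_hasFDerivAt p hs
  have h1' := h1.smul hf
  have h2' := ((RCLike.ofRealCLM (K := 𝕜)).hasFDerivAt).comp p h2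
  have h3 := (h1'.add h2').prodMk (hasFDerivAt_snd (𝕜 := ℝ) (p := p))
  refine (h3.congr_of_eventuallyEq (Eventually.of_forall fun q => ?_)).congr_fderiv ?_
  · simp [flow, RCLike.real_smul_eq_coe_mul]
  · ext q
    · simp [jointDeriv, RCLike.real_smul_eq_coe_mul, field]
    · simp [jointDeriv, RCLike.real_smul_eq_coe_mul, field]
    · simp [jointDeriv, RCLike.real_smul_eq_coe_mul, field]
      ring
    · simp [jointDeriv]

/-- Differentiation in `h` reproduces the exponential times `β t`, so only the bound of order zero
needs the restriction of `h` to a bounded interval. -/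
theorem paramSmooth_exp {K : Set (𝕜 × ℝ)} {h₁ : ℝ} (hK : ∀ p ∈ K, p.2 ∈ Icc 0 h₁) (n : ℕ) :
    ParamSmooth ℝ (fun _ => 1) K n
      (fun (_ : Unit) (t : ℝ) (p : 𝕜 × ℝ) => Real.exp (φ.β * (p.2 * t))) := by
  have h0 : ParamSmooth ℝ (fun _ => 1) K 0
      (fun (_ : Unit) (t : ℝ) (p : 𝕜 × ℝ) => Real.exp (φ.β * (p.2 * t))) := by
    refine ⟨fun _ => by fun_prop, Real.exp (|φ.β| * h₁), fun _ t ht p hp => ?_⟩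
    have h2 := hK p hp
    rw [Real.norm_of_nonneg (Real.exp_pos _).le, mul_one, Real.exp_le_exp]
    have h3 : p.2 * t ≤ h₁ * 1 := mul_le_mul h2.2 ht.2 ht.1 (h2.1.trans h2.2)
    calc φ.β * (p.2 * t) ≤ |φ.β| * (p.2 * t) :=
          mul_le_mul_of_nonneg_right (le_abs_self _) (mul_nonneg h2.1 ht.1)
      _ ≤ |φ.β| * h₁ := mul_le_mul_of_nonneg_left (by linarith) (abs_nonneg _)
  induction n with
  | zero => exact h0
  | succ n ih =>
    refine ⟨h0, fun _ t p => (φ.β * t) • (Real.exp (φ.β * (p.2 * t)) •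
      ContinuousLinearMap.snd ℝ 𝕜 ℝ), fun _ t _ p _ => ?_, ?_⟩
    · have hs : HasFDerivAt (fun p : 𝕜 × ℝ => p.2 * t) (t • ContinuousLinearMap.snd ℝ 𝕜 ℝ) p :=
        hasFDerivAt_snd.mul_const t
      refine ((hs.const_mul φ.β).exp.hasFDerivWithinAt).congr_fderiv ?_
      ext <;> simp
      ring
    · have h1 := ParamSmooth.clm ((ContinuousLinearMap.lsmul ℝ ℝ).flip
        (ContinuousLinearMap.snd ℝ 𝕜 ℝ)) ih
      exact ParamSmooth.bilin (ContinuousLinearMap.lsmul ℝ ℝ)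
        (ParamSmooth.of_const (C := |φ.β|) (fun _ => by fun_prop) (fun _ t ht => by
          rw [norm_mul, Real.norm_eq_abs, Real.norm_of_nonneg ht.1]
          exact mul_le_of_le_one_right (abs_nonneg _) ht.2) n) h1

theorem paramSmooth_jointDeriv {K : Set (𝕜 × ℝ)} {h₁ C : ℝ} (hK : ∀ p ∈ K, p.2 ∈ Icc 0 h₁)
    (hC : ∀ p ∈ K, ‖φ.field p.1‖ ≤ C) (n : ℕ) :
    ParamSmooth ℝ (fun _ => 1) K n (fun (_ : Unit) (t : ℝ) (p : 𝕜 × ℝ) => φ.jointDeriv t p) := by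
  have he := φ.paramSmooth_exp hK n
  have ht : ParamSmooth ℝ (fun _ => 1) K n (fun (_ : Unit) (t : ℝ) (_ : 𝕜 × ℝ) => t) :=
    ParamSmooth.of_const (C := 1) (fun _ => by fun_prop)
      (fun _ t ht => by rw [Real.norm_of_nonneg ht.1]; exact ht.2) n
  have hu : ParamSmooth ℝ (fun _ => 1) K n
      (fun (_ : Unit) (_ : ℝ) (p : 𝕜 × ℝ) => φ.field p.1) := by
    have h0 : ParamSmooth ℝ (fun _ => 1) K 0
        (fun (_ : Unit) (_ : ℝ) (p : 𝕜 × ℝ) => φ.field p.1) :=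
      ⟨fun _ => by unfold field; fun_prop, C, fun _ t _ p hp => by simpa using hC p hp⟩
    cases n with
    | zero => exact h0
    | succ n =>
      refine ⟨h0, fun _ _ _ => φ.β • ContinuousLinearMap.fst ℝ 𝕜 ℝ, fun _ _ _ p _ => ?_,
        ParamSmooth.of_const (C := ‖φ.β • ContinuousLinearMap.fst ℝ 𝕜 ℝ‖)
          (fun _ => by fun_prop) (fun _ _ _ => le_rfl) n⟩
      have h := ((hasFDerivAt_fst (𝕜 := ℝ) (p := p)).const_smul φ.β).const_add (φ.α : 𝕜)
      refine (h.congr_of_eventuallyEq (Eventually.of_forall fun q => ?_)).hasFDerivWithinAt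
      simp [field, RCLike.real_smul_eq_coe_mul]
  have h1 := ParamSmooth.clm ((ContinuousLinearMap.lsmul ℝ ℝ).flip
    ((ContinuousLinearMap.inl ℝ 𝕜 ℝ).comp (ContinuousLinearMap.fst ℝ 𝕜 ℝ))) he
  have h2 := ParamSmooth.bilin (ContinuousLinearMap.lsmul ℝ ℝ)
    (ParamSmooth.bilin (ContinuousLinearMap.lsmul ℝ ℝ) ht he)
    (ParamSmooth.clm ((ContinuousLinearMap.compL ℝ _ _ _ (ContinuousLinearMap.inl ℝ 𝕜 ℝ)).comp
      (ContinuousLinearMap.smulRightL ℝ (𝕜 × ℝ) 𝕜 (ContinuousLinearMap.snd ℝ 𝕜 ℝ))) hu)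
  have h3 := ParamSmooth.of_const (𝕂 := ℝ) (ι := Unit) (X := 𝕜 × ℝ) (K := K)
    (c := fun _ _ => (ContinuousLinearMap.inr ℝ 𝕜 ℝ).comp (ContinuousLinearMap.snd ℝ 𝕜 ℝ))
    (C := ‖(ContinuousLinearMap.inr ℝ 𝕜 ℝ).comp (ContinuousLinearMap.snd ℝ 𝕜 ℝ)‖)
    (fun _ => by fun_prop) (fun _ _ _ => le_rfl) n
  exact (h1.add h2).add h3

end AffineFlow

namespace BddSmooth

theorem of_affine {𝕂 : Type*} [NontriviallyNormedField 𝕂] {ι X E : Type*} [NormedAddCommGroup X]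
    [NormedSpace 𝕂 X] [NormedAddCommGroup E] [NormedSpace 𝕂 E] {n : ℕ} {K : Set X}
    {F : ι → X → E} {C C' : ℝ} (hK : UniqueDiffOn 𝕂 K) {L : ι → X →L[𝕂] E}
    (hL : ∀ i, ‖L i‖ ≤ C) (hF : ∀ i, ∀ p ∈ K, HasFDerivWithinAt (F i) (L i) K p)
    (hb : ∀ i, ∀ p ∈ K, ‖F i p‖ ≤ C') : BddSmooth 𝕂 n (fun _ => 1) K F := by
  have h0 : ∃ C : ℝ, ∀ i, ∀ p ∈ K, ‖F i p‖ ≤ C * 1 := ⟨C', by simpa using hb⟩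
  rcases n with _ | n
  · exact zero_iff.2 ⟨fun i p hp => (hF i p hp).continuousWithinAt, h0⟩
  · exact succ_of_hasFDerivWithinAt hK (fun _ _ => zero_le_one) h0 hF (const hK hL)

end BddSmooth

/-! ### Frames and their function classes -/

/-- A nested family of domains in `𝕜 = ℝ` or `ℂ` with affine flows acting on it and with weights
that describe the decay at its infinite ends. -/
structure Frame (𝕜 : Type) [RCLike 𝕜] where
  Ω : ℕ → Set 𝕜
  h₁ : ℝ
  -- The number of derivatives over `𝕜` required beyond the joint order. It is `0` on a real
  -- interval and `1` on complex regions, where it keeps functions of joint order `0` holomorphic.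
  σ : ℕ
  κ : Type
  w : κ → 𝕜 → ℝ
  Λ : Type
  fin : Fintype Λ
  φ : Λ → AffineFlow
  ω : Λ → ℝ
  h₁_pos : 0 < h₁
  w_nonneg : ∀ e v, 0 ≤ w e v
  w_cont : ∀ e, Continuous (w e)
  w_bdd : ∀ e l, ∃ c, ∀ τ ∈ Icc 0 h₁, ∀ v, w e ((φ l).flow τ v) ≤ c * w e v
  uniq : ∀ s, UniqueDiffOn ℝ (Ω s)
  locConvex : ∀ s, ∀ p ∈ Ω s, ∃ ε > 0, Convex ℝ (Ω s ∩ Metric.ball p ε)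
  -- The domains have the same germ at each common point. Thus `der`, which is defined through `Ω
  -- 0`, is the derivative on every domain of the chain.
  nhds : ∀ s, ∀ v ∈ Ω s, 𝓝[Ω s] v = 𝓝[Ω 0] v
  maps : ∀ l s, ∀ τ ∈ Icc 0 h₁, ∀ v ∈ Ω (s + 1), (φ l).flow τ v ∈ Ω s
  anti : ∀ s, Ω (s + 1) ⊆ Ω s
  field_bdd : ∀ l, ∃ C, ∀ v ∈ Ω 0, ‖(φ l).field v‖ ≤ C
  -- The derivative in `v` is recovered as a combination, with constant coefficients, of the
  -- derivatives along the flows.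
  sum_field : ∀ v : 𝕜, ∑ l, (ω l : 𝕜) * (φ l).field v = 1
  -- Every domain reaches every end, so bounds and equations pass to the limits there.
  ends : ∀ e s ε, 0 < ε → ∃ v ∈ Ω s, w e v < ε

namespace Frame

attribute [instance] Frame.fin

variable {𝕜 : Type} [RCLike 𝕜] (P : Frame 𝕜)

theorem sub_zero (s : ℕ) : P.Ω s ⊆ P.Ω 0 := by
  induction s with
  | zero => exact subset_rfl
  | succ s ih => exact (P.anti s).trans ih

theorem uniq' (s : ℕ) : UniqueDiffOn 𝕜 (P.Ω s) := (P.uniq s).mono_field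

/-- The domain in both variables. -/
def dom (s : ℕ) : Set (𝕜 × ℝ) := P.Ω s ×ˢ Icc 0 P.h₁

theorem uniq_dom (s : ℕ) : UniqueDiffOn ℝ (P.dom s) :=
  (P.uniq s).prod (uniqueDiffOn_Icc P.h₁_pos)

theorem locConvex_dom (s : ℕ) : ∀ p ∈ P.dom s, ∃ ε > 0, Convex ℝ (P.dom s ∩ Metric.ball p ε) := by
  intro p hp
  obtain ⟨ε, hε, hc⟩ := P.locConvex s p.1 hp.1
  refine ⟨ε, hε, ?_⟩
  have : P.dom s ∩ Metric.ball p ε =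
      ((P.Ω s ∩ Metric.ball p.1 ε) ×ˢ Icc 0 P.h₁) ∩ Metric.ball p ε := by
    ext q
    simp only [dom, mem_inter_iff, mem_prod, Metric.mem_ball, Prod.dist_eq, max_lt_iff]
    tauto
  rw [this]
  exact (hc.prod (convex_Icc _ _)).inter (convex_ball _ _)

section Classes

variable {E E₁ E₂ E₃ : Type}
  [NormedAddCommGroup E] [NormedSpace ℝ E] [NormedSpace 𝕜 E] [IsScalarTower ℝ 𝕜 E]
  [NormedAddCommGroup E₁] [NormedSpace ℝ E₁] [NormedSpace 𝕜 E₁] [IsScalarTower ℝ 𝕜 E₁]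
  [NormedAddCommGroup E₂] [NormedSpace ℝ E₂] [NormedSpace 𝕜 E₂] [IsScalarTower ℝ 𝕜 E₂]
  [NormedAddCommGroup E₃] [NormedSpace ℝ E₃] [NormedSpace 𝕜 E₃] [IsScalarTower ℝ 𝕜 E₃]

/-- `f(v, h)` is jointly of class `C^n`, of class `C^{n + σ}` over `𝕜` in `v`, with bounds, and
converges at the ends; if `b` holds, then the limits vanish. -/
structure Cls (s : ℕ) (b : Prop) (n : ℕ) (f : 𝕜 → ℝ → E) : Prop where
  joint : BddSmooth ℝ n (fun _ => 1) (P.dom s) (fun _ : Unit => Function.uncurry f)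
  slice : BddSmooth 𝕜 (n + P.σ) (fun _ => 1) (P.Ω s) (fun (h : Icc (0 : ℝ) P.h₁) v => f v h)
  tail : ∀ e, ∃ L : ℝ → E, (b → L = 0) ∧
    BddSmooth 𝕜 (n + P.σ) (P.w e) (P.Ω s) (fun (h : Icc (0 : ℝ) P.h₁) v => f v h - L h)

variable {P} {s n m : ℕ} {b b' : Prop} {f g : 𝕜 → ℝ → E}

namespace Cls

theorem bound (hf : P.Cls s b n f) :
    ∃ C, 0 ≤ C ∧ ∀ v ∈ P.Ω s, ∀ h ∈ Icc 0 P.h₁, ‖f v h‖ ≤ C := by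
  obtain ⟨C, hC0, hC⟩ := hf.slice.bound_one
  exact ⟨C, hC0, fun v hv h hh => hC ⟨h, hh⟩ v hv⟩

theorem of_le (hf : P.Cls s b n f) (hmn : m ≤ n) : P.Cls s b m f where
  joint := hf.joint.of_le hmn
  slice := hf.slice.of_le (by omega)
  tail e := by
    obtain ⟨L, hb, hL⟩ := hf.tail e
    exact ⟨L, hb, hL.of_le (by omega)⟩

theorem weaken (hf : P.Cls s b n f) (hb : b' → b) : P.Cls s b' n f where
  joint := hf.joint
  slice := hf.slice
  tail e := by
    obtain ⟨L, hL⟩ := hf.tail e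
    exact ⟨L, fun h => hL.1 (hb h), hL.2⟩

theorem congr (hf : P.Cls s b n f) (hfg : ∀ v ∈ P.Ω s, ∀ h ∈ Icc 0 P.h₁, g v h = f v h) :
    P.Cls s b n g where
  joint := hf.joint.congr fun _ p hp => hfg p.1 hp.1 p.2 hp.2
  slice := hf.slice.congr fun h v hv => hfg v hv h h.2
  tail e := by
    obtain ⟨L, hb, hL⟩ := hf.tail e
    exact ⟨L, hb, hL.congr fun h v hv => by rw [hfg v hv h h.2]⟩

theorem zero : P.Cls s b n (fun _ _ => (0 : E)) where
  joint := BddSmooth.zero.congr fun _ _ _ => rfl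
  slice := BddSmooth.zero
  tail _ := ⟨0, fun _ => rfl, BddSmooth.zero.congr fun _ _ _ => by simp⟩

theorem const (c : E) : P.Cls s False n (fun _ _ => c) where
  joint := (BddSmooth.const (P.uniq_dom s) (c := fun _ => c) fun _ => le_rfl).congr
    fun _ _ _ => rfl
  slice := BddSmooth.const (P.uniq' s) (c := fun _ => c) fun _ => le_rfl
  tail _ := ⟨fun _ => c, False.elim, BddSmooth.zero.congr fun _ _ _ => by simp⟩

theorem add (hf : P.Cls s b n f) (hg : P.Cls s b n g) :
    P.Cls s b n (fun v h => f v h + g v h) where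
  joint := (hf.joint.add (P.uniq_dom s) hg.joint).congr fun _ _ _ => rfl
  slice := hf.slice.add (P.uniq' s) hg.slice
  tail e := by
    obtain ⟨L, hb, hL⟩ := hf.tail e
    obtain ⟨L', hb', hL'⟩ := hg.tail e
    exact ⟨L + L', fun h => by rw [hb h, hb' h, add_zero],
      (hL.add (P.uniq' s) hL').congr fun h v _ => by simp only [Pi.add_apply]; abel⟩

theorem clm (T : E →L[𝕜] E₁) (hf : P.Cls s b n f) : P.Cls s b n (fun v h => T (f v h)) where
  joint := (BddSmooth.clm (P.uniq_dom s) (T.restrictScalars ℝ) hf.joint).congr fun _ _ _ => rfl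
  slice := BddSmooth.clm (P.uniq' s) T hf.slice
  tail e := by
    obtain ⟨L, hb, hL⟩ := hf.tail e
    exact ⟨fun h => T (L h), fun h => by rw [hb h]; ext; simp,
      (BddSmooth.clm (P.uniq' s) T hL).congr fun h v _ => by simp⟩

theorem neg (hf : P.Cls s b n f) : P.Cls s b n (fun v h => -f v h) :=
  (clm (-ContinuousLinearMap.id 𝕜 E) hf).congr fun _ _ _ _ => by simp

theorem sub (hf : P.Cls s b n f) (hg : P.Cls s b n g) :
    P.Cls s b n (fun v h => f v h - g v h) :=
  (hf.add hg.neg).congr fun _ _ _ _ => sub_eq_add_neg _ _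

theorem sum {ι : Type*} (t : Finset ι) {f : ι → 𝕜 → ℝ → E} (hf : ∀ i ∈ t, P.Cls s b n (f i)) :
    P.Cls s b n (fun v h => ∑ i ∈ t, f i v h) := by
  classical
  induction t using Finset.induction_on with
  | empty => simpa using zero
  | insert i t hi ih =>
    refine ((hf i (Finset.mem_insert_self _ _)).add
      (ih fun j hj => hf j (Finset.mem_insert_of_mem hj))).congr fun v _ h _ => ?_
    rw [Finset.sum_insert hi]

/-- At a single point of weight less than `1`, `L h` differs from the bounded value `f v h` by a
bounded amount. -/
theorem tail_bound {L : ℝ → E} (hf : P.Cls s b n f) (e : P.κ)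
    (hL : BddSmooth 𝕜 (n + P.σ) (P.w e) (P.Ω s) (fun (h : Icc (0 : ℝ) P.h₁) v => f v h - L h)) :
    ∃ C, ∀ h : Icc (0 : ℝ) P.h₁, ‖L h‖ ≤ C := by
  obtain ⟨C, hC0, hC⟩ := hf.bound
  obtain ⟨C', hC'⟩ := hL.bound
  obtain ⟨v, hv, hwv⟩ := P.ends e s 1 one_pos
  refine ⟨C + |C'|, fun h => ?_⟩
  have h1 := hC' h v hv
  have h2 := hC v hv h h.2
  have h3 : C' * P.w e v ≤ |C'| * 1 :=
    (mul_le_mul_of_nonneg_right (le_abs_self C') (P.w_nonneg e v)).trans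
      (mul_le_mul_of_nonneg_left hwv.le (abs_nonneg _))
  calc ‖L h‖ = ‖f v h - (f v h - L h)‖ := by rw [sub_sub_cancel]
    _ ≤ ‖f v h‖ + ‖f v h - L h‖ := norm_sub_le _ _
    _ ≤ C + |C'| := by linarith

/-- At an end, `B f g - B L L' = B (f - L) g + B L (g - L')`, and each term has one decaying and one
bounded factor. -/
theorem bilin (B : E₁ →L[𝕜] E₂ →L[𝕜] E₃) {f : 𝕜 → ℝ → E₁} {g : 𝕜 → ℝ → E₂}
    (hf : P.Cls s b n f) (hg : P.Cls s b' n g) :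
    P.Cls s (b ∨ b') n (fun v h => B (f v h) (g v h)) where
  joint := (BddSmooth.bilin (P.uniq_dom s) (B.bilinearRestrictScalars ℝ) hf.joint hg.joint).congr
    fun _ _ _ => rfl
  slice := BddSmooth.bilin (P.uniq' s) B hf.slice hg.slice
  tail e := by
    obtain ⟨L, hb, hL⟩ := hf.tail e
    obtain ⟨L', hb', hL'⟩ := hg.tail e
    obtain ⟨C, hC⟩ := hf.tail_bound e hL
    refine ⟨fun h => B (L h) (L' h), ?_, ?_⟩
    · rintro (h | h)
      · rw [hb h]; ext; simp
      · rw [hb' h]; ext; simp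
    · refine ((BddSmooth.bilin (P.uniq' s) B hL hg.slice).add (P.uniq' s)
        (BddSmooth.bilin' (P.uniq' s) B (BddSmooth.const (P.uniq' s) hC) hL')).congr
        fun h v _ => ?_
      simp

theorem h_smul (hf : P.Cls s b n f) : P.Cls s b n (fun v h => h • f v h) where
  joint := by
    refine (BddSmooth.bilin' (P.uniq_dom s) (ContinuousLinearMap.lsmul ℝ ℝ) (F := fun _ p => p.2)
      (BddSmooth.of_affine (C' := P.h₁) (P.uniq_dom s)
        (L := fun _ => ContinuousLinearMap.snd ℝ 𝕜 ℝ) (fun _ => le_rfl)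
        (fun _ _ _ => hasFDerivWithinAt_snd) fun _ p hp => ?_) hf.joint).congr fun _ _ _ => rfl
    rw [Real.norm_of_nonneg hp.2.1]
    exact hp.2.2
  slice := by
    refine (BddSmooth.bilin' (P.uniq' s) (ContinuousLinearMap.lsmul 𝕜 𝕜 : 𝕜 →L[𝕜] E →L[𝕜] E)
      (BddSmooth.const (C := P.h₁) (P.uniq' s) (c := fun h : Icc (0 : ℝ) P.h₁ => ((h : ℝ) : 𝕜)) fun h => ?_)
      hf.slice).congr fun h v hv => ?_
    · rw [RCLike.norm_ofReal, abs_of_nonneg h.2.1]; exact h.2.2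
    · rw [RCLike.real_smul_eq_coe_smul (K := 𝕜)]; rfl
  tail e := by
    obtain ⟨L, hb, hL⟩ := hf.tail e
    refine ⟨fun h => h • L h, fun h => by rw [hb h]; ext; simp, ?_⟩
    refine (BddSmooth.bilin' (P.uniq' s) (ContinuousLinearMap.lsmul 𝕜 𝕜 : 𝕜 →L[𝕜] E →L[𝕜] E)
      (BddSmooth.const (C := P.h₁) (P.uniq' s) (c := fun h : Icc (0 : ℝ) P.h₁ => ((h : ℝ) : 𝕜)) fun h => ?_)
      hL).congr fun h v hv => ?_
    · rw [RCLike.norm_ofReal, abs_of_nonneg h.2.1]; exact h.2.2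
    · rw [← smul_sub, RCLike.real_smul_eq_coe_smul (K := 𝕜)]; rfl

theorem pow_smul (hf : P.Cls s b n f) (k : ℕ) : P.Cls s b n (fun v h => h ^ k • f v h) := by
  induction k with
  | zero => simpa using hf
  | succ k ih => exact ih.h_smul.congr fun v _ h _ => by rw [pow_succ', mul_smul]

theorem real_smul (c : ℝ) (hf : P.Cls s b n f) : P.Cls s b n (fun v h => c • f v h) :=
  (clm ((c : 𝕜) • ContinuousLinearMap.id 𝕜 E) hf).congr fun v _ h _ => by
    rw [RCLike.real_smul_eq_coe_smul (K := 𝕜)]; rfl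

end Cls

/-- The derivative in the first variable. -/
def der (P : Frame 𝕜) (f : 𝕜 → ℝ → E) (v : 𝕜) (h : ℝ) : E :=
  derivWithin (fun v => f v h) (P.Ω 0) v

theorem Cls.hasDerivWithinAt (hf : P.Cls s b (n + 1) f) {v : 𝕜} (hv : v ∈ P.Ω s) {h : ℝ}
    (hh : h ∈ Icc 0 P.h₁) :
    HasDerivWithinAt (fun v => f v h) (P.der f v h) (P.Ω s) v := by
  have h1 := (hf.slice.1 ⟨h, hh⟩).differentiableOn (by norm_cast; omega) v hv
  have h2 : DifferentiableWithinAt 𝕜 (fun v => f v h) (P.Ω 0) v := by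
    obtain ⟨L, hL⟩ := h1
    refine ⟨L, ?_⟩
    rw [HasFDerivWithinAt, P.nhds s v hv] at hL
    exact hL
  have h3 := h2.hasDerivWithinAt
  exact h3.mono (P.sub_zero s)

theorem der_eq_of_hasDerivWithinAt {v : 𝕜} (hv : v ∈ P.Ω s) {h : ℝ} {f' : E}
    (hf : HasDerivWithinAt (fun v => f v h) f' (P.Ω s) v) : P.der f v h = f' := by
  have h1 : HasDerivWithinAt (fun v => f v h) f' (P.Ω 0) v := by
    rw [hasDerivWithinAt_iff_hasFDerivWithinAt] at hf ⊢
    rw [HasFDerivWithinAt, ← P.nhds s v hv]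
    exact hf
  exact h1.derivWithin (P.uniq' 0 v (P.sub_zero s hv))

/-- Subtracting the limit does not affect the derivative, so the derivative decays at the ends even
when `f` only converges. -/
theorem Cls.der (hf : P.Cls s b (n + 1) f) : P.Cls s True n (P.der f) where
  joint := by
    refine (BddSmooth.clm (P.uniq_dom s)
      (ContinuousLinearMap.apply ℝ E ((1, 0) : 𝕜 × ℝ))
      (hf.joint.fderivWithin (P.uniq_dom s))).congr fun _ p hp => ?_
    have h1 := hf.joint.hasFDerivWithinAt n.succ_ne_zero () hp
    have h2 := hf.hasDerivWithinAt hp.1 hp.2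
    have h3 : HasFDerivWithinAt (fun v : 𝕜 => ((v, p.2) : 𝕜 × ℝ))
        (ContinuousLinearMap.inl ℝ 𝕜 ℝ) (P.Ω s) p.1 :=
      (hasFDerivAt_prodMk_left p.1 p.2).hasFDerivWithinAt
    have h4 := h1.comp (f := fun v : 𝕜 => ((v, p.2) : 𝕜 × ℝ)) p.1 h3 fun v hv => ⟨hv, hp.2⟩
    have h5 := h2.hasFDerivWithinAt.restrictScalars ℝ
    have h6 := (P.uniq s p.1 hp.1).eq h4 h5
    have h7 := congrArg (fun L : 𝕜 →L[ℝ] E => L 1) h6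
    simp only [ContinuousLinearMap.coe_comp, Function.comp_apply,
      ContinuousLinearMap.inl_apply, ContinuousLinearMap.coe_restrictScalars',
      ContinuousLinearMap.toSpanSingleton_apply, one_smul] at h7
    exact h7.symm
  slice := by
    have hs : BddSmooth 𝕜 (n + P.σ + 1) (fun _ => 1) (P.Ω s)
        (fun (h : Icc (0 : ℝ) P.h₁) v => f v h) := hf.slice.of_le (by omega)
    refine (BddSmooth.clm (P.uniq' s) (ContinuousLinearMap.apply 𝕜 E (1 : 𝕜))
      (hs.fderivWithin (P.uniq' s))).congr fun h v hv => ?_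
    have h1 := (hf.hasDerivWithinAt hv h.2).hasFDerivWithinAt.fderivWithin (P.uniq' s v hv)
    simp [h1]
  tail e := by
    obtain ⟨L, -, hL⟩ := hf.tail e
    have hs : BddSmooth 𝕜 (n + P.σ + 1) (P.w e) (P.Ω s)
        (fun (h : Icc (0 : ℝ) P.h₁) v => f v h - L h) := hL.of_le (by omega)
    refine ⟨0, fun _ => rfl, (BddSmooth.clm (P.uniq' s) (ContinuousLinearMap.apply 𝕜 E (1 : 𝕜))
      (hs.fderivWithin (P.uniq' s))).congr fun h v hv => ?_⟩
    have h1 := ((hf.hasDerivWithinAt hv h.2).sub_const (L h)).hasFDerivWithinAt.fderivWithin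
      (P.uniq' s v hv)
    simp [h1]

end Classes

end Frame

/-! ### Averages and increments along the flows -/

namespace Frame

variable {𝕜 : Type} [RCLike 𝕜] (P : Frame 𝕜)

variable {E : Type}
  [NormedAddCommGroup E] [NormedSpace ℝ E] [NormedSpace 𝕜 E] [IsScalarTower ℝ 𝕜 E]
  {s n m : ℕ} {b b' : Prop} {f g : 𝕜 → ℝ → E}

/-- The weighted average of `f` along the flow, for times between `0` and `h`. -/
def avg (l : P.Λ) (k : ℝ → ℝ) (f : 𝕜 → ℝ → E) (v : 𝕜) (h : ℝ) : E :=
  ∫ t in (0 : ℝ)..1, k t • f ((P.φ l).flow (h * t) v) h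

/-- The increment of `f` along the flow for time `h`. -/
def inc (l : P.Λ) (f : 𝕜 → ℝ → E) (v : 𝕜) (h : ℝ) : E :=
  f ((P.φ l).flow h v) h - f v h

/-- The difference of `f` and its average. -/
def osc (l : P.Λ) (f : 𝕜 → ℝ → E) (v : 𝕜) (h : ℝ) : E :=
  f v h - P.avg l (fun _ => 1) f v h

/-- The derivative of `f` along the vector field of the flow. -/
def lie (l : P.Λ) (f : 𝕜 → ℝ → E) (v : 𝕜) (h : ℝ) : E :=
  (P.φ l).field v • P.der f v h

variable {P}

theorem mul_mem_Icc {h t : ℝ} (hh : h ∈ Icc 0 P.h₁) (ht : t ∈ Icc (0 : ℝ) 1) :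
    h * t ∈ Icc 0 P.h₁ :=
  ⟨mul_nonneg hh.1 ht.1, (mul_le_of_le_one_right hh.1 ht.2).trans hh.2⟩

theorem flow_mem (l : P.Λ) {h t : ℝ} (hh : h ∈ Icc 0 P.h₁) (ht : t ∈ Icc (0 : ℝ) 1) {v : 𝕜}
    (hv : v ∈ P.Ω (s + 1)) : (P.φ l).flow (h * t) v ∈ P.Ω s :=
  P.maps l s _ (mul_mem_Icc hh ht) v hv

theorem continuous_flow_joint (l : P.Λ) :
    Continuous fun q : ℝ × 𝕜 => (P.φ l).flow q.1 q.2 := by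
  have := (P.φ l).continuous_c
  unfold AffineFlow.flow
  fun_prop

theorem paramSmooth_joint (l : P.Λ) {f : 𝕜 → ℝ → E}
    (hf : BddSmooth ℝ n (fun _ => 1) (P.dom s) (fun _ : Unit => Function.uncurry f)) :
    ParamSmooth ℝ (fun _ => 1) (P.dom (s + 1)) n
      (fun (_ : Unit) t p => Function.uncurry f ((P.φ l).flow (p.2 * t) p.1, p.2)) := by
  obtain ⟨C, hC⟩ := P.field_bdd l
  refine ParamSmooth.comp (γ := fun _ t p => ((P.φ l).flow (p.2 * t) p.1, p.2))
    (γ' := fun _ t p => (P.φ l).jointDeriv t p) (K := P.dom (s + 1))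
    (w := fun _ => 1) (c := 1) id (P.uniq_dom s) hf
    (fun _ t ht p hp => ⟨flow_mem l hp.2 ht hp.1, hp.2⟩) (fun _ => ?_)
    (fun _ t _ p _ => ((P.φ l).hasFDerivAt_joint t p).hasFDerivWithinAt)
    (fun m => (P.φ l).paramSmooth_jointDeriv (h₁ := P.h₁) (C := C) (fun p hp => hp.2)
      (fun p hp => hC p.1 (P.sub_zero _ hp.1)) m)
    (fun _ _ => zero_le_one) (fun _ _ _ _ _ => by simp)
  exact (Continuous.prodMk ((continuous_flow_joint l).comp (by fun_prop :
    Continuous fun q : ℝ × (𝕜 × ℝ) => (q.2.2 * q.1, q.2.1))) (by fun_prop)).continuousOn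

theorem paramSmooth_slice (l : P.Λ) {w : 𝕜 → ℝ} {c : ℝ} {f : Icc (0 : ℝ) P.h₁ → 𝕜 → E}
    (hw : ∀ v, 0 ≤ w v) (hwc : ∀ τ ∈ Icc 0 P.h₁, ∀ v, w ((P.φ l).flow τ v) ≤ c * w v)
    (hf : BddSmooth 𝕜 n w (P.Ω s) f) :
    ParamSmooth 𝕜 w (P.Ω (s + 1)) n
      (fun (h : Icc (0 : ℝ) P.h₁) t v => f h ((P.φ l).flow (h * t) v)) := by
  refine ParamSmooth.comp (γ := fun (h : Icc (0 : ℝ) P.h₁) t v => (P.φ l).flow (h * t) v)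
    (γ' := fun (h : Icc (0 : ℝ) P.h₁) t _ => (Real.exp ((P.φ l).β * (h * t)) : 𝕜) • ContinuousLinearMap.id 𝕜 𝕜)
    (c := c) id (P.uniq' s) hf
    (fun h t ht p hp => flow_mem l h.2 ht hp) (fun h => ?_)
    (fun h t _ p _ => ((P.φ l).hasFDerivAt_flow _ p).hasFDerivWithinAt)
    (fun m => ParamSmooth.of_const (C := Real.exp (|(P.φ l).β| * P.h₁)) (fun h => ?_)
      (fun h t ht => ?_) m)
    (fun v _ => hw v) (fun h t ht v hv => hwc _ (mul_mem_Icc h.2 ht) v)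
  · exact ((continuous_flow_joint l).comp (by fun_prop :
      Continuous fun q : ℝ × 𝕜 => ((h : ℝ) * q.1, q.2))).continuousOn
  · exact Continuous.continuousOn (by fun_prop)
  · have h2 := mul_mem_Icc h.2 ht
    rw [norm_smul, RCLike.norm_ofReal, Real.abs_exp]
    refine (mul_le_of_le_one_right (Real.exp_pos _).le ContinuousLinearMap.norm_id_le).trans ?_
    rw [Real.exp_le_exp]
    exact (mul_le_mul_of_nonneg_right (le_abs_self _) h2.1).trans
      (mul_le_mul_of_nonneg_left h2.2 (abs_nonneg _))

/-- The flow maps each domain into the previous one and changes the weights by bounded factors only.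
So composition costs one domain and leaves the limits unchanged. -/
theorem Cls.shift (l : P.Λ) (hf : P.Cls s b n f) :
    P.Cls (s + 1) b n (fun v h => f ((P.φ l).flow h v) h) where
  joint := by
    have h1 := (paramSmooth_joint l hf.joint).at_param (P.uniq_dom _) (fun _ _ => zero_le_one)
      (t := 1) (by simp)
    exact h1.congr fun _ p _ => by simp [Function.uncurry]
  slice := by
    have h1 := (paramSmooth_slice (c := 1) l (fun _ => zero_le_one)
      (fun _ _ _ => by simp) hf.slice).at_param
      (P.uniq' _) (fun _ _ => zero_le_one) (t := 1) (by simp)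
    exact h1.congr fun _ v _ => by simp
  tail e := by
    obtain ⟨L, hb, hL⟩ := hf.tail e
    obtain ⟨c, hc⟩ := P.w_bdd e l
    have h1 := (paramSmooth_slice l (P.w_nonneg e) hc hL).at_param
      (P.uniq' _) (fun v _ => P.w_nonneg e v) (t := 1) (by simp)
    exact ⟨L, hb, h1.congr fun _ v _ => by simp⟩

theorem Cls.continuousOn_flow (l : P.Λ) (hf : P.Cls s b n f) {v : 𝕜} (hv : v ∈ P.Ω (s + 1)) {h : ℝ}
    (hh : h ∈ Icc 0 P.h₁) :
    ContinuousOn (fun t => f ((P.φ l).flow (h * t) v) h) (Icc 0 1) :=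
  (paramSmooth_slice (c := 1) l (fun _ => zero_le_one)
    (fun _ _ _ => by simp) hf.slice).continuousOn_left ⟨h, hh⟩ hv

theorem intervalIntegrable_of_continuousOn {F : ℝ → E} (hF : ContinuousOn F (Icc 0 1)) :
    IntervalIntegrable F MeasureTheory.volume 0 1 :=
  ContinuousOn.intervalIntegrable (by rwa [uIcc_of_le zero_le_one])

/-- Smoothness is that of a parameter integral over times in the unit interval. The limit at an end
is multiplied by the integral of `k`. -/
theorem Cls.avg [CompleteSpace E] (l : P.Λ) {k : ℝ → ℝ} (hk : Continuous k)
    (hf : P.Cls s b n f) : P.Cls (s + 1) b n (P.avg l k f) := by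
  obtain ⟨C, hC⟩ := isCompact_Icc.exists_bound_of_continuousOn (f := k) (s := Icc (0 : ℝ) 1)
    hk.continuousOn
  have hC' : ∀ t ∈ Icc (0 : ℝ) 1, ‖((k t : ℝ) : 𝕜)‖ ≤ C := fun t ht => by
    rw [RCLike.norm_ofReal]; exact hC t ht
  refine ⟨?_, ?_, fun e => ?_⟩
  · have h1 := ParamSmooth.bilin (ContinuousLinearMap.lsmul ℝ ℝ).flip
      (paramSmooth_joint l hf.joint) (ParamSmooth.of_const (c := fun _ t => k t)
        (fun _ => hk.continuousOn) (fun _ => hC) n)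
    exact (h1.integral (P.uniq_dom _) (fun _ _ => zero_le_one) continuousOn_const
      (P.locConvex_dom _)).congr fun _ _ _ => rfl
  · have h1 := ParamSmooth.bilin (ContinuousLinearMap.lsmul 𝕜 𝕜 : 𝕜 →L[𝕜] E →L[𝕜] E).flip
      (paramSmooth_slice (c := 1) l (fun _ => zero_le_one) (fun _ _ _ => by simp) hf.slice)
      (ParamSmooth.of_const (c := fun _ t => ((k t : ℝ) : 𝕜))
        (fun _ => (RCLike.continuous_ofReal.comp hk).continuousOn) (fun _ => hC') _)
    refine (h1.integral (P.uniq' _) (fun _ _ => zero_le_one) continuousOn_const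
      (P.locConvex _)).congr fun h v _ => ?_
    simp only [Frame.avg, RCLike.real_smul_eq_coe_smul (K := 𝕜)]
    rfl
  · obtain ⟨L, hb, hL⟩ := hf.tail e
    obtain ⟨c, hc⟩ := P.w_bdd e l
    refine ⟨fun h => (∫ t in (0 : ℝ)..1, k t) • L h, fun h => by rw [hb h]; ext; simp, ?_⟩
    have h1 := ParamSmooth.bilin (ContinuousLinearMap.lsmul 𝕜 𝕜 : 𝕜 →L[𝕜] E →L[𝕜] E).flip
      (paramSmooth_slice l (P.w_nonneg e) hc hL)
      (ParamSmooth.of_const (c := fun _ t => ((k t : ℝ) : 𝕜))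
        (fun _ => (RCLike.continuous_ofReal.comp hk).continuousOn) (fun _ => hC') _)
    refine (h1.integral (P.uniq' _) (fun v _ => P.w_nonneg e v) (P.w_cont e).continuousOn
      (P.locConvex _)).congr fun h v hv => ?_
    have h2 : ∀ t, ((ContinuousLinearMap.lsmul 𝕜 𝕜 : 𝕜 →L[𝕜] E →L[𝕜] E).flip
        (f ((P.φ l).flow (h * t) v) h - L h)) ((k t : ℝ) : 𝕜)
        = k t • f ((P.φ l).flow (h * t) v) h - k t • L h := fun t => by
      rw [← smul_sub, RCLike.real_smul_eq_coe_smul (K := 𝕜)]; rfl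
    simp only [h2]
    rw [intervalIntegral.integral_sub, intervalIntegral.integral_smul_const]
    · rfl
    · exact intervalIntegrable_of_continuousOn
        (hk.continuousOn.smul (hf.continuousOn_flow l hv h.2))
    · exact intervalIntegrable_of_continuousOn (hk.continuousOn.smul continuousOn_const)

theorem Cls.anti (hf : P.Cls s b n f) : P.Cls (s + 1) b n f where
  joint := hf.joint.mono_set (P.uniq_dom _) (P.uniq_dom _) (prod_mono (P.anti s) subset_rfl)
  slice := hf.slice.mono_set (P.uniq' _) (P.uniq' _) (P.anti s)
  tail e := by
    obtain ⟨L, hb, hL⟩ := hf.tail e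
    exact ⟨L, hb, hL.mono_set (P.uniq' _) (P.uniq' _) (P.anti s)⟩

theorem Cls.osc [CompleteSpace E] (l : P.Λ) (hf : P.Cls s b n f) :
    P.Cls (s + 1) b n (P.osc l f) :=
  hf.anti.sub (hf.avg l continuous_const)

/-- The field is affine and bounded on the domains, so it neither costs smoothness nor disturbs the
decay of the derivative. -/
theorem Cls.lie (l : P.Λ) (hf : P.Cls s b (n + 1) f) : P.Cls s True n (P.lie l f) := by
  obtain ⟨C, hC⟩ := P.field_bdd l
  have h1 := hf.der
  refine ⟨?_, ?_, fun e => ?_⟩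
  · refine (BddSmooth.bilin' (P.uniq_dom s) ((ContinuousLinearMap.lsmul 𝕜 𝕜 :
      𝕜 →L[𝕜] E →L[𝕜] E).bilinearRestrictScalars ℝ) (F := fun _ p => (P.φ l).field p.1)
      (BddSmooth.of_affine (C' := C) (P.uniq_dom s)
        (L := fun _ => (P.φ l).β • ContinuousLinearMap.fst ℝ 𝕜 ℝ) (fun _ => le_rfl)
        (fun _ p _ => ?_) fun _ p hp => hC _ (P.sub_zero s hp.1)) h1.joint).congr
      fun _ _ _ => rfl
    have h := ((hasFDerivAt_fst (𝕜 := ℝ) (p := p)).const_smul (P.φ l).β).const_add ((P.φ l).α : 𝕜)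
    refine (h.congr_of_eventuallyEq (Eventually.of_forall fun q => ?_)).hasFDerivWithinAt
    simp [AffineFlow.field, RCLike.real_smul_eq_coe_mul]
  all_goals
    have h2 : BddSmooth 𝕜 (n + P.σ) (fun _ => 1) (P.Ω s)
        (fun (_ : Icc (0 : ℝ) P.h₁) v => (P.φ l).field v) := by
      refine BddSmooth.of_affine (C' := C) (P.uniq' s)
        (L := fun _ => ((P.φ l).β : 𝕜) • ContinuousLinearMap.id 𝕜 𝕜) (fun _ => le_rfl)
        (fun _ v _ => ?_) fun _ v hv => hC _ (P.sub_zero s hv)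
      have h := ((hasFDerivAt_id (𝕜 := 𝕜) v).const_smul ((P.φ l).β : 𝕜)).const_add
        ((P.φ l).α : 𝕜)
      refine (h.congr_of_eventuallyEq (Eventually.of_forall fun q => ?_)).hasFDerivWithinAt
      simp [AffineFlow.field]
  · exact (BddSmooth.bilin' (P.uniq' s) (ContinuousLinearMap.lsmul 𝕜 𝕜 :
      𝕜 →L[𝕜] E →L[𝕜] E) h2 h1.slice).congr fun _ _ _ => rfl
  · obtain ⟨L, hb, hL⟩ := h1.tail e
    refine ⟨0, fun _ => rfl, (BddSmooth.bilin' (P.uniq' s) (ContinuousLinearMap.lsmul 𝕜 𝕜 :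
      𝕜 →L[𝕜] E →L[𝕜] E) h2 hL).congr fun h v _ => ?_⟩
    simp [hb trivial, Frame.lie]

theorem hasDerivWithinAt_along (l : P.Λ) (hf : P.Cls s b (n + 1) f) {v : 𝕜}
    (hv : v ∈ P.Ω (s + 1)) {h : ℝ} (hh : h ∈ Icc 0 P.h₁) {t : ℝ} (ht : t ∈ Icc (0 : ℝ) 1) :
    HasDerivWithinAt (fun t => f ((P.φ l).flow (h * t) v) h)
      (h • P.lie l f ((P.φ l).flow (h * t) v) h) (Icc 0 1) t := by
  have h1 := hf.hasDerivWithinAt (flow_mem l hh ht hv) hh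
  have h2 : HasDerivAt (fun t : ℝ => (P.φ l).flow (h * t) v)
      (h • (P.φ l).field ((P.φ l).flow (h * t) v)) t :=
    ((P.φ l).hasDerivAt_flow (h * t) v).scomp t (by simpa using (hasDerivAt_id t).const_mul h)
  have h3 := h1.scomp t h2.hasDerivWithinAt (fun t ht => flow_mem l hh ht hv)
  rw [smul_assoc] at h3
  exact h3

/-- The fundamental theorem of calculus for `f` along the trajectory, with time rescaled by `h`. -/
theorem Cls.inc_eq [CompleteSpace E] (l : P.Λ) (hf : P.Cls s b (n + 1) f) {v : 𝕜}
    (hv : v ∈ P.Ω (s + 1))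
    {h : ℝ} (hh : h ∈ Icc 0 P.h₁) :
    P.inc l f v h = h • P.avg l (fun _ => 1) (P.lie l f) v h := by
  have h1 : ∀ t ∈ Ioo (0 : ℝ) 1, HasDerivAt (fun t => f ((P.φ l).flow (h * t) v) h)
      (h • P.lie l f ((P.φ l).flow (h * t) v) h) t := fun t ht =>
    (hasDerivWithinAt_along l hf hv hh (Ioo_subset_Icc_self ht)).hasDerivAt (Icc_mem_nhds ht.1 ht.2)
  have h2 := intervalIntegral.integral_eq_sub_of_hasDerivAt_of_le zero_le_one
    (hf.continuousOn_flow l hv hh) h1 (intervalIntegrable_of_continuousOn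
      (continuousOn_const.smul ((hf.lie l).continuousOn_flow l hv hh)))
  rw [intervalIntegral.integral_smul] at h2
  simp only [mul_zero, mul_one, AffineFlow.flow_zero] at h2
  simp only [inc, Frame.avg, one_smul, h2]

/-- Integration by parts along the trajectory against `1 - t`. This is the mechanism that trades one
derivative for one factor `h`. -/
theorem Cls.osc_eq [CompleteSpace E] (l : P.Λ) (hf : P.Cls s b (n + 1) f) {v : 𝕜}
    (hv : v ∈ P.Ω (s + 1))
    {h : ℝ} (hh : h ∈ Icc 0 P.h₁) :
    P.osc l f v h = h • -P.avg l (fun t => 1 - t) (P.lie l f) v h := by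
  have h1 : ∀ t ∈ Ioo (0 : ℝ) 1, HasDerivAt
      (fun t => (1 - t) • f ((P.φ l).flow (h * t) v) h)
      ((1 - t) • h • P.lie l f ((P.φ l).flow (h * t) v) h
        + (-1 : ℝ) • f ((P.φ l).flow (h * t) v) h) t := fun t ht =>
    ((hasDerivAt_id t).const_sub 1).smul
      ((hasDerivWithinAt_along l hf hv hh (Ioo_subset_Icc_self ht)).hasDerivAt
        (Icc_mem_nhds ht.1 ht.2))
  have hc0 := hf.continuousOn_flow l hv hh
  have hc1 := (hf.lie l).continuousOn_flow l hv hh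
  have hc2 : ContinuousOn (fun t : ℝ => 1 - t) (Icc 0 1) := by fun_prop
  have hi1 := intervalIntegrable_of_continuousOn (hc2.smul (continuousOn_const.smul hc1) :
    ContinuousOn (fun t => (1 - t) • h • P.lie l f ((P.φ l).flow (h * t) v) h) (Icc 0 1))
  have hi2 := intervalIntegrable_of_continuousOn (continuousOn_const.smul hc0 :
    ContinuousOn (fun t => (-1 : ℝ) • f ((P.φ l).flow (h * t) v) h) (Icc 0 1))
  have h2 := intervalIntegral.integral_eq_sub_of_hasDerivAt_of_le zero_le_one
    (hc2.smul hc0) h1 (hi1.add hi2)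
  have h3 := intervalIntegral.integral_add hi1 hi2
  simp only [Pi.smul_apply'] at h2 h3
  rw [h3, intervalIntegral.integral_smul] at h2
  simp only [smul_comm _ h, intervalIntegral.integral_smul] at h2
  simp only [mul_zero, mul_one, AffineFlow.flow_zero, sub_self, zero_smul, _root_.sub_zero,
    one_smul, zero_sub, neg_smul] at h2
  simp only [Frame.osc, Frame.avg, one_smul, smul_neg]
  rw [← sub_eq_zero] at h2 ⊢
  rw [← h2]
  abel

end Frame

/-! ### Orders of smallness, and a substitute for `h ∂` without loss of derivatives -/

namespace Frame

variable {𝕜 : Type} [RCLike 𝕜] (P : Frame 𝕜)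

variable {E E₁ E₂ E₃ : Type}
  [NormedAddCommGroup E] [NormedSpace ℝ E] [NormedSpace 𝕜 E] [IsScalarTower ℝ 𝕜 E]
  [NormedAddCommGroup E₁] [NormedSpace ℝ E₁] [NormedSpace 𝕜 E₁] [IsScalarTower ℝ 𝕜 E₁]
  [NormedAddCommGroup E₂] [NormedSpace ℝ E₂] [NormedSpace 𝕜 E₂] [IsScalarTower ℝ 𝕜 E₂]
  [NormedAddCommGroup E₃] [NormedSpace ℝ E₃] [NormedSpace 𝕜 E₃] [IsScalarTower ℝ 𝕜 E₃]
  {s n m r k : ℕ} {b b' : Prop} {f f' g g' : 𝕜 → ℝ → E}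

/-- `f` is of class `Cls` on the domains far in the chain. -/
def Ev (b : Prop) (n : ℕ) (f : 𝕜 → ℝ → E) : Prop := ∀ᶠ s in atTop, P.Cls s b n f

/-- Equality on the domains far in the chain. -/
def EqEv (f g : 𝕜 → ℝ → E) : Prop :=
  ∀ᶠ s in atTop, ∀ v ∈ P.Ω s, ∀ h ∈ Icc 0 P.h₁, f v h = g v h

/-- `f` is `h ^ k` times a decaying function of class `C^{r - k}`. -/
def Small (r k : ℕ) (f : 𝕜 → ℝ → E) : Prop :=
  ∃ G : 𝕜 → ℝ → E, P.Ev True (r - k) G ∧ P.EqEv f (fun v h => h ^ k • G v h)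

variable {P}

/-- Each operation along a flow consumes one domain of the chain. Only finitely many operations are
performed, so speaking of all sufficiently late domains removes the bookkeeping. -/
theorem eventually_succ {p q : ℕ → Prop} (hp : ∀ᶠ s in atTop, p s) (hq : ∀ s, p s → q (s + 1)) :
    ∀ᶠ s in atTop, q s := by
  obtain ⟨N, hN⟩ := eventually_atTop.1 hp
  filter_upwards [eventually_ge_atTop (N + 1)] with s hs
  obtain ⟨t, rfl⟩ : ∃ t, s = t + 1 := ⟨s - 1, by omega⟩
  exact hq t (hN t (by omega))

namespace EqEv

theorem refl (f : 𝕜 → ℝ → E) : P.EqEv f f := Eventually.of_forall fun _ _ _ _ _ => rfl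

theorem trans {u : 𝕜 → ℝ → E} (h : P.EqEv f g) (h' : P.EqEv g u) : P.EqEv f u := by
  filter_upwards [h, h'] with s h h' v hv t ht
  rw [h v hv t ht, h' v hv t ht]

theorem map₂ (F : E₁ → E₂ → E) {f f' : 𝕜 → ℝ → E₁} {g g' : 𝕜 → ℝ → E₂} (h : P.EqEv f f')
    (h' : P.EqEv g g') : P.EqEv (fun v t => F (f v t) (g v t)) (fun v t => F (f' v t) (g' v t)) := by
  filter_upwards [h, h'] with s h h' v hv t ht
  rw [h v hv t ht, h' v hv t ht]

theorem smul (F : ℝ → ℝ) (h : P.EqEv f g) :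
    P.EqEv (fun v t => F t • f v t) (fun v t => F t • g v t) := by
  filter_upwards [h] with s h v hv t ht
  rw [h v hv t ht]

theorem sum {ι : Type*} (t : Finset ι) {f g : ι → 𝕜 → ℝ → E}
    (hfg : ∀ i ∈ t, P.EqEv (f i) (g i)) :
    P.EqEv (fun v h => ∑ i ∈ t, f i v h) (fun v h => ∑ i ∈ t, g i v h) := by
  have h1 : ∀ᶠ s in atTop, ∀ i ∈ t, ∀ v ∈ P.Ω s, ∀ h ∈ Icc 0 P.h₁, f i v h = g i v h :=
    (Finset.eventually_all t).2 hfg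
  filter_upwards [h1] with s h1 v hv h hh
  exact Finset.sum_congr rfl fun i hi => h1 i hi v hv h hh

theorem avg (l : P.Λ) (κ : ℝ → ℝ) (h : P.EqEv f g) : P.EqEv (P.avg l κ f) (P.avg l κ g) := by
  refine eventually_succ h fun s h v hv t ht => ?_
  refine intervalIntegral.integral_congr fun τ hτ => ?_
  rw [uIcc_of_le zero_le_one] at hτ
  simp only [h _ (flow_mem l ht hτ hv) t ht]

theorem osc (l : P.Λ) (h : P.EqEv f g) : P.EqEv (P.osc l f) (P.osc l g) :=
  map₂ (fun x y => x - y) h (h.avg l _)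

theorem inc (l : P.Λ) (h : P.EqEv f g) : P.EqEv (P.inc l f) (P.inc l g) := by
  have h1 : P.EqEv (fun v t => f ((P.φ l).flow t v) t) (fun v t => g ((P.φ l).flow t v) t) :=
    eventually_succ h fun s h v hv t ht => h _ (P.maps l s t ht v hv) t ht
  exact map₂ (fun x y => x - y) h1 h

theorem osc_iterate (l : P.Λ) (h : P.EqEv f g) (i : ℕ) :
    P.EqEv ((P.osc l)^[i] f) ((P.osc l)^[i] g) := by
  induction i with
  | zero => exact h
  | succ i ih =>
    rw [Function.iterate_succ_apply', Function.iterate_succ_apply']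
    exact ih.osc l

end EqEv

namespace Ev

theorem of_le (h : P.Ev b n f) (hmn : m ≤ n) : P.Ev b m f := h.mono fun _ h => h.of_le hmn

theorem weaken (h : P.Ev b n f) (hb : b' → b) : P.Ev b' n f := h.mono fun _ h => h.weaken hb

theorem cnv (h : P.Ev b n f) : P.Ev False n f := h.weaken False.elim

theorem congr (h : P.Ev b n f) (h' : P.EqEv g f) : P.Ev b n g := by
  filter_upwards [h, h'] with s h h' using h.congr h'

theorem const (c : E) : P.Ev False n (fun _ _ => c) := Eventually.of_forall fun _ => Cls.const c

theorem zero : P.Ev b n (fun _ _ => (0 : E)) := Eventually.of_forall fun _ => Cls.zero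

theorem add (h : P.Ev b n f) (h' : P.Ev b n g) : P.Ev b n (fun v t => f v t + g v t) := by
  filter_upwards [h, h'] with s h h' using h.add h'

theorem sub (h : P.Ev b n f) (h' : P.Ev b n g) : P.Ev b n (fun v t => f v t - g v t) := by
  filter_upwards [h, h'] with s h h' using h.sub h'

theorem neg (h : P.Ev b n f) : P.Ev b n (fun v t => -f v t) := h.mono fun _ h => h.neg

theorem bilin (B : E₁ →L[𝕜] E₂ →L[𝕜] E₃) {f : 𝕜 → ℝ → E₁} {g : 𝕜 → ℝ → E₂} (h : P.Ev b n f)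
    (h' : P.Ev b' n g) : P.Ev (b ∨ b') n (fun v t => B (f v t) (g v t)) := by
  filter_upwards [h, h'] with s h h' using h.bilin B h'

theorem pow_smul (h : P.Ev b n f) (k : ℕ) : P.Ev b n (fun v t => t ^ k • f v t) :=
  h.mono fun _ h => h.pow_smul k

theorem h_smul (h : P.Ev b n f) : P.Ev b n (fun v t => t • f v t) :=
  h.mono fun _ h => h.h_smul

theorem real_smul (c : ℝ) (h : P.Ev b n f) : P.Ev b n (fun v t => c • f v t) :=
  h.mono fun _ h => h.real_smul c

theorem sum {ι : Type*} (t : Finset ι) {f : ι → 𝕜 → ℝ → E} (hf : ∀ i ∈ t, P.Ev b n (f i)) :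
    P.Ev b n (fun v h => ∑ i ∈ t, f i v h) := by
  have h1 : ∀ᶠ s in atTop, ∀ i ∈ t, P.Cls s b n (f i) := (Finset.eventually_all t).2 hf
  exact h1.mono fun _ h => Cls.sum t h

theorem lie (l : P.Λ) (h : P.Ev b (n + 1) f) : P.Ev True n (P.lie l f) := h.mono fun _ h => h.lie l

theorem der (h : P.Ev b (n + 1) f) : P.Ev True n (P.der f) := h.mono fun _ h => h.der

variable [CompleteSpace E]

theorem avg (l : P.Λ) {κ : ℝ → ℝ} (hκ : Continuous κ) (h : P.Ev b n f) : P.Ev b n (P.avg l κ f) :=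
  eventually_succ h fun _ h => h.avg l hκ

theorem osc (l : P.Λ) (h : P.Ev b n f) : P.Ev b n (P.osc l f) :=
  eventually_succ h fun _ h => h.osc l

theorem osc_iterate (l : P.Λ) (h : P.Ev b n f) (i : ℕ) : P.Ev b n ((P.osc l)^[i] f) := by
  induction i with
  | zero => exact h
  | succ i ih => rw [Function.iterate_succ_apply']; exact ih.osc l

/-- The shifted function has the same limits as the function itself, so their difference decays at
the ends. -/
theorem inc (l : P.Λ) (h : P.Ev b n f) : P.Ev True n (P.inc l f) := by
  refine eventually_succ h fun s h => ?_
  have h1 := h.shift l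
  refine ⟨(h1.sub h.anti).joint, (h1.sub h.anti).slice, fun e => ?_⟩
  obtain ⟨L, -, hL⟩ := h.tail e
  obtain ⟨c, hc⟩ := P.w_bdd e l
  have h2 := (paramSmooth_slice l (P.w_nonneg e) hc hL).at_param
    (P.uniq' _) (fun v _ => P.w_nonneg e v) (t := 1) (by simp)
  refine ⟨0, fun _ => rfl, (h2.sub (P.uniq' _)
    (hL.mono_set (P.uniq' _) (P.uniq' _) (P.anti s))).congr fun t v _ => ?_⟩
  simp [Frame.inc]

theorem inc_eq (l : P.Λ) (h : P.Ev b (n + 1) f) :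
    P.EqEv (P.inc l f) (fun v t => t • P.avg l (fun _ => 1) (P.lie l f) v t) :=
  eventually_succ h fun _ h _ hv _ ht => h.inc_eq l hv ht

theorem osc_eq (l : P.Λ) (h : P.Ev b (n + 1) f) :
    P.EqEv (P.osc l f) (fun v t => t • -P.avg l (fun t => 1 - t) (P.lie l f) v t) :=
  eventually_succ h fun _ h _ hv _ ht => h.osc_eq l hv ht

theorem osc_sub (l : P.Λ) (h : P.Ev b n f) (h' : P.Ev b' n g) :
    P.EqEv (P.osc l (fun v t => f v t - g v t)) (fun v t => P.osc l f v t - P.osc l g v t) := by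
  refine eventually_succ (h.and h') fun s h v hv t ht => ?_
  simp only [Frame.osc, Frame.avg, one_smul]
  rw [intervalIntegral.integral_sub (intervalIntegrable_of_continuousOn
    (h.1.continuousOn_flow l hv ht)) (intervalIntegrable_of_continuousOn
    (h.2.continuousOn_flow l hv ht))]
  abel

theorem osc_iterate_sub (l : P.Λ) (h : P.Ev b n f) (h' : P.Ev b' n g) (i : ℕ) :
    P.EqEv ((P.osc l)^[i] (fun v t => f v t - g v t))
      (fun v t => (P.osc l)^[i] f v t - (P.osc l)^[i] g v t) := by
  induction i with
  | zero => exact EqEv.refl _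
  | succ i ih =>
    simp only [Function.iterate_succ_apply']
    exact (ih.osc l).trans (osc_sub l (h.osc_iterate l i) (h'.osc_iterate l i))

end Ev

/-- The flow moves `v` and leaves `h` alone, so factors that depend on `h` alone pass through. -/
theorem osc_smul (l : P.Λ) (F : ℝ → ℝ) (f : 𝕜 → ℝ → E) :
    P.osc l (fun v t => F t • f v t) = fun v t => F t • P.osc l f v t := by
  ext v t
  simp only [osc, avg, one_smul, intervalIntegral.integral_smul, smul_sub]

theorem osc_iterate_smul (l : P.Λ) (F : ℝ → ℝ) (f : 𝕜 → ℝ → E) (i : ℕ) :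
    (P.osc l)^[i] (fun v t => F t • f v t) = fun v t => F t • (P.osc l)^[i] f v t := by
  induction i with
  | zero => rfl
  | succ i ih => simp only [Function.iterate_succ_apply', ih, osc_smul]

theorem inc_smul (l : P.Λ) (F : ℝ → ℝ) (f : 𝕜 → ℝ → E) :
    P.inc l (fun v t => F t • f v t) = fun v t => F t • P.inc l f v t := by
  ext v t
  simp only [inc, smul_sub]

variable (P) in
/-- An approximation of `h ∂_v` that loses no derivatives. -/
def diffOp (r : ℕ) (f : 𝕜 → ℝ → E) (v : 𝕜) (h : ℝ) : E :=
  -- Since `inc f = h avg (lie f)` and `avg = 1 - osc`, the sum of powers of `osc` is a truncated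
  -- Neumann series that inverts `avg`.
  ∑ l, P.ω l • ∑ i ∈ Finset.range r, (P.osc l)^[i] (P.inc l f) v h

theorem diffOp_smul (r : ℕ) (F : ℝ → ℝ) (f : 𝕜 → ℝ → E) :
    P.diffOp r (fun v t => F t • f v t) = fun v t => F t • P.diffOp r f v t := by
  ext v t
  simp only [diffOp, inc_smul, osc_iterate_smul, Finset.smul_sum]
  exact Finset.sum_congr rfl fun l _ => Finset.sum_congr rfl fun i _ => smul_comm _ _ _

theorem EqEv.diffOp (r : ℕ) (h : P.EqEv f g) : P.EqEv (P.diffOp r f) (P.diffOp r g) :=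
  EqEv.sum _ fun l _ => EqEv.smul (fun _ => P.ω l)
    (EqEv.sum _ fun i _ => (h.inc l).osc_iterate l i)

section Complete

variable [CompleteSpace E]

theorem Ev.diffOp (r : ℕ) (h : P.Ev b n f) : P.Ev True n (P.diffOp r f) :=
  Ev.sum _ fun l _ => Ev.real_smul _ (Ev.sum _ fun i _ => (h.inc l).osc_iterate l i)

theorem Ev.diffOp_eq (r : ℕ) (h : P.Ev b (n + 1) f) : P.EqEv (P.diffOp r f) (fun v t =>
    t • ∑ l, P.ω l • ∑ i ∈ Finset.range r,
      (P.osc l)^[i] (P.avg l (fun _ => 1) (P.lie l f)) v t) := by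
  have h1 : ∀ l i, P.EqEv ((P.osc l)^[i] (P.inc l f))
      (fun v t => t • (P.osc l)^[i] (P.avg l (fun _ => 1) (P.lie l f)) v t) := fun l i => by
    rw [← osc_iterate_smul l (fun t => t)]
    exact (h.inc_eq l).osc_iterate l i
  refine (EqEv.sum Finset.univ fun l _ => EqEv.smul (fun _ => P.ω l)
    (EqEv.sum (Finset.range r) fun i _ => h1 l i)).trans
    (Eventually.of_forall fun s v _ t _ => ?_)
  simp only [Finset.smul_sum]
  exact Finset.sum_congr rfl fun l _ => Finset.sum_congr rfl fun i _ => smul_comm _ _ _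

/-- Each of the `k` oscillations uses up one derivative and yields one factor `h`. -/
theorem Small.osc_iterate_of (l : P.Λ) (h : P.Ev True n f) (hk : k ≤ n) :
    P.Small n k ((P.osc l)^[k] f) := by
  induction k with
  | zero => exact ⟨f, h, Eventually.of_forall fun s v _ t _ => by simp⟩
  | succ k ih =>
    obtain ⟨G, hG, hGe⟩ := ih (by omega)
    have hG' : P.Ev True (n - (k + 1) + 1) G := hG.of_le (by omega)
    refine ⟨fun v t => -P.avg l (fun t => 1 - t) (P.lie l G) v t,
      (((hG'.lie l).avg l (by fun_prop))).neg, ?_⟩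
    rw [Function.iterate_succ_apply']
    refine (hGe.osc l).trans ?_
    rw [osc_smul l (fun t => t ^ k)]
    refine ((hG'.osc_eq l).smul (fun t => t ^ k)).trans
      (Eventually.of_forall fun s v _ t _ => ?_)
    simp only [smul_smul, pow_succ]

theorem Small.osc_iterate (l : P.Λ) (h : P.Small r k f) (i : ℕ) :
    P.Small r k ((P.osc l)^[i] f) := by
  obtain ⟨G, hG, hGe⟩ := h
  refine ⟨(P.osc l)^[i] G, hG.osc_iterate l i, ?_⟩
  have h1 := hGe.osc_iterate l i
  rwa [osc_iterate_smul l (fun t => t ^ k)] at h1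

/-- Telescoping, because `avg f = f - osc f`. -/
theorem Ev.sum_osc_avg (l : P.Λ) (h : P.Ev b n f) (r : ℕ) :
    P.EqEv (fun v t => ∑ i ∈ Finset.range r, (P.osc l)^[i] (P.avg l (fun _ => 1) f) v t)
      (fun v t => f v t - (P.osc l)^[r] f v t) := by
  have h0 : P.avg l (fun _ => 1) f = fun v t => f v t - P.osc l f v t := by
    ext v t
    simp only [Frame.osc, sub_sub_cancel]
  have h1 : ∀ i, P.EqEv ((P.osc l)^[i] (P.avg l (fun _ => 1) f))
      (fun v t => (P.osc l)^[i] f v t - (P.osc l)^[i + 1] f v t) := fun i => by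
    rw [h0, Function.iterate_succ_apply]
    exact h.osc_iterate_sub l (h.osc l) i
  refine (EqEv.sum (Finset.range r) fun i _ => h1 i).trans
    (Eventually.of_forall fun s v _ t _ => ?_)
  exact Finset.sum_range_sub' (fun i => (P.osc l)^[i] f v t) r

end Complete

namespace Small

theorem congr (h : P.Small r k f) (hg : P.EqEv g f) : P.Small r k g := by
  obtain ⟨G, hG, hGe⟩ := h
  exact ⟨G, hG, hg.trans hGe⟩

theorem zero : P.Small r k (fun _ _ => (0 : E)) :=
  ⟨fun _ _ => 0, Ev.zero, Eventually.of_forall fun _ _ _ _ _ => by simp⟩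

theorem of_ev (h : P.Ev True r f) : P.Small r 0 f :=
  ⟨f, h, Eventually.of_forall fun _ _ _ _ _ => by simp⟩

theorem ev (h : P.Small r k f) : P.Ev True (r - k) f := by
  obtain ⟨G, hG, hGe⟩ := h
  exact (hG.pow_smul k).congr hGe

theorem add (hf : P.Small r k f) (hg : P.Small r k g) :
    P.Small r k (fun v t => f v t + g v t) := by
  obtain ⟨F, hF, hFe⟩ := hf
  obtain ⟨G, hG, hGe⟩ := hg
  refine ⟨_, hF.add hG, (EqEv.map₂ (fun x y => x + y) hFe hGe).trans
    (Eventually.of_forall fun s v _ t _ => ?_)⟩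
  simp only [smul_add]

theorem neg (hf : P.Small r k f) : P.Small r k (fun v t => -f v t) := by
  obtain ⟨F, hF, hFe⟩ := hf
  refine ⟨_, hF.neg, ?_⟩
  filter_upwards [hFe] with s h v hv t ht
  rw [h v hv t ht, smul_neg]

theorem sub (hf : P.Small r k f) (hg : P.Small r k g) :
    P.Small r k (fun v t => f v t - g v t) :=
  (hf.add hg.neg).congr (Eventually.of_forall fun _ _ _ _ _ => sub_eq_add_neg _ _)

theorem real_smul (c : ℝ) (hf : P.Small r k f) : P.Small r k (fun v t => c • f v t) := by
  obtain ⟨F, hF, hFe⟩ := hf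
  refine ⟨_, hF.real_smul c, ?_⟩
  filter_upwards [hFe] with s h v hv t ht
  rw [h v hv t ht, smul_comm]

theorem sum {ι : Type*} (t : Finset ι) {f : ι → 𝕜 → ℝ → E} (hf : ∀ i ∈ t, P.Small r k (f i)) :
    P.Small r k (fun v h => ∑ i ∈ t, f i v h) := by
  classical
  induction t using Finset.induction_on with
  | empty => simpa using zero
  | insert i t hi ih =>
    refine ((hf i (Finset.mem_insert_self _ _)).add
      (ih fun j hj => hf j (Finset.mem_insert_of_mem hj))).congr
      (Eventually.of_forall fun _ v _ h _ => ?_)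
    simp only [Finset.sum_insert hi]

theorem bilin (B : E₁ →L[𝕜] E₂ →L[𝕜] E₃) {f : 𝕜 → ℝ → E₁} {g : 𝕜 → ℝ → E₂}
    (hf : P.Small r k f) (hg : P.Ev False r g) : P.Small r k (fun v t => B (f v t) (g v t)) := by
  obtain ⟨F, hF, hFe⟩ := hf
  refine ⟨_, (hF.bilin B (hg.of_le (Nat.sub_le _ _))).weaken (fun _ => Or.inl trivial),
    (EqEv.map₂ (fun x y => B x y) hFe (EqEv.refl g)).trans
      (Eventually.of_forall fun s v _ t _ => ?_)⟩
  simp only [RCLike.real_smul_eq_coe_smul (K := 𝕜), map_smul, _root_.smul_apply]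

theorem bilin' (B : E₁ →L[𝕜] E₂ →L[𝕜] E₃) {f : 𝕜 → ℝ → E₁} {g : 𝕜 → ℝ → E₂}
    (hf : P.Ev False r f) (hg : P.Small r k g) : P.Small r k (fun v t => B (f v t) (g v t)) := by
  simpa using bilin B.flip hg hf

/-- A product of functions of orders `1` and `k` has order `k + 1`. -/
theorem bilin_succ (B : E₁ →L[𝕜] E₂ →L[𝕜] E₃) {f : 𝕜 → ℝ → E₁} {g : 𝕜 → ℝ → E₂}
    (hf : P.Small r 1 f) (hg : P.Small r k g) (hk : k + 1 ≤ r) :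
    P.Small r (k + 1) (fun v t => B (f v t) (g v t)) := by
  obtain ⟨F, hF, hFe⟩ := hf
  obtain ⟨G, hG, hGe⟩ := hg
  refine ⟨_, ((hF.of_le (by omega)).bilin B (hG.of_le (by omega))).weaken
    (fun _ => Or.inl trivial), (EqEv.map₂ (fun x y => B x y) hFe hGe).trans
      (Eventually.of_forall fun s v _ t _ => ?_)⟩
  simp only [RCLike.real_smul_eq_coe_smul (K := 𝕜), map_smul, _root_.smul_apply,
    smul_smul, pow_succ]
  push_cast
  congr 1
  ring

variable [CompleteSpace E]

/-- The increment supplies a factor `h` at the price of one derivative of the cofactor, so the order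
goes up by one. -/
theorem diffOp (hf : P.Small r k f) (hk : k + 1 ≤ r) : P.Small r (k + 1) (P.diffOp r f) := by
  obtain ⟨G, hG, hGe⟩ := hf
  have hG' : P.Ev True (r - (k + 1) + 1) G := hG.of_le (by omega)
  refine ⟨_, Ev.sum Finset.univ fun l _ => Ev.real_smul (P.ω l) (Ev.sum (Finset.range r) fun i _ =>
    (((hG'.lie l).avg l (κ := fun _ => 1) continuous_const).osc_iterate l i)), ?_⟩
  refine (hGe.diffOp r).trans ?_
  rw [diffOp_smul r (fun t => t ^ k)]
  refine ((hG'.diffOp_eq r).smul (fun t => t ^ k)).trans (Eventually.of_forall fun s v _ t _ => ?_)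
  simp only [smul_smul, pow_succ]

/-- The error is `-h` times a combination of `osc^r (lie f)`, where `lie f` has `r - 1` derivatives.
Of the `r` oscillations, `k - 1` are spent on powers of `h`; together with the explicit factor this
makes `h ^ k`. The same function admits this for every `k` in the range, which is why one
transformation serves all orders. -/
theorem diffOp_sub (hf : P.Ev b r f) (hk : 1 ≤ k) (hkr : k ≤ r) :
    P.Small r k (fun v t => P.diffOp r f v t - t • P.der f v t) := by
  obtain ⟨n, rfl⟩ : ∃ n, r = n + 1 := ⟨r - 1, by omega⟩
  obtain ⟨j, rfl⟩ : ∃ j, k = j + 1 := ⟨k - 1, by omega⟩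
  have h1 : ∀ l, P.Small n j ((P.osc l)^[n + 1] (P.lie l f)) := fun l => by
    have h2 := Small.osc_iterate_of (k := j) l (hf.lie l) (by omega)
    -- The remaining oscillations are not needed for powers of `h` and merely preserve the class.
    have h3 := Small.osc_iterate l h2 (n + 1 - j)
    rwa [← Function.iterate_add_apply, Nat.sub_add_cancel (by omega)] at h3
  have h2 := sum Finset.univ fun l _ => real_smul (-P.ω l) (h1 l)
  obtain ⟨G, hG, hGe⟩ := h2
  refine ⟨G, hG.of_le (by omega), ?_⟩
  have h3 := EqEv.sum Finset.univ fun l _ =>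
    EqEv.smul (fun _ => P.ω l) ((hf.lie l).sum_osc_avg l (n + 1))
  filter_upwards [hf.diffOp_eq (n + 1), h3, hGe] with s h1 h3 hGe v hv t ht
  have h4 : ∑ l, P.ω l • P.lie l f v t = P.der f v t := by
    simp only [Frame.lie, RCLike.real_smul_eq_coe_smul (K := 𝕜), smul_smul, ← Finset.sum_smul,
      P.sum_field, one_smul]
  rw [h1 v hv t ht, h3 v hv t ht, pow_succ', mul_smul, ← hGe v hv t ht, ← smul_sub]
  simp only [smul_sub, Finset.sum_sub_distrib, h4, neg_smul, Finset.sum_neg_distrib, smul_neg]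
  abel

end Small

end Frame

/-! ### Sylvester and Riccati equations for single matrices -/

theorem ContinuousLinearMap.exists_inverse_of_bilin {E EA EB : Type*} [NormedAddCommGroup E]
    [NormedSpace ℂ E] [FiniteDimensional ℂ E] [NormedAddCommGroup EA] [NormedSpace ℂ EA]
    [NormedAddCommGroup EB] [NormedSpace ℂ EB] {K : ℝ} (hK : 0 ≤ K)
    (β : EB →L[ℂ] E →L[ℂ] E) (α : E →L[ℂ] EA →L[ℂ] E) {b : EB} {a : EA}
    (h : ∀ Y, ‖Y‖ ≤ K * ‖β b Y - α Y a‖) : ∃ G : E → E, (∀ R, β b (G R) - α (G R) a = R) ∧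
      (∀ R, ‖G R‖ ≤ K * ‖R‖) ∧ ∀ R R', G (R - R') = G R - G R' := by
  obtain ⟨G, hG, hG1, -⟩ := ContinuousLinearMap.exists_inverse_of_bound (β b - α.flip a) hK h
  exact ⟨G, fun R => congrArg (fun L : E →L[ℂ] E => L R) hG1,
    fun R => (G.le_opNorm R).trans (mul_le_mul_of_nonneg_right hG (norm_nonneg _)), map_sub G⟩

theorem ContinuousLinearMap.tendsto_bilin {E E₁ E₂ ι : Type*} [NormedAddCommGroup E]
    [NormedSpace ℂ E] [NormedAddCommGroup E₁] [NormedSpace ℂ E₁] [NormedAddCommGroup E₂]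
    [NormedSpace ℂ E₂] (B : E →L[ℂ] E₁ →L[ℂ] E₂) {F : Filter ι} {a : ι → E} {b : ι → E₁} {a' : E}
    {b' : E₁} (ha : Tendsto a F (𝓝 a')) (hb : Tendsto b F (𝓝 b')) :
    Tendsto (fun n => B (a n) (b n)) F (𝓝 (B a' b')) :=
  (B.continuous₂.tendsto (a', b')).comp (ha.prodMk_nhds hb)

namespace Matrix

variable {l m : Type*} [Fintype l] [Fintype m]

/-- `Y ↦ B Y - Y A` is bounded below by `1 / K`. -/
def SylBound (K : ℝ) (B : Matrix l l ℂ) (A : Matrix m m ℂ) : Prop :=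
  ∀ Y : Matrix l m ℂ, ‖Y‖ ≤ K * ‖B * Y - Y * A‖

theorem SylBound.eq_of_eq {K : ℝ} {B : Matrix l l ℂ} {A : Matrix m m ℂ} (h : SylBound K B A)
    {Y Y' : Matrix l m ℂ} (hY : B * Y - Y * A = B * Y' - Y' * A) : Y = Y' := by
  have h1 := h (Y - Y')
  have h2 : B * (Y - Y') - (Y - Y') * A = 0 := by
    rw [Matrix.mul_sub, Matrix.sub_mul, sub_sub_sub_comm, hY, sub_self]
  rw [h2, norm_zero, mul_zero] at h1
  exact sub_eq_zero.1 (norm_le_zero_iff.1 h1)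

theorem SylBound.exists_inverse {K : ℝ} (hK : 0 ≤ K) {B : Matrix l l ℂ} {A : Matrix m m ℂ}
    (h : SylBound K B A) : ∃ G : Matrix l m ℂ → Matrix l m ℂ,
      (∀ R, B * G R - G R * A = R) ∧ (∀ R, ‖G R‖ ≤ K * ‖R‖) ∧ ∀ R R', G (R - R') = G R - G R' :=
  ContinuousLinearMap.exists_inverse_of_bilin hK (mulCLM ℂ l l m) (mulCLM ℂ l m m) h

theorem tendsto_mul {i j k ι : Type*} [Fintype i] [Fintype j] [Fintype k] {F : Filter ι}
    {a : ι → Matrix i j ℂ} {b : ι → Matrix j k ℂ} {a' : Matrix i j ℂ} {b' : Matrix j k ℂ}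
    (ha : Tendsto a F (𝓝 a')) (hb : Tendsto b F (𝓝 b')) :
    Tendsto (fun n => a n * b n) F (𝓝 (a' * b')) :=
  ContinuousLinearMap.tendsto_bilin (mulCLM ℂ i j k) ha hb

/-- The perturbation contributes at most half of `‖Y‖`, which is absorbed on the left and doubles
the constant. -/
theorem SylBound.perturb {K : ℝ} (hK : 0 ≤ K) {B D : Matrix l l ℂ} {A D' : Matrix m m ℂ}
    (h : SylBound K B A) (hD : K * (‖D‖ + ‖D'‖) ≤ 1 / 2) (Y : Matrix l m ℂ) :
    ‖Y‖ ≤ 2 * K * ‖B * Y - Y * A - D * Y - Y * D'‖ := by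
  have h1 := h Y
  have h2 : ‖B * Y - Y * A‖ ≤ ‖B * Y - Y * A - D * Y - Y * D'‖ + ‖D‖ * ‖Y‖ + ‖Y‖ * ‖D'‖ := by
    calc ‖B * Y - Y * A‖ = ‖(B * Y - Y * A - D * Y - Y * D') + D * Y + Y * D'‖ := by
          congr 1; abel
      _ ≤ _ := norm_add₃_le.trans (add_le_add (add_le_add le_rfl (Matrix.linfty_opNorm_mul _ _))
          (Matrix.linfty_opNorm_mul _ _))
  have h3 := mul_le_mul_of_nonneg_left h2 hK
  have h4 := mul_le_mul_of_nonneg_right hD (norm_nonneg Y)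
  nlinarith

/-- Existence of a small solution of a Riccati equation. -/
theorem exists_riccati {K q ε : ℝ} (hK : 0 ≤ K) (hq : 0 ≤ q) (hε : 0 ≤ ε)
    (hs : 8 * K ^ 2 * q * ε ≤ 1) {B : Matrix l l ℂ} {A : Matrix m m ℂ} {Q : Matrix m l ℂ}
    {c : Matrix l m ℂ} (h : SylBound K B A) (hQ : ‖Q‖ ≤ q) (hc : ‖c‖ ≤ ε) :
    ∃ Z : Matrix l m ℂ, ‖Z‖ ≤ 2 * K * ε ∧ c + B * Z - Z * A - Z * Q * Z = 0 := by
  obtain ⟨G, hG, hGb, hGs⟩ := h.exists_inverse hK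
  set ρ := 2 * K * ε with hρ
  have hρ0 : 0 ≤ ρ := by positivity
  -- `K q ρ = 2 K² q ε`. This makes `F` below, whose fixed points solve the equation, map the ball
  -- of radius `ρ` into itself with Lipschitz constant `2 K q ρ ≤ 1/2`.
  have hKρ : K * q * ρ ≤ 1 / 4 := by rw [hρ]; nlinarith
  let F : Matrix l m ℂ → Matrix l m ℂ := fun Z => G (Z * Q * Z - c)
  have hZQ : ∀ Z Z' : Matrix l m ℂ, ‖Z * Q * Z'‖ ≤ q * (‖Z‖ * ‖Z'‖) := fun Z Z' =>
    calc ‖Z * Q * Z'‖ ≤ ‖Z * Q‖ * ‖Z'‖ := Matrix.linfty_opNorm_mul _ _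
      _ ≤ ‖Z‖ * q * ‖Z'‖ := mul_le_mul_of_nonneg_right ((Matrix.linfty_opNorm_mul _ _).trans
          (mul_le_mul_of_nonneg_left hQ (norm_nonneg _))) (norm_nonneg _)
      _ = q * (‖Z‖ * ‖Z'‖) := by ring
  have hmaps : MapsTo F (Metric.closedBall 0 ρ) (Metric.closedBall 0 ρ) := by
    intro Z hZ
    rw [mem_closedBall_zero_iff] at hZ ⊢
    have h1 : ‖Z * Q * Z - c‖ ≤ q * (ρ * ρ) + ε :=
      (norm_sub_le _ _).trans (add_le_add ((hZQ Z Z).trans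
        (mul_le_mul_of_nonneg_left (mul_le_mul hZ hZ (norm_nonneg _) hρ0) hq)) hc)
    calc ‖F Z‖ ≤ K * (q * (ρ * ρ) + ε) := (hGb _).trans (mul_le_mul_of_nonneg_left h1 hK)
      _ = (K * q * ρ) * ρ + K * ε := by ring
      _ ≤ 1 / 4 * ρ + ρ / 2 := by
        rw [show K * ε = ρ / 2 by rw [hρ]; ring]
        gcongr
      _ ≤ ρ := by linarith
  have hcontr : ContractingWith (1 / 2 : NNReal) (hmaps.restrict F _ _) := by
    refine ⟨by norm_num, LipschitzWith.of_dist_le_mul fun Z Z' => ?_⟩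
    have hZ := mem_closedBall_zero_iff.1 Z.2
    have hZ' := mem_closedBall_zero_iff.1 Z'.2
    rw [Subtype.dist_eq, Subtype.dist_eq, dist_eq_norm, dist_eq_norm]
    simp only [MapsTo.val_restrict_apply, F]
    rw [← hGs]
    have h1 : (Z.1 * Q * Z.1 - c) - (Z'.1 * Q * Z'.1 - c)
        = (Z.1 - Z'.1) * Q * Z.1 + Z'.1 * Q * (Z.1 - Z'.1) := by
      simp only [Matrix.sub_mul, Matrix.mul_sub]; abel
    rw [h1]
    refine (hGb _).trans ?_
    have h2 := norm_add_le_of_le (hZQ (Z.1 - Z'.1) Z.1) (hZQ Z'.1 (Z.1 - Z'.1))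
    have h3 : ‖Z.1 - Z'.1‖ * ‖Z.1‖ ≤ ‖Z.1 - Z'.1‖ * ρ :=
      mul_le_mul_of_nonneg_left hZ (norm_nonneg _)
    have h4 : ‖Z'.1‖ * ‖Z.1 - Z'.1‖ ≤ ρ * ‖Z.1 - Z'.1‖ :=
      mul_le_mul_of_nonneg_right hZ' (norm_nonneg _)
    calc K * ‖(Z.1 - Z'.1) * Q * Z.1 + Z'.1 * Q * (Z.1 - Z'.1)‖
        ≤ K * (q * (‖Z.1 - Z'.1‖ * ρ) + q * (ρ * ‖Z.1 - Z'.1‖)) := by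
          refine mul_le_mul_of_nonneg_left (h2.trans ?_) hK
          gcongr
      _ = 2 * (K * q * ρ) * ‖Z.1 - Z'.1‖ := by ring
      _ ≤ ((1 / 2 : NNReal) : ℝ) * ‖Z.1 - Z'.1‖ := by
        refine mul_le_mul_of_nonneg_right ?_ (norm_nonneg _)
        push_cast
        linarith
  obtain ⟨Z, hZ, hfix, -⟩ := hcontr.exists_fixedPoint' Metric.isClosed_closedBall.isComplete hmaps
    (Metric.mem_closedBall_self hρ0) (edist_ne_top _ _)
  refine ⟨Z, mem_closedBall_zero_iff.1 hZ, ?_⟩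
  have h1 := hG (Z * Q * Z - c)
  rw [show G (Z * Q * Z - c) = Z from hfix] at h1
  rw [add_sub_assoc, h1]
  abel

end Matrix

/-! ### Matrix equations in the function classes -/

namespace Frame

variable {𝕜 : Type} [RCLike 𝕜] [NormedAlgebra 𝕜 ℂ] [IsScalarTower ℝ 𝕜 ℂ] [FiniteDimensional 𝕜 ℂ]
  {P : Frame 𝕜} {l m p : Type} [Fintype l] [Fintype m] [Fintype p] {s n r k : ℕ} {b b' : Prop}

theorem Ev.matMul {f : 𝕜 → ℝ → Matrix l m ℂ} {g : 𝕜 → ℝ → Matrix m p ℂ}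
    (h : P.Ev b n f) (h' : P.Ev b' n g) : P.Ev (b ∨ b') n (fun v t => f v t * g v t) :=
  h.bilin (Matrix.mulCLM 𝕜 l m p) h'

theorem Ev.matMul_cnv {f : 𝕜 → ℝ → Matrix l m ℂ} {g : 𝕜 → ℝ → Matrix m p ℂ}
    (h : P.Ev False n f) (h' : P.Ev False n g) : P.Ev False n (fun v t => f v t * g v t) :=
  (h.matMul h').cnv

theorem Small.matMul {f : 𝕜 → ℝ → Matrix l m ℂ} {g : 𝕜 → ℝ → Matrix m p ℂ}
    (h : P.Small r k f) (h' : P.Ev False r g) : P.Small r k (fun v t => f v t * g v t) :=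
  h.bilin (Matrix.mulCLM 𝕜 l m p) h'

theorem Small.matMul' {f : 𝕜 → ℝ → Matrix l m ℂ} {g : 𝕜 → ℝ → Matrix m p ℂ}
    (h : P.Ev False r f) (h' : P.Small r k g) : P.Small r k (fun v t => f v t * g v t) :=
  Small.bilin' (Matrix.mulCLM 𝕜 l m p) h h'

theorem Small.matMul_succ {f : 𝕜 → ℝ → Matrix l m ℂ} {g : 𝕜 → ℝ → Matrix m p ℂ}
    (h : P.Small r 1 f) (h' : P.Small r k g) (hk : k + 1 ≤ r) :
    P.Small r (k + 1) (fun v t => f v t * g v t) :=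
  Small.bilin_succ (Matrix.mulCLM 𝕜 l m p) h h' hk

theorem Small.matMul_succ' {f : 𝕜 → ℝ → Matrix l m ℂ} {g : 𝕜 → ℝ → Matrix m p ℂ}
    (h : P.Small r k f) (h' : P.Small r 1 g) (hk : k + 1 ≤ r) :
    P.Small r (k + 1) (fun v t => f v t * g v t) :=
  Small.bilin_succ (Matrix.mulCLM 𝕜 l m p).flip h' h hk

/-- Compactness provides a candidate for the limit at an end. An algebraic equation passes to it
along the sequence, and convergence on the whole domain is deduced from the equation afterwards. -/
theorem exists_limit_point {E : Type} [NormedAddCommGroup E] [ProperSpace E] (e : P.κ)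
    {F : 𝕜 → E} {C : ℝ} (hF : ∀ v ∈ P.Ω s, ‖F v‖ ≤ C) :
    ∃ v : ℕ → 𝕜, (∀ k, v k ∈ P.Ω s) ∧ Tendsto (fun k => P.w e (v k)) atTop (𝓝 0) ∧
      ∃ G, ‖G‖ ≤ C ∧ Tendsto (fun k => F (v k)) atTop (𝓝 G) := by
  choose v hv hw using fun k : ℕ => P.ends e s (1 / ((k : ℝ) + 1)) (by positivity)
  have h0 : Tendsto (fun k => P.w e (v k)) atTop (𝓝 0) :=
    squeeze_zero (fun k => P.w_nonneg e _) (fun k => (hw k).le) tendsto_one_div_add_atTop_nhds_zero_nat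
  obtain ⟨G, hG, ψ, hψ, hlim⟩ := (isCompact_closedBall (0 : E) C).tendsto_subseq
    (x := fun k => F (v k)) fun k => mem_closedBall_zero_iff.2 (hF _ (hv k))
  exact ⟨v ∘ ψ, fun k => hv _, h0.comp hψ.tendsto_atTop, G, mem_closedBall_zero_iff.1 hG, hlim⟩

theorem tendsto_of_tail {E : Type} [NormedAddCommGroup E] [NormedSpace 𝕜 E] {e : P.κ}
    {f : 𝕜 → ℝ → E} {L : ℝ → E}
    (hL : BddSmooth 𝕜 n (P.w e) (P.Ω s) (fun (h : Icc (0 : ℝ) P.h₁) v => f v h - L h))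
    {v : ℕ → 𝕜} (hv : ∀ k, v k ∈ P.Ω s) (hw : Tendsto (fun k => P.w e (v k)) atTop (𝓝 0))
    {h : ℝ} (hh : h ∈ Icc 0 P.h₁) : Tendsto (fun k => f (v k) h) atTop (𝓝 (L h)) := by
  obtain ⟨C, hC⟩ := hL.bound
  rw [tendsto_iff_norm_sub_tendsto_zero]
  refine squeeze_zero (fun _ => norm_nonneg _) (fun k => hC ⟨h, hh⟩ _ (hv k)) ?_
  simpa using hw.const_mul C

/-- A small solution of a Riccati equation belongs to the class of the coefficients. -/
theorem Cls.riccati {c Z : 𝕜 → ℝ → Matrix l m ℂ} {B : 𝕜 → ℝ → Matrix l l ℂ}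
    {A : 𝕜 → ℝ → Matrix m m ℂ} {Q : 𝕜 → ℝ → Matrix m l ℂ} {K q ρ : ℝ} (hK : 0 ≤ K) (hq : 0 ≤ q)
    (hρ : 0 ≤ ρ)
    (hs : 4 * K * ρ * q ≤ 1) (hc : P.Cls s False n c) (hB : P.Cls s False n B)
    (hA : P.Cls s False n A) (hQ : P.Cls s False n Q)
    (hsyl : ∀ v ∈ P.Ω s, ∀ h ∈ Icc 0 P.h₁, Matrix.SylBound K (B v h) (A v h))
    (hQq : ∀ v ∈ P.Ω s, ∀ h ∈ Icc 0 P.h₁, ‖Q v h‖ ≤ q)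
    (hZ : ∀ v ∈ P.Ω s, ∀ h ∈ Icc 0 P.h₁, ‖Z v h‖ ≤ ρ)
    (heq : ∀ v ∈ P.Ω s, ∀ h ∈ Icc 0 P.h₁,
      c v h + B v h * Z v h - Z v h * A v h - Z v h * Q v h * Z v h = 0) :
    P.Cls s False n Z := by
  -- The Riccati equation linearized between two small matrices, with the uniform bound of the
  -- Sylvester operator up to a factor `2`.
  have key : ∀ {v h} (_ : v ∈ P.Ω s) (_ : h ∈ Icc 0 P.h₁) (Z Z' : Matrix l m ℂ),
      ‖Z‖ ≤ ρ → ‖Z'‖ ≤ ρ → ∀ Y : Matrix l m ℂ, ‖Y‖ ≤ 2 * K *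
        ‖B v h * Y - Y * A v h - Z * Q v h * Y - Y * (Q v h * Z')‖ := by
    intro v h hv hh Z Z' hZ hZ' Y
    refine (hsyl v hv h hh).perturb hK ?_ Y
    have h1 : ‖Z * Q v h‖ ≤ ρ * q := (Matrix.linfty_opNorm_mul _ _).trans
      (mul_le_mul hZ (hQq v hv h hh) (norm_nonneg _) hρ)
    have h2 : ‖Q v h * Z'‖ ≤ q * ρ := (Matrix.linfty_opNorm_mul _ _).trans
      (mul_le_mul (hQq v hv h hh) hZ' (norm_nonneg _) hq)
    nlinarith [mul_le_mul_of_nonneg_left (add_le_add h1 h2) hK]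
  refine ⟨?_, ?_, fun e => ?_⟩
  · refine BddSmooth.riccati (κ := 2 * K) (C := ρ) (P.uniq_dom s) (by positivity) hc.joint
      hB.joint hA.joint hQ.joint (fun _ p hp => hZ _ hp.1 _ hp.2)
      (fun _ p hp => heq _ hp.1 _ hp.2) fun _ p hp q hq Y => ?_
    have := key hq.1 hq.2 _ _ (hZ _ hp.1 _ hp.2) (hZ _ hq.1 _ hq.2) Y
    rwa [← Matrix.mul_assoc] at this
  · refine BddSmooth.riccati (κ := 2 * K) (C := ρ) (P.uniq' s) (by positivity) hc.slice
      hB.slice hA.slice hQ.slice (fun h v hv => hZ _ hv _ h.2)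
      (fun h v hv => heq _ hv _ h.2) fun h p hp q hq Y => ?_
    have := key hq h.2 _ _ (hZ _ hp _ h.2) (hZ _ hq _ h.2) Y
    rwa [← Matrix.mul_assoc] at this
  · obtain ⟨Lc, -, hLc⟩ := hc.tail e
    obtain ⟨LB, -, hLB⟩ := hB.tail e
    obtain ⟨LA, -, hLA⟩ := hA.tail e
    obtain ⟨LQ, -, hLQ⟩ := hQ.tail e
    have hlim : ∀ h : ℝ, ∃ L : Matrix l m ℂ, h ∈ Icc 0 P.h₁ →
        (‖L‖ ≤ ρ ∧ Lc h + LB h * L - L * LA h - L * LQ h * L = 0) := by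
      intro h
      by_cases hh : h ∈ Icc 0 P.h₁
      · obtain ⟨v, hv, hw, L, hL, hLt⟩ := exists_limit_point (F := fun v => Z v h) e
          fun v hv => hZ v hv h hh
        refine ⟨L, fun _ => ⟨hL, ?_⟩⟩
        have h1 := tendsto_of_tail hLc hv hw hh
        have h2 := tendsto_of_tail hLB hv hw hh
        have h3 := tendsto_of_tail hLA hv hw hh
        have h4 := tendsto_of_tail hLQ hv hw hh
        have h5 := ((h1.add (Matrix.tendsto_mul h2 hLt)).sub (Matrix.tendsto_mul hLt h3)).sub
          (Matrix.tendsto_mul (Matrix.tendsto_mul hLt h4) hLt)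
        simp only [heq _ (hv _) h hh] at h5
        exact (tendsto_nhds_unique h5 tendsto_const_nhds)
      · exact ⟨0, fun h => absurd h hh⟩
    choose L hL using hlim
    refine ⟨L, False.elim, ?_⟩
    have hu := P.uniq' s
    have hLs : BddSmooth 𝕜 (n + P.σ) (fun _ => 1) (P.Ω s)
        (fun (h : Icc (0 : ℝ) P.h₁) (_ : 𝕜) => L h) :=
      BddSmooth.const hu (c := fun h : Icc (0 : ℝ) P.h₁ => L h) fun h => (hL h h.2).1
    have hZs : BddSmooth 𝕜 (n + P.σ) (fun _ => 1) (P.Ω s)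
        (fun (h : Icc (0 : ℝ) P.h₁) v => Z v h) := by
      refine BddSmooth.riccati (κ := 2 * K) (C := ρ) (P.uniq' s) (by positivity) hc.slice
        hB.slice hA.slice hQ.slice (fun h v hv => hZ _ hv _ h.2)
        (fun h v hv => heq _ hv _ h.2) fun h p hp q hq Y => ?_
      have := key hq h.2 _ _ (hZ _ hp _ h.2) (hZ _ hq _ h.2) Y
      rwa [← Matrix.mul_assoc] at this
    -- The limit `L` solves the limiting Riccati equation. Subtracting, `Z - L` solves a Sylvester
    -- equation with coefficients `B - Z Q` and `A + Q L` whose right-hand side consists of the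
    -- decaying deviations of the coefficients.
    refine BddSmooth.sylvester (κ := 2 * K) (P.uniq' s) (by positivity)
      (R := fun (h : Icc (0 : ℝ) P.h₁) v => -((c v h - Lc h) + (B v h - LB h) * L h
        - L h * (A v h - LA h) - L h * ((Q v h - LQ h) * L h)))
      (B := fun (h : Icc (0 : ℝ) P.h₁) v => B v h - Z v h * Q v h)
      (A := fun (h : Icc (0 : ℝ) P.h₁) v => A v h + Q v h * L h) ?_ ?_ ?_ ?_ ?_
    · exact (((hLc.add hu (hLB.matMul hu hLs)).sub hu (BddSmooth.matMul' hu hLs hLA)).sub hu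
        (BddSmooth.matMul' hu hLs (hLQ.matMul hu hLs))).neg hu
    · exact hB.slice.sub hu (hZs.matMul hu hQ.slice)
    · exact hA.slice.add hu (hQ.slice.matMul hu hLs)
    · intro h v hv
      have h1 := heq v hv h h.2
      have h2 := (hL h h.2).2
      have h3 := congrArg₂ (fun x y => x - y) h1 h2
      simp only [sub_self] at h3
      rw [← sub_eq_zero]
      refine Eq.trans ?_ h3
      simp only [Matrix.mul_sub, Matrix.sub_mul, Matrix.mul_add, Matrix.mul_assoc]
      abel
    · intro h v hv Y
      have := key hv h.2 _ _ (hZ v hv h h.2) (hL h h.2).1 Y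
      convert this using 3
      simp only [Matrix.sub_mul, Matrix.mul_add, Matrix.mul_assoc]
      abel

end Frame

/-! ### Approximate Riccati equations and block-diagonalization -/

namespace Frame

theorem Ev.diffOp_sub {𝕜 : Type} [RCLike 𝕜] {P : Frame 𝕜} {E : Type}
    [NormedAddCommGroup E] [NormedSpace ℝ E] [NormedSpace 𝕜 E] [IsScalarTower ℝ 𝕜 E]
    [CompleteSpace E] {n : ℕ} {b b' : Prop} {f g : 𝕜 → ℝ → E} (r : ℕ) (h : P.Ev b n f)
    (h' : P.Ev b' n g) : P.EqEv (P.diffOp r (fun v t => f v t - g v t))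
      (fun v t => P.diffOp r f v t - P.diffOp r g v t) := by
  have h1 : ∀ l i, P.EqEv ((P.osc l)^[i] (P.inc l fun v t => f v t - g v t))
      (fun v t => (P.osc l)^[i] (P.inc l f) v t - (P.osc l)^[i] (P.inc l g) v t) := fun l i => by
    have h2 : P.inc l (fun v t => f v t - g v t) = fun v t => P.inc l f v t - P.inc l g v t := by
      ext v t
      simp only [Frame.inc]
      abel
    rw [h2]
    exact (h.inc l).osc_iterate_sub l (h'.inc l) i
  refine (EqEv.sum Finset.univ fun l _ => EqEv.smul (fun _ => P.ω l)
    (EqEv.sum (Finset.range r) fun i _ => h1 l i)).trans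
    (Eventually.of_forall fun s v _ t _ => ?_)
  simp only [Finset.sum_sub_distrib, smul_sub]
  rfl

variable {𝕜 : Type} [RCLike 𝕜] [NormedAlgebra 𝕜 ℂ] [IsScalarTower ℝ 𝕜 ℂ] [FiniteDimensional 𝕜 ℂ]
  {P : Frame 𝕜} {l m p : Type} [Fintype l] [Fintype m] [Fintype p] {s n r k : ℕ} {b b' : Prop}

theorem Cls.sylvester {R Y : 𝕜 → ℝ → Matrix l m ℂ} {B : 𝕜 → ℝ → Matrix l l ℂ}
    {A : 𝕜 → ℝ → Matrix m m ℂ} {K : ℝ} (hK : 0 ≤ K) (hR : P.Cls s True n R)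
    (hB : P.Cls s False n B) (hA : P.Cls s False n A)
    (hsyl : ∀ v ∈ P.Ω s, ∀ h ∈ Icc 0 P.h₁, Matrix.SylBound K (B v h) (A v h))
    (heq : ∀ v ∈ P.Ω s, ∀ h ∈ Icc 0 P.h₁, B v h * Y v h - Y v h * A v h = R v h) :
    P.Cls s True n Y where
  joint := BddSmooth.sylvester (P.uniq_dom s) hK hR.joint hB.joint hA.joint
    (fun _ p hp => heq _ hp.1 _ hp.2) fun _ p hp => hsyl _ hp.1 _ hp.2
  slice := BddSmooth.sylvester (P.uniq' s) hK hR.slice hB.slice hA.slice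
    (fun h v hv => heq _ hv _ h.2) fun h v hv => hsyl _ hv _ h.2
  tail e := by
    obtain ⟨L, hb, hL⟩ := hR.tail e
    refine ⟨0, fun _ => rfl, (BddSmooth.sylvester (P.uniq' s) hK hL hB.slice hA.slice
      (Y := fun (h : Icc (0 : ℝ) P.h₁) v => Y v h)
      (fun h v hv => ?_) fun h v hv => hsyl _ hv _ h.2).congr fun h v hv => by simp⟩
    rw [hb trivial]
    simpa using heq v hv h h.2

/-- The equation is solved with the cofactor `G` of `h ^ k` on the right; uniqueness identifies `h ^
k` times that solution with `Y`. -/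
theorem Small.sylvester {R Y : 𝕜 → ℝ → Matrix l m ℂ} {B : 𝕜 → ℝ → Matrix l l ℂ}
    {A : 𝕜 → ℝ → Matrix m m ℂ} {K : ℝ} (hK : 0 ≤ K) (hR : P.Small r k R)
    (hB : P.Ev False r B) (hA : P.Ev False r A)
    (hsyl : ∀ᶠ s in atTop, ∀ v ∈ P.Ω s, ∀ h ∈ Icc 0 P.h₁, Matrix.SylBound K (B v h) (A v h))
    (heq : P.EqEv (fun v h => B v h * Y v h - Y v h * A v h) R) : P.Small r k Y := by
  obtain ⟨G, hG, hGe⟩ := hR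
  have hex : ∀ v h, ∃ X : Matrix l m ℂ, Matrix.SylBound K (B v h) (A v h) →
      B v h * X - X * A v h = G v h := fun v h => by
    by_cases hs : Matrix.SylBound K (B v h) (A v h)
    · obtain ⟨J, hJ, -⟩ := hs.exists_inverse hK
      exact ⟨J (G v h), fun _ => hJ _⟩
    · exact ⟨0, fun h => absurd h hs⟩
  choose X hX using hex
  refine ⟨X, ?_, ?_⟩
  · filter_upwards [hG, hB, hA, hsyl] with s hG hB hA hsyl
    exact hG.sylvester hK (hB.of_le (Nat.sub_le _ _)) (hA.of_le (Nat.sub_le _ _)) hsyl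
      fun v hv h hh => hX v h (hsyl v hv h hh)
  · filter_upwards [hGe, hsyl, heq] with s hGe hsyl heq v hv h hh
    refine (hsyl v hv h hh).eq_of_eq ?_
    rw [heq v hv h hh, hGe v hv h hh, Matrix.mul_smul, Matrix.smul_mul, ← smul_sub,
      hX v h (hsyl v hv h hh)]

/-- A factor of order one raises each order by one. All orders are carried along at once because a
given order does not imply the lower ones: the regularity demanded of the cofactor grows as the
power of `h` falls. -/
theorem Small.matMul_improve {F : 𝕜 → ℝ → Matrix l m ℂ} {Y : 𝕜 → ℝ → Matrix m p ℂ}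
    (hF : ∀ k ≤ 1, P.Small r k F) (hY : ∀ k ≤ r, k ≤ n → P.Small r k Y) :
    ∀ k ≤ r, k ≤ n + 1 → P.Small r k (fun v h => F v h * Y v h) := by
  intro k hk hkn
  rcases Nat.eq_zero_or_pos k with rfl | hk0
  · exact (hF 0 (by omega)).matMul (hY 0 (by omega) (by omega)).ev.cnv
  · obtain ⟨j, rfl⟩ : ∃ j, k = j + 1 := ⟨k - 1, by omega⟩
    exact (hF 1 le_rfl).matMul_succ (hY j (by omega) (by omega)) hk

theorem Small.matMul_improve' {F : 𝕜 → ℝ → Matrix m p ℂ} {Y : 𝕜 → ℝ → Matrix l m ℂ}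
    (hY : ∀ k ≤ r, k ≤ n → P.Small r k Y) (hF : ∀ k ≤ 1, P.Small r k F) :
    ∀ k ≤ r, k ≤ n + 1 → P.Small r k (fun v h => Y v h * F v h) := by
  intro k hk hkn
  rcases Nat.eq_zero_or_pos k with rfl | hk0
  · exact Small.matMul' (hY 0 (by omega) (by omega)).ev.cnv (hF 0 (by omega))
  · obtain ⟨j, rfl⟩ : ∃ j, k = j + 1 := ⟨k - 1, by omega⟩
    exact (hY j (by omega) (by omega)).matMul_succ' (hF 1 le_rfl) hk

/-- An approximate solution of `h ∂_v Z = c + B Z - Z A - Z Q Z` without loss of derivatives. -/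
theorem exists_approx_riccati (hr : 1 ≤ r) {c Z₀ : 𝕜 → ℝ → Matrix l m ℂ}
    {B B₀ : 𝕜 → ℝ → Matrix l l ℂ} {A A₀ : 𝕜 → ℝ → Matrix m m ℂ} {Q : 𝕜 → ℝ → Matrix m l ℂ} {K : ℝ}
    (hK : 0 ≤ K) (hc : P.Ev False r c) (hB : P.Ev False r B)
    (hA : P.Ev False r A) (hQ : P.Ev False r Q) (hZ₀ : P.Ev False r Z₀)
    (hB₀ : P.Ev False r B₀) (hA₀ : P.Ev False r A₀)
    (hsyl : ∀ᶠ s in atTop, ∀ v ∈ P.Ω s, ∀ h ∈ Icc 0 P.h₁, Matrix.SylBound K (B₀ v h) (A₀ v h))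
    (hR : ∀ k ≤ 1, P.Small r k (fun v h =>
      c v h + B v h * Z₀ v h - Z₀ v h * A v h - Z₀ v h * Q v h * Z₀ v h))
    (hBB : ∀ k ≤ 1, P.Small r k (fun v h => B v h - Z₀ v h * Q v h - B₀ v h))
    (hAA : ∀ k ≤ 1, P.Small r k (fun v h => A v h + Q v h * Z₀ v h - A₀ v h)) :
    ∃ Z, P.Ev False r Z ∧ (∀ k ≤ 1, P.Small r k (fun v h => Z v h - Z₀ v h)) ∧
      ∀ k ≤ r, P.Small r k (fun v h =>
        c v h + B v h * Z v h - Z v h * A v h - Z v h * Q v h * Z v h - P.diffOp r Z v h) := by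
  -- Each step subtracts the solution `Y` of a Sylvester equation whose right-hand side is the
  -- current residual. Its operator is the fixed one with coefficients `B₀`, `A₀`.
  suffices H : ∀ n : ℕ, ∃ Z, P.Ev False r Z ∧ (∀ k ≤ 1, P.Small r k (fun v h => Z v h - Z₀ v h)) ∧
      ∀ k ≤ r, k ≤ n + 1 → P.Small r k (fun v h =>
        c v h + B v h * Z v h - Z v h * A v h - Z v h * Q v h * Z v h - P.diffOp r Z v h) by
    obtain ⟨Z, h1, h2, h3⟩ := H r
    exact ⟨Z, h1, h2, fun k hk => h3 k hk (by omega)⟩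
  intro n
  induction n with
  | zero =>
    refine ⟨Z₀, hZ₀, fun k _ => Small.zero.congr (Eventually.of_forall fun s v _ t _ => sub_self _),
      fun k hk hk1 => (hR k (by omega)).sub ?_⟩
    rcases Nat.eq_zero_or_pos k with rfl | hk0
    · exact Small.of_ev (hZ₀.diffOp r)
    · obtain rfl : k = 1 := by omega
      obtain ⟨n, rfl⟩ : ∃ n, r = n + 1 := ⟨r - 1, by omega⟩
      -- At order one, `diffOp Z₀` is `h ∂Z₀`, which has an explicit factor `h`, plus a small error.
      have h1 := Small.diffOp_sub hZ₀ le_rfl hr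
      have h2 : P.Small (n + 1) 1 (fun v t => t • P.der Z₀ v t) :=
        ⟨_, hZ₀.der, Eventually.of_forall fun s v _ t _ => by simp⟩
      exact (h1.add h2).congr (Eventually.of_forall fun s v _ t _ => by simp)
  | succ n ih =>
    obtain ⟨Z, hZ, hZZ, hE⟩ := ih
    set E : 𝕜 → ℝ → Matrix l m ℂ := fun v h =>
      c v h + B v h * Z v h - Z v h * A v h - Z v h * Q v h * Z v h - P.diffOp r Z v h with hEdef
    have hex : ∀ v h, ∃ X : Matrix l m ℂ, Matrix.SylBound K (B₀ v h) (A₀ v h) →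
        B₀ v h * X - X * A₀ v h = E v h := fun v h => by
      by_cases hs : Matrix.SylBound K (B₀ v h) (A₀ v h)
      · obtain ⟨J, hJ, -⟩ := hs.exists_inverse hK
        exact ⟨J (E v h), fun _ => hJ _⟩
      · exact ⟨0, fun h => absurd h hs⟩
    choose Y hY using hex
    have hYe : P.EqEv (fun v h => B₀ v h * Y v h - Y v h * A₀ v h) E := by
      filter_upwards [hsyl] with s hsyl v hv h hh using hY v h (hsyl v hv h hh)
    have hYs : ∀ k ≤ r, k ≤ n + 1 → P.Small r k Y := fun k hk hkn =>
      (hE k hk hkn).sylvester hK hB₀ hA₀ hsyl hYe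
    have hYev : P.Ev False r Y := by simpa using (hYs 0 (Nat.zero_le _) (Nat.zero_le _)).ev.cnv
    refine ⟨fun v h => Z v h - Y v h, hZ.sub hYev, fun k hk => ?_, ?_⟩
    · exact ((hZZ k hk).sub (hYs k (by omega) (by omega))).congr
        (Eventually.of_forall fun s v _ t _ => sub_right_comm _ _ _)
    -- The Sylvester equation for `Y` cancels the old residual. Each remaining term either
    -- multiplies `Y` by a factor of order one or is `diffOp Y`, so its order exceeds that of `Y` by
    -- one.
    · have hnew : P.EqEv (fun v h => c v h + B v h * (Z v h - Y v h) - (Z v h - Y v h) * A v h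
          - (Z v h - Y v h) * Q v h * (Z v h - Y v h) - P.diffOp r (fun v h => Z v h - Y v h) v h)
          (fun v h => (Z v h - Z₀ v h) * Q v h * Y v h + Y v h * (A v h + Q v h * Z₀ v h - A₀ v h)
            + Y v h * (Q v h * (Z v h - Z₀ v h)) - (B v h - Z₀ v h * Q v h - B₀ v h) * Y v h
            - Y v h * Q v h * Y v h + P.diffOp r Y v h) := by
        filter_upwards [hYe, hZ.diffOp_sub r hYev] with s hYe hD v hv h hh
        have h1 := hYe v hv h hh
        rw [hD v hv h hh]
        rw [hEdef, ← sub_eq_zero] at h1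
        rw [← sub_eq_zero]
        refine Eq.trans ?_ (congrArg (fun x => -x) h1 |>.trans neg_zero)
        simp only [Matrix.mul_sub, Matrix.sub_mul, Matrix.mul_add, Matrix.mul_assoc]
        abel
      intro k hk hkn
      refine Small.congr ?_ hnew
      have hY1 : ∀ k ≤ 1, P.Small r k Y := fun k hk => hYs k (by omega) (by omega)
      refine Small.add (Small.sub (Small.sub (Small.add (Small.add ?_ ?_) ?_) ?_) ?_) ?_
      · exact Small.matMul_improve (fun k hk => (hZZ k hk).matMul hQ) hYs k hk hkn
      · exact Small.matMul_improve' hYs hAA k hk hkn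
      · exact Small.matMul_improve' hYs (fun k hk => Small.matMul' hQ (hZZ k hk)) k hk hkn
      · exact Small.matMul_improve hBB hYs k hk hkn
      · exact Small.matMul_improve (fun k hk => (hY1 k hk).matMul hQ) hYs k hk hkn
      · rcases Nat.eq_zero_or_pos k with rfl | hk0
        · exact Small.of_ev (hYev.diffOp r)
        · obtain ⟨j, rfl⟩ : ∃ j, k = j + 1 := ⟨k - 1, by omega⟩
          exact (hYs j (by omega) (by omega)).diffOp hk

/-- Exact block-diagonalization up to small off-diagonal blocks. -/
theorem exists_blockDiag (hr : 1 ≤ r) {M₁₁ : 𝕜 → ℝ → Matrix l l ℂ} {M₁₂ : 𝕜 → ℝ → Matrix l m ℂ}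
    {M₂₁ : 𝕜 → ℝ → Matrix m l ℂ} {M₂₂ : 𝕜 → ℝ → Matrix m m ℂ} {K q ε : ℝ} (hK : 0 ≤ K) (hq : 0 ≤ q)
    (hε : 0 ≤ ε) (hs : 8 * K ^ 2 * q * ε ≤ 1)
    (h₁₁ : P.Ev False r M₁₁) (h₁₂ : P.Ev False r M₁₂) (h₂₁ : P.Ev False r M₂₁)
    (h₂₂ : P.Ev False r M₂₂)
    (hsyl : ∀ v ∈ P.Ω 0, ∀ h ∈ Icc 0 P.h₁, Matrix.SylBound K (M₂₂ v h) (M₁₁ v h))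
    (hsyl' : ∀ v ∈ P.Ω 0, ∀ h ∈ Icc 0 P.h₁, Matrix.SylBound K (M₁₁ v h) (M₂₂ v h))
    (hMq : ∀ v ∈ P.Ω 0, ∀ h ∈ Icc 0 P.h₁, ‖M₁₂ v h‖ ≤ q)
    (hMε : ∀ v ∈ P.Ω 0, ∀ h ∈ Icc 0 P.h₁, ‖M₂₁ v h‖ ≤ ε) :
    ∃ (Z : 𝕜 → ℝ → Matrix m l ℂ) (X : 𝕜 → ℝ → Matrix l m ℂ) (A₁₁ : 𝕜 → ℝ → Matrix l l ℂ)
      (A₂₂ : 𝕜 → ℝ → Matrix m m ℂ) (O₁₂ : 𝕜 → ℝ → Matrix l m ℂ) (O₂₁ : 𝕜 → ℝ → Matrix m l ℂ),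
      P.Ev False r Z ∧ P.Ev False r X ∧ P.Ev False (r - 1) A₁₁ ∧ P.Ev False (r - 1) A₂₂ ∧
      (∀ k, 1 ≤ k → k ≤ r → P.Small r k O₁₂) ∧ (∀ k, 1 ≤ k → k ≤ r → P.Small r k O₂₁) ∧
      (∀ v h, O₂₁ v h = M₂₁ v h + M₂₂ v h * Z v h - Z v h * (M₁₁ v h + M₁₂ v h * Z v h)
        - h • P.der Z v h) ∧
      (∀ v h, A₁₁ v h = M₁₁ v h + M₁₂ v h * Z v h - X v h * O₂₁ v h) ∧
      (∀ v h, A₂₂ v h = M₂₂ v h - Z v h * M₁₂ v h + O₂₁ v h * X v h) ∧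
      ∀ v h, O₁₂ v h = (M₁₁ v h + M₁₂ v h * Z v h) * X v h + M₁₂ v h - X v h * A₂₂ v h
        - h • P.der X v h := by
  -- The small root of the algebraic Riccati equation, that is, the equation without its derivative.
  have hex : ∀ v h, ∃ Z : Matrix m l ℂ, v ∈ P.Ω 0 → h ∈ Icc 0 P.h₁ → (‖Z‖ ≤ 2 * K * ε ∧
      M₂₁ v h + M₂₂ v h * Z - Z * M₁₁ v h - Z * M₁₂ v h * Z = 0) := fun v h => by
    by_cases hv : v ∈ P.Ω 0 ∧ h ∈ Icc 0 P.h₁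
    · obtain ⟨Z, hZ⟩ := Matrix.exists_riccati hK hq hε hs (hsyl v hv.1 h hv.2)
        (hMq v hv.1 h hv.2) (hMε v hv.1 h hv.2)
      exact ⟨Z, fun _ _ => hZ⟩
    · exact ⟨0, fun h h' => absurd ⟨h, h'⟩ hv⟩
  choose Z₀ hZ₀ using hex
  have hZ₀s : P.Ev False r Z₀ := by
    filter_upwards [h₁₁, h₁₂, h₂₁, h₂₂] with s h₁₁ h₁₂ h₂₁ h₂₂
    have h0 := P.sub_zero s
    exact Cls.riccati hK hq (ρ := 2 * K * ε) (by positivity) (by nlinarith) h₂₁ h₂₂ h₁₁ h₁₂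
      (fun v hv => hsyl v (h0 hv)) (fun v hv => hMq v (h0 hv))
      (fun v hv h hh => (hZ₀ v h (h0 hv) hh).1) (fun v hv h hh => (hZ₀ v h (h0 hv) hh).2)
  -- The diagonal blocks corrected by `Z₀` still have invertible Sylvester operators, with constant
  -- `2 K`.
  have hpert : ∀ v ∈ P.Ω 0, ∀ h ∈ Icc 0 P.h₁,
      K * (‖Z₀ v h * M₁₂ v h‖ + ‖M₁₂ v h * Z₀ v h‖) ≤ 1 / 2 := by
    intro v hv h hh
    have h1 := (hZ₀ v h hv hh).1
    have h2 : ‖Z₀ v h * M₁₂ v h‖ ≤ 2 * K * ε * q := (Matrix.linfty_opNorm_mul _ _).trans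
      (mul_le_mul h1 (hMq v hv h hh) (norm_nonneg _) (by positivity))
    have h3 : ‖M₁₂ v h * Z₀ v h‖ ≤ q * (2 * K * ε) := (Matrix.linfty_opNorm_mul _ _).trans
      (mul_le_mul (hMq v hv h hh) h1 (norm_nonneg _) hq)
    nlinarith [mul_le_mul_of_nonneg_left (add_le_add h2 h3) hK]
  have hP₀ : P.Ev False r (fun v h => M₁₁ v h + M₁₂ v h * Z₀ v h) :=
    h₁₁.add (h₁₂.matMul_cnv hZ₀s)
  have hR₀ : P.Ev False r (fun v h => M₂₂ v h - Z₀ v h * M₁₂ v h) :=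
    h₂₂.sub (hZ₀s.matMul_cnv h₁₂)
  have hsyl₀ : ∀ v ∈ P.Ω 0, ∀ h ∈ Icc 0 P.h₁, Matrix.SylBound (2 * K)
      (M₂₂ v h - Z₀ v h * M₁₂ v h) (M₁₁ v h + M₁₂ v h * Z₀ v h) := by
    intro v hv h hh Y
    refine ((hsyl v hv h hh).perturb hK (hpert v hv h hh) Y).trans_eq ?_
    congr 2
    rw [Matrix.sub_mul, Matrix.mul_add]
    abel
  have hsyl₀' : ∀ v ∈ P.Ω 0, ∀ h ∈ Icc 0 P.h₁, Matrix.SylBound (2 * K)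
      (M₁₁ v h + M₁₂ v h * Z₀ v h) (M₂₂ v h - Z₀ v h * M₁₂ v h) := by
    intro v hv h hh Y
    have h1 := (hsyl' v hv h hh).perturb hK (D := -(M₁₂ v h * Z₀ v h)) (D' := -(Z₀ v h * M₁₂ v h))
      (by rw [norm_neg, norm_neg, add_comm]; exact hpert v hv h hh) Y
    refine h1.trans_eq ?_
    congr 2
    rw [Matrix.mul_sub, Matrix.add_mul, Matrix.neg_mul, Matrix.mul_neg]
    abel
  obtain ⟨Z, hZ, hZZ, hZe⟩ := exists_approx_riccati hr (c := M₂₁) (B := M₂₂) (A := M₁₁) (Q := M₁₂)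
    (Z₀ := Z₀) (K := 2 * K) (by positivity) h₂₁ h₂₂ h₁₁ h₁₂ hZ₀s hR₀ hP₀
    (Eventually.of_forall fun s v hv => hsyl₀ v (P.sub_zero s hv))
    (fun k _ => Small.zero.congr (Eventually.of_forall fun s v hv h hh =>
      (hZ₀ v h (P.sub_zero s hv) hh).2))
    (fun k _ => Small.zero.congr (Eventually.of_forall fun s v hv h hh => sub_self _))
    (fun k _ => Small.zero.congr (Eventually.of_forall fun s v hv h hh => sub_self _))
  have hexX : ∀ v h, ∃ X : Matrix l m ℂ, v ∈ P.Ω 0 → h ∈ Icc 0 P.h₁ →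
      (M₁₁ v h + M₁₂ v h * Z₀ v h) * X - X * (M₂₂ v h - Z₀ v h * M₁₂ v h) = -M₁₂ v h ∧
      ‖X‖ ≤ 2 * K * q := fun v h => by
    by_cases hv : v ∈ P.Ω 0 ∧ h ∈ Icc 0 P.h₁
    · obtain ⟨J, hJ, hJb, -⟩ := (hsyl₀' v hv.1 h hv.2).exists_inverse (by positivity)
      refine ⟨J (-M₁₂ v h), fun _ _ => ⟨hJ _, (hJb _).trans ?_⟩⟩
      rw [norm_neg]
      exact mul_le_mul_of_nonneg_left (hMq v hv.1 h hv.2) (by positivity)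
    · exact ⟨0, fun h h' => absurd ⟨h, h'⟩ hv⟩
  choose X₀ hX₀ using hexX
  have hX₀s : P.Ev False r X₀ := by
    filter_upwards [h₁₂, hP₀, hR₀] with s h₁₂ hP₀ hR₀
    have h0 := P.sub_zero s
    -- The equation for `X₀` is linear, so it is treated as a Riccati equation with vanishing
    -- quadratic term.
    refine Cls.riccati (K := 2 * K) (q := 0) (ρ := 2 * K * q) (Q := fun _ _ => 0)
      (by positivity) le_rfl (by positivity) (by simp) h₁₂ hP₀ hR₀
      (Cls.zero) (fun v hv => hsyl₀' v (h0 hv)) (fun v hv h hh => by simp)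
      (fun v hv h hh => (hX₀ v h (h0 hv) hh).2) (fun v hv h hh => ?_)
    rw [add_sub_assoc, (hX₀ v h (h0 hv) hh).1]
    simp
  have hPr : P.Ev False r (fun v h => M₁₁ v h + M₁₂ v h * Z v h) := h₁₁.add (h₁₂.matMul_cnv hZ)
  have hRr : P.Ev False r (fun v h => M₂₂ v h - Z v h * M₁₂ v h) := h₂₂.sub (hZ.matMul_cnv h₁₂)
  have hPP : ∀ k ≤ 1, P.Small r k (fun v h => (M₁₁ v h + M₁₂ v h * Z v h)
      - (M₁₁ v h + M₁₂ v h * Z₀ v h)) := fun k hk =>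
    (Small.matMul' h₁₂ (hZZ k hk)).congr (Eventually.of_forall fun s v _ h _ => by
      simp only [Matrix.mul_sub, add_sub_add_left_eq_sub])
  have hRR : ∀ k ≤ 1, P.Small r k (fun v h => (M₂₂ v h - Z v h * M₁₂ v h)
      - (M₂₂ v h - Z₀ v h * M₁₂ v h)) := fun k hk =>
    ((hZZ k hk).matMul h₁₂).neg.congr (Eventually.of_forall fun s v _ h _ => by
      simp only [Matrix.sub_mul, sub_sub_sub_cancel_left, neg_sub])
  obtain ⟨X, hX, -, hXe⟩ := exists_approx_riccati hr (c := M₁₂)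
    (B := fun v h => M₁₁ v h + M₁₂ v h * Z v h) (A := fun v h => M₂₂ v h - Z v h * M₁₂ v h)
    (Q := fun _ _ => 0) (Z₀ := X₀) (K := 2 * K) (by positivity) h₁₂ hPr hRr Ev.zero hX₀s hP₀ hR₀
    (Eventually.of_forall fun s v hv => hsyl₀' v (P.sub_zero s hv))
    (fun k hk => ((((hPP k hk).matMul hX₀s).sub (Small.matMul' hX₀s (hRR k hk)))).congr
      (Eventually.of_forall fun s v hv h hh => by
        have h1 := (hX₀ v h (P.sub_zero s hv) hh).1
        rw [← sub_eq_zero] at h1 ⊢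
        refine Eq.trans ?_ h1
        simp only [Matrix.mul_sub, Matrix.sub_mul, Matrix.add_mul,
          Matrix.mul_zero, Matrix.zero_mul]
        abel))
    (fun k hk => (hPP k hk).congr (Eventually.of_forall fun s v hv h hh => by simp))
    (fun k hk => (hRR k hk).congr (Eventually.of_forall fun s v hv h hh => by simp))
  -- The residual with the true derivative. It is the residual for `diffOp` plus `diffOp Z - h ∂Z`,
  -- and both are small of every order `1 ≤ k ≤ r`.
  let O₂₁ : 𝕜 → ℝ → Matrix m l ℂ := fun v h => M₂₁ v h + M₂₂ v h * Z v h
    - Z v h * (M₁₁ v h + M₁₂ v h * Z v h) - h • P.der Z v h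
  have hO₂₁ : ∀ k, 1 ≤ k → k ≤ r → P.Small r k O₂₁ := fun k hk hkr =>
    ((hZe k hkr).add (Small.diffOp_sub hZ hk hkr)).congr (Eventually.of_forall fun s v _ h _ => by
      simp only [O₂₁, Matrix.mul_add, Matrix.mul_assoc]
      abel)
  have hO₂₁s : P.Ev False (r - 1) O₂₁ := (hO₂₁ 1 le_rfl hr).ev.cnv
  refine ⟨Z, X, fun v h => M₁₁ v h + M₁₂ v h * Z v h - X v h * O₂₁ v h,
    fun v h => M₂₂ v h - Z v h * M₁₂ v h + O₂₁ v h * X v h, _, O₂₁, hZ, hX,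
    (hPr.of_le (Nat.sub_le _ _)).sub ((hX.of_le (Nat.sub_le _ _)).matMul_cnv hO₂₁s),
    (hRr.of_le (Nat.sub_le _ _)).add (hO₂₁s.matMul_cnv (hX.of_le (Nat.sub_le _ _))), ?_, hO₂₁,
    fun _ _ => rfl, fun _ _ => rfl, fun _ _ => rfl, fun _ _ => rfl⟩
  intro k hk hkr
  -- Besides the residual for `diffOp` and its error there is the term `X O₂₁ X`, which arises
  -- because the diagonal block `A₂₂` contains `O₂₁ X`.
  refine (((hXe k hkr).add (Small.diffOp_sub hX hk hkr)).sub
    (Small.matMul' hX ((hO₂₁ k hk hkr).matMul hX))).congr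
    (Eventually.of_forall fun s v _ h _ => ?_)
  simp only [Matrix.mul_add, Matrix.mul_sub, Matrix.mul_zero, Matrix.zero_mul]
  abel

end Frame

/-! ### The transformation of the system in block form -/

namespace Matrix

variable {l m p : Type*} [Fintype l] [Fintype m] [Fintype p] [DecidableEq l] [DecidableEq m]

variable (l m) in
/-- The inclusion of the first summand. -/
def inj₁ : Matrix (l ⊕ m) l ℂ := fromRows 1 0

variable (l m) in
/-- The inclusion of the second summand. -/
def inj₂ : Matrix (l ⊕ m) m ℂ := fromRows 0 1

variable (l m) in
/-- The projection to the first summand. -/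
def proj₁ : Matrix l (l ⊕ m) ℂ := fromCols 1 0

variable (l m) in
/-- The projection to the second summand. -/
def proj₂ : Matrix m (l ⊕ m) ℂ := fromCols 0 1

theorem inj₂_mul_proj₁ (Z : Matrix m l ℂ) :
    inj₂ l m * Z * proj₁ l m = fromBlocks 0 0 Z 0 := by
  rw [inj₂, proj₁, fromRows_mul, fromRows_mul_fromCols]
  simp

theorem inj₁_mul_proj₂ (Z : Matrix l m ℂ) :
    inj₁ l m * Z * proj₂ l m = fromBlocks 0 Z 0 0 := by
  rw [inj₁, proj₂, fromRows_mul, fromRows_mul_fromCols]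
  simp

theorem proj₁_mul_inj₁ (M : Matrix (l ⊕ m) (l ⊕ m) ℂ) :
    proj₁ l m * M * inj₁ l m = M.toBlocks₁₁ := by
  conv_lhs => rw [← M.fromBlocks_toBlocks]
  simp [inj₁, proj₁, fromCols_mul_fromBlocks, fromCols_mul_fromRows]

theorem proj₁_mul_inj₂ (M : Matrix (l ⊕ m) (l ⊕ m) ℂ) :
    proj₁ l m * M * inj₂ l m = M.toBlocks₁₂ := by
  conv_lhs => rw [← M.fromBlocks_toBlocks]
  simp [inj₂, proj₁, fromCols_mul_fromBlocks, fromCols_mul_fromRows]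

theorem proj₂_mul_inj₁ (M : Matrix (l ⊕ m) (l ⊕ m) ℂ) :
    proj₂ l m * M * inj₁ l m = M.toBlocks₂₁ := by
  conv_lhs => rw [← M.fromBlocks_toBlocks]
  simp [inj₁, proj₂, fromCols_mul_fromBlocks, fromCols_mul_fromRows]

theorem proj₂_mul_inj₂ (M : Matrix (l ⊕ m) (l ⊕ m) ℂ) :
    proj₂ l m * M * inj₂ l m = M.toBlocks₂₂ := by
  conv_lhs => rw [← M.fromBlocks_toBlocks]
  simp [inj₂, proj₂, fromCols_mul_fromBlocks, fromCols_mul_fromRows]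

theorem fromBlocks_lower_eq (Z : Matrix m l ℂ) :
    fromBlocks 1 0 Z 1 = 1 + inj₂ l m * Z * proj₁ l m := by
  rw [inj₂_mul_proj₁, ← fromBlocks_one, fromBlocks_add]
  simp

theorem fromBlocks_upper_eq (X : Matrix l m ℂ) :
    fromBlocks 1 X 0 1 = 1 + inj₁ l m * X * proj₂ l m := by
  rw [inj₁_mul_proj₂, ← fromBlocks_one, fromBlocks_add]
  simp

theorem hasDerivWithinAt_mul {𝕜 : Type*} [RCLike 𝕜] [NormedAlgebra 𝕜 ℂ]
    {f : 𝕜 → Matrix l m ℂ} {g : 𝕜 → Matrix m p ℂ} {f' : Matrix l m ℂ} {g' : Matrix m p ℂ}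
    {s : Set 𝕜} {x : 𝕜} (hf : HasDerivWithinAt f f' s x) (hg : HasDerivWithinAt g g' s x) :
    HasDerivWithinAt (fun x => f x * g x) (f x * g' + f' * g x) s x :=
  (mulCLM 𝕜 l m p).hasDerivWithinAt_of_bilinear hf hg

end Matrix

namespace Frame

variable {𝕜 : Type} [RCLike 𝕜] [NormedAlgebra 𝕜 ℂ] [IsScalarTower ℝ 𝕜 ℂ] [FiniteDimensional 𝕜 ℂ]
  {P : Frame 𝕜} {l m p : Type} [Fintype l] [Fintype m] [Fintype p] [DecidableEq l] [DecidableEq m]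
  {s n r k : ℕ} {b b' : Prop}

/-- A limit point `J` of the inverses at an end satisfies `L J = 1`, and then `G - J = -G (S - L) J`
decays. -/
theorem Cls.inverse {S G : 𝕜 → ℝ → Matrix l l ℂ} {C : ℝ} (hS : P.Cls s False n S)
    (hC : ∀ v ∈ P.Ω s, ∀ h ∈ Icc 0 P.h₁, ‖G v h‖ ≤ C)
    (hSG : ∀ v ∈ P.Ω s, ∀ h ∈ Icc 0 P.h₁, S v h * G v h = 1)
    (hGS : ∀ v ∈ P.Ω s, ∀ h ∈ Icc 0 P.h₁, G v h * S v h = 1) : P.Cls s False n G := by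
  have hGs : BddSmooth 𝕜 (n + P.σ) (fun _ => 1) (P.Ω s)
      (fun (h : Icc (0 : ℝ) P.h₁) v => G v h) :=
    hS.slice.inverse (P.uniq' s) (fun h v hv => hC v hv h h.2) (fun h v hv => hSG v hv h h.2)
      (fun h v hv => hGS v hv h h.2)
  refine ⟨hS.joint.inverse (P.uniq_dom s) (fun _ p hp => hC _ hp.1 _ hp.2)
    (fun _ p hp => hSG _ hp.1 _ hp.2) (fun _ p hp => hGS _ hp.1 _ hp.2), hGs, fun e => ?_⟩
  obtain ⟨L, -, hL⟩ := hS.tail e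
  have hlim : ∀ h : ℝ, ∃ J : Matrix l l ℂ, h ∈ Icc 0 P.h₁ → (‖J‖ ≤ C ∧ L h * J = 1) := by
    intro h
    by_cases hh : h ∈ Icc 0 P.h₁
    · obtain ⟨v, hv, hw, J, hJ, hJt⟩ := exists_limit_point (F := fun v => G v h) e
        fun v hv => hC v hv h hh
      have h1 := Matrix.tendsto_mul (tendsto_of_tail hL hv hw hh) hJt
      simp only [hSG _ (hv _) h hh] at h1
      exact ⟨J, fun _ => ⟨hJ, tendsto_nhds_unique h1 tendsto_const_nhds⟩⟩
    · exact ⟨0, fun h => absurd h hh⟩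
  choose J hJ using hlim
  have hu := P.uniq' s
  have hJs : BddSmooth 𝕜 (n + P.σ) (fun _ => 1) (P.Ω s)
      (fun (h : Icc (0 : ℝ) P.h₁) (_ : 𝕜) => J h) :=
    BddSmooth.const hu (c := fun h : Icc (0 : ℝ) P.h₁ => J h) fun h => (hJ h h.2).1
  refine ⟨J, False.elim, ((BddSmooth.matMul' hu hGs (hL.matMul hu hJs)).neg hu).congr
    fun h v hv => ?_⟩
  rw [Matrix.sub_mul, (hJ h h.2).2, Matrix.mul_sub, ← Matrix.mul_assoc, hGS v hv h h.2,
    Matrix.one_mul, Matrix.mul_one, neg_sub]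

/-- `S` is taken one order smoother than `A`, so that `M`, which contains the derivative of `S`, is
still of class `C^r`. The factors `S`, `L`, `U` are then applied in turn, each with its own
conjugation identity. -/
theorem exists_transform (hr : 1 ≤ r) {A S Sinv : 𝕜 → ℝ → Matrix (l ⊕ m) (l ⊕ m) ℂ} {K q ε : ℝ}
    (hK : 0 ≤ K) (hq : 0 ≤ q) (hε : 0 ≤ ε) (hs : 8 * K ^ 2 * q * ε ≤ 1) (hA : P.Ev False r A)
    (hS : P.Ev False (r + 1) S) (hSi : P.Ev False r Sinv)
    (hSS : ∀ v ∈ P.Ω 0, ∀ h ∈ Icc 0 P.h₁, S v h * Sinv v h = 1)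
    {M : 𝕜 → ℝ → Matrix (l ⊕ m) (l ⊕ m) ℂ}
    (hM : ∀ v h, M v h = Sinv v h * (A v h * S v h - h • P.der S v h))
    (hsyl : ∀ v ∈ P.Ω 0, ∀ h ∈ Icc 0 P.h₁,
      Matrix.SylBound K (M v h).toBlocks₂₂ (M v h).toBlocks₁₁)
    (hsyl' : ∀ v ∈ P.Ω 0, ∀ h ∈ Icc 0 P.h₁,
      Matrix.SylBound K (M v h).toBlocks₁₁ (M v h).toBlocks₂₂)
    (hMq : ∀ v ∈ P.Ω 0, ∀ h ∈ Icc 0 P.h₁, ‖(M v h).toBlocks₁₂‖ ≤ q)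
    (hMε : ∀ v ∈ P.Ω 0, ∀ h ∈ Icc 0 P.h₁, ‖(M v h).toBlocks₂₁‖ ≤ ε) :
    ∃ (T T' Tinv : 𝕜 → ℝ → Matrix (l ⊕ m) (l ⊕ m) ℂ) (A₁₁ : 𝕜 → ℝ → Matrix l l ℂ)
      (A₂₂ : 𝕜 → ℝ → Matrix m m ℂ) (O₁₂ : 𝕜 → ℝ → Matrix l m ℂ) (O₂₁ : 𝕜 → ℝ → Matrix m l ℂ),
      P.Ev False r T ∧ P.Ev False r Tinv ∧ P.Ev False (r - 1) A₁₁ ∧ P.Ev False (r - 1) A₂₂ ∧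
      (∀ k, 1 ≤ k → k ≤ r → P.Small r k O₁₂) ∧ (∀ k, 1 ≤ k → k ≤ r → P.Small r k O₂₁) ∧
      ∀ᶠ s in atTop, ∀ v ∈ P.Ω s, ∀ h ∈ Icc 0 P.h₁, T v h * Tinv v h = 1 ∧
        HasDerivWithinAt (fun v => T v h) (T' v h) (P.Ω s) v ∧
        h • T' v h = A v h * T v h
          - T v h * Matrix.fromBlocks (A₁₁ v h) (O₁₂ v h) (O₂₁ v h) (A₂₂ v h) := by
  have hS' : P.Ev False r (P.der S) := hS.der.cnv
  have hSr : P.Ev False r S := hS.of_le (Nat.le_succ r)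
  have hMs : P.Ev False r M := by
    have h1 := hSi.matMul_cnv ((hA.matMul_cnv hSr).sub hS'.h_smul)
    exact h1.congr (Eventually.of_forall fun s v _ h _ => hM v h)
  obtain ⟨Z, X, A₁₁, A₂₂, O₁₂, O₂₁, hZ, hX, h₁₁, h₂₂, h₁₂, h₂₁, e₂₁, e₁₁, e₂₂, e₁₂⟩ :=
    exists_blockDiag (P := P) hr hK hq hε hs
      (((Ev.const (Matrix.proj₁ l m)).matMul_cnv hMs).matMul_cnv (Ev.const (Matrix.inj₁ l m)) |>.congr
        (Eventually.of_forall fun s v _ h _ => (Matrix.proj₁_mul_inj₁ (M v h)).symm))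
      (((Ev.const (Matrix.proj₁ l m)).matMul_cnv hMs).matMul_cnv (Ev.const (Matrix.inj₂ l m)) |>.congr
        (Eventually.of_forall fun s v _ h _ => (Matrix.proj₁_mul_inj₂ (M v h)).symm))
      (((Ev.const (Matrix.proj₂ l m)).matMul_cnv hMs).matMul_cnv (Ev.const (Matrix.inj₁ l m)) |>.congr
        (Eventually.of_forall fun s v _ h _ => (Matrix.proj₂_mul_inj₁ (M v h)).symm))
      (((Ev.const (Matrix.proj₂ l m)).matMul_cnv hMs).matMul_cnv (Ev.const (Matrix.inj₂ l m)) |>.congr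
        (Eventually.of_forall fun s v _ h _ => (Matrix.proj₂_mul_inj₂ (M v h)).symm))
      hsyl hsyl' hMq hMε
  have hLs : ∀ {Z : 𝕜 → ℝ → Matrix m l ℂ}, P.Ev False r Z →
      P.Ev False r (fun v h => Matrix.fromBlocks 1 0 (Z v h) 1) := fun {Z} hZ =>
    ((Ev.const 1).add (((Ev.const (Matrix.inj₂ l m)).matMul_cnv hZ).matMul_cnv
      (Ev.const (Matrix.proj₁ l m)))).congr (Eventually.of_forall fun s v _ h _ =>
        Matrix.fromBlocks_lower_eq _)
  have hUs : ∀ {X : 𝕜 → ℝ → Matrix l m ℂ}, P.Ev False r X →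
      P.Ev False r (fun v h => Matrix.fromBlocks 1 (X v h) 0 1) := fun {X} hX =>
    ((Ev.const 1).add (((Ev.const (Matrix.inj₁ l m)).matMul_cnv hX).matMul_cnv
      (Ev.const (Matrix.proj₂ l m)))).congr (Eventually.of_forall fun s v _ h _ =>
        Matrix.fromBlocks_upper_eq _)
  let L : 𝕜 → ℝ → Matrix (l ⊕ m) (l ⊕ m) ℂ := fun v h => Matrix.fromBlocks 1 0 (Z v h) 1
  let U : 𝕜 → ℝ → Matrix (l ⊕ m) (l ⊕ m) ℂ := fun v h => Matrix.fromBlocks 1 (X v h) 0 1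
  let L' : 𝕜 → ℝ → Matrix (l ⊕ m) (l ⊕ m) ℂ := fun v h => Matrix.fromBlocks 0 0 (P.der Z v h) 0
  let U' : 𝕜 → ℝ → Matrix (l ⊕ m) (l ⊕ m) ℂ := fun v h => Matrix.fromBlocks 0 (P.der X v h) 0 0
  have hL' : ∀ᶠ s in atTop, ∀ v ∈ P.Ω s, ∀ h ∈ Icc 0 P.h₁,
      HasDerivWithinAt (fun v => L v h) (L' v h) (P.Ω s) v := by
    obtain ⟨n, rfl⟩ : ∃ n, r = n + 1 := ⟨r - 1, by omega⟩
    filter_upwards [hZ] with s hZ v hv h hh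
    have h1 := Matrix.hasDerivWithinAt_mul (Matrix.hasDerivWithinAt_mul
      (hasDerivWithinAt_const v (P.Ω s) (Matrix.inj₂ l m)) (hZ.hasDerivWithinAt hv hh))
      (hasDerivWithinAt_const v (P.Ω s) (Matrix.proj₁ l m))
    have h2 := h1.const_add (1 : Matrix (l ⊕ m) (l ⊕ m) ℂ)
    simp only [← Matrix.fromBlocks_lower_eq] at h2
    simp only [Matrix.mul_zero, Matrix.zero_mul, add_zero, zero_add, Matrix.inj₂_mul_proj₁] at h2
    exact h2
  have hU' : ∀ᶠ s in atTop, ∀ v ∈ P.Ω s, ∀ h ∈ Icc 0 P.h₁,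
      HasDerivWithinAt (fun v => U v h) (U' v h) (P.Ω s) v := by
    obtain ⟨n, rfl⟩ : ∃ n, r = n + 1 := ⟨r - 1, by omega⟩
    filter_upwards [hX] with s hX v hv h hh
    have h1 := Matrix.hasDerivWithinAt_mul (Matrix.hasDerivWithinAt_mul
      (hasDerivWithinAt_const v (P.Ω s) (Matrix.inj₁ l m)) (hX.hasDerivWithinAt hv hh))
      (hasDerivWithinAt_const v (P.Ω s) (Matrix.proj₂ l m))
    have h2 := h1.const_add (1 : Matrix (l ⊕ m) (l ⊕ m) ℂ)
    simp only [← Matrix.fromBlocks_upper_eq] at h2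
    simp only [Matrix.mul_zero, Matrix.zero_mul, add_zero, zero_add, Matrix.inj₁_mul_proj₂] at h2
    exact h2
  refine ⟨fun v h => S v h * L v h * U v h,
    fun v h => S v h * L v h * U' v h + (S v h * L' v h + P.der S v h * L v h) * U v h,
    fun v h => Matrix.fromBlocks 1 (-X v h) 0 1 * (Matrix.fromBlocks 1 0 (-Z v h) 1 * Sinv v h),
    A₁₁, A₂₂, O₁₂, O₂₁, (hSr.matMul_cnv (hLs hZ)).matMul_cnv (hUs hX),
    (hUs hX.neg).matMul_cnv ((hLs hZ.neg).matMul_cnv hSi), h₁₁, h₂₂, h₁₂, h₂₁, ?_⟩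
  filter_upwards [hS, hL', hU'] with s hS hL' hU' v hv h hh
  have hv0 := P.sub_zero s hv
  refine ⟨?_, Matrix.hasDerivWithinAt_mul (Matrix.hasDerivWithinAt_mul (hS.hasDerivWithinAt hv hh)
    (hL' v hv h hh)) (hU' v hv h hh), ?_⟩
  · have h1 : U v h * Matrix.fromBlocks 1 (-X v h) 0 1 = 1 := by
      simp [U, Matrix.fromBlocks_multiply]
    have h2 : L v h * Matrix.fromBlocks 1 0 (-Z v h) 1 = 1 := by
      simp [L, Matrix.fromBlocks_multiply]
    calc S v h * L v h * U v h * (Matrix.fromBlocks 1 (-X v h) 0 1 *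
          (Matrix.fromBlocks 1 0 (-Z v h) 1 * Sinv v h))
        = S v h * (L v h * (U v h * Matrix.fromBlocks 1 (-X v h) 0 1) *
          Matrix.fromBlocks 1 0 (-Z v h) 1) * Sinv v h := by simp only [Matrix.mul_assoc]
      _ = 1 := by rw [h1, Matrix.mul_one, h2, Matrix.mul_one, hSS v hv0 h hh]
  · set N := Matrix.fromBlocks (A₁₁ v h) (O₁₂ v h) (O₂₁ v h) (A₂₂ v h) with hN
    -- The coefficient after conjugation by `S L`. Its lower left block is already the remainder
    -- `O₂₁`, and only the upper right block is left for `U`.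
    set N₁ := Matrix.fromBlocks ((M v h).toBlocks₁₁ + (M v h).toBlocks₁₂ * Z v h)
      (M v h).toBlocks₁₂ (O₂₁ v h) ((M v h).toBlocks₂₂ - Z v h * (M v h).toBlocks₁₂) with hN₁
    have h1 : M v h * L v h = L v h * N₁ + h • L' v h := by
      conv_lhs => rw [← (M v h).fromBlocks_toBlocks]
      simp only [L, L', N₁, Matrix.fromBlocks_multiply, Matrix.fromBlocks_smul,
        Matrix.fromBlocks_add, e₂₁, Matrix.one_mul, Matrix.mul_one, Matrix.zero_mul,
        Matrix.mul_zero, add_zero, zero_add, smul_zero]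
      congr 1 <;> abel
    have h2 : N₁ * U v h = U v h * N + h • U' v h := by
      simp only [U, U', N, N₁, Matrix.fromBlocks_multiply, Matrix.fromBlocks_smul,
        Matrix.fromBlocks_add, e₁₁, e₁₂, Matrix.one_mul, Matrix.mul_one, Matrix.zero_mul,
        Matrix.mul_zero, add_zero, zero_add, smul_zero]
      congr 1
      · abel
      · abel
      · rw [e₂₂]; abel
    have h3 : h • P.der S v h = A v h * S v h - S v h * M v h := by
      rw [hM, ← Matrix.mul_assoc, hSS v hv0 h hh, Matrix.one_mul, sub_sub_cancel]
    have h4 : h • L' v h = M v h * L v h - L v h * N₁ := by rw [h1]; abel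
    have h5 : h • U' v h = N₁ * U v h - U v h * N := by rw [h2]; abel
    calc h • (S v h * L v h * U' v h + (S v h * L' v h + P.der S v h * L v h) * U v h)
        = S v h * L v h * (h • U' v h) +
          (S v h * (h • L' v h) + (h • P.der S v h) * L v h) * U v h := by
          rw [Matrix.mul_smul, Matrix.mul_smul, Matrix.smul_mul h (P.der S v h), ← smul_add,
            Matrix.smul_mul h, ← smul_add]
      _ = A v h * (S v h * L v h * U v h) - S v h * L v h * U v h * N := by
          rw [h3, h4, h5]
          simp only [Matrix.mul_sub, Matrix.sub_mul, Matrix.add_mul, Matrix.mul_assoc]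
          abel

end Frame

/-! ### Separated spectra, Sylvester bounds and unitary block-triangularization -/

namespace Matrix

variable {l m : Type*} [Fintype l] [Fintype m] [DecidableEq l] [DecidableEq m]

/-- The norm is the largest absolute row sum, so rows may be repeated but columns may not. -/
theorem norm_submatrix_le {l' m' : Type*} [Fintype l'] [Fintype m'] (M : Matrix l m ℂ) (f : l' → l)
    {g : m' → m} (hg : Function.Injective g) : ‖M.submatrix f g‖ ≤ ‖M‖ := by
  rw [linfty_opNorm_def, linfty_opNorm_def, NNReal.coe_le_coe]
  refine Finset.sup_le fun i _ => ?_
  refine le_trans ?_ (Finset.le_sup (Finset.mem_univ (f i)))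
  calc ∑ j, ‖M.submatrix f g i j‖₊ = ∑ j ∈ Finset.univ.map ⟨g, hg⟩, ‖M (f i) j‖₊ := by
        rw [Finset.sum_map]; rfl
    _ ≤ ∑ j, ‖M (f i) j‖₊ := Finset.sum_le_sum_of_subset (Finset.subset_univ _)

theorem norm_toBlocks₁₁_le (M : Matrix (l ⊕ m) (l ⊕ m) ℂ) : ‖M.toBlocks₁₁‖ ≤ ‖M‖ :=
  norm_submatrix_le M Sum.inl Sum.inl_injective

theorem norm_toBlocks₁₂_le (M : Matrix (l ⊕ m) (l ⊕ m) ℂ) : ‖M.toBlocks₁₂‖ ≤ ‖M‖ :=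
  norm_submatrix_le M Sum.inl Sum.inr_injective

theorem norm_toBlocks₂₁_le (M : Matrix (l ⊕ m) (l ⊕ m) ℂ) : ‖M.toBlocks₂₁‖ ≤ ‖M‖ :=
  norm_submatrix_le M Sum.inr Sum.inl_injective

theorem norm_toBlocks₂₂_le (M : Matrix (l ⊕ m) (l ⊕ m) ℂ) : ‖M.toBlocks₂₂‖ ≤ ‖M‖ :=
  norm_submatrix_le M Sum.inr Sum.inr_injective

theorem norm_root_le {B : Matrix l l ℂ} {t : l → ℂ}
    (h : B.charpoly = ∏ i, (Polynomial.X - Polynomial.C (t i))) (i : l) : ‖t i‖ ≤ ‖B‖ := by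
  have h1 : (scalar l (t i) - B).det = 0 := by
    rw [← eval_charpoly, h, Polynomial.eval_prod]
    exact Finset.prod_eq_zero (Finset.mem_univ i) (by simp)
  obtain ⟨v, hv, hBv⟩ := exists_mulVec_eq_zero_iff.2 h1
  have h2 : t i • v = B.mulVec v := by
    rw [sub_mulVec, sub_eq_zero] at hBv
    rw [← hBv]
    ext j
    simp [scalar_apply, mulVec_diagonal]
  have h3 := linfty_opNorm_mulVec B v
  rw [← h2, norm_smul] at h3
  exact le_of_mul_le_mul_right h3 (norm_pos_iff.2 hv)

theorem aeval_mul_eq_mul_aeval {B : Matrix l l ℂ} {C : Matrix m m ℂ} {Y : Matrix l m ℂ}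
    (h : B * Y = Y * C) (p : Polynomial ℂ) :
    Polynomial.aeval B p * Y = Y * Polynomial.aeval C p := by
  induction p using Polynomial.induction_on' with
  | add p q hp hq => simp only [map_add, Matrix.add_mul, Matrix.mul_add, hp, hq]
  | monomial n a =>
    have hn : ∀ n, B ^ n * Y = Y * C ^ n := fun n => by
      induction n with
      | zero => simp
      | succ n ih => rw [pow_succ, pow_succ, Matrix.mul_assoc, h, ← Matrix.mul_assoc, ih,
          Matrix.mul_assoc]
    simp only [Polynomial.aeval_monomial, hn, Algebra.algebraMap_eq_smul_one,
      Matrix.smul_mul, Matrix.mul_smul, Matrix.one_mul]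

/-- In a Bézout relation for the two characteristic polynomials, evaluation at `B` kills one term by
Cayley–Hamilton. Moving the other across `Y` turns it into the characteristic polynomial of `C`
evaluated at `C`, which vanishes too. -/
theorem eq_zero_of_intertwines {B : Matrix l l ℂ} {C : Matrix m m ℂ} {Y : Matrix l m ℂ}
    (h : B * Y = Y * C) (hBC : IsCoprime B.charpoly C.charpoly) : Y = 0 := by
  obtain ⟨a, b, hab⟩ := hBC
  have h1 := congrArg (Polynomial.aeval B) hab
  rw [map_add, map_mul, map_mul, aeval_self_charpoly, mul_zero, zero_add, map_one] at h1
  have h2 := aeval_mul_eq_mul_aeval h C.charpoly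
  rw [aeval_self_charpoly, Matrix.mul_zero] at h2
  rw [← Matrix.one_mul Y, ← h1, Matrix.mul_assoc, h2, Matrix.mul_zero]

theorem isCoprime_prod {t : l → ℂ} {u : m → ℂ} (h : ∀ i j, t i ≠ u j) :
    IsCoprime (∏ i, (Polynomial.X - Polynomial.C (t i)))
      (∏ j, (Polynomial.X - Polynomial.C (u j))) :=
  IsCoprime.prod_left fun i _ => IsCoprime.prod_right fun j _ =>
    Polynomial.isCoprime_X_sub_C_of_isUnit_sub (sub_ne_zero.2 (h i j)).isUnit

theorem continuous_det_scalar_sub :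
    Continuous (fun p : ℂ × Matrix l l ℂ => (scalar l p.1 - p.2).det) := by
  have h : Continuous (fun p : ℂ × Matrix l l ℂ => (p.1 • (1 : Matrix l l ℂ) - p.2).det) := by
    fun_prop
  refine h.congr fun p => ?_
  rw [scalar_apply, smul_one_eq_diagonal]

theorem det_scalar_sub_eq_prod_iff {M : Matrix l l ℂ} {t : l → ℂ} :
    (∀ z, (scalar l z - M).det = ∏ i, (z - t i)) ↔
      M.charpoly = ∏ i, (Polynomial.X - Polynomial.C (t i)) := by
  constructor
  · intro h
    refine Polynomial.funext fun z => ?_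
    rw [eval_charpoly, h, Polynomial.eval_prod]
    simp
  · intro h z
    rw [← eval_charpoly, h, Polynomial.eval_prod]
    simp

variable (l m) in
/-- Sylvester operators with separated spectra are uniformly invertible on bounded sets. -/
theorem exists_sylBound (R : ℝ) {d : ℝ} (hd : 0 < d) : ∃ K : ℝ, 0 ≤ K ∧
    ∀ (B : Matrix l l ℂ) (C : Matrix m m ℂ) (t : l → ℂ) (u : m → ℂ), ‖B‖ ≤ R → ‖C‖ ≤ R →
      B.charpoly = ∏ i, (Polynomial.X - Polynomial.C (t i)) →
      C.charpoly = ∏ i, (Polynomial.X - Polynomial.C (u i)) →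
      (∀ i j, d ≤ ‖t i - u j‖) → SylBound K B C := by
  let X := Matrix l l ℂ × Matrix m m ℂ × (l → ℂ) × (m → ℂ) × Matrix l m ℂ
  -- The eigenvalue lists are part of the point, and the factorization of the characteristic
  -- polynomial is stated as an identity for each `z`. So all conditions are closed and `S` is
  -- compact.
  let S : Set X := {x | ‖x.1‖ ≤ R ∧ ‖x.2.1‖ ≤ R ∧ ‖x.2.2.1‖ ≤ R ∧ ‖x.2.2.2.1‖ ≤ R ∧
    ‖x.2.2.2.2‖ = 1 ∧ (∀ z, (scalar l z - x.1).det = ∏ i, (z - x.2.2.1 i)) ∧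
    (∀ z, (scalar m z - x.2.1).det = ∏ i, (z - x.2.2.2.1 i)) ∧
    ∀ i j, d ≤ ‖x.2.2.1 i - x.2.2.2.1 j‖}
  have hclosed : IsClosed S := by
    have k1 : IsClosed {x : X | ‖x.1‖ ≤ R} := isClosed_le (by fun_prop) (by fun_prop)
    have k2 : IsClosed {x : X | ‖x.2.1‖ ≤ R} := isClosed_le (by fun_prop) (by fun_prop)
    have k3 : IsClosed {x : X | ‖x.2.2.1‖ ≤ R} := isClosed_le (by fun_prop) (by fun_prop)
    have k4 : IsClosed {x : X | ‖x.2.2.2.1‖ ≤ R} := isClosed_le (by fun_prop) (by fun_prop)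
    have k5 : IsClosed {x : X | ‖x.2.2.2.2‖ = 1} := isClosed_eq (by fun_prop) (by fun_prop)
    have k6 : IsClosed {x : X | ∀ z, (scalar l z - x.1).det = ∏ i, (z - x.2.2.1 i)} := by
      rw [ofPred_forall]
      exact isClosed_iInter fun z => isClosed_eq
        (continuous_det_scalar_sub.comp (continuous_const.prodMk continuous_fst)) (by fun_prop)
    have k7 : IsClosed {x : X | ∀ z, (scalar m z - x.2.1).det = ∏ i, (z - x.2.2.2.1 i)} := by
      rw [ofPred_forall]
      exact isClosed_iInter fun z => isClosed_eq
        (continuous_det_scalar_sub.comp (continuous_const.prodMk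
          (continuous_fst.comp continuous_snd))) (by fun_prop)
    have k8 : IsClosed {x : X | ∀ i j, d ≤ ‖x.2.2.1 i - x.2.2.2.1 j‖} := by
      simp only [ofPred_forall]
      exact isClosed_iInter fun i => isClosed_iInter fun j => isClosed_le (by fun_prop)
        (by fun_prop)
    exact k1.inter (k2.inter (k3.inter (k4.inter (k5.inter (k6.inter (k7.inter k8))))))
  have hbdd : Bornology.IsBounded S := by
    refine (Metric.isBounded_closedBall (x := (0 : X)) (r := max R 1)).subset fun x hx => ?_
    obtain ⟨h1, h2, h3, h4, h5, -⟩ := hx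
    rw [mem_closedBall_zero_iff]
    refine norm_prod_le_iff.2 ⟨h1.trans (le_max_left _ _), norm_prod_le_iff.2
      ⟨h2.trans (le_max_left _ _), norm_prod_le_iff.2 ⟨h3.trans (le_max_left _ _),
      norm_prod_le_iff.2 ⟨h4.trans (le_max_left _ _), h5.le.trans (le_max_right _ _)⟩⟩⟩⟩
  have hcomp : IsCompact S := Metric.isCompact_of_isClosed_isBounded hclosed hbdd
  have hcont : Continuous (fun x : X => ‖x.1 * x.2.2.2.2 - x.2.2.2.2 * x.2.1‖) := by fun_prop
  -- On the compact set `S` the minimum is attained. It is positive, because a vanishing Sylvester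
  -- image would force `Y = 0` by coprimality.
  obtain ⟨c, hc, hcS⟩ : ∃ c : ℝ, 0 < c ∧ ∀ x ∈ S, c ≤ ‖x.1 * x.2.2.2.2 - x.2.2.2.2 * x.2.1‖ := by
    rcases S.eq_empty_or_nonempty with hS | hS
    · exact ⟨1, one_pos, by simp [hS]⟩
    · obtain ⟨x, hx, hmin⟩ := hcomp.exists_isMinOn hS hcont.continuousOn
      refine ⟨_, ?_, fun y hy => hmin hy⟩
      rw [norm_pos_iff, sub_ne_zero]
      intro h
      obtain ⟨-, -, -, -, h5, h6, h7, h8⟩ := hx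
      have h9 := eq_zero_of_intertwines h (by
        rw [det_scalar_sub_eq_prod_iff.1 h6, det_scalar_sub_eq_prod_iff.1 h7]
        refine isCoprime_prod fun i j hij => ?_
        have := h8 i j
        rw [hij, sub_self, norm_zero] at this
        exact this.not_gt hd)
      rw [h9, norm_zero] at h5
      exact zero_ne_one h5
  refine ⟨c⁻¹, by positivity, fun B C t u hB hC ht hu hsep Y => ?_⟩
  rcases eq_or_ne Y 0 with rfl | hY
  · simp
  have hYp : 0 < ‖Y‖ := norm_pos_iff.2 hY
  have hR : 0 ≤ R := (norm_nonneg _).trans hB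
  have h1 := hcS (B, C, t, u, ((‖Y‖⁻¹ : ℝ) : ℂ) • Y) ⟨hB, hC,
    (pi_norm_le_iff_of_nonneg hR).2 fun i => (norm_root_le ht i).trans hB,
    (pi_norm_le_iff_of_nonneg hR).2 fun i => (norm_root_le hu i).trans hC, by
      rw [norm_smul, Complex.norm_real, norm_inv, norm_norm, inv_mul_cancel₀ hYp.ne'],
    det_scalar_sub_eq_prod_iff.2 ht, det_scalar_sub_eq_prod_iff.2 hu, hsep⟩
  simp only [Matrix.mul_smul, Matrix.smul_mul, ← smul_sub, norm_smul, Complex.norm_real, norm_inv,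
    norm_norm] at h1
  rw [inv_mul_eq_div, le_div_iff₀ hc]
  rw [inv_mul_eq_div, le_div_iff₀ hYp] at h1
  linarith

/-- `V` is unitary and block-triangularizes `A`, with the given spectra of the diagonal blocks. -/
structure IsTriangularizer (A : Matrix (l ⊕ m) (l ⊕ m) ℂ) (t : l → ℂ) (u : m → ℂ)
    (V : Matrix (l ⊕ m) (l ⊕ m) ℂ) : Prop where
  unitary : V ∈ unitaryGroup (l ⊕ m) ℂ
  lower : (star V * A * V).toBlocks₂₁ = 0
  charpoly₁ : (star V * A * V).toBlocks₁₁.charpoly = ∏ i, (Polynomial.X - Polynomial.C (t i))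
  charpoly₂ : (star V * A * V).toBlocks₂₂.charpoly = ∏ i, (Polynomial.X - Polynomial.C (u i))

theorem charpoly_conj_unitary {V A : Matrix l l ℂ} (hV : V ∈ unitaryGroup l ℂ) :
    (star V * A * V).charpoly = A.charpoly := by
  have h1 := mem_unitaryGroup_iff.1 hV
  have h2 := mem_unitaryGroup_iff'.1 hV
  have h3 := charpoly_units_conj ⟨star V, V, h2, h1⟩ A
  rwa [← coe_units_inv, Units.inv_mk] at h3

/-- A matrix with an eigenvalue is unitarily equivalent to one that splits it off. -/
theorem exists_unitary_eigen (A : Matrix (Unit ⊕ m) (Unit ⊕ m) ℂ) {z : ℂ}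
    (hz : A.charpoly.eval z = 0) : ∃ V ∈ unitaryGroup (Unit ⊕ m) ℂ,
      (star V * A * V).toBlocks₂₁ = 0 ∧ (star V * A * V).toBlocks₁₁ = fun _ _ => z := by
  rw [eval_charpoly] at hz
  obtain ⟨v, hv, hAv⟩ := exists_mulVec_eq_zero_iff.2 hz
  have hAv' : A.mulVec v = z • v := by
    rw [sub_mulVec, sub_eq_zero] at hAv
    rw [← hAv]
    ext j
    simp [scalar_apply, mulVec_diagonal]
  let e : EuclideanSpace ℂ (Unit ⊕ m) := WithLp.toLp 2 v
  have he : e ≠ 0 := fun h => hv (by simpa [e] using h)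
  -- The normalized eigenvector becomes the first column of the unitary matrix.
  obtain ⟨b, hb⟩ := Orthonormal.exists_orthonormalBasis_extension_of_card_eq (𝕜 := ℂ)
    (E := EuclideanSpace ℂ (Unit ⊕ m)) (ι := Unit ⊕ m) (by simp)
    (v := fun _ => ((‖e‖⁻¹ : ℝ) : ℂ) • e) (s := {Sum.inl ()}) (by
      constructor
      · intro i
        simp [norm_smul, inv_mul_cancel₀ (norm_ne_zero_iff.2 he)]
      · intro i j hij
        exact absurd (Subtype.ext (i.2.trans j.2.symm)) hij)
  have hb0 := hb (Sum.inl ()) rfl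
  let V : Matrix (Unit ⊕ m) (Unit ⊕ m) ℂ := of fun i j => b j i
  have hVV : star V * V = 1 := by
    ext i j
    have := (orthonormal_iff_ite.1 b.orthonormal) i j
    rw [EuclideanSpace.inner_eq_star_dotProduct, dotProduct_comm] at this
    simpa [V, Matrix.mul_apply, star_apply, one_apply, dotProduct] using this
  have hcol : ∀ i, (A * V) i (Sum.inl ()) = z * V i (Sum.inl ()) := by
    intro i
    have h1 : ∀ k, V k (Sum.inl ()) = ((‖e‖⁻¹ : ℝ) : ℂ) * v k := fun k => by
      simp only [V, of_apply, hb0]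
      simp [e]
    have h2 := congrFun hAv' i
    simp only [mulVec, dotProduct, Pi.smul_apply, smul_eq_mul] at h2
    rw [mul_apply]
    simp only [h1]
    calc ∑ k, A i k * (((‖e‖⁻¹ : ℝ) : ℂ) * v k) = ((‖e‖⁻¹ : ℝ) : ℂ) * ∑ k, A i k * v k := by
          rw [Finset.mul_sum]
          exact Finset.sum_congr rfl fun k _ => by ring
      _ = _ := by rw [h2]; ring
  have hfirst : ∀ i, (star V * A * V) i (Sum.inl ()) = z *
      (1 : Matrix (Unit ⊕ m) (Unit ⊕ m) ℂ) i (Sum.inl ()) := by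
    intro i
    rw [Matrix.mul_assoc, mul_apply]
    simp only [hcol]
    rw [← hVV, mul_apply, Finset.mul_sum]
    exact Finset.sum_congr rfl fun k _ => by ring
  refine ⟨V, mem_unitaryGroup_iff'.2 hVV, ?_, ?_⟩
  · ext i j
    exact (hfirst (Sum.inr i)).trans (by simp)
  · ext i j
    exact (hfirst (Sum.inl i)).trans (by simp)

end Matrix

/-! ### Existence and proximity of triangularizers -/

namespace Matrix

variable {l m : Type*} [Fintype l] [Fintype m] [DecidableEq l] [DecidableEq m]

theorem charpoly_of_toBlocks₂₁_eq_zero {M : Matrix (l ⊕ m) (l ⊕ m) ℂ} (h : M.toBlocks₂₁ = 0) :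
    M.charpoly = M.toBlocks₁₁.charpoly * M.toBlocks₂₂.charpoly := by
  conv_lhs => rw [← fromBlocks_toBlocks M, h]
  rw [charpoly_fromBlocks_zero₂₁]

theorem prod_X_sub_C_ne_zero (t : l → ℂ) : ∏ i, (Polynomial.X - Polynomial.C (t i)) ≠ 0 :=
  (Polynomial.monic_prod_of_monic _ _ fun _ _ => Polynomial.monic_X_sub_C _).ne_zero

/-- The characteristic polynomial of the other diagonal block is determined by cancellation. -/
theorem IsTriangularizer.of_charpoly₂ {A V : Matrix (l ⊕ m) (l ⊕ m) ℂ} {t : l → ℂ} {u : m → ℂ}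
    (hV : V ∈ unitaryGroup (l ⊕ m) ℂ) (h : (star V * A * V).toBlocks₂₁ = 0)
    (h₂ : (star V * A * V).toBlocks₂₂.charpoly = ∏ i, (Polynomial.X - Polynomial.C (u i)))
    (hA : A.charpoly = (∏ i, (Polynomial.X - Polynomial.C (t i))) *
      ∏ i, (Polynomial.X - Polynomial.C (u i))) : IsTriangularizer A t u V := by
  refine ⟨hV, h, ?_, h₂⟩
  have h3 := charpoly_of_toBlocks₂₁_eq_zero h
  rw [charpoly_conj_unitary hV, hA, h₂] at h3
  exact (mul_right_cancel₀ (prod_X_sub_C_ne_zero u) h3).symm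

theorem fromBlocks_mem_unitaryGroup {W₁ : Matrix l l ℂ} {W₂ : Matrix m m ℂ}
    (h₁ : W₁ ∈ unitaryGroup l ℂ) (h₂ : W₂ ∈ unitaryGroup m ℂ) :
    fromBlocks W₁ 0 0 W₂ ∈ unitaryGroup (l ⊕ m) ℂ := by
  rw [mem_unitaryGroup_iff'] at *
  rw [star_eq_conjTranspose, fromBlocks_conjTranspose, fromBlocks_multiply]
  simp only [star_eq_conjTranspose] at h₁ h₂
  simp [h₁, h₂]

theorem star_fromBlocks_mul_mul (W₁ : Matrix l l ℂ) (W₂ : Matrix m m ℂ)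
    (M : Matrix (l ⊕ m) (l ⊕ m) ℂ) :
    star (fromBlocks W₁ 0 0 W₂) * M * fromBlocks W₁ 0 0 W₂ =
      fromBlocks (star W₁ * M.toBlocks₁₁ * W₁) (star W₁ * M.toBlocks₁₂ * W₂)
        (star W₂ * M.toBlocks₂₁ * W₁) (star W₂ * M.toBlocks₂₂ * W₂) := by
  conv_lhs => rw [← fromBlocks_toBlocks M]
  rw [star_eq_conjTranspose, fromBlocks_conjTranspose, fromBlocks_multiply, fromBlocks_multiply]
  simp [star_eq_conjTranspose]

/-- The freedom in the choice of a triangularizer that is used to move it close to a given one. -/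
theorem IsTriangularizer.mul_fromBlocks {A V : Matrix (l ⊕ m) (l ⊕ m) ℂ} {t : l → ℂ} {u : m → ℂ}
    (h : IsTriangularizer A t u V) {W₁ : Matrix l l ℂ} {W₂ : Matrix m m ℂ}
    (h₁ : W₁ ∈ unitaryGroup l ℂ) (h₂ : W₂ ∈ unitaryGroup m ℂ) :
    IsTriangularizer A t u (V * fromBlocks W₁ 0 0 W₂) := by
  have e : star (V * fromBlocks W₁ 0 0 W₂) * A * (V * fromBlocks W₁ 0 0 W₂) =
      star (fromBlocks W₁ 0 0 W₂) * (star V * A * V) * fromBlocks W₁ 0 0 W₂ := by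
    rw [star_mul]; simp only [Matrix.mul_assoc]
  rw [star_fromBlocks_mul_mul] at e
  refine ⟨mul_mem h.unitary (fromBlocks_mem_unitaryGroup h₁ h₂), ?_, ?_, ?_⟩
  · rw [e, toBlocks_fromBlocks₂₁, h.lower]; simp
  · rw [e, toBlocks_fromBlocks₁₁, charpoly_conj_unitary h₁, h.charpoly₁]
  · rw [e, toBlocks_fromBlocks₂₂, charpoly_conj_unitary h₂, h.charpoly₂]

/-- The equivalence that splits off the first index. -/
def splitIndex (n : ℕ) (m : Type*) : Fin (n + 1) ⊕ m ≃ Unit ⊕ (Fin n ⊕ m) where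
  toFun := Sum.elim (Fin.cons (Sum.inl ()) fun i => Sum.inr (Sum.inl i))
    fun j => Sum.inr (Sum.inr j)
  invFun := Sum.elim (fun _ => Sum.inl 0) (Sum.elim (fun i => Sum.inl i.succ) Sum.inr)
  left_inv := by
    rintro (i | j)
    · refine Fin.cases ?_ (fun i => ?_) i <;> simp
    · simp
  right_inv := by rintro (i | i | j) <;> simp

/-- Schur's triangularization stopped after the first group: split off an eigenvector for `t 0` and
treat the complementary block by induction. -/
theorem exists_isTriangularizer {n : ℕ} (A : Matrix (Fin n ⊕ m) (Fin n ⊕ m) ℂ) (t : Fin n → ℂ)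
    (u : m → ℂ) (hA : A.charpoly = (∏ i, (Polynomial.X - Polynomial.C (t i))) *
      ∏ i, (Polynomial.X - Polynomial.C (u i))) : ∃ V, IsTriangularizer A t u V := by
  induction n with
  | zero =>
    have h1 : (star (1 : Matrix (Fin 0 ⊕ m) (Fin 0 ⊕ m) ℂ) * A * 1).toBlocks₂₁ = 0 := by
      ext i j; exact j.elim0
    refine ⟨1, .of_charpoly₂ (one_mem _) h1 ?_ hA⟩
    have h2 := charpoly_of_toBlocks₂₁_eq_zero h1
    rw [charpoly_conj_unitary (one_mem _), hA] at h2
    simpa [charpoly, det_isEmpty] using h2.symm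
  | succ n ih =>
    let e := splitIndex n m
    let A' := reindex e e A
    have hA' : A'.charpoly = (Polynomial.X - Polynomial.C (t 0)) *
        ((∏ i : Fin n, (Polynomial.X - Polynomial.C (t i.succ))) *
          ∏ i, (Polynomial.X - Polynomial.C (u i))) := by
      rw [charpoly_reindex, hA, Fin.prod_univ_succ, mul_assoc]
    obtain ⟨V₁, hV₁, h21, h11⟩ := exists_unitary_eigen A' (z := t 0) (by simp [hA'])
    have h1 := charpoly_of_toBlocks₂₁_eq_zero h21
    have h2 : (star V₁ * A' * V₁).toBlocks₁₁.charpoly = Polynomial.X - Polynomial.C (t 0) := by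
      change (charmatrix _).det = _
      rw [det_unique, charmatrix_apply, h11]
      simp
    rw [charpoly_conj_unitary hV₁, hA', h2] at h1
    obtain ⟨V₂, hV₂⟩ := ih _ (fun i => t i.succ)
      (mul_left_cancel₀ (Polynomial.monic_X_sub_C _).ne_zero h1).symm
    have hV' := mul_mem hV₁ (fromBlocks_mem_unitaryGroup (one_mem (unitaryGroup Unit ℂ)) hV₂.unitary)
    have hconj : star (V₁ * fromBlocks 1 0 0 V₂) * A' * (V₁ * fromBlocks 1 0 0 V₂) =
        star (fromBlocks 1 0 0 V₂) * (star V₁ * A' * V₁) * fromBlocks 1 0 0 V₂ := by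
      rw [star_mul]; simp only [Matrix.mul_assoc]
    rw [star_fromBlocks_mul_mul, h21] at hconj
    have hsub : star ((V₁ * fromBlocks 1 0 0 V₂).submatrix e e) * A *
        (V₁ * fromBlocks 1 0 0 V₂).submatrix e e =
        (star (V₁ * fromBlocks 1 0 0 V₂) * A' * (V₁ * fromBlocks 1 0 0 V₂)).submatrix e e := by
      have h3 : A = A'.submatrix e e := by ext i j; simp [A']
      have h4 : star ((V₁ * fromBlocks 1 0 0 V₂).submatrix e e) =
        (star (V₁ * fromBlocks 1 0 0 V₂)).submatrix e e := rfl
      rw [h4, h3, submatrix_mul_equiv, submatrix_mul_equiv]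
    rw [hconj] at hsub
    refine ⟨(V₁ * fromBlocks 1 0 0 V₂).submatrix e e, .of_charpoly₂ ?_ ?_ ?_ hA⟩
    · rw [mem_unitaryGroup_iff'] at hV' ⊢
      have : star ((V₁ * fromBlocks 1 0 0 V₂).submatrix e e) =
        (star (V₁ * fromBlocks 1 0 0 V₂)).submatrix e e := rfl
      rw [this, submatrix_mul_equiv, hV', submatrix_one_equiv]
    · rw [hsub]
      ext i j
      refine Fin.cases ?_ (fun j => ?_) j
      · simp [toBlocks₂₁, e, splitIndex]
      · exact congrFun (congrFun hV₂.lower i) j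
    · rw [hsub]
      exact hV₂.charpoly₂

theorem norm_le_card_of_entry_le {A : Matrix l m ℂ} (h : ∀ i j, ‖A i j‖ ≤ 1) :
    ‖A‖ ≤ Fintype.card m := by
  rw [linfty_opNorm_def, ← NNReal.coe_natCast, NNReal.coe_le_coe]
  refine Finset.sup_le fun i _ => ?_
  calc ∑ j, ‖A i j‖₊ ≤ ∑ _j : m, (1 : NNReal) := Finset.sum_le_sum fun j _ => h i j
    _ = Fintype.card m := by simp

theorem norm_le_of_mem_unitaryGroup {V : Matrix l l ℂ} (hV : V ∈ unitaryGroup l ℂ) :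
    ‖V‖ ≤ Fintype.card l :=
  norm_le_card_of_entry_le fun i j => entry_norm_bound_of_unitary hV i j

theorem star_mem_unitaryGroup {V : Matrix l l ℂ} (hV : V ∈ unitaryGroup l ℂ) :
    star V ∈ unitaryGroup l ℂ := Unitary.star_mem hV

theorem isCompact_unitaryGroup : IsCompact {V : Matrix l l ℂ | V ∈ unitaryGroup l ℂ} := by
  refine Metric.isCompact_of_isClosed_isBounded ?_ ?_
  · simp only [mem_unitaryGroup_iff', star_eq_conjTranspose]
    exact isClosed_eq (by fun_prop) (by fun_prop)
  · refine (Metric.isBounded_closedBall (x := (0 : Matrix l l ℂ)) (r := Fintype.card l)).subset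
      fun V hV => ?_
    rw [mem_closedBall_zero_iff]
    exact norm_le_of_mem_unitaryGroup hV

theorem continuous_toBlocks₂₁ :
    Continuous (fun M : Matrix (l ⊕ m) (l ⊕ m) ℂ => M.toBlocks₂₁) :=
  AddMonoidHomClass.continuous_of_bound
    ({ toFun := toBlocks₂₁, map_zero' := rfl, map_add' := fun _ _ => rfl } :
      Matrix (l ⊕ m) (l ⊕ m) ℂ →+ Matrix m l ℂ) 1
    fun M => by rw [one_mul]; exact norm_toBlocks₂₁_le M

open scoped ComplexOrder in
-- `G* G = 1` makes the square block `a` unitary, and then `a a* + b b* = 1` leaves `b b* = 0`.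
theorem unitary_of_toBlocks₂₁_eq_zero {G : Matrix (l ⊕ m) (l ⊕ m) ℂ}
    (hG : G ∈ unitaryGroup (l ⊕ m) ℂ) (h : G.toBlocks₂₁ = 0) :
    G.toBlocks₁₁ ∈ unitaryGroup l ℂ ∧ G.toBlocks₂₂ ∈ unitaryGroup m ℂ ∧ G.toBlocks₁₂ = 0 := by
  obtain ⟨a, b, c, d, rfl⟩ : ∃ a b c d, G = fromBlocks a b c d :=
    ⟨_, _, _, _, (fromBlocks_toBlocks G).symm⟩
  simp only [toBlocks_fromBlocks₁₁, toBlocks_fromBlocks₁₂, toBlocks_fromBlocks₂₁,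
    toBlocks_fromBlocks₂₂] at *
  subst h
  have h1 := mem_unitaryGroup_iff.1 hG
  have h2 := mem_unitaryGroup_iff'.1 hG
  rw [star_eq_conjTranspose, fromBlocks_conjTranspose, fromBlocks_multiply, ← fromBlocks_one,
    fromBlocks_inj] at h1 h2
  simp only [conjTranspose_zero, Matrix.zero_mul, Matrix.mul_zero, add_zero, zero_add] at h1 h2
  have ha : a ∈ unitaryGroup l ℂ := mem_unitaryGroup_iff'.2 h2.1
  refine ⟨ha, mem_unitaryGroup_iff.2 h1.2.2.2, ?_⟩
  have h3 := h1.1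
  rw [← star_eq_conjTranspose a, mem_unitaryGroup_iff.1 ha, add_eq_left] at h3
  exact self_mul_conjTranspose_eq_zero.1 h3

variable (l m) in
/-- A unitary matrix with small lower left block is close to a block-diagonal unitary matrix. -/
theorem exists_blockDiag_unitary {ε : ℝ} (hε : 0 < ε) : ∃ δ > 0,
    ∀ G ∈ unitaryGroup (l ⊕ m) ℂ, ‖G.toBlocks₂₁‖ ≤ δ → ∃ W₁ ∈ unitaryGroup l ℂ,
      ∃ W₂ ∈ unitaryGroup m ℂ, ‖G * fromBlocks W₁ 0 0 W₂ - 1‖ ≤ ε := by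
  -- The unitary matrices that no block-diagonal unitary brings within less than `ε` of the
  -- identity. This set is compact and the lower left block does not vanish on it; `δ` is half of
  -- the minimum of its norm there.
  let S : Set (Matrix (l ⊕ m) (l ⊕ m) ℂ) := {G | G ∈ unitaryGroup (l ⊕ m) ℂ} ∩
    ⋂ W₁ ∈ unitaryGroup l ℂ, ⋂ W₂ ∈ unitaryGroup m ℂ,
      {G | ε ≤ ‖G * fromBlocks W₁ 0 0 W₂ - 1‖}
  have hS : IsCompact S := isCompact_unitaryGroup.inter_right <|
    isClosed_biInter fun W₁ _ => isClosed_biInter fun W₂ _ =>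
      isClosed_le continuous_const (by fun_prop)
  have hcont : Continuous (fun G : Matrix (l ⊕ m) (l ⊕ m) ℂ => ‖G.toBlocks₂₁‖) :=
    continuous_toBlocks₂₁.norm
  obtain ⟨c, hc, hcS⟩ : ∃ c : ℝ, 0 < c ∧ ∀ G ∈ S, c ≤ ‖G.toBlocks₂₁‖ := by
    rcases S.eq_empty_or_nonempty with h | h
    · exact ⟨1, one_pos, by simp [h]⟩
    · obtain ⟨G, hG, hmin⟩ := hS.exists_isMinOn h hcont.continuousOn
      refine ⟨_, ?_, fun y hy => hmin hy⟩
      rw [norm_pos_iff]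
      intro h0
      obtain ⟨h1, h2, h3⟩ := unitary_of_toBlocks₂₁_eq_zero hG.1 h0
      have h4 := hG.2
      simp only [mem_iInter, mem_ofPred_eq] at h4
      have h5 := h4 _ (star_mem_unitaryGroup h1) _ (star_mem_unitaryGroup h2)
      have h6 : G = fromBlocks G.toBlocks₁₁ 0 0 G.toBlocks₂₂ := by
        conv_lhs => rw [← fromBlocks_toBlocks G, h0, h3]
      have h7 : G * fromBlocks (star G.toBlocks₁₁) 0 0 (star G.toBlocks₂₂) = 1 := by
        conv_lhs => rw [h6]
        rw [toBlocks_fromBlocks₁₁, toBlocks_fromBlocks₂₂, fromBlocks_multiply,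
          mem_unitaryGroup_iff.1 h1, mem_unitaryGroup_iff.1 h2]
        simp
      rw [h7, sub_self, norm_zero] at h5
      exact h5.not_gt hε
  refine ⟨c / 2, by positivity, fun G hG hGc => ?_⟩
  by_contra! hcon
  have := hcS G ⟨hG, by
    simp only [mem_iInter, mem_ofPred_eq]
    exact fun W₁ h₁ W₂ h₂ => (hcon W₁ h₁ W₂ h₂).le⟩
  linarith

variable (l m) in
/-- Triangularizers of nearby matrices can be chosen close to each other. -/
theorem exists_isTriangularizer_near (R : ℝ) {d ε : ℝ} (hd : 0 < d) (hε : 0 < ε) : ∃ δ > 0,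
    ∀ (A A' V V' : Matrix (l ⊕ m) (l ⊕ m) ℂ) (t t' : l → ℂ) (u u' : m → ℂ), ‖A‖ ≤ R → ‖A'‖ ≤ R →
      (∀ i j, d ≤ ‖t' i - u j‖) → IsTriangularizer A t u V → IsTriangularizer A' t' u' V' →
      ‖A - A'‖ ≤ δ → ∃ U, IsTriangularizer A' t' u' U ∧ ‖U - V‖ ≤ ε := by
  set c : ℝ := ((Fintype.card (l ⊕ m) : ℕ) : ℝ)
  have hc : 0 ≤ c := Nat.cast_nonneg _
  obtain ⟨K, hK, hsyl⟩ := exists_sylBound m l (c * R * c) hd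
  obtain ⟨δ, hδ, hW⟩ := exists_blockDiag_unitary l m (ε := ε / (c + 1)) (by positivity)
  refine ⟨δ / (K * c * c + 1), by positivity, fun A A' V V' t t' u u' hA hA' hsep hV hV' hAA' => ?_⟩
  have hnorm : ∀ {B V V' : Matrix (l ⊕ m) (l ⊕ m) ℂ} {r : ℝ}, V ∈ unitaryGroup (l ⊕ m) ℂ →
      V' ∈ unitaryGroup (l ⊕ m) ℂ → ‖B‖ ≤ r → ‖star V * B * V'‖ ≤ c * r * c := by
    intro B V V' r hV hV' hB
    have hr := (norm_nonneg _).trans hB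
    calc ‖star V * B * V'‖ ≤ ‖star V‖ * ‖B‖ * ‖V'‖ :=
          (norm_mul_le _ _).trans (mul_le_mul_of_nonneg_right (norm_mul_le _ _) (norm_nonneg _))
      _ ≤ c * r * c := by
          gcongr
          · exact norm_le_of_mem_unitaryGroup (star_mem_unitaryGroup hV)
          · exact norm_le_of_mem_unitaryGroup hV'
  have hVV := mem_unitaryGroup_iff.1 hV.unitary
  have hVV' := mem_unitaryGroup_iff.1 hV'.unitary
  -- The lower left block of `G` solves a Sylvester equation with right-hand side of size `‖A -
  -- A'‖`. Its coefficients have the spectra `u` and `t'`, whence the hypothesis of separation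
  -- across the two matrices. A small block is then removed by a block-diagonal unitary factor.
  set G := star V * V'
  have hG : G ∈ unitaryGroup (l ⊕ m) ℂ := mul_mem (star_mem_unitaryGroup hV.unitary) hV'.unitary
  have hMG : (star V * A * V) * G - G * (star V' * A' * V') = star V * (A - A') * V' := by
    simp only [G]
    rw [show star V * A * V * (star V * V') = star V * A * (V * star V) * V' by
      simp only [Matrix.mul_assoc], hVV,
      show star V * V' * (star V' * A' * V') = star V * (V' * star V') * A' * V' by
      simp only [Matrix.mul_assoc], hVV']
    noncomm_ring
  have h21 : (star V * A * V).toBlocks₂₂ * G.toBlocks₂₁ - G.toBlocks₂₁ * (star V' * A' * V').toBlocks₁₁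
      = (star V * (A - A') * V').toBlocks₂₁ := by
    rw [← hMG]
    have e : ∀ M N : Matrix (l ⊕ m) (l ⊕ m) ℂ, (M * N).toBlocks₂₁ =
        M.toBlocks₂₁ * N.toBlocks₁₁ + M.toBlocks₂₂ * N.toBlocks₂₁ := by
      intro M N
      ext i j
      simp [toBlocks₂₁, toBlocks₂₂, toBlocks₁₁, mul_apply, Fintype.sum_sum_type]
    have e' : ∀ M N : Matrix (l ⊕ m) (l ⊕ m) ℂ, (M - N).toBlocks₂₁ =
      M.toBlocks₂₁ - N.toBlocks₂₁ := fun _ _ => rfl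
    rw [e', e _ G, e G, hV.lower, hV'.lower, Matrix.zero_mul, Matrix.mul_zero, zero_add, add_zero]
  have hsmall : ‖G.toBlocks₂₁‖ ≤ δ := by
    have h1 := hsyl _ _ u t' ((norm_toBlocks₂₂_le _).trans (hnorm hV.unitary hV.unitary hA))
      ((norm_toBlocks₁₁_le _).trans (hnorm hV'.unitary hV'.unitary hA')) hV.charpoly₂ hV'.charpoly₁
      (fun i j => by rw [norm_sub_rev]; exact hsep j i) G.toBlocks₂₁
    rw [h21] at h1
    have h2 := (norm_toBlocks₂₁_le _).trans (hnorm hV.unitary hV'.unitary hAA')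
    calc ‖G.toBlocks₂₁‖ ≤ K * (c * (δ / (K * c * c + 1)) * c) :=
          h1.trans (mul_le_mul_of_nonneg_left h2 hK)
      _ = (K * c * c) / (K * c * c + 1) * δ := by ring
      _ ≤ 1 * δ := by
          refine mul_le_mul_of_nonneg_right ?_ hδ.le
          rw [div_le_one (by positivity)]
          linarith
      _ = δ := one_mul δ
  obtain ⟨W₁, hW₁, W₂, hW₂, hW⟩ := hW G hG hsmall
  refine ⟨_, hV'.mul_fromBlocks hW₁ hW₂, ?_⟩
  have h3 : V' * fromBlocks W₁ 0 0 W₂ - V = V * (G * fromBlocks W₁ 0 0 W₂ - 1) := by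
    simp only [G]
    rw [mul_sub, mul_one, ← Matrix.mul_assoc, ← Matrix.mul_assoc, hVV, one_mul]
  calc ‖V' * fromBlocks W₁ 0 0 W₂ - V‖ ≤ ‖V‖ * ‖G * fromBlocks W₁ 0 0 W₂ - 1‖ := by
        rw [h3]; exact norm_mul_le _ _
    _ ≤ c * (ε / (c + 1)) := by
        gcongr
        exact norm_le_of_mem_unitaryGroup hV.unitary
    _ = c / (c + 1) * ε := by ring
    _ ≤ 1 * ε := by
        refine mul_le_mul_of_nonneg_right ?_ hε.le
        rw [div_le_one (by positivity)]
        linarith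
    _ = ε := one_mul ε

end Matrix

/-! ### Separation of eigenvalue groups at nearby points -/

namespace Matrix

variable {l m : Type*} [Fintype l] [Fintype m] [DecidableEq l] [DecidableEq m]

/-- Two groups of eigenvalues that are separated at each point are separated at nearby points. -/
theorem exists_cross_separation {A : ℝ → Matrix (l ⊕ m) (l ⊕ m) ℂ} {t : l → ℝ → ℂ} {u : m → ℝ → ℂ}
    {R d : ℝ} (hA : ∀ x, ‖A x‖ ≤ R) (huc : UniformContinuous A) (ht : ∀ i, Continuous (t i))
    (hu : ∀ i, Continuous (u i))
    (hchar : ∀ x, (A x).charpoly = (∏ i, (Polynomial.X - Polynomial.C (t i x))) *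
      ∏ i, (Polynomial.X - Polynomial.C (u i x)))
    (hd : 0 < d) (hsep : ∀ x i j, d ≤ ‖t i x - u j x‖) :
    ∃ η > 0, ∀ x y, |x - y| ≤ η → ∀ i j, d / 2 ≤ ‖t i x - u j y‖ := by
  let f : ℂ × Matrix (l ⊕ m) (l ⊕ m) ℂ → ℂ := fun p => (scalar (l ⊕ m) p.1 - p.2).det
  let S : Set (ℂ × Matrix (l ⊕ m) (l ⊕ m) ℂ) := Metric.closedBall 0 R ×ˢ Metric.closedBall 0 R
  have hS : IsCompact S := (isCompact_closedBall _ _).prod (isCompact_closedBall _ _)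
  have hfS : UniformContinuousOn f S :=
    hS.uniformContinuousOn_of_continuous continuous_det_scalar_sub.continuousOn
  set N := Fintype.card l + Fintype.card m
  -- If `z` had distance more than `d / 4` from all eigenvalues of `A w`, then the determinant of `z
  -- - A w` would be at least `(d / 4) ^ N` in norm.
  obtain ⟨δ, hδ, hfδ⟩ := Metric.uniformContinuousOn_iff.1 hfS ((d / 4) ^ N) (by positivity)
  obtain ⟨η, hη, hAη⟩ := Metric.uniformContinuous_iff.1 huc δ hδ
  refine ⟨η / 2, by positivity, fun x y hxy i j => ?_⟩
  have hfac : ∀ w z, f (z, A w) = (∏ i, (z - t i w)) * ∏ j, (z - u j w) := by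
    intro w z
    simp only [f]
    rw [← eval_charpoly, hchar, Polynomial.eval_mul, Polynomial.eval_prod, Polynomial.eval_prod]
    simp
  have hchar' : (A y).charpoly = ∏ k, (Polynomial.X -
      Polynomial.C (Sum.elim (fun i => t i y) (fun j => u j y) k)) := by
    rw [hchar, Fintype.prod_sum_type]; simp
  set z := u j y
  have hz : ‖z‖ ≤ R := (norm_root_le hchar' (Sum.inr j)).trans (hA y)
  have hroot : f (z, A y) = 0 := by
    rw [hfac]
    exact mul_eq_zero_of_right _ (Finset.prod_eq_zero (Finset.mem_univ j) (sub_self _))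
  have hcover : ∀ w ∈ uIcc x y, (∃ i, ‖z - t i w‖ ≤ d / 4) ∨ ∃ j, ‖z - u j w‖ ≤ d / 4 := by
    intro w hw
    have h1 : dist w y < η := by
      have := abs_sub_right_of_mem_uIcc hw
      rw [Real.dist_eq, abs_sub_comm]
      rw [abs_sub_comm] at hxy
      linarith
    have h2 := hfδ (z, A w) ⟨mem_closedBall_zero_iff.2 hz, mem_closedBall_zero_iff.2 (hA w)⟩
      (z, A y) ⟨mem_closedBall_zero_iff.2 hz, mem_closedBall_zero_iff.2 (hA y)⟩ (by
        rw [Prod.dist_eq, dist_self]; exact max_lt hδ (hAη h1))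
    rw [hroot, dist_zero_right, hfac, norm_mul, norm_prod, norm_prod] at h2
    by_contra! hcon
    refine h2.not_ge ?_
    rw [pow_add]
    refine mul_le_mul ?_ ?_ (by positivity) (by positivity)
    · calc (d / 4) ^ Fintype.card l = ∏ _i : l, d / 4 := by rw [Finset.prod_const, Finset.card_univ]
        _ ≤ _ := Finset.prod_le_prod (fun _ _ => by positivity) fun i _ => (hcon.1 i).le
    · calc (d / 4) ^ Fintype.card m = ∏ _i : m, d / 4 := by rw [Finset.prod_const, Finset.card_univ]
        _ ≤ _ := Finset.prod_le_prod (fun _ _ => by positivity) fun i _ => (hcon.2 i).le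
  have hdisj : ∀ w i j, ‖z - t i w‖ ≤ d / 4 → ‖z - u j w‖ ≤ d / 4 → False := by
    intro w i j h1 h2
    have h3 : ‖t i w - u j w‖ ≤ ‖z - u j w‖ + ‖z - t i w‖ := by
      have := norm_sub_le (z - u j w) (z - t i w)
      rwa [sub_sub_sub_cancel_left] at this
    have := hsep w i j
    linarith
  -- The segment between `x` and `y` is covered by the closed sets on which `z` is close to the
  -- first or to the second group. They are disjoint, and if the claim failed the first would
  -- contain `x` while the second contains `y`, against connectedness.
  by_contra! hlt
  have hc1 : IsClosed {w | ∃ i, ‖z - t i w‖ ≤ d / 4} := by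
    rw [ofPred_exists]
    exact isClosed_iUnion_of_finite fun i =>
      isClosed_le (continuous_const.sub (ht i)).norm continuous_const
  have hc2 : IsClosed {w | ∃ i, ‖z - u i w‖ ≤ d / 4} := by
    rw [ofPred_exists]
    exact isClosed_iUnion_of_finite fun i =>
      isClosed_le (continuous_const.sub (hu i)).norm continuous_const
  obtain ⟨w, -, ⟨i', hi'⟩, j', hj'⟩ := isPreconnected_closed_iff.1 (isPreconnected_uIcc (a := x)
    (b := y)) _ _ hc1 hc2 hcover ⟨x, left_mem_uIcc, by
      rcases hcover x left_mem_uIcc with h | ⟨j', hj'⟩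
      · exact h
      · have h1 := hsep x i j'
        have h2 : ‖t i x - u j' x‖ ≤ ‖t i x - z‖ + ‖z - u j' x‖ := by
          have := norm_add_le (t i x - z) (z - u j' x)
          rwa [sub_add_sub_cancel] at this
        linarith⟩ ⟨y, right_mem_uIcc, j, by
          change ‖z - z‖ ≤ _
          rw [sub_self, norm_zero]; positivity⟩
  exact hdisj w i' j' hi' hj'

end Matrix

/-! ### Smooth interpolation of triangularizers on a grid -/

/-- Dependent choice from `0` in both directions. -/
theorem exists_int_chain {α : Type*} {P : ℤ → α → Prop} {Q : α → α → Prop} (h₀ : ∃ x, P 0 x)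
    (hf : ∀ j x, P j x → ∃ y, P (j + 1) y ∧ Q x y) (hb : ∀ j x, P j x → ∃ y, P (j - 1) y ∧ Q y x) :
    ∃ f : ℤ → α, ∀ j, P j (f j) ∧ Q (f j) (f (j + 1)) := by
  obtain ⟨x₀, hx₀⟩ := h₀
  choose F hFP hFQ using hf
  choose B hBP hBQ using hb
  let g : ∀ n : ℕ, {x // P n x} := fun n => Nat.rec (motive := fun n => {x // P n x})
    ⟨x₀, hx₀⟩ (fun n x => ⟨F n x.1 x.2, by push_cast; exact hFP n x.1 x.2⟩) n
  let b : ∀ n : ℕ, {x // P (-n) x} := fun n => Nat.rec (motive := fun n => {x // P (-n) x})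
    ⟨x₀, by simpa using hx₀⟩ (fun n x => ⟨B (-n) x.1 x.2, by
      have := hBP (-n) x.1 x.2
      rwa [← neg_add'] at this⟩) n
  let f : ℤ → α := fun j => match j with
    | .ofNat n => (g n).1
    | .negSucc n => (b (n + 1)).1
  refine ⟨f, fun j => ?_⟩
  match j with
  | .ofNat n => exact ⟨(g n).2, hFQ n (g n).1 (g n).2⟩
  | .negSucc 0 => exact ⟨(b 1).2, hBQ (-(0 : ℕ)) (b 0).1 (b 0).2⟩
  | .negSucc (n + 1) => exact ⟨(b (n + 2)).2, hBQ (-(n + 1 : ℕ)) (b (n + 1)).1 (b (n + 1)).2⟩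

namespace BddSmooth

variable {X E : Type*} [NormedAddCommGroup X] [NormedSpace ℝ X] [NormedAddCommGroup E]
  [NormedSpace ℝ E]

theorem of_locally {ι : Type*} {n : ℕ} {F : ι → X → E} {G : X → E}
    (hF : BddSmooth ℝ n (fun _ => 1) univ F) (h : ∀ p, ∃ i, G =ᶠ[𝓝 p] F i) :
    BddSmooth ℝ n (fun _ => 1) univ (fun _ : Unit => G) := by
  obtain ⟨C, hC⟩ := hF.2
  refine ⟨fun _ => contDiffOn_univ.2 (contDiff_iff_contDiffAt.2 fun p => ?_), C,
    fun _ j hj p _ => ?_⟩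
  · obtain ⟨i, hi⟩ := h p
    exact (contDiffOn_univ.1 (hF.1 i)).contDiffAt.congr_of_eventuallyEq hi
  · obtain ⟨i, hi⟩ := h p
    have := hC i j hj p trivial
    rw [iteratedFDerivWithin_univ] at this ⊢
    rwa [hi.iteratedFDeriv ℝ j |>.eq_of_nhds]

end BddSmooth

theorem bddSmooth_smoothTransition (n : ℕ) :
    BddSmooth ℝ n (fun _ => 1) univ (fun _ : Unit => Real.smoothTransition) := by
  have hbound : ∀ j : ℕ, ∃ C, ∀ x, ‖iteratedFDeriv ℝ j Real.smoothTransition x‖ ≤ C := by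
    intro j
    have hcont : Continuous (iteratedFDeriv ℝ j Real.smoothTransition) :=
      (Real.smoothTransition.contDiff (n := j)).continuous_iteratedFDeriv le_rfl
    obtain ⟨C, hC⟩ := (isCompact_Icc (a := (0 : ℝ)) (b := 1)).exists_bound_of_continuousOn
      hcont.continuousOn
    have hconst : ∀ (c x : ℝ), |c| ≤ 1 → ‖iteratedFDeriv ℝ j (fun _ : ℝ => c) x‖ ≤ 1 := by
      intro c x hc
      rcases j with _ | j
      · simpa using hc
      · rw [iteratedFDeriv_const_of_ne (Nat.succ_ne_zero j)]; simp
    refine ⟨max C 1, fun x => ?_⟩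
    by_cases hx0 : x < 0
    · have : Real.smoothTransition =ᶠ[𝓝 x] fun _ => 0 := by
        filter_upwards [Iio_mem_nhds hx0] with y hy
        exact Real.smoothTransition.zero_of_nonpos (le_of_lt hy)
      rw [this.iteratedFDeriv ℝ j |>.eq_of_nhds]
      exact (hconst 0 x (by simp)).trans (le_max_right _ _)
    by_cases hx1 : 1 < x
    · have : Real.smoothTransition =ᶠ[𝓝 x] fun _ => 1 := by
        filter_upwards [Ioi_mem_nhds hx1] with y hy
        exact Real.smoothTransition.one_of_one_le (le_of_lt hy)
      rw [this.iteratedFDeriv ℝ j |>.eq_of_nhds]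
      exact (hconst 1 x (by simp)).trans (le_max_right _ _)
    · exact (hC x ⟨not_lt.1 hx0, not_lt.1 hx1⟩).trans (le_max_left _ _)
  choose C hC using hbound
  refine ⟨fun _ => Real.smoothTransition.contDiff.contDiffOn, ∑ j ∈ Finset.range (n + 1), C j,
    fun _ j hj p _ => ?_⟩
  rw [iteratedFDerivWithin_univ, mul_one]
  exact (hC j p).trans (Finset.single_le_sum (f := C)
    (fun i _ => (norm_nonneg _).trans (hC i 0)) (Finset.mem_range.2 (Nat.lt_succ_of_le hj)))

/-- A bounded sequence over the integers is interpolated by a smooth function with bounded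
derivatives. -/
theorem exists_interpolation {E : Type} [NormedAddCommGroup E] [NormedSpace ℝ E] (U : ℤ → E)
    {C η : ℝ} (hU : ∀ j, ‖U j‖ ≤ C) (hη : 0 < η) : ∃ S : ℝ → E,
      (∀ n, BddSmooth ℝ n (fun _ => 1) univ (fun _ : Unit => S)) ∧
      (∀ x, ∃ j : ℤ, |x - j * η| ≤ η ∧ ‖S x - U j‖ ≤ ‖U (j + 1) - U j‖) ∧
      (∀ (J : ℤ) V, (∀ j ≥ J, U j = V) → ∀ x ≥ J * η, S x = V) ∧
      ∀ (J : ℤ) V, (∀ j ≤ J, U j = V) → ∀ x < J * η, S x = V := by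
  -- The factor `2` completes the transition in the first half of each cell. Neighbouring pieces
  -- therefore agree on an open interval around the common node, and the glued function is smooth.
  let F : ℤ → ℝ → E := fun j x =>
    U j + Real.smoothTransition (2 * (x / η - j)) • (U (j + 1) - U j)
  have hF : ∀ n, BddSmooth ℝ n (fun _ => 1) univ F := by
    intro n
    have h1 : BddSmooth ℝ n (fun _ => 1) univ
        (fun (j : ℤ) x => Real.smoothTransition (2 * (x / η - j))) := by
      refine BddSmooth.comp (c := 1) (fun _ => ()) (L := (2 / η) • ContinuousLinearMap.id ℝ ℝ)
        uniqueDiffOn_univ uniqueDiffOn_univ (bddSmooth_smoothTransition n) (by simp)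
        (fun j x _ => ?_) (by simp) (by simp) (by simp)
      have h2 : HasDerivAt (fun x : ℝ => 2 * (x / η - j)) (2 * (1 / η)) x :=
        (((hasDerivAt_id x).div_const η).sub_const _).const_mul 2
      refine (h2.hasFDerivAt.congr_fderiv ?_).hasFDerivWithinAt
      ext
      simp [div_eq_mul_inv]
    refine (BddSmooth.const uniqueDiffOn_univ hU).add uniqueDiffOn_univ
      (BddSmooth.bilin uniqueDiffOn_univ (ContinuousLinearMap.lsmul ℝ ℝ) h1
      (BddSmooth.const (C := C + C) uniqueDiffOn_univ (c := fun j => U (j + 1) - U j) fun j =>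
        (norm_sub_le _ _).trans (add_le_add (hU _) (hU _))))
  let S : ℝ → E := fun x => F ⌊x / η⌋ x
  have hle : ∀ x, (⌊x / η⌋ : ℝ) * η ≤ x := fun x => (le_div_iff₀ hη).1 (Int.floor_le _)
  have hlt : ∀ x, x < ((⌊x / η⌋ : ℝ) + 1) * η := fun x => (div_lt_iff₀ hη).1 (Int.lt_floor_add_one _)
  refine ⟨S, fun n => (hF n).of_locally fun x => ⟨⌊x / η⌋, ?_⟩, fun x => ⟨⌊x / η⌋, ?_, ?_⟩,
    fun J V hV x hx => ?_, fun J V hV x hx => ?_⟩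
  · have hcont : Continuous (fun y : ℝ => y / η) := by fun_prop
    have h1 : ∀ᶠ y in 𝓝 x, (⌊x / η⌋ : ℝ) - 1 / 2 < y / η :=
      hcont.continuousAt.eventually_const_lt (by have := Int.floor_le (x / η); linarith)
    have h2 : ∀ᶠ y in 𝓝 x, y / η < ⌊x / η⌋ + 1 :=
      hcont.continuousAt.eventually_lt_const (Int.lt_floor_add_one _)
    filter_upwards [h1, h2] with y hy1 hy2
    set j := ⌊x / η⌋
    by_cases hj : (j : ℝ) ≤ y / η
    · have : ⌊y / η⌋ = j := Int.floor_eq_iff.2 ⟨hj, hy2⟩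
      simp only [S, this]
    · push Not at hj
      have : ⌊y / η⌋ = j - 1 := Int.floor_eq_iff.2 ⟨by push_cast; linarith, by push_cast; linarith⟩
      simp only [S, this, F]
      rw [Real.smoothTransition.one_of_one_le (by push_cast; linarith),
        Real.smoothTransition.zero_of_nonpos (by linarith)]
      simp
  · rw [abs_of_nonneg (by linarith [hle x])]
    linarith [hlt x]
  · simp only [S, F, add_sub_cancel_left, norm_smul]
    refine mul_le_of_le_one_left (norm_nonneg _) ?_
    rw [Real.norm_of_nonneg (Real.smoothTransition.nonneg _)]
    exact Real.smoothTransition.le_one _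
  · have h1 : J ≤ ⌊x / η⌋ := Int.le_floor.2 ((le_div_iff₀ hη).2 hx)
    simp only [S, F]
    rw [hV _ h1, hV _ (by omega)]
    simp
  · have h1 : ⌊x / η⌋ < J := Int.floor_lt.2 ((div_lt_iff₀ hη).2 hx)
    simp only [S, F]
    rw [hV _ h1.le, hV _ (by omega)]
    simp

/-- If `A` converges at `+∞`, the grid index is frozen once `A` is within `ε / 2` of its limit. The
interpolated matrix becomes constant there and still fits `A`. -/
theorem exists_clamp_top {E : Type*} [NormedAddCommGroup E] (A : ℝ → E) {η ε : ℝ} (hη : 0 < η)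
    (hε : 0 < ε) (hA : ∀ x y, |x - y| ≤ η → ‖A x - A y‖ ≤ ε) : ∃ f : ℤ → ℤ,
      (∀ j, f (j + 1) = f j ∨ f (j + 1) = f j + 1) ∧ (∀ j ≤ 0, f j = j) ∧ (∀ j ≥ 0, 0 ≤ f j) ∧
      (∀ (j : ℤ) x, |x - j * η| ≤ η → ‖A x - A (f j * η)‖ ≤ ε) ∧
      ∀ L, Tendsto A atTop (𝓝 L) → ∃ J k, ∀ j ≥ J, f j = k := by
  by_cases h : ∃ L, Tendsto A atTop (𝓝 L)
  · obtain ⟨L, hL⟩ := h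
    obtain ⟨X, hX⟩ := eventually_atTop.1 ((Metric.tendsto_nhds.1 hL) (ε / 2) (half_pos hε))
    -- One cell is added because `x` may lie a full cell to the left of its grid point.
    refine ⟨fun j => min j (max 0 (⌈X / η⌉ + 1)), fun j => by grind, fun j hj => by grind,
      fun j hj => by grind, fun j x hx => ?_, fun _ _ => ⟨max 0 (⌈X / η⌉ + 1), max 0 (⌈X / η⌉ + 1),
        fun j hj => by grind⟩⟩
    set J := max 0 (⌈X / η⌉ + 1)
    have hJX : X ≤ (J - 1) * η := by
      rw [← div_le_iff₀ hη]
      have h1 : ⌈X / η⌉ + 1 ≤ J := le_max_right _ _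
      have h2 : ((⌈X / η⌉ + 1 : ℤ) : ℝ) ≤ J := by exact_mod_cast h1
      push_cast at h2
      linarith [Int.le_ceil (X / η)]
    beta_reduce
    rcases le_total j J with hj | hj
    · rw [min_eq_left hj]; exact hA _ _ hx
    · rw [min_eq_right hj]
      have hj' : (J : ℝ) ≤ j := by exact_mod_cast hj
      have h1 : X ≤ x := by
        have := abs_le.1 hx
        nlinarith
      have h2 : X ≤ J * η := by linarith
      have h3 := hX x h1
      have h4 := hX _ h2
      rw [← dist_eq_norm]
      exact (dist_triangle_right _ _ L).trans (by linarith)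
  · refine ⟨id, fun j => Or.inr rfl, fun _ _ => rfl, fun _ h => h, fun j x hx => hA _ _ hx,
      fun L hL => absurd ⟨L, hL⟩ h⟩

/-- The one-sided clamp is applied to `A` and to its reflection. Each is the identity on the side it
does not treat, so the composition works at both ends. -/
theorem exists_clamp {E : Type*} [NormedAddCommGroup E] (A : ℝ → E) {η ε : ℝ} (hη : 0 < η)
    (hε : 0 < ε) (hA : ∀ x y, |x - y| ≤ η → ‖A x - A y‖ ≤ ε) : ∃ f : ℤ → ℤ,
      (∀ j, f (j + 1) = f j ∨ f (j + 1) = f j + 1) ∧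
      (∀ (j : ℤ) x, |x - j * η| ≤ η → ‖A x - A (f j * η)‖ ≤ ε) ∧
      (∀ L, Tendsto A atTop (𝓝 L) → ∃ J k, ∀ j ≥ J, f j = k) ∧
      ∀ L, Tendsto A atBot (𝓝 L) → ∃ J k, ∀ j ≤ J, f j = k := by
  obtain ⟨f, h1, h2, h3, h4, h5⟩ := exists_clamp_top A hη hε hA
  obtain ⟨g, g1, g2, g3, g4, g5⟩ := exists_clamp_top (fun x => A (-x)) hη hε fun x y hxy =>
    hA _ _ (by rwa [neg_sub_neg, abs_sub_comm])
  refine ⟨fun j => -g (-f j), fun j => ?_, fun j x hx => ?_, fun L hL => ?_, fun L hL => ?_⟩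
  · beta_reduce
    rcases h1 j with h | h
    · left; rw [h]
    · have h6 := g1 (-f j - 1)
      rw [sub_add_cancel] at h6
      rw [h, neg_add']
      omega
  · beta_reduce
    rcases le_total 0 j with hj | hj
    · rw [g2 (-f j) (by linarith [h3 j hj]), neg_neg]
      exact h4 j x hx
    · rw [h2 j hj]
      have := g4 (-j) (-x) (by
        push_cast
        rw [neg_mul, sub_neg_eq_add, neg_add_eq_sub, abs_sub_comm]; exact hx)
      simpa [neg_mul] using this
  · obtain ⟨J, k, hk⟩ := h5 L hL
    exact ⟨J, -g (-k), fun j hj => by beta_reduce; rw [hk j hj]⟩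
  · obtain ⟨J, k, hk⟩ := g5 L (hL.comp tendsto_neg_atTop_atBot)
    exact ⟨min 0 (-J), -k, fun j hj => by
      beta_reduce
      rw [h2 j (hj.trans (min_le_left _ _)), hk (-j) (by have := hj.trans (min_le_right _ _); omega)]⟩

namespace Matrix

/-- A smooth matrix function with bounded derivatives that nearly block-triangularizes `A`. -/
theorem exists_smooth_triangularizer {n : ℕ} {m : Type} [Fintype m] [DecidableEq m]
    {A : ℝ → Matrix (Fin n ⊕ m) (Fin n ⊕ m) ℂ} {t : Fin n → ℝ → ℂ} {u : m → ℝ → ℂ}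
    {R d ε : ℝ} (hA : ∀ x, ‖A x‖ ≤ R) (huc : UniformContinuous A) (ht : ∀ i, Continuous (t i))
    (hu : ∀ i, Continuous (u i))
    (hchar : ∀ x, (A x).charpoly = (∏ i, (Polynomial.X - Polynomial.C (t i x))) *
      ∏ i, (Polynomial.X - Polynomial.C (u i x)))
    (hd : 0 < d) (hsep : ∀ x i j, d ≤ ‖t i x - u j x‖) (hε : 0 < ε) :
    ∃ S : ℝ → Matrix (Fin n ⊕ m) (Fin n ⊕ m) ℂ,
      (∀ k, BddSmooth ℝ k (fun _ => 1) univ (fun _ : Unit => S)) ∧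
      (∀ x, ∃ y V, IsTriangularizer (A y) (fun i => t i y) (fun j => u j y) V ∧
        ‖A x - A y‖ ≤ ε ∧ ‖S x - V‖ ≤ ε) ∧
      (∀ L, Tendsto A atTop (𝓝 L) → ∃ X V, ∀ x ≥ X, S x = V) ∧
      ∀ L, Tendsto A atBot (𝓝 L) → ∃ X V, ∀ x ≤ X, S x = V := by
  obtain ⟨η₁, hη₁, hcross⟩ := exists_cross_separation hA huc ht hu hchar hd hsep
  obtain ⟨δ, hδ, hnear⟩ := exists_isTriangularizer_near (Fin n) m R (half_pos hd) hε
  obtain ⟨η₂, hη₂, hAη⟩ := Metric.uniformContinuous_iff.1 huc (min δ ε) (lt_min hδ hε)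
  set η := min η₁ (η₂ / 2)
  have hη : 0 < η := lt_min hη₁ (by positivity)
  have hAη' : ∀ x y, |x - y| ≤ η → ‖A x - A y‖ ≤ min δ ε := fun x y hxy => by
    rw [← dist_eq_norm]
    refine (hAη ?_).le
    rw [Real.dist_eq]
    exact (hxy.trans (min_le_right _ _)).trans_lt (half_lt_self hη₂)
  have hstep : ∀ x y V, |x - y| ≤ η → IsTriangularizer (A x) (fun i => t i x) (fun j => u j x) V →
      ∃ U, IsTriangularizer (A y) (fun i => t i y) (fun j => u j y) U ∧ ‖U - V‖ ≤ ε := by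
    intro x y V hxy hV
    obtain ⟨V', hV'⟩ := exists_isTriangularizer (A y) (fun i => t i y) (fun j => u j y) (hchar y)
    refine hnear (A x) (A y) V V' _ _ _ _ (hA x) (hA y) (fun i j => ?_) hV hV'
      ((hAη' x y hxy).trans (min_le_left _ _))
    exact hcross y x (by rw [abs_sub_comm]; exact hxy.trans (min_le_left _ _)) i j
  obtain ⟨U, hU⟩ := exists_int_chain
    (P := fun (j : ℤ) V => IsTriangularizer (A (j * η)) (fun i => t i (j * η))
      (fun i => u i (j * η)) V) (Q := fun V V' => ‖V' - V‖ ≤ ε)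
    (by exact_mod_cast exists_isTriangularizer _ _ _ (hchar ((0 : ℤ) * η)))
    (fun j V hV => hstep _ _ V (by
      push_cast
      rw [← sub_mul, sub_add_cancel_left, neg_one_mul, abs_neg, abs_of_pos hη]) hV)
    (fun j V hV => by
      obtain ⟨V', h1, h2⟩ := hstep _ (((j - 1 : ℤ) : ℝ) * η) V (by
        push_cast
        rw [← sub_mul, sub_sub_cancel, one_mul, abs_of_pos hη]) hV
      exact ⟨V', h1, by rwa [norm_sub_rev]⟩)
  obtain ⟨f, hf1, hf2, hf3, hf4⟩ := exists_clamp A hη hε fun x y hxy =>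
    (hAη' x y hxy).trans (min_le_right _ _)
  obtain ⟨S, hS, hSU, hS3, hS4⟩ := exists_interpolation (fun j => U (f j))
    (C := ((Fintype.card (Fin n ⊕ m) : ℕ) : ℝ))
    (fun j => norm_le_of_mem_unitaryGroup (hU (f j)).1.unitary) hη
  refine ⟨S, hS, fun x => ?_, fun L hL => ?_, fun L hL => ?_⟩
  · obtain ⟨j, hj, hSj⟩ := hSU x
    refine ⟨f j * η, U (f j), (hU (f j)).1, hf2 j x hj, hSj.trans ?_⟩
    rcases hf1 j with h | h
    · rw [h, sub_self, norm_zero]; exact hε.le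
    · rw [h]; exact (hU (f j)).2
  · obtain ⟨J, k, hk⟩ := hf3 L hL
    exact ⟨J * η, U k, hS3 J (U k) fun j hj => by rw [hk j hj]⟩
  · obtain ⟨J, k, hk⟩ := hf4 L hL
    -- The interpolation is constant strictly to the left of `J * η`; subtracting `1` makes the
    -- closed half-line admissible.
    exact ⟨J * η - 1, U k, fun x hx => hS4 J (U k) (fun j hj => by rw [hk j hj]) x (by linarith)⟩

/-! ### Tolerances for the conjugated matrix -/

variable (l m : Type) [Fintype l] [Fintype m] [DecidableEq l] [DecidableEq m]

/-- Near a block-triangularization, the conjugated matrix `S⁻¹ (A S - E)` has separated diagonal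
blocks, bounded upper right block and small lower left block. -/
theorem exists_triangularization_tolerance {R d : ℝ} (hR : 0 ≤ R) (hd : 0 < d) :
    ∃ K q ε' ε C : ℝ, 0 ≤ K ∧ 0 ≤ q ∧ 0 ≤ ε' ∧ 8 * K ^ 2 * q * ε' ≤ 1 ∧ 0 < ε ∧
      ∀ (A A' S V E : Matrix (l ⊕ m) (l ⊕ m) ℂ) (t : l → ℂ) (u : m → ℂ), ‖A'‖ ≤ R →
        IsTriangularizer A' t u V → (∀ i j, d ≤ ‖t i - u j‖) → ‖A - A'‖ ≤ ε → ‖S - V‖ ≤ ε →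
        ‖E‖ ≤ ε → S * S⁻¹ = 1 ∧ ‖S⁻¹‖ ≤ C ∧
          SylBound K (S⁻¹ * (A * S - E)).toBlocks₂₂ (S⁻¹ * (A * S - E)).toBlocks₁₁ ∧
          SylBound K (S⁻¹ * (A * S - E)).toBlocks₁₁ (S⁻¹ * (A * S - E)).toBlocks₂₂ ∧
          ‖(S⁻¹ * (A * S - E)).toBlocks₁₂‖ ≤ q ∧ ‖(S⁻¹ * (A * S - E)).toBlocks₂₁‖ ≤ ε' := by
  set c : ℝ := ((Fintype.card (l ⊕ m) : ℕ) : ℝ)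
  have hc : 0 ≤ c := Nat.cast_nonneg _
  obtain ⟨K₁, hK₁, hsyl₁⟩ := exists_sylBound l m (c * R * c) hd
  obtain ⟨K₂, hK₂, hsyl₂⟩ := exists_sylBound m l (c * R * c) hd
  set K := max K₁ K₂
  have hK : 0 ≤ K := hK₁.trans (le_max_left _ _)
  set R' := c * R * c
  have hR' : 0 ≤ R' := by positivity
  set q := R' + 1
  -- `2 * K` is the Sylvester constant after perturbation, so this is what the smallness condition
  -- of the Riccati equation asks for.
  set ε' := 1 / (8 * (2 * K) ^ 2 * q + 1)
  have hq : 0 < q := by positivity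
  have hε' : 0 < ε' := by positivity
  -- The admitted distance between the conjugated matrix and the exact triangular form: small enough
  -- for the lower left block, for the bound `q`, and for the perturbation of the Sylvester
  -- operators.
  set ρ := min (min ε' 1) (1 / (4 * (K + 1)))
  have hρ : 0 < ρ := by positivity
  have hρ1 : ρ ≤ ε' := (min_le_left _ _).trans (min_le_left _ _)
  have hρ2 : ρ ≤ 1 := (min_le_left _ _).trans (min_le_right _ _)
  have hρ3 : K * (ρ + ρ) ≤ 1 / 2 := by
    have h1 : ρ ≤ 1 / (4 * (K + 1)) := min_le_right _ _
    rw [le_div_iff₀ (by positivity)] at h1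
    nlinarith
  set B := 2 * c * (c + 2 + R + R')
  have hB : 0 ≤ B := by positivity
  set ε := min (1 / 2) (min (1 / (2 * (c + 1))) (ρ / (B + 1)))
  have hε : 0 < ε := by positivity
  have hε1 : ε ≤ 1 := (min_le_left _ _).trans (by norm_num)
  have hε2 : c * ε ≤ 1 / 2 := by
    have h1 : ε ≤ 1 / (2 * (c + 1)) := (min_le_right _ _).trans (min_le_left _ _)
    rw [le_div_iff₀ (by positivity)] at h1
    nlinarith
  have hε3 : B * ε ≤ ρ := by
    have h1 : ε ≤ ρ / (B + 1) := (min_le_right _ _).trans (min_le_right _ _)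
    rw [le_div_iff₀ (by positivity)] at h1
    nlinarith
  refine ⟨2 * K, q, ε', ε, 2 * c, by positivity, hq.le, hε'.le, ?_, hε, ?_⟩
  · simp only [ε']
    rw [mul_one_div, div_le_one (by positivity)]
    linarith
  intro A A' S V E t u hA' hV hsep hAA' hSV hE
  have hVn := norm_le_of_mem_unitaryGroup hV.unitary
  have hVs := norm_le_of_mem_unitaryGroup (star_mem_unitaryGroup hV.unitary)
  have hVV := mem_unitaryGroup_iff.1 hV.unitary
  have hVV' := mem_unitaryGroup_iff'.1 hV.unitary
  have hsmall : ‖star V * (V - S)‖ ≤ 1 / 2 := by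
    refine (norm_mul_le _ _).trans (le_trans ?_ hε2)
    rw [norm_sub_rev] at hSV
    exact mul_le_mul hVs hSV (norm_nonneg _) hc
  have hunit : IsUnit S := by
    have h1 : S = V * (1 - star V * (V - S)) := by
      rw [mul_sub, mul_one, ← Matrix.mul_assoc, hVV, one_mul, sub_sub_cancel]
    have h2 : IsUnit V := IsUnit.of_mul_eq_one _ hVV
    rw [h1]
    exact h2.mul (Units.oneSub _ (hsmall.trans_lt (by norm_num))).isUnit
  have hdet := (isUnit_iff_isUnit_det S).1 hunit
  have hSS : S * S⁻¹ = 1 := mul_nonsing_inv S hdet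
  have hSS' : S⁻¹ * S = 1 := nonsing_inv_mul S hdet
  have hSi : ‖S⁻¹‖ ≤ 2 * c := by
    -- The second term has norm at most half of `‖S⁻¹‖`, whence the bound `2 * c`.
    have h1 : S⁻¹ = star V + (star V * (V - S)) * S⁻¹ := by
      rw [Matrix.mul_sub, Matrix.sub_mul, hVV', one_mul, Matrix.mul_assoc, hSS]
      noncomm_ring
    have h2 : ‖S⁻¹‖ ≤ c + 1 / 2 * ‖S⁻¹‖ := by
      calc ‖S⁻¹‖ ≤ ‖star V‖ + ‖(star V * (V - S)) * S⁻¹‖ := by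
            conv_lhs => rw [h1]
            exact norm_add_le _ _
        _ ≤ c + ‖star V * (V - S)‖ * ‖S⁻¹‖ := add_le_add hVs (norm_mul_le _ _)
        _ ≤ _ := by gcongr
    linarith
  set T₀ := star V * A' * V
  have hT₀ : ‖T₀‖ ≤ R' := by
    calc ‖T₀‖ ≤ ‖star V‖ * ‖A'‖ * ‖V‖ :=
          (norm_mul_le _ _).trans (mul_le_mul_of_nonneg_right (norm_mul_le _ _) (norm_nonneg _))
      _ ≤ c * R * c := by gcongr
  set M := S⁻¹ * (A * S - E)
  -- From `V T₀ = A' V`. Each term on the right contains a difference of size at most `ε`, or is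
  -- `E`.
  have hD : M - T₀ = S⁻¹ * ((A - A') * S + A' * (S - V) - (S - V) * T₀ - E) := by
    have h1 : V * T₀ = A' * V := by
      simp only [T₀]
      rw [← Matrix.mul_assoc, ← Matrix.mul_assoc, hVV, one_mul]
    have h2 : T₀ = S⁻¹ * (S * T₀) := by rw [← Matrix.mul_assoc, hSS', one_mul]
    simp only [M]
    conv_lhs => rw [h2, ← mul_sub]
    congr 1
    rw [sub_mul S V T₀, h1]
    noncomm_ring
  have hSn : ‖S‖ ≤ c + 1 := by
    calc ‖S‖ = ‖V + (S - V)‖ := by rw [add_sub_cancel]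
      _ ≤ ‖V‖ + ‖S - V‖ := norm_add_le _ _
      _ ≤ c + 1 := add_le_add hVn (hSV.trans hε1)
  have hDn : ‖M - T₀‖ ≤ ρ := by
    have h1 : ‖(A - A') * S + A' * (S - V) - (S - V) * T₀ - E‖ ≤ (c + 2 + R + R') * ε := by
      calc ‖(A - A') * S + A' * (S - V) - (S - V) * T₀ - E‖
          ≤ ‖A - A'‖ * ‖S‖ + ‖A'‖ * ‖S - V‖ + ‖S - V‖ * ‖T₀‖ + ‖E‖ := by
            refine (norm_sub_le _ _).trans (add_le_add ((norm_sub_le _ _).trans (add_le_add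
              ((norm_add_le _ _).trans (add_le_add ?_ ?_)) ?_)) le_rfl) <;> exact norm_mul_le _ _
        _ ≤ ε * (c + 1) + R * ε + ε * R' + ε := by gcongr
        _ = (c + 2 + R + R') * ε := by ring
    rw [hD]
    calc _ ≤ ‖S⁻¹‖ * ‖(A - A') * S + A' * (S - V) - (S - V) * T₀ - E‖ := norm_mul_le _ _
      _ ≤ 2 * c * ((c + 2 + R + R') * ε) := by gcongr
      _ = B * ε := by ring
      _ ≤ ρ := hε3
  have h11 : ‖M.toBlocks₁₁ - T₀.toBlocks₁₁‖ ≤ ρ := (norm_toBlocks₁₁_le (M - T₀)).trans hDn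
  have h12 : ‖M.toBlocks₁₂ - T₀.toBlocks₁₂‖ ≤ ρ := (norm_toBlocks₁₂_le (M - T₀)).trans hDn
  have h21 : ‖M.toBlocks₂₁ - T₀.toBlocks₂₁‖ ≤ ρ := (norm_toBlocks₂₁_le (M - T₀)).trans hDn
  have h22 : ‖M.toBlocks₂₂ - T₀.toBlocks₂₂‖ ≤ ρ := (norm_toBlocks₂₂_le (M - T₀)).trans hDn
  have hmono : ∀ {i j : Type} [Fintype i] [Fintype j] {K' : ℝ} {B : Matrix i i ℂ}
      {C : Matrix j j ℂ}, K' ≤ K → SylBound K' B C → SylBound K B C := fun hKK h Y =>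
    (h Y).trans (mul_le_mul_of_nonneg_right hKK (norm_nonneg _))
  have hsub : ∀ {i j : Type} [Fintype i] [Fintype j] {B B' : Matrix i i ℂ} {C C' : Matrix j j ℂ},
      SylBound K B C → ‖B' - B‖ ≤ ρ → ‖C' - C‖ ≤ ρ → SylBound (2 * K) B' C' := by
    intro i j _ _ B B' C C' h hB hC Y
    have h1 := h.perturb hK (D := B - B') (D' := C' - C) (by
      rw [norm_sub_rev B B']
      exact (mul_le_mul_of_nonneg_left (add_le_add hB hC) hK).trans hρ3) Y
    have h2 : B * Y - Y * C - (B - B') * Y - Y * (C' - C) = B' * Y - Y * C' := by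
      rw [Matrix.sub_mul, Matrix.mul_sub]; abel
    rwa [h2] at h1
  have k11 := (norm_toBlocks₁₁_le T₀).trans hT₀
  have k22 := (norm_toBlocks₂₂_le T₀).trans hT₀
  refine ⟨hSS, hSi, hsub (hmono (le_max_right _ _) (hsyl₂ _ _ u t k22 k11 hV.charpoly₂ hV.charpoly₁
    fun i j => by rw [norm_sub_rev]; exact hsep j i)) h22 h11,
    hsub (hmono (le_max_left _ _) (hsyl₁ _ _ t u k11 k22 hV.charpoly₁ hV.charpoly₂ hsep)) h11 h22,
    ?_, ?_⟩
  · calc ‖M.toBlocks₁₂‖ = ‖T₀.toBlocks₁₂ + (M.toBlocks₁₂ - T₀.toBlocks₁₂)‖ := by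
          rw [add_sub_cancel]
      _ ≤ R' + 1 := (norm_add_le _ _).trans
          (add_le_add ((norm_toBlocks₁₂_le T₀).trans hT₀) (h12.trans hρ2))
  · rw [hV.lower, sub_zero] at h21
    exact h21.trans hρ1

end Matrix

/-! ### Block-diagonalization from a good approximate triangularizer -/

namespace Frame

variable {𝕜 : Type} [RCLike 𝕜] [NormedAlgebra 𝕜 ℂ] [IsScalarTower ℝ 𝕜 ℂ] [FiniteDimensional 𝕜 ℂ]
  {P : Frame 𝕜} {l m : Type} [Fintype l] [Fintype m] [DecidableEq l] [DecidableEq m] {s r : ℕ}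

/-- `T` conjugates the system with coefficient `A` to one that is block-diagonal up to order
`h ^ r`. -/
structure BlockDiag (P : Frame 𝕜) (s r : ℕ) (A T T' Tinv : 𝕜 → ℝ → Matrix (l ⊕ m) (l ⊕ m) ℂ)
    (A₁₁ : 𝕜 → ℝ → Matrix l l ℂ) (A₂₂ : 𝕜 → ℝ → Matrix m m ℂ) (θ₁ : ℕ → 𝕜 → ℝ → Matrix l m ℂ)
    (θ₂ : ℕ → 𝕜 → ℝ → Matrix m l ℂ) : Prop where
  cls : P.Cls s False r T
  cls_inv : P.Cls s False r Tinv
  cls₁₁ : P.Cls s False (r - 1) A₁₁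
  cls₂₂ : P.Cls s False (r - 1) A₂₂
  cls₁ : ∀ k, 1 ≤ k → k ≤ r → P.Cls s True (r - k) (θ₁ k)
  cls₂ : ∀ k, 1 ≤ k → k ≤ r → P.Cls s True (r - k) (θ₂ k)
  mul_inv : ∀ v ∈ P.Ω s, ∀ h ∈ Icc 0 P.h₁, T v h * Tinv v h = 1
  deriv : ∀ v ∈ P.Ω s, ∀ h ∈ Icc 0 P.h₁, HasDerivWithinAt (fun v => T v h) (T' v h) (P.Ω s) v
  eq : ∀ k, 1 ≤ k → k ≤ r → ∀ v ∈ P.Ω s, ∀ h ∈ Icc 0 P.h₁, h • T' v h = A v h * T v h -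
    T v h * Matrix.fromBlocks (A₁₁ v h) (h ^ k • θ₁ k v h) (h ^ k • θ₂ k v h) (A₂₂ v h)

/-- The finitely many cofactors, one for each `k`, are taken on a common domain. -/
theorem Small.choose {E : Type} [NormedAddCommGroup E] [NormedSpace ℝ E] [NormedSpace 𝕜 E]
    [IsScalarTower ℝ 𝕜 E] {f : 𝕜 → ℝ → E} (h : ∀ k, 1 ≤ k → k ≤ r → P.Small r k f) :
    ∃ θ : ℕ → 𝕜 → ℝ → E, ∀ᶠ s in atTop, ∀ k, 1 ≤ k → k ≤ r → P.Cls s True (r - k) (θ k) ∧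
      ∀ v ∈ P.Ω s, ∀ t ∈ Icc 0 P.h₁, f v t = t ^ k • θ k v t := by
  choose! θ hθ using h
  refine ⟨θ, ?_⟩
  have h1 : ∀ᶠ s in atTop, ∀ k ∈ Finset.Icc 1 r, P.Cls s True (r - k) (θ k) ∧
      ∀ v ∈ P.Ω s, ∀ t ∈ Icc 0 P.h₁, f v t = t ^ k • θ k v t := by
    rw [Filter.eventually_all_finset]
    intro k hk
    rw [Finset.mem_Icc] at hk
    exact (hθ k hk.1 hk.2).1.and (hθ k hk.1 hk.2).2
  filter_upwards [h1] with s hs k hk1 hk2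
  exact hs k (Finset.mem_Icc.2 ⟨hk1, hk2⟩)

/-- If `S` nearly block-triangularizes `A` and varies slowly, then the system can be
block-diagonalized. -/
theorem exists_blockDiag_of_tolerance (hr : 1 ≤ r) {A : 𝕜 → ℝ → Matrix (l ⊕ m) (l ⊕ m) ℂ}
    {S : 𝕜 → Matrix (l ⊕ m) (l ⊕ m) ℂ} (hA : P.Cls 0 False r A)
    (hS : P.Cls 0 False (r + 1) (fun v _ => S v)) {K q ε' C : ℝ} (hK : 0 ≤ K) (hq : 0 ≤ q)
    (hε' : 0 ≤ ε') (hs : 8 * K ^ 2 * q * ε' ≤ 1)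
    (htol : ∀ v ∈ P.Ω 0, ∀ h ∈ Icc 0 P.h₁, ∀ E, E = h • P.der (fun v _ => S v) v h →
      S v * (S v)⁻¹ = 1 ∧ ‖(S v)⁻¹‖ ≤ C ∧
        Matrix.SylBound K ((S v)⁻¹ * (A v h * S v - E)).toBlocks₂₂
          ((S v)⁻¹ * (A v h * S v - E)).toBlocks₁₁ ∧
        Matrix.SylBound K ((S v)⁻¹ * (A v h * S v - E)).toBlocks₁₁
          ((S v)⁻¹ * (A v h * S v - E)).toBlocks₂₂ ∧
        ‖((S v)⁻¹ * (A v h * S v - E)).toBlocks₁₂‖ ≤ q ∧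
        ‖((S v)⁻¹ * (A v h * S v - E)).toBlocks₂₁‖ ≤ ε') :
    ∃ s T T' Tinv A₁₁ A₂₂ θ₁ θ₂, P.BlockDiag s r A T T' Tinv A₁₁ A₂₂ θ₁ θ₂ := by
  have hev : ∀ {E : Type} [NormedAddCommGroup E] [NormedSpace ℝ E] [NormedSpace 𝕜 E]
      [IsScalarTower ℝ 𝕜 E] {n : ℕ} {f : 𝕜 → ℝ → E}, P.Cls 0 False n f → P.Ev False n f := by
    intro E _ _ _ _ n f hf
    refine Eventually.of_forall fun s => ?_
    induction s with
    | zero => exact hf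
    | succ s ih => exact ih.anti
  have h0 : ∀ v ∈ P.Ω 0, S v * (S v)⁻¹ = 1 := fun v hv =>
    (htol v hv 0 ⟨le_rfl, P.h₁_pos.le⟩ _ rfl).1
  have hSi : P.Cls 0 False r (fun v _ => (S v)⁻¹) :=
    (hS.of_le (Nat.le_succ r)).inverse (C := C) (fun v hv h hh => (htol v hv h hh _ rfl).2.1)
      (fun v hv _ _ => h0 v hv) fun v hv _ _ => mul_eq_one_comm.1 (h0 v hv)
  obtain ⟨T, T', Tinv, A₁₁, A₂₂, O₁₂, O₂₁, hT, hTi, h₁₁, h₂₂, h₁₂, h₂₁, h⟩ :=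
    exists_transform hr hK hq hε' hs (hev hA) (hev hS) (hev hSi) (fun v hv _ _ => h0 v hv)
      (M := fun v h => (S v)⁻¹ * (A v h * S v - h • P.der (fun v _ => S v) v h)) (fun _ _ => rfl)
      (fun v hv h hh => (htol v hv h hh _ rfl).2.2.1)
      (fun v hv h hh => (htol v hv h hh _ rfl).2.2.2.1)
      (fun v hv h hh => (htol v hv h hh _ rfl).2.2.2.2.1)
      (fun v hv h hh => (htol v hv h hh _ rfl).2.2.2.2.2)
  obtain ⟨θ₁, hθ₁⟩ := Small.choose h₁₂
  obtain ⟨θ₂, hθ₂⟩ := Small.choose h₂₁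
  obtain ⟨s, k1, k2, k3, k4, k5, k6, k7⟩ :=
    (hT.and (hTi.and (h₁₁.and (h₂₂.and (hθ₁.and (hθ₂.and h)))))).exists
  refine ⟨s, T, T', Tinv, A₁₁, A₂₂, θ₁, θ₂, k1, k2, k3, k4, fun k hk hkr => (k5 k hk hkr).1,
    fun k hk hkr => (k6 k hk hkr).1, fun v hv h hh => (k7 v hv h hh).1,
    fun v hv h hh => (k7 v hv h hh).2.1, fun k hk hkr v hv h hh => ?_⟩
  rw [(k7 v hv h hh).2.2, (k5 k hk hkr).2 v hv h hh, (k6 k hk hkr).2 v hv h hh]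

end Frame

/-! ### Flows and frames on intervals -/

/-- The flows adapted to an interval: translations that map it into itself, or contractions to its
two endpoints. -/
structure IntervalFlow (a b : EReal) where
  Λ : Type
  fin : Fintype Λ
  φ : Λ → AffineFlow
  ω : Λ → ℝ
  sum_field : ∀ (𝕜 : Type) [RCLike 𝕜] (v : 𝕜), ∑ l, (ω l : 𝕜) * (φ l).field v = 1
  kind : ∀ l, (b = ⊤ ∧ (φ l).α = 1 ∧ (φ l).β = 0 ∧ ∀ τ, (φ l).c τ = τ) ∨
    (a = ⊥ ∧ b ≠ ⊤ ∧ (φ l).α = -1 ∧ (φ l).β = 0 ∧ ∀ τ, (φ l).c τ = -τ) ∨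
    (a ≠ ⊥ ∧ b ≠ ⊤ ∧ (φ l).α ∈ realInterval a b ∧ (φ l).β = -1 ∧
      ∀ τ, (φ l).c τ = (φ l).α * (1 - Real.exp (-τ)))

def AffineFlow.translation (α : ℝ) : AffineFlow where
  α := α
  β := 0
  c τ := α * τ
  c_zero := mul_zero α
  hasDerivAt_c τ := by simpa using (hasDerivAt_id τ).const_mul α
  rate τ := by simp

def AffineFlow.contraction (α : ℝ) : AffineFlow where
  α := α
  β := -1
  c τ := α * (1 - Real.exp (-τ))
  c_zero := by simp
  hasDerivAt_c τ := by
    have h1 : HasDerivAt (fun τ => Real.exp (-τ)) (Real.exp (-τ) * -1) τ :=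
      (hasDerivAt_neg τ).exp
    have h2 := (h1.const_sub 1).const_mul α
    simpa using h2
  rate τ := by rw [neg_one_mul]; ring

/-- Towards an infinite end one translation suffices. On a bounded interval no translation stays
inside, so the contractions to the two endpoints are used; their fields `b - v` and `a - v` differ
by the constant `b - a`. -/
theorem exists_intervalFlow {a b : EReal} (hab : a < b) : Nonempty (IntervalFlow a b) := by
  by_cases hb : b = ⊤
  · exact ⟨⟨Unit, inferInstance, fun _ => .translation 1, fun _ => 1,
      fun 𝕜 _ v => by simp [AffineFlow.field, AffineFlow.translation],
      fun _ => Or.inl ⟨hb, rfl, rfl, fun τ => one_mul τ⟩⟩⟩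
  by_cases ha : a = ⊥
  · exact ⟨⟨Unit, inferInstance, fun _ => .translation (-1), fun _ => -1,
      fun 𝕜 _ v => by simp [AffineFlow.field, AffineFlow.translation],
      fun _ => Or.inr (Or.inl ⟨ha, hb, rfl, rfl, fun τ => neg_one_mul τ⟩)⟩⟩
  · lift a to ℝ using ⟨fun h => (h ▸ hab).not_ge le_top, ha⟩
    lift b to ℝ using ⟨hb, fun h => (h ▸ hab).not_ge bot_le⟩
    have hab' : a < b := EReal.coe_lt_coe_iff.1 hab
    have h1 : ((b : ℝ) - a) ≠ 0 := (sub_pos.2 hab').ne'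
    refine ⟨⟨Bool, inferInstance, fun e => .contraction (if e then b else a),
      fun e => if e then 1 / (b - a) else -1 / (b - a), fun 𝕜 _ v => ?_,
      fun e => Or.inr (Or.inr ⟨ha, hb, ?_, rfl, fun τ => rfl⟩)⟩⟩
    · have h2 : ((b : 𝕜) - (a : 𝕜)) ≠ 0 := by exact_mod_cast h1
      simp only [Fintype.sum_bool, AffineFlow.field, AffineFlow.contraction, if_true]
      simp only [Bool.false_eq_true, if_false]
      push_cast
      field_simp
      ring
    · simp only [AffineFlow.contraction, realInterval, mem_ofPred_eq, EReal.coe_le_coe_iff]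
      split_ifs
      · exact ⟨hab'.le, le_rfl⟩
      · exact ⟨le_rfl, hab'.le⟩

theorem convex_realInterval (a b : EReal) : Convex ℝ (realInterval a b) := by
  refine OrdConnected.convex ⟨fun x hx y hy z hz => ⟨hx.1.trans ?_, le_trans ?_ hy.2⟩⟩
  · exact EReal.coe_le_coe_iff.2 hz.1
  · exact EReal.coe_le_coe_iff.2 hz.2

theorem exists_lt_subset_realInterval {a b : EReal} (hab : a < b) :
    ∃ p q : ℝ, p < q ∧ Icc p q ⊆ realInterval a b := by
  obtain ⟨p, hap, hpb⟩ := EReal.lt_iff_exists_real_btwn.1 hab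
  obtain ⟨q, hpq, hqb⟩ := EReal.lt_iff_exists_real_btwn.1 hpb
  exact ⟨p, q, EReal.coe_lt_coe_iff.1 hpq, fun x hx =>
    ⟨hap.le.trans (EReal.coe_le_coe_iff.2 hx.1), (EReal.coe_le_coe_iff.2 hx.2).trans hqb.le⟩⟩

theorem uniqueDiffOn_realInterval {a b : EReal} (hab : a < b) :
    UniqueDiffOn ℝ (realInterval a b) := by
  obtain ⟨p, q, hpq, hs⟩ := exists_lt_subset_realInterval hab
  refine uniqueDiffOn_convex (convex_realInterval a b) ⟨(p + q) / 2, ?_⟩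
  exact interior_mono hs (by rw [interior_Icc]; constructor <;> linarith)

theorem mem_realInterval_of_le_top {a : EReal} {x y : ℝ} (hx : x ∈ realInterval a ⊤) (h : x ≤ y) :
    y ∈ realInterval a ⊤ := ⟨hx.1.trans (EReal.coe_le_coe_iff.2 h), le_top⟩

theorem mem_realInterval_of_bot_le {b : EReal} {x y : ℝ} (hx : x ∈ realInterval ⊥ b) (h : y ≤ x) :
    y ∈ realInterval ⊥ b := ⟨bot_le, (EReal.coe_le_coe_iff.2 h).trans hx.2⟩

theorem BddSmooth.uniformCOn {X E : Type} [NormedAddCommGroup X] [NormedSpace ℝ X]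
    [NormedAddCommGroup E] [NormedSpace ℝ E] {n : ℕ} {f : X → ℝ → E} {S : Set X} {h₀ : ℝ}
    (h : BddSmooth ℝ n (fun _ => 1) (S ×ˢ Icc 0 h₀) (fun _ : Unit => Function.uncurry f)) :
    UniformCOn n f S h₀ := by
  obtain ⟨C, hC⟩ := h.2
  exact ⟨h.1 (), C, fun j hj p hp => by simpa using hC () j hj p hp⟩

theorem UniformCOn.bddSmooth {X E : Type} [NormedAddCommGroup X] [NormedSpace ℝ X]
    [NormedAddCommGroup E] [NormedSpace ℝ E] {n : ℕ} {f : X → ℝ → E} {S : Set X} {h₀ : ℝ}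
    (h : UniformCOn n f S h₀) :
    BddSmooth ℝ n (fun _ => 1) (S ×ˢ Icc 0 h₀) (fun _ : Unit => Function.uncurry f) := by
  obtain ⟨C, hC⟩ := h.2
  exact ⟨fun _ => h.1, C, fun _ j hj p hp => by simpa using hC j hj p hp⟩

namespace IntervalFlow

variable {𝕜 : Type} [RCLike 𝕜] {a b : EReal} (Φ : IntervalFlow a b)

attribute [instance] IntervalFlow.fin

theorem flow_cases (l : Φ.Λ) : (b = ⊤ ∧ ∀ τ (v : 𝕜), (Φ.φ l).flow τ v = v + (τ : 𝕜)) ∨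
    (a = ⊥ ∧ b ≠ ⊤ ∧ ∀ τ (v : 𝕜), (Φ.φ l).flow τ v = v - (τ : 𝕜)) ∨
    (a ≠ ⊥ ∧ b ≠ ⊤ ∧ ∃ e ∈ realInterval a b, ∀ τ (v : 𝕜), (Φ.φ l).flow τ v =
      (Real.exp (-τ) : 𝕜) * v + ((1 - Real.exp (-τ) : ℝ) : 𝕜) * (e : 𝕜)) := by
  rcases Φ.kind l with ⟨h1, -, h2, h3⟩ | ⟨h1, h1', -, h2, h3⟩ | ⟨h1, h1', h4, h2, h3⟩
  · exact Or.inl ⟨h1, fun τ v => by simp [AffineFlow.flow, h2, h3]⟩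
  · exact Or.inr (Or.inl ⟨h1, h1', fun τ v => by
      simp [AffineFlow.flow, h2, h3, sub_eq_add_neg]⟩)
  · refine Or.inr (Or.inr ⟨h1, h1', _, h4, fun τ v => ?_⟩)
    simp only [AffineFlow.flow, h2, h3, neg_one_mul]
    push_cast
    ring

/-- The sign of an infinite end: `true` is `+∞` and `false` is `-∞`. -/
def sgn (e : Bool) : ℝ := if e then 1 else -1

theorem abs_sgn (e : Bool) : |sgn e| = 1 := by cases e <;> simp [sgn]

/-- The data of a frame on `[a, b]`, with the infinite ends singled out by `p`. -/
structure FrameData (𝕜 : Type) [RCLike 𝕜] (a b : EReal) (Φ : IntervalFlow a b) (p : Bool → Prop)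
    (h₁ : ℝ) (Ω : ℕ → Set 𝕜) : Prop where
  h₁_pos : 0 < h₁
  top : p true → b = ⊤
  bot : p false → a = ⊥
  uniq : ∀ s, UniqueDiffOn ℝ (Ω s)
  locConvex : ∀ s, ∀ p ∈ Ω s, ∃ ε > 0, Convex ℝ (Ω s ∩ Metric.ball p ε)
  nhds : ∀ s, ∀ v ∈ Ω s, 𝓝[Ω s] v = 𝓝[Ω 0] v
  maps : ∀ l s, ∀ τ ∈ Icc 0 h₁, ∀ v ∈ Ω (s + 1), (Φ.φ l).flow τ v ∈ Ω s
  anti : ∀ s, Ω (s + 1) ⊆ Ω s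
  bounded : a ≠ ⊥ → b ≠ ⊤ → ∃ C, ∀ v ∈ Ω 0, ‖v‖ ≤ C
  ends : ∀ e, p e → ∀ s X, ∃ v ∈ Ω s, X ≤ sgn e * RCLike.re v
  real : ∀ s, ∀ x ∈ realInterval a b, (x : 𝕜) ∈ Ω s

/-- The exponential weight at an infinite end. -/
def weight (η : ℝ) (e : Bool) (v : 𝕜) : ℝ := Real.exp (-(η * (sgn e * RCLike.re v)))

/-- The frame attached to an interval. -/
def FrameData.frame {Φ : IntervalFlow a b} {p : Bool → Prop} {h₁ : ℝ} {Ω : ℕ → Set 𝕜}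
    (D : FrameData 𝕜 a b Φ p h₁ Ω) (σ : ℕ) {η : ℝ} (hη : 0 < η) : Frame 𝕜 where
  Ω := Ω
  h₁ := h₁
  σ := σ
  κ := {e // p e}
  w e v := weight η e.1 v
  Λ := Φ.Λ
  fin := Φ.fin
  φ := Φ.φ
  ω := Φ.ω
  h₁_pos := D.h₁_pos
  w_nonneg _ _ := (Real.exp_pos _).le
  w_cont e := by
    unfold weight
    exact Real.continuous_exp.comp (continuous_const.mul
      (continuous_const.mul RCLike.continuous_re)).neg
  w_bdd e l := by
    -- Translations move the real part by at most `h₁`. Contractions occur only when there is no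
    -- infinite end.
    refine ⟨Real.exp (η * h₁), fun τ hτ v => ?_⟩
    rw [weight, weight, ← Real.exp_add]
    refine Real.exp_le_exp.2 ?_
    have key : ∀ t : ℝ, |t| ≤ h₁ → -(η * (sgn e.1 * (RCLike.re v + t))) ≤
        η * h₁ + -(η * (sgn e.1 * RCLike.re v)) := by
      intro t ht
      have h1 : -(sgn e.1 * t) ≤ h₁ := by
        refine (neg_le_abs _).trans ?_
        rwa [abs_mul, abs_sgn, one_mul]
      nlinarith
    rcases Φ.flow_cases (𝕜 := 𝕜) l with ⟨-, h⟩ | ⟨-, -, h⟩ | ⟨h1, h2, -⟩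
    · have := key τ (by rw [abs_of_nonneg hτ.1]; exact hτ.2)
      rw [h]
      simpa using this
    · have := key (-τ) (by rw [abs_neg, abs_of_nonneg hτ.1]; exact hτ.2)
      rw [h]
      simpa [sub_eq_add_neg] using this
    · obtain ⟨e, he⟩ := e
      cases e
      · exact absurd (D.bot he) h1
      · exact absurd (D.top he) h2
  uniq := D.uniq
  locConvex := D.locConvex
  nhds := D.nhds
  maps := D.maps
  anti := D.anti
  field_bdd l := by
    rcases Φ.kind l with ⟨-, h1, h2, -⟩ | ⟨-, -, h1, h2, -⟩ | ⟨h1, h2, -, h3, -⟩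
    · exact ⟨1, fun v _ => by simp [AffineFlow.field, h1, h2]⟩
    · exact ⟨1, fun v _ => by simp [AffineFlow.field, h1, h2]⟩
    · obtain ⟨C, hC⟩ := D.bounded h1 h2
      refine ⟨|(Φ.φ l).α| + C, fun v hv => ?_⟩
      rw [AffineFlow.field, h3]
      refine (norm_add_le _ _).trans (add_le_add (by simp) ?_)
      simpa using hC v hv
  sum_field v := Φ.sum_field 𝕜 v
  ends e s ε hε := by
    -- The bound makes the exponent of the weight at most `log ε - 1`.
    obtain ⟨v, hv, hX⟩ := D.ends e.1 e.2 s ((1 - Real.log ε) / η)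
    refine ⟨v, hv, ?_⟩
    rw [div_le_iff₀ hη, mul_comm] at hX
    rw [weight, ← Real.lt_log_iff_exp_lt hε]
    linarith

end IntervalFlow

namespace Frame

variable {𝕜 : Type} [RCLike 𝕜] {P : Frame 𝕜} {s n : ℕ} {c : Prop} {I : Set ℝ} {E : Type}
  [NormedAddCommGroup E] [NormedSpace ℝ E] [NormedSpace 𝕜 E] [IsScalarTower ℝ 𝕜 E]

theorem Cls.uniformCOn {f : 𝕜 → ℝ → E} (hf : P.Cls s c n f) (hI : UniqueDiffOn ℝ I)
    (hIs : ∀ x ∈ I, (x : 𝕜) ∈ P.Ω s) : UniformCOn n (fun (x : ℝ) h => f (x : 𝕜) h) I P.h₁ := by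
  refine BddSmooth.uniformCOn ((BddSmooth.comp (c := 1) (w := fun _ => 1) (K := I ×ˢ Icc 0 P.h₁)
    (γ := fun (_ : Unit) p => ((p.1 : 𝕜), p.2)) (L := (RCLike.ofRealCLM (K := 𝕜)).prodMap
    (ContinuousLinearMap.id ℝ ℝ)) (fun _ => ()) (hI.prod (uniqueDiffOn_Icc P.h₁_pos))
    (P.uniq_dom s) hf.joint (fun _ p hp => ⟨hIs _ hp.1, hp.2⟩) (fun _ p _ => ?_) (by simp)
    (by simp) (by simp)).congr fun _ _ _ => rfl)
  exact ((RCLike.ofRealCLM (K := 𝕜)).prodMap (ContinuousLinearMap.id ℝ ℝ)).hasFDerivWithinAt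

theorem bddSmooth_ofReal {ι : Type} {f : ι → 𝕜 → E} {w : 𝕜 → ℝ} (hI : UniqueDiffOn ℝ I)
    (hIs : ∀ x ∈ I, (x : 𝕜) ∈ P.Ω s) (hw : ∀ v, 0 ≤ w v) (h : BddSmooth 𝕜 n w (P.Ω s) f) :
    BddSmooth ℝ n (fun x : ℝ => w (x : 𝕜)) I (fun i (x : ℝ) => f i (x : 𝕜)) :=
  BddSmooth.comp (c := 1) (L := RCLike.ofRealCLM (K := 𝕜)) id hI (P.uniq s)
    (h.restrictScalars (P.uniq s)) (fun _ => hIs)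
    (fun _ _ _ => (RCLike.ofRealCLM (K := 𝕜)).hasFDerivWithinAt)
    (fun _ _ => hw _) (fun _ _ => hw _) fun _ _ _ => (one_mul _).ge

theorem Cls.exists_iteratedDerivWithin_le {f : 𝕜 → ℝ → E} (hf : P.Cls s c n f) (e : P.κ)
    (hI : UniqueDiffOn ℝ I) (hIs : ∀ x ∈ I, (x : 𝕜) ∈ P.Ω s) :
    ∃ L : ℝ → E, (c → L = 0) ∧ ∃ C, ∀ h ∈ Icc 0 P.h₁, ∀ x ∈ I, ∀ j ≤ n,
      ‖iteratedDerivWithin j (fun y : ℝ => f (y : 𝕜) h - L h) I x‖ ≤ C * P.w e (x : 𝕜) := by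
  obtain ⟨L, hL0, hL⟩ := hf.tail e
  obtain ⟨C, hC⟩ := (bddSmooth_ofReal hI hIs (P.w_nonneg e) (hL.of_le (Nat.le_add_right n P.σ))).2
  refine ⟨L, hL0, C, fun h hh x hx j hj => ?_⟩
  rw [← norm_iteratedFDerivWithin_eq_norm_iteratedDerivWithin]
  exact hC ⟨h, hh⟩ j hj x hx

end Frame

/-! ### Conjugation of systems, and the conclusions drawn from a block-diagonalization -/

namespace Matrix

variable {ι : Type*} [Fintype ι]

/-- Multiplication of a matrix and a vector as a bilinear map. -/
def mulVecCLM (ι : Type*) [Fintype ι] : Matrix ι ι ℂ →L[ℝ] (ι → ℂ) →L[ℝ] (ι → ℂ) :=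
  LinearMap.mkContinuous₂
    (LinearMap.mk₂ ℝ (fun (A : Matrix ι ι ℂ) (v : ι → ℂ) => A.mulVec v)
      (fun A A' B => Matrix.add_mulVec A A' B) (fun c A B => Matrix.smul_mulVec c A B)
      (fun A B B' => Matrix.mulVec_add A B B') (fun c A B => Matrix.mulVec_smul A c B)) 1
    (fun A B => by simpa using Matrix.linfty_opNorm_mulVec A B)

theorem hasDerivWithinAt_mulVec {f : ℝ → Matrix ι ι ℂ} {g : ℝ → ι → ℂ} {f' : Matrix ι ι ℂ}
    {g' : ι → ℂ} {s : Set ℝ} {x : ℝ} (hf : HasDerivWithinAt f f' s x)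
    (hg : HasDerivWithinAt g g' s x) :
    HasDerivWithinAt (fun x => (f x).mulVec (g x)) ((f x).mulVec g' + f'.mulVec (g x)) s x :=
  (mulVecCLM ι).hasDerivWithinAt_of_bilinear hf hg

end Matrix

/-- For the forward direction, differentiability of `V` comes from `V = T⁻¹ (T V)`. Derivatives
within `I` are unique, so the derivative of `T V` is given by the product rule, and `T` is
cancelled. -/
theorem solvesOn_iff_of_conjugation {ι : Type*} [Fintype ι] [DecidableEq ι] {I : Set ℝ}
    (hI : UniqueDiffOn ℝ I) {h : ℝ} {A B T T' Ti Ti' : ℝ → Matrix ι ι ℂ}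
    (hT : ∀ x ∈ I, HasDerivWithinAt T (T' x) I x) (hTi : ∀ x ∈ I, HasDerivWithinAt Ti (Ti' x) I x)
    (hTT : ∀ x ∈ I, T x * Ti x = 1)
    (heq : ∀ x ∈ I, (h : ℂ) • T' x = A x * T x - T x * B x) (V : ℝ → ι → ℂ) :
    SolvesOn I h A (fun x => (T x).mulVec (V x)) ↔ SolvesOn I h B V := by
  have hTT' : ∀ x ∈ I, Ti x * T x = 1 := fun x hx => mul_eq_one_comm.1 (hTT x hx)
  constructor
  · intro hW x hx
    obtain ⟨W', hW', hWe⟩ := hW x hx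
    have h1 : HasDerivWithinAt V ((Ti x).mulVec W' + (Ti' x).mulVec ((T x).mulVec (V x))) I x := by
      refine (Matrix.hasDerivWithinAt_mulVec (hTi x hx) hW').congr (fun y hy => ?_) ?_
      · rw [Matrix.mulVec_mulVec, hTT' y hy, Matrix.one_mulVec]
      · rw [Matrix.mulVec_mulVec, hTT' x hx, Matrix.one_mulVec]
    refine ⟨_, h1, ?_⟩
    set V' := (Ti x).mulVec W' + (Ti' x).mulVec ((T x).mulVec (V x))
    have h2 := Matrix.hasDerivWithinAt_mulVec (hT x hx) h1
    have h3 : W' = (T x).mulVec V' + (T' x).mulVec (V x) := (hI x hx).eq_deriv _ hW' h2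
    have h4 : (T x).mulVec ((h : ℂ) • V') = (T x).mulVec ((B x).mulVec (V x)) := by
      have h5 : (h : ℂ) • W' = (T x).mulVec ((h : ℂ) • V') + ((h : ℂ) • T' x).mulVec (V x) := by
        rw [h3, smul_add, Matrix.mulVec_smul, Matrix.smul_mulVec]
      rw [heq x hx, Matrix.sub_mulVec, hWe, Matrix.mulVec_mulVec] at h5
      rw [Matrix.mulVec_mulVec]
      linear_combination -h5
    have h5 := congrArg (Ti x).mulVec h4
    rwa [Matrix.mulVec_mulVec, Matrix.mulVec_mulVec _ (Ti x) (T x), hTT' x hx, Matrix.one_mulVec,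
      Matrix.one_mulVec] at h5
  · intro hV x hx
    obtain ⟨V', hV', hVe⟩ := hV x hx
    refine ⟨_, Matrix.hasDerivWithinAt_mulVec (hT x hx) hV', ?_⟩
    rw [smul_add, ← Matrix.mulVec_smul, hVe, ← Matrix.smul_mulVec, heq x hx, Matrix.sub_mulVec]
    simp only [Matrix.mulVec_mulVec]
    abel

section Conclusion

variable {𝕜 : Type} [RCLike 𝕜] [NormedAlgebra 𝕜 ℂ] [IsScalarTower ℝ 𝕜 ℂ] [FiniteDimensional 𝕜 ℂ]
  {P : Frame 𝕜} {I : Set ℝ} {n₁ n₂ s r : ℕ}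
  {A T T' Tinv : 𝕜 → ℝ → Matrix (Fin n₁ ⊕ Fin n₂) (Fin n₁ ⊕ Fin n₂) ℂ}
  {A₁₁ : 𝕜 → ℝ → Matrix (Fin n₁) (Fin n₁) ℂ} {A₂₂ : 𝕜 → ℝ → Matrix (Fin n₂) (Fin n₂) ℂ}
  {θ₁ : ℕ → 𝕜 → ℝ → Matrix (Fin n₁) (Fin n₂) ℂ} {θ₂ : ℕ → 𝕜 → ℝ → Matrix (Fin n₂) (Fin n₁) ℂ}

theorem blockSystem_eq (k : ℕ) (h : ℝ) (P : Matrix (Fin n₁) (Fin n₁) ℂ)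
    (Q : Matrix (Fin n₂) (Fin n₂) ℂ) (R : Matrix (Fin n₁) (Fin n₂) ℂ)
    (S : Matrix (Fin n₂) (Fin n₁) ℂ) :
    blockSystem k h P Q R S = Matrix.fromBlocks P (h ^ k • R) (h ^ k • S) Q := by
  rw [blockSystem, Matrix.fromBlocks_smul, Matrix.fromBlocks_add]
  have e : ∀ {i j : Type} (M : Matrix i j ℂ), ((h : ℂ) ^ k) • M = h ^ k • M := by
    intro i j M
    ext
    simp
  simp [e]

theorem HasDerivWithinAt.comp_rclike_ofReal {E : Type} [NormedAddCommGroup E] [NormedSpace ℝ E]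
    [NormedSpace 𝕜 E] [IsScalarTower ℝ 𝕜 E] {f : 𝕜 → E} {f' : E} {Ω : Set 𝕜} {x : ℝ}
    (hf : HasDerivWithinAt f f' Ω (x : 𝕜)) (hI : ∀ x ∈ I, (x : 𝕜) ∈ Ω) :
    HasDerivWithinAt (fun x : ℝ => f (x : 𝕜)) f' I x := by
  have h1 := (hf.hasFDerivWithinAt.restrictScalars ℝ).comp (f := fun x : ℝ => (x : 𝕜)) x
    ((RCLike.ofRealCLM (K := 𝕜)).hasFDerivWithinAt (s := I)) hI
  have h2 := h1.hasDerivWithinAt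
  simpa [Function.comp_def] using h2

namespace Frame.BlockDiag

theorem norm_inv_le (B : P.BlockDiag s r A T T' Tinv A₁₁ A₂₂ θ₁ θ₂) : ∃ C, ∀ v ∈ P.Ω s,
    ∀ h ∈ Icc 0 P.h₁, IsUnit (T v h) ∧ ‖(T v h)⁻¹‖ ≤ C := by
  obtain ⟨C, -, hC⟩ := B.cls_inv.bound
  refine ⟨C, fun v hv h hh => ⟨IsUnit.of_mul_eq_one _ (B.mul_inv v hv h hh), ?_⟩⟩
  rw [Matrix.inv_eq_right_inv (B.mul_inv v hv h hh)]
  exact hC v hv h hh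

theorem uniformlyInvertibleOn (B : P.BlockDiag s r A T T' Tinv A₁₁ A₂₂ θ₁ θ₂)
    (hIs : ∀ x ∈ I, (x : 𝕜) ∈ P.Ω s) :
    UniformlyInvertibleOn (fun (x : ℝ) h => T (x : 𝕜) h) I P.h₁ := by
  obtain ⟨C, hC⟩ := B.norm_inv_le
  exact ⟨C, fun x hx h hh => hC _ (hIs x hx) h hh⟩

theorem solvesOn_iff (B : P.BlockDiag s r A T T' Tinv A₁₁ A₂₂ θ₁ θ₂) (hI : UniqueDiffOn ℝ I)
    (hIs : ∀ x ∈ I, (x : 𝕜) ∈ P.Ω s)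
    {AR : ℝ → ℝ → Matrix (Fin n₁ ⊕ Fin n₂) (Fin n₁ ⊕ Fin n₂) ℂ}
    (hA : ∀ x ∈ I, ∀ h ∈ Icc 0 P.h₁, A (x : 𝕜) h = AR x h) {k : ℕ} (hk : 1 ≤ k) (hkr : k ≤ r)
    {h : ℝ} (hh : h ∈ Ioc 0 P.h₁) (V : ℝ → (Fin n₁ ⊕ Fin n₂) → ℂ) :
    SolvesOn I h (fun x => AR x h) (fun x => (T (x : 𝕜) h).mulVec (V x)) ↔
      SolvesOn I h (fun x => blockSystem k h (A₁₁ (x : 𝕜) h) (A₂₂ (x : 𝕜) h) (θ₁ k (x : 𝕜) h)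
        (θ₂ k (x : 𝕜) h)) V := by
  have hh' : h ∈ Icc 0 P.h₁ := ⟨hh.1.le, hh.2⟩
  obtain ⟨n, rfl⟩ : ∃ n, r = n + 1 := ⟨r - 1, by omega⟩
  refine solvesOn_iff_of_conjugation hI
    (fun x hx => (B.deriv _ (hIs x hx) h hh').comp_rclike_ofReal hIs)
    (fun x hx => (B.cls_inv.hasDerivWithinAt (hIs x hx) hh').comp_rclike_ofReal hIs)
    (fun x hx => B.mul_inv _ (hIs x hx) h hh') (fun x hx => ?_) V
  rw [blockSystem_eq, ← hA x hx h hh', ← B.eq k hk hkr _ (hIs x hx) h hh']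
  ext
  simp

end Frame.BlockDiag

/-- Convergence in `m` derivatives at the end with the given sign. -/
def ExpConv {E : Type*} [NormedAddCommGroup E] [NormedSpace ℝ E] (e : Bool) (m : ℕ)
    (F : ℝ → ℝ → E) (L : ℝ → E) (I : Set ℝ) (h₀ : ℝ) : Prop :=
  ∃ C η : ℝ, 0 < η ∧ ∀ h ∈ Icc (0 : ℝ) h₀, ∀ x ∈ I, 0 ≤ IntervalFlow.sgn e * x → ∀ j ≤ m,
    ‖iteratedDerivWithin j (fun y => F y h - L h) I x‖ ≤ C * IntervalFlow.weight η e x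

theorem expConv_true {E : Type*} [NormedAddCommGroup E] [NormedSpace ℝ E] {m : ℕ}
    {F : ℝ → ℝ → E} {L : ℝ → E} {I : Set ℝ} {h₀ : ℝ} :
    ExpConv true m F L I h₀ ↔ ExpConvTop m F L I h₀ := by
  simp [ExpConv, ExpConvTop, IntervalFlow.weight, IntervalFlow.sgn]

theorem expConv_false {E : Type*} [NormedAddCommGroup E] [NormedSpace ℝ E] {m : ℕ}
    {F : ℝ → ℝ → E} {L : ℝ → E} {I : Set ℝ} {h₀ : ℝ} :
    ExpConv false m F L I h₀ ↔ ExpConvBot m F L I h₀ := by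
  simp [ExpConv, ExpConvBot, IntervalFlow.weight, IntervalFlow.sgn]

section

variable {a b : EReal} {Φ : IntervalFlow a b} {p : Bool → Prop} {h₁ : ℝ} {Ω : ℕ → Set 𝕜}
  (D : IntervalFlow.FrameData 𝕜 a b Φ p h₁ Ω) {σ : ℕ} {η : ℝ} (hη : 0 < η) {n : ℕ} {c : Prop}
  {E : Type} [NormedAddCommGroup E] [NormedSpace ℝ E] [NormedSpace 𝕜 E] [IsScalarTower ℝ 𝕜 E]

theorem Frame.Cls.exists_expConv {f : 𝕜 → ℝ → E} (hf : (D.frame σ hη).Cls s c n f) {e : Bool}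
    (he : p e) (hI : UniqueDiffOn ℝ (realInterval a b)) : ∃ L : ℝ → E, (c → L = 0) ∧
      ExpConv e n (fun (x : ℝ) h => f (x : 𝕜) h) L (realInterval a b) h₁ := by
  obtain ⟨L, hL0, C, hC⟩ := hf.exists_iteratedDerivWithin_le ⟨e, he⟩ hI (D.real s)
  refine ⟨L, hL0, C, η, hη, fun h hh x hx _ j hj => ?_⟩
  have h1 := hC h hh x hx j hj
  have h2 : (D.frame σ hη).w ⟨e, he⟩ (x : 𝕜) = IntervalFlow.weight η e x := by
    change IntervalFlow.weight η e (x : 𝕜) = _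
    simp [IntervalFlow.weight]
  rwa [h2] at h1

theorem Frame.Cls.exists_expConv_false {f : 𝕜 → ℝ → E} (hf : (D.frame σ hη).Cls s False n f)
    {e : Bool} (he : p e) (hI : UniqueDiffOn ℝ (realInterval a b)) : ∃ L : ℝ → E,
      ExpConv e n (fun (x : ℝ) h => f (x : 𝕜) h) L (realInterval a b) h₁ := by
  obtain ⟨L, -, h⟩ := hf.exists_expConv D hη he hI
  exact ⟨L, h⟩

theorem Frame.Cls.expConv_zero {f : 𝕜 → ℝ → E} (hf : (D.frame σ hη).Cls s True n f)
    {e : Bool} (he : p e) (hI : UniqueDiffOn ℝ (realInterval a b)) :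
      ExpConv e n (fun (x : ℝ) h => f (x : 𝕜) h) (fun _ => 0) (realInterval a b) h₁ := by
  obtain ⟨L, hL, h⟩ := hf.exists_expConv D hη he hI
  rw [hL trivial] at h
  exact h

end

/-- The conclusions on the real interval. -/
theorem Frame.BlockDiag.real_conclusion {a b : EReal} (hab : a < b) {Φ : IntervalFlow a b}
    {p : Bool → Prop} {h₁ : ℝ} {Ω : ℕ → Set 𝕜} (D : IntervalFlow.FrameData 𝕜 a b Φ p h₁ Ω) {σ : ℕ}
    {η : ℝ} (hη : 0 < η) (B : (D.frame σ hη).BlockDiag s r A T T' Tinv A₁₁ A₂₂ θ₁ θ₂)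
    {AR : ℝ → ℝ → Matrix (Fin n₁ ⊕ Fin n₂) (Fin n₁ ⊕ Fin n₂) ℂ}
    (hA : ∀ x ∈ realInterval a b, ∀ h ∈ Icc 0 h₁, A (x : 𝕜) h = AR x h) {k : ℕ} (hk : 1 ≤ k)
    (hkr : k ≤ r) :
    (UniformCOn r (fun (x : ℝ) h => T (x : 𝕜) h) (realInterval a b) h₁ ∧
      UniformlyInvertibleOn (fun (x : ℝ) h => T (x : 𝕜) h) (realInterval a b) h₁ ∧
      UniformCOn (r - k) (fun (x : ℝ) h => A₁₁ (x : 𝕜) h) (realInterval a b) h₁ ∧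
      UniformCOn (r - k) (fun (x : ℝ) h => A₂₂ (x : 𝕜) h) (realInterval a b) h₁ ∧
      UniformCOn (r - k) (fun (x : ℝ) h => θ₁ k (x : 𝕜) h) (realInterval a b) h₁ ∧
      UniformCOn (r - k) (fun (x : ℝ) h => θ₂ k (x : 𝕜) h) (realInterval a b) h₁ ∧
      ∀ h ∈ Ioc (0 : ℝ) h₁, ∀ V : ℝ → (Fin n₁ ⊕ Fin n₂) → ℂ,
        SolvesOn (realInterval a b) h (fun x => AR x h) (fun x => (T (x : 𝕜) h).mulVec (V x)) ↔
        SolvesOn (realInterval a b) h (fun x => blockSystem k h (A₁₁ (x : 𝕜) h) (A₂₂ (x : 𝕜) h)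
          (θ₁ k (x : 𝕜) h) (θ₂ k (x : 𝕜) h)) V) ∧
    ∀ e, p e →
      (∃ L, ExpConv e (r - k) (fun (x : ℝ) h => A₁₁ (x : 𝕜) h) L (realInterval a b) h₁) ∧
      (∃ L, ExpConv e (r - k) (fun (x : ℝ) h => A₂₂ (x : 𝕜) h) L (realInterval a b) h₁) ∧
      ExpConv e (r - k) (fun (x : ℝ) h => θ₁ k (x : 𝕜) h) (fun _ => 0) (realInterval a b) h₁ ∧
      ExpConv e (r - k) (fun (x : ℝ) h => θ₂ k (x : 𝕜) h) (fun _ => 0) (realInterval a b) h₁ := by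
  have hI := uniqueDiffOn_realInterval hab
  have hIs := D.real s
  have hle : r - k ≤ r - 1 := by omega
  have h11 := B.cls₁₁.of_le hle
  have h22 := B.cls₂₂.of_le hle
  refine ⟨⟨B.cls.uniformCOn hI hIs, B.uniformlyInvertibleOn hIs, h11.uniformCOn hI hIs,
    h22.uniformCOn hI hIs, (B.cls₁ k hk hkr).uniformCOn hI hIs,
    (B.cls₂ k hk hkr).uniformCOn hI hIs, fun h hh V => B.solvesOn_iff hI hIs hA hk hkr hh V⟩,
    fun e he => ⟨h11.exists_expConv_false D hη he hI, h22.exists_expConv_false D hη he hI,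
      (B.cls₁ k hk hkr).expConv_zero D hη he hI, (B.cls₂ k hk hkr).expConv_zero D hη he hI⟩⟩

end Conclusion

/-- Here `σ = 1`, so functions of joint order `n = 0` are still complex differentiable in `z`. -/
theorem Frame.Cls.isAnalyticExtension {a b : EReal} {Φ : IntervalFlow a b}
    {h₁ : ℝ} {Ω : ℕ → Set ℂ} {p : Bool → Prop} (D : IntervalFlow.FrameData ℂ a b Φ p h₁ Ω) {η : ℝ}
    (hη : 0 < η) (hpt : b = ⊤ → p true) (hpb : a = ⊥ → p false) {E : Type} [NormedAddCommGroup E]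
    [NormedSpace ℝ E] [NormedSpace ℂ E] [IsScalarTower ℝ ℂ E] {s n : ℕ} {c : Prop} {f : ℂ → ℝ → E}
    (hf : (D.frame 1 hη).Cls s c n f) : ∃ Lp Lm : ℝ → E, (c → Lp = fun _ => 0) ∧
      (c → Lm = fun _ => 0) ∧
      IsAnalyticExtension n a b (Ω s) h₁ (fun (x : ℝ) h => f (x : ℂ) h) f Lp Lm := by
  have htail : ∀ e, ∃ L : ℝ → E, (c → L = fun _ => 0) ∧ ∃ C, 0 ≤ C ∧ (p e → ∀ h ∈ Icc 0 h₁,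
      ∀ z ∈ Ω s, ‖f z h - L h‖ ≤ C * IntervalFlow.weight η e z) := by
    intro e
    by_cases he : p e
    · obtain ⟨L, hL0, hL⟩ := hf.tail ⟨e, he⟩
      obtain ⟨C, hC⟩ := hL.bound
      refine ⟨L, hL0, |C|, abs_nonneg C, fun _ h hh z hz => (hC ⟨h, hh⟩ z hz).trans ?_⟩
      exact mul_le_mul_of_nonneg_right (le_abs_self C) (Real.exp_pos _).le
    · exact ⟨fun _ => 0, fun _ => rfl, 0, le_rfl, fun h => absurd h he⟩
  obtain ⟨Lp, hLp, C, hC, hCp⟩ := htail true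
  obtain ⟨Lm, hLm, C', hC', hCm⟩ := htail false
  refine ⟨Lp, Lm, hLp, hLm, fun _ _ _ _ => rfl, fun h hh => ?_, hf.joint.uniformCOn, max C C', η, hη,
    fun h hh z hz => ⟨fun hb _ => ?_, fun ha _ => ?_⟩⟩
  · exact (hf.slice.1 ⟨h, hh⟩).differentiableOn (by
      norm_cast
      exact Nat.succ_ne_zero n)
  · refine (hCp (hpt hb) h hh z hz).trans ?_
    have : IntervalFlow.weight η true z = Real.exp (-η * z.re) := by
      simp [IntervalFlow.weight, IntervalFlow.sgn]
    rw [this]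
    exact mul_le_mul_of_nonneg_right (le_max_left _ _) (Real.exp_pos _).le
  · refine (hCm (hpb ha) h hh z hz).trans ?_
    have : IntervalFlow.weight η false z = Real.exp (η * z.re) := by
      simp [IntervalFlow.weight, IntervalFlow.sgn]
    rw [this]
    exact mul_le_mul_of_nonneg_right (le_max_right _ _) (Real.exp_pos _).le

/-! ### The construction on a real interval -/

/-- The mean value inequality on convex subsets, with one constant for all of them; the whole set
need not be convex. -/
theorem BddSmooth.exists_lipschitz {ι X E : Type*} [NormedAddCommGroup X] [NormedSpace ℝ X]
    [NormedAddCommGroup E] [NormedSpace ℝ E] {n : ℕ} (hn : 1 ≤ n) {K : Set X} {F : ι → X → E}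
    (h : BddSmooth ℝ n (fun _ => 1) K F) (hu : UniqueDiffOn ℝ K) : ∃ C, 0 ≤ C ∧
      ∀ K' ⊆ K, Convex ℝ K' → ∀ i, ∀ p ∈ K', ∀ q ∈ K', ‖F i p - F i q‖ ≤ C * ‖p - q‖ := by
  obtain ⟨C, hC0, hC⟩ := ((h.of_le hn : BddSmooth ℝ (0 + 1) _ K F).fderivWithin hu).bound_one
  exact ⟨C, hC0, fun K' hKK' hK i p hp q hq => hK.norm_image_sub_le_of_norm_hasFDerivWithin_le
    (fun x hx => (h.hasFDerivWithinAt (by omega) i (hKK' hx)).mono hKK')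
    (fun x hx => hC i x (hKK' hx)) hq hp⟩

/-- The nearest-point retraction onto the interval. Composition with it extends coefficients and
eigenvalues to the whole line, with constant values beyond the finite ends. -/
theorem exists_clip {a b : EReal} (hab : a < b) : ∃ c : ℝ → ℝ, (∀ x, c x ∈ realInterval a b) ∧
    (∀ x ∈ realInterval a b, c x = x) ∧ (∀ x y, |c x - c y| ≤ |x - y|) ∧
    (b ≠ ⊤ → ∃ X y, ∀ x ≥ X, c x = y) ∧ (a ≠ ⊥ → ∃ X y, ∀ x ≤ X, c x = y) := by
  have hm : ∀ a x y : ℝ, |max a x - max a y| ≤ |x - y| := fun a x y => by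
    have := abs_max_sub_max_le_max a x a y
    rwa [sub_self, abs_zero, max_eq_right (abs_nonneg (x - y))] at this
  have hm' : ∀ a x y : ℝ, |min a x - min a y| ≤ |x - y| := fun a x y => by
    have := abs_min_sub_min_le_max a x a y
    rwa [sub_self, abs_zero, max_eq_right (abs_nonneg (x - y))] at this
  by_cases ha : a = ⊥ <;> by_cases hb : b = ⊤
  · subst ha hb
    exact ⟨id, fun x => ⟨bot_le, le_top⟩, fun _ _ => rfl, fun _ _ => le_rfl, fun h => absurd rfl h,
      fun h => absurd rfl h⟩
  · subst ha
    lift b to ℝ using ⟨hb, fun h => (h ▸ hab).not_ge bot_le⟩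
    refine ⟨fun x => min b x, fun x => ⟨bot_le, EReal.coe_le_coe_iff.2 (min_le_left _ _)⟩,
      fun x hx => min_eq_right (EReal.coe_le_coe_iff.1 hx.2), hm' b,
      fun _ => ⟨b, b, fun x hx => min_eq_left hx⟩, fun h => absurd rfl h⟩
  · subst hb
    lift a to ℝ using ⟨fun h => (h ▸ hab).not_ge le_top, ha⟩
    refine ⟨fun x => max a x, fun x => ⟨EReal.coe_le_coe_iff.2 (le_max_left _ _), le_top⟩,
      fun x hx => max_eq_right (EReal.coe_le_coe_iff.1 hx.1), hm a, fun h => absurd rfl h,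
      fun _ => ⟨a, a, fun x hx => max_eq_left hx⟩⟩
  · lift a to ℝ using ⟨fun h => (h ▸ hab).not_ge le_top, ha⟩
    lift b to ℝ using ⟨hb, fun h => (h ▸ hab).not_ge bot_le⟩
    have hab' : a < b := EReal.coe_lt_coe_iff.1 hab
    refine ⟨fun x => max a (min b x), fun x => ⟨EReal.coe_le_coe_iff.2 (le_max_left _ _),
      EReal.coe_le_coe_iff.2 (max_le hab'.le (min_le_left _ _))⟩, fun x hx => ?_,
      fun x y => (hm _ _ _).trans (hm' _ _ _), fun _ => ⟨b, b, fun x hx => ?_⟩,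
      fun _ => ⟨a, a, fun x hx => ?_⟩⟩
    · beta_reduce
      rw [min_eq_right (EReal.coe_le_coe_iff.1 hx.2), max_eq_right (EReal.coe_le_coe_iff.1 hx.1)]
    · beta_reduce
      rw [min_eq_left hx, max_eq_right hab'.le]
    · exact max_eq_left ((min_le_right _ _).trans hx)

/-- A smooth approximate block-triangularization on an interval. -/
theorem exists_interval_triangularizer {n₁ n₂ r : ℕ} (hr : 1 ≤ r) {a b : EReal} (hab : a < b)
    {h₀ : ℝ} (hh₀ : 0 < h₀) {A : ℝ → ℝ → Matrix (Fin n₁ ⊕ Fin n₂) (Fin n₁ ⊕ Fin n₂) ℂ}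
    (hA : UniformCOn r A (realInterval a b) h₀) {lam : Fin n₁ → ℝ → ℂ} {mu : Fin n₂ → ℝ → ℂ}
    (hlam : ∀ i, ContinuousOn (lam i) (realInterval a b))
    (hmu : ∀ j, ContinuousOn (mu j) (realInterval a b))
    (hchar : ∀ x ∈ realInterval a b, (A x 0).charpoly =
      (∏ i, (Polynomial.X - Polynomial.C (lam i x))) *
        ∏ j, (Polynomial.X - Polynomial.C (mu j x)))
    {d : ℝ} (hd : 0 < d) (hsep : ∀ x ∈ realInterval a b, ∀ i j, d ≤ ‖lam i x - mu j x‖) {ε : ℝ}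
    (hε : 0 < ε) : ∃ S : ℝ → Matrix (Fin n₁ ⊕ Fin n₂) (Fin n₁ ⊕ Fin n₂) ℂ,
      (∀ k, BddSmooth ℝ k (fun _ => 1) univ (fun _ : Unit => S)) ∧
      (∀ x ∈ realInterval a b, ∃ y ∈ realInterval a b, ∃ V,
        Matrix.IsTriangularizer (A y 0) (fun i => lam i y) (fun j => mu j y) V ∧
        ‖A x 0 - A y 0‖ ≤ ε ∧ ‖S x - V‖ ≤ ε) ∧
      ((b = ⊤ → ∃ L, Tendsto (fun x => A x 0) atTop (𝓝 L)) → ∃ X V, ∀ x ≥ X, S x = V) ∧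
      ((a = ⊥ → ∃ L, Tendsto (fun x => A x 0) atBot (𝓝 L)) → ∃ X V, ∀ x ≤ X, S x = V) := by
  obtain ⟨c, hcI, hcid, hclip, hct, hcb⟩ := exists_clip hab
  have hI := uniqueDiffOn_realInterval hab
  obtain ⟨C, hC0, hC⟩ := hA.bddSmooth.exists_lipschitz hr (hI.prod (uniqueDiffOn_Icc hh₀))
  have h0 : (0 : ℝ) ∈ Icc 0 h₀ := ⟨le_rfl, hh₀.le⟩
  have hc : Continuous c := by
    rw [Metric.continuous_iff]
    intro x ε hε
    exact ⟨ε, hε, fun y hy => (hclip y x).trans_lt hy⟩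
  obtain ⟨R, -, hR⟩ := hA.bddSmooth.bound_one
  have huc : UniformContinuous (fun x => A (c x) 0) := by
    refine Metric.uniformContinuous_iff.2 ?_
    intro ε hε
    refine ⟨ε / (C + 1), by positivity, fun {x y} hxy => ?_⟩
    rw [Real.dist_eq] at hxy
    have h1 := hC _ subset_rfl ((convex_realInterval a b).prod (convex_Icc 0 h₀)) ()
      (c x, 0) ⟨hcI x, h0⟩ (c y, 0) ⟨hcI y, h0⟩
    have h2 : ‖((c x, 0) : ℝ × ℝ) - (c y, 0)‖ ≤ |x - y| := by
      simpa [Prod.norm_def] using hclip x y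
    rw [dist_eq_norm]
    rw [lt_div_iff₀ (by positivity)] at hxy
    calc _ ≤ C * |x - y| := h1.trans (mul_le_mul_of_nonneg_left h2 hC0)
      _ ≤ |x - y| * (C + 1) := by nlinarith [abs_nonneg (x - y)]
      _ < ε := hxy
  obtain ⟨S, hS, hSV, hSt, hSb⟩ := Matrix.exists_smooth_triangularizer
    (A := fun x => A (c x) 0) (t := fun i x => lam i (c x)) (u := fun j x => mu j (c x)) (R := R)
    (fun x => hR () (c x, 0) ⟨hcI x, h0⟩) huc
    (fun i => (hlam i).comp_continuous hc hcI) (fun j => (hmu j).comp_continuous hc hcI)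
    (fun x => hchar _ (hcI x)) hd (fun x => hsep _ (hcI x)) hε
  refine ⟨S, hS, fun x hx => ?_, fun hL => ?_, fun hL => ?_⟩
  · obtain ⟨y, V, hV, h1, h2⟩ := hSV x
    refine ⟨c y, hcI y, V, hV, ?_, h2⟩
    rwa [hcid x hx] at h1
  · by_cases hb : b = ⊤
    · obtain ⟨L, hL⟩ := hL hb
      refine hSt L (hL.congr' ?_)
      subst hb
      filter_upwards [eventually_ge_atTop (c 0)] with x hx
      rw [hcid x (mem_realInterval_of_le_top (hcI 0) hx)]
    · obtain ⟨X, y, hX⟩ := hct hb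
      refine hSt (A y 0) (tendsto_const_nhds.congr' ?_)
      filter_upwards [eventually_ge_atTop X] with x hx
      rw [hX x hx]
  · by_cases ha : a = ⊥
    · obtain ⟨L, hL⟩ := hL ha
      refine hSb L (hL.congr' ?_)
      subst ha
      filter_upwards [eventually_le_atBot (c 0)] with x hx
      rw [hcid x (mem_realInterval_of_bot_le (hcI 0) hx)]
    · obtain ⟨X, y, hX⟩ := hcb ha
      refine hSb (A y 0) (tendsto_const_nhds.congr' ?_)
      filter_upwards [eventually_le_atBot X] with x hx
      rw [hX x hx]

open IntervalFlow in
theorem one_le_exp_mul_weight {η : ℝ} (hη : 0 ≤ η) {e : Bool} {x X : ℝ} (hx : sgn e * x ≤ X) :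
    1 ≤ Real.exp (η * X) * weight η e x := by
  rw [weight, ← Real.exp_add, Real.one_le_exp_iff]
  have : η * (sgn e * x) ≤ η * X := mul_le_mul_of_nonneg_left hx hη
  simpa using this

open IntervalFlow in
theorem weight_le_weight {η η' : ℝ} (h : η' ≤ η) {e : Bool} {x : ℝ} (hx : 0 ≤ sgn e * x) :
    weight η e x ≤ weight η' e x := by
  refine Real.exp_le_exp.2 (neg_le_neg (mul_le_mul_of_nonneg_right h ?_))
  simpa using hx

open IntervalFlow in
-- Beyond `X` the difference vanishes identically, and before `X` the weight is bounded below, so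
-- every rate is admissible.
theorem BddSmooth.sub_eventually_const {E : Type} [NormedAddCommGroup E] [NormedSpace ℝ E] {n : ℕ}
    {S : ℝ → E} {V : E} {X : ℝ} {e : Bool} (hS : BddSmooth ℝ n (fun _ => 1) univ (fun _ : Unit => S))
    (hV : ∀ x, X ≤ sgn e * x → S x = V) {η : ℝ} (hη : 0 ≤ η) :
    BddSmooth ℝ n (weight η e) univ (fun (_ : Unit) x => S x - V) := by
  have h1 : BddSmooth ℝ n (fun _ => 1) univ (fun (_ : Unit) x => S x - V) :=
    hS.sub uniqueDiffOn_univ (BddSmooth.const uniqueDiffOn_univ (c := fun _ => V) fun _ => le_rfl)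
  obtain ⟨C, hC⟩ := h1.2
  refine ⟨h1.1, |C| * Real.exp (η * X), fun i j hj x hx => ?_⟩
  rcases le_or_gt (sgn e * x) X with hxX | hxX
  · calc _ ≤ |C| * 1 := (hC i j hj x hx).trans (by gcongr; exact le_abs_self C)
      _ ≤ |C| * (Real.exp (η * X) * weight η e x) := by
        gcongr; exact one_le_exp_mul_weight hη hxX
      _ = _ := by ring
  · have h2 : (fun x => S x - V) =ᶠ[𝓝 x] fun _ => 0 := by
      have : ∀ᶠ y in 𝓝 x, X < sgn e * y :=
        (continuous_const.mul continuous_id).continuousAt.eventually_const_lt hxX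
      filter_upwards [this] with y hy
      rw [hV y hy.le, sub_self]
    rw [iteratedFDerivWithin_univ, h2.iteratedFDeriv ℝ j |>.eq_of_nhds]
    have h3 : iteratedFDeriv ℝ j (fun _ : ℝ => (0 : E)) x = 0 := by
      change iteratedFDeriv ℝ j (0 : ℝ → E) x = 0
      simp
    rw [h3, norm_zero]
    exact mul_nonneg (by positivity) (Real.exp_pos _).le

open IntervalFlow in
-- On the half-line away from the end the weight is at least `1`, so boundedness suffices there. All
-- smaller rates are allowed so that both ends can share one.
theorem ExpConv.exists_bddSmooth {E : Type} [NormedAddCommGroup E] [NormedSpace ℝ E] {n : ℕ}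
    {F : ℝ → ℝ → E} {I : Set ℝ} {h₀ : ℝ} {L : ℝ → E} {e : Bool} (hI : UniqueDiffOn ℝ I)
    (hF : BddSmooth ℝ n (fun _ => 1) I (fun (h : Icc 0 h₀) x => F x h))
    (hL : ExpConv e n F L I h₀) (hne : ∃ x ∈ I, 0 ≤ sgn e * x) :
    ∃ η₀ > 0, ∀ η, 0 < η → η ≤ η₀ →
      BddSmooth ℝ n (weight η e) I (fun (h : Icc 0 h₀) x => F x h - L h) := by
  obtain ⟨C, η₀, hη₀, hC⟩ := hL
  refine ⟨η₀, hη₀, fun η hη hηη₀ => ?_⟩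
  obtain ⟨C₁, hC₁0, hC₁⟩ := hF.bound_one
  obtain ⟨x₀, hx₀, hx₀'⟩ := hne
  have hLb : ∀ h : Icc (0 : ℝ) h₀, ‖L h‖ ≤ C₁ + |C| := by
    intro h
    have h1 := hC h h.2 x₀ hx₀ hx₀' 0 (Nat.zero_le _)
    rw [iteratedDerivWithin_zero] at h1
    have h2 : weight η₀ e x₀ ≤ 1 := by
      rw [weight, Real.exp_le_one_iff, neg_nonpos]
      exact mul_nonneg hη₀.le (by simpa using hx₀')
    have h3 : C * weight η₀ e x₀ ≤ |C| * 1 :=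
      (mul_le_mul_of_nonneg_right (le_abs_self C) (Real.exp_pos _).le).trans
        (mul_le_mul_of_nonneg_left h2 (abs_nonneg C))
    calc ‖L h‖ = ‖F x₀ h - (F x₀ h - L h)‖ := by rw [sub_sub_cancel]
      _ ≤ ‖F x₀ h‖ + ‖F x₀ h - L h‖ := norm_sub_le _ _
      _ ≤ C₁ + |C| := by linarith [hC₁ h x₀ hx₀]
  have h1 : BddSmooth ℝ n (fun _ => 1) I (fun (h : Icc 0 h₀) x => F x h - L h) :=
    hF.sub hI (BddSmooth.const hI hLb)
  obtain ⟨C₂, hC₂⟩ := h1.2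
  refine ⟨h1.1, max |C| |C₂|, fun h j hj x hx => ?_⟩
  rcases le_total 0 (sgn e * x) with hx0 | hx0
  · rw [norm_iteratedFDerivWithin_eq_norm_iteratedDerivWithin]
    calc _ ≤ |C| * weight η₀ e x := (hC h h.2 x hx hx0 j hj).trans
          (mul_le_mul_of_nonneg_right (le_abs_self C) (Real.exp_pos _).le)
      _ ≤ |C| * weight η e x :=
        mul_le_mul_of_nonneg_left (weight_le_weight hηη₀ hx0) (abs_nonneg C)
      _ ≤ _ := mul_le_mul_of_nonneg_right (le_max_left _ _) (Real.exp_pos _).le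
  · calc _ ≤ |C₂| * 1 := (hC₂ h j hj x hx).trans (by gcongr; exact le_abs_self C₂)
      _ ≤ |C₂| * (Real.exp (η * 0) * weight η e x) := by
        gcongr; exact one_le_exp_mul_weight hη.le hx0
      _ = |C₂| * weight η e x := by simp
      _ ≤ _ := mul_le_mul_of_nonneg_right (le_max_right _ _) (Real.exp_pos _).le

open IntervalFlow in
theorem ExpConv.tendsto_zero_right {E : Type*} [NormedAddCommGroup E] [NormedSpace ℝ E] {n : ℕ}
    {F : ℝ → ℝ → E} {I : Set ℝ} {h₀ : ℝ} (hh₀ : 0 ≤ h₀) {L : ℝ → E} {e : Bool}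
    (hL : ExpConv e n F L I h₀) {l : Filter ℝ} (hI : ∀ᶠ x in l, x ∈ I)
    (hl : Tendsto (fun x => sgn e * x) l atTop) : Tendsto (fun x => F x 0) l (𝓝 (L 0)) := by
  obtain ⟨C, η, hη, hC⟩ := hL
  rw [tendsto_iff_norm_sub_tendsto_zero]
  refine squeeze_zero' (g := fun x => C * weight η e x)
    (Eventually.of_forall fun _ => norm_nonneg _) ?_ ?_
  · filter_upwards [hI, hl.eventually_ge_atTop 0] with x hx hx0
    simpa using hC 0 ⟨le_rfl, hh₀⟩ x hx hx0 0 (Nat.zero_le _)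
  · have h1 : Tendsto (fun x => weight η e x) l (𝓝 0) := by
      simp only [weight, RCLike.re_to_real]
      exact Real.tendsto_exp_neg_atTop_nhds_zero.comp (hl.const_mul_atTop hη)
    simpa using h1.const_mul C

/-- The end with the given sign is infinite. -/
def IsInfiniteEnd (a b : EReal) (e : Bool) : Prop := if e then b = ⊤ else a = ⊥

theorem IsInfiniteEnd.exists_mem {a b : EReal} (hab : a < b) {e : Bool} (he : IsInfiniteEnd a b e)
    (X : ℝ) : ∃ x ∈ realInterval a b, X ≤ IntervalFlow.sgn e * x := by
  obtain ⟨p, q, hpq, hs⟩ := exists_lt_subset_realInterval hab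
  have hp := hs (left_mem_Icc.2 hpq.le)
  cases e
  · obtain rfl : a = ⊥ := by simpa [IsInfiniteEnd] using he
    refine ⟨min p (-X), mem_realInterval_of_bot_le hp (min_le_left _ _), ?_⟩
    simp only [IntervalFlow.sgn, Bool.false_eq_true, if_false]
    linarith [min_le_right p (-X)]
  · obtain rfl : b = ⊤ := by simpa [IsInfiniteEnd] using he
    refine ⟨max p X, mem_realInterval_of_le_top hp (le_max_left _ _), ?_⟩
    simp only [IntervalFlow.sgn, if_true, one_mul]
    exact le_max_right _ _

theorem BddSmooth.slice {E : Type} [NormedAddCommGroup E] [NormedSpace ℝ E] {X : Type}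
    [NormedAddCommGroup X] [NormedSpace ℝ X] {n : ℕ} {f : X → ℝ → E} {K : Set X} {h₀ : ℝ}
    (hh₀ : 0 < h₀) (hK : UniqueDiffOn ℝ K)
    (h : BddSmooth ℝ n (fun _ => 1) (K ×ˢ Icc 0 h₀) (fun _ : Unit => Function.uncurry f)) :
    BddSmooth ℝ n (fun _ => 1) K (fun (t : Icc 0 h₀) x => f x t) :=
  BddSmooth.comp (c := 1) (γ := fun (t : Icc 0 h₀) x => (x, (t : ℝ)))
    (L := ContinuousLinearMap.inl ℝ X ℝ) (fun _ => ()) hK (hK.prod (uniqueDiffOn_Icc hh₀)) h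
    (fun t _ hx => ⟨hx, t.2⟩)
    (fun t x _ => (hasFDerivAt_prodMk_left x (t : ℝ)).hasFDerivWithinAt) (by simp) (by simp)
    (by simp)

theorem BddSmooth.comp_fst {E : Type} [NormedAddCommGroup E] [NormedSpace ℝ E] {X : Type}
    [NormedAddCommGroup X] [NormedSpace ℝ X] {n : ℕ} {S : X → E} {K : Set X} {h₀ : ℝ}
    (hh₀ : 0 < h₀) (hK : UniqueDiffOn ℝ K) (h : BddSmooth ℝ n (fun _ => 1) K (fun _ : Unit => S)) :
    BddSmooth ℝ n (fun _ => 1) (K ×ˢ Icc 0 h₀)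
      (fun _ : Unit => Function.uncurry (fun x (_ : ℝ) => S x)) :=
  (BddSmooth.comp (c := 1) (w := fun _ => 1) (γ := fun (_ : Unit) (p : X × ℝ) => p.1)
    (L := ContinuousLinearMap.fst ℝ X ℝ) (fun _ => ()) (hK.prod (uniqueDiffOn_Icc hh₀)) hK h
    (fun _ _ hp => hp.1) (fun _ _ _ => hasFDerivWithinAt_fst) (by simp) (by simp) (by simp)).congr
    fun _ _ _ => rfl

theorem frameData_real {a b : EReal} (hab : a < b) (Φ : IntervalFlow a b) {p : Bool → Prop}
    (hp : ∀ e, p e → IsInfiniteEnd a b e) {h₁ : ℝ} (hh₁ : 0 < h₁) :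
    IntervalFlow.FrameData ℝ a b Φ p h₁ (fun _ => realInterval a b) where
  h₁_pos := hh₁
  top h := by simpa [IsInfiniteEnd] using hp _ h
  bot h := by simpa [IsInfiniteEnd] using hp _ h
  uniq _ := uniqueDiffOn_realInterval hab
  locConvex _ _ _ := ⟨1, one_pos, (convex_realInterval a b).inter (convex_ball _ _)⟩
  nhds _ _ _ := rfl
  anti _ := subset_rfl
  real _ _ h := h
  ends e he s X := (hp e he).exists_mem hab X
  bounded ha hb := by
    lift a to ℝ using ⟨fun h => (h ▸ hab).not_ge le_top, ha⟩
    lift b to ℝ using ⟨hb, fun h => (h ▸ hab).not_ge bot_le⟩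
    refine ⟨max |a| |b|, fun v hv => ?_⟩
    exact abs_le_max_abs_abs (EReal.coe_le_coe_iff.1 hv.1) (EReal.coe_le_coe_iff.1 hv.2)
  maps l s τ hτ v hv := by
    rcases Φ.flow_cases (𝕜 := ℝ) l with ⟨rfl, h⟩ | ⟨rfl, -, h⟩ | ⟨-, -, e, he, h⟩
    · rw [h]
      exact mem_realInterval_of_le_top hv (le_add_of_nonneg_right hτ.1)
    · rw [h]
      exact mem_realInterval_of_bot_le hv (sub_le_self _ hτ.1)
    · rw [h]
      have h1 : Real.exp (-τ) ≤ 1 := Real.exp_le_one_iff.2 (neg_nonpos.2 hτ.1)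
      exact (convex_realInterval a b) hv he (Real.exp_pos _).le (sub_nonneg.2 h1)
        (add_sub_cancel _ _)

/-- Block-diagonalization on the real interval. -/
theorem exists_real_blockDiag {n₁ n₂ r : ℕ} (hr : 1 ≤ r) {a b : EReal} (hab : a < b)
    {h₀ : ℝ} (hh₀ : 0 < h₀) {A : ℝ → ℝ → Matrix (Fin n₁ ⊕ Fin n₂) (Fin n₁ ⊕ Fin n₂) ℂ}
    (hA : UniformCOn r A (realInterval a b) h₀) {lam : Fin n₁ → ℝ → ℂ} {mu : Fin n₂ → ℝ → ℂ}
    (hlam : ∀ i, ContinuousOn (lam i) (realInterval a b))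
    (hmu : ∀ j, ContinuousOn (mu j) (realInterval a b))
    (hchar : ∀ x ∈ realInterval a b, (A x 0).charpoly =
      (∏ i, (Polynomial.X - Polynomial.C (lam i x))) *
        ∏ j, (Polynomial.X - Polynomial.C (mu j x)))
    {d : ℝ} (hd : 0 < d) (hsep : ∀ x ∈ realInterval a b, ∀ i j, d ≤ ‖lam i x - mu j x‖)
    (Φ : IntervalFlow a b) {p : Bool → Prop} (hp : ∀ e, p e → IsInfiniteEnd a b e)
    (hpA : ∀ e, p e → ∃ L, ExpConv e r A L (realInterval a b) h₀) :
    ∃ h₁, h₁ ≤ h₀ ∧ ∃ (D : IntervalFlow.FrameData ℝ a b Φ p h₁ (fun _ => realInterval a b)) (η : ℝ)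
      (hη : 0 < η), ∃ s T T' Tinv A₁₁ A₂₂ θ₁ θ₂,
      (D.frame 0 hη).BlockDiag s r A T T' Tinv A₁₁ A₂₂ θ₁ θ₂ := by
  have hI := uniqueDiffOn_realInterval hab
  have h0 : (0 : ℝ) ∈ Icc 0 h₀ := ⟨le_rfl, hh₀.le⟩
  obtain ⟨R, hR0, hR⟩ := hA.bddSmooth.bound_one
  obtain ⟨K, q, ε', ε, C, hK, hq, hε', hsmall, hε, htol⟩ :=
    Matrix.exists_triangularization_tolerance (Fin n₁) (Fin n₂) hR0 hd
  obtain ⟨S, hS, hSV, hSt, hSb⟩ := exists_interval_triangularizer hr hab hh₀ hA hlam hmu hchar hd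
    hsep (half_pos hε)
  obtain ⟨CA, hCA0, hCA⟩ := hA.bddSmooth.exists_lipschitz hr (hI.prod (uniqueDiffOn_Icc hh₀))
  obtain ⟨CS, hCS0, hCS⟩ := ((hS 1).fderivWithin uniqueDiffOn_univ).bound_one
  -- Small enough that `A(x, h)` is within `ε / 2` of `A(x, 0)` and that `h S'` is at most `ε`.
  set h₁ := min h₀ (min (ε / 2 / (CA + 1)) (ε / (CS + 1)))
  have hh₁ : 0 < h₁ := by positivity
  have hh₁₀ : h₁ ≤ h₀ := min_le_left _ _
  have hh₁A : CA * h₁ ≤ ε / 2 := by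
    have h1 : h₁ ≤ ε / 2 / (CA + 1) := (min_le_right _ _).trans (min_le_left _ _)
    rw [le_div_iff₀ (by positivity)] at h1
    nlinarith
  have hh₁S : h₁ * CS ≤ ε := by
    have h1 : h₁ ≤ ε / (CS + 1) := (min_le_right _ _).trans (min_le_right _ _)
    rw [le_div_iff₀ (by positivity)] at h1
    nlinarith
  have hsub : Icc 0 h₁ ⊆ Icc 0 h₀ := Icc_subset_Icc_right hh₁₀
  have hslice := hA.bddSmooth.slice hh₀ hI
  have hrate : ∀ e, ∃ η₀ > 0, p e → ∃ L : ℝ → _, ∀ η, 0 < η → η ≤ η₀ →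
      BddSmooth ℝ r (IntervalFlow.weight η e) (realInterval a b)
        (fun (h : Icc 0 h₀) x => A x h - L h) := by
    intro e
    by_cases he : p e
    · obtain ⟨L, hL⟩ := hpA e he
      obtain ⟨η₀, hη₀, h⟩ := hL.exists_bddSmooth hI hslice ((hp e he).exists_mem hab 0)
      exact ⟨η₀, hη₀, fun _ => ⟨L, h⟩⟩
    · exact ⟨1, one_pos, fun h => absurd h he⟩
  choose η₀ hη₀ hrate using hrate
  set η := min (η₀ true) (η₀ false)
  have hη : 0 < η := lt_min (hη₀ _) (hη₀ _)
  have hηe : ∀ e, η ≤ η₀ e := fun e => by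
    cases e
    · exact min_le_right _ _
    · exact min_le_left _ _
  have D := frameData_real hab Φ hp hh₁
  refine ⟨h₁, hh₁₀, D, η, hη, ?_⟩
  set P := D.frame 0 hη
  -- Convergence of `A` at an end lets `S` be constant near it, which gives `S` the decay needed for
  -- membership in the class.
  have hSconst : ∀ e, p e → ∃ X V, ∀ x, X ≤ IntervalFlow.sgn e * x → S x = V := by
    intro e he
    obtain ⟨L, hL⟩ := hpA e he
    have hinf := hp e he
    cases e
    · have ha : a = ⊥ := by simpa [IsInfiniteEnd] using hinf
      obtain ⟨X, V, hX⟩ := hSb fun _ => ⟨L 0, hL.tendsto_zero_right hh₀.le (by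
        subst ha
        obtain ⟨x, hx, -⟩ := hinf.exists_mem hab 0
        filter_upwards [eventually_le_atBot x] with y hy
        exact mem_realInterval_of_bot_le hx hy) (by
        simpa [IntervalFlow.sgn] using tendsto_neg_atBot_atTop)⟩
      refine ⟨-X, V, fun x hx => hX x ?_⟩
      simpa [IntervalFlow.sgn] using hx
    · have hb : b = ⊤ := by simpa [IsInfiniteEnd] using hinf
      obtain ⟨X, V, hX⟩ := hSt fun _ => ⟨L 0, hL.tendsto_zero_right hh₀.le (by
        subst hb
        obtain ⟨x, hx, -⟩ := hinf.exists_mem hab 0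
        filter_upwards [eventually_ge_atTop x] with y hy
        exact mem_realInterval_of_le_top hx hy) (by
        simp only [IntervalFlow.sgn, if_true, one_mul]
        exact tendsto_id)⟩
      refine ⟨X, V, fun x hx => hX x ?_⟩
      simpa [IntervalFlow.sgn] using hx
  have hAc : P.Cls 0 False r A := by
    refine ⟨hA.bddSmooth.mono_set (hI.prod (uniqueDiffOn_Icc hh₀)) (P.uniq_dom 0)
      (prod_mono subset_rfl hsub), hslice.reindex (Set.inclusion hsub), fun e => ?_⟩
    obtain ⟨L, hL⟩ := hrate e.1 e.2
    exact ⟨L, False.elim, (hL η hη (hηe e.1)).reindex (Set.inclusion hsub)⟩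
  have hSI : ∀ k, BddSmooth ℝ k (fun _ => 1) (realInterval a b) (fun _ : Unit => S) := fun k =>
    (hS k).mono_set uniqueDiffOn_univ hI (subset_univ _)
  have hSc : P.Cls 0 False (r + 1) (fun v _ => S v) := by
    refine ⟨(hSI _).comp_fst hh₁ hI, (hSI _).reindex (fun _ => ()), fun e => ?_⟩
    obtain ⟨X, V, hX⟩ := hSconst e.1 e.2
    exact ⟨fun _ => V, False.elim, (((hS _).sub_eventually_const hX hη.le).mono_set
      uniqueDiffOn_univ hI (subset_univ _)).reindex (fun _ => ())⟩
  refine Frame.exists_blockDiag_of_tolerance hr hAc hSc hK hq hε' hsmall (C := C)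
    fun x hx h hh E hE => ?_
  obtain ⟨y, hy, V, hV, h1, h2⟩ := hSV x hx
  refine htol (A x h) (A y 0) (S x) V E _ _ (hR () (y, 0) ⟨hy, h0⟩) hV (hsep y hy) ?_
    (h2.trans (by linarith)) ?_
  · have h3 := hCA _ subset_rfl ((convex_realInterval a b).prod (convex_Icc 0 h₀)) () (x, h)
      ⟨hx, hsub hh⟩ (x, 0) ⟨hx, h0⟩
    have h4 : ‖((x, h) : ℝ × ℝ) - (x, 0)‖ ≤ h₁ := by
      simp only [Prod.mk_sub_mk, sub_self, sub_zero, Prod.norm_def, norm_zero]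
      rw [max_eq_right (norm_nonneg _), Real.norm_of_nonneg hh.1]
      exact hh.2
    calc ‖A x h - A y 0‖ = ‖(A x h - A x 0) + (A x 0 - A y 0)‖ := by rw [sub_add_sub_cancel]
      _ ≤ ‖A x h - A x 0‖ + ‖A x 0 - A y 0‖ := norm_add_le _ _
      _ ≤ ε / 2 + ε / 2 := add_le_add (h3.trans
          ((mul_le_mul_of_nonneg_left h4 hCA0).trans hh₁A)) h1
      _ = ε := add_halves ε
  · have h3 : HasDerivAt S (deriv S x) x :=
      ((contDiffOn_univ.1 ((hS 1).1 ())).differentiable (by simp) x).hasDerivAt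
    have h4 : P.der (fun v _ => S v) x h = deriv S x :=
      Frame.der_eq_of_hasDerivWithinAt (s := 0) (P := P) (f := fun v _ => S v) hx
        h3.hasDerivWithinAt
    have h5 := hCS () x trivial
    rw [fderivWithin_univ, ← norm_deriv_eq_norm_fderiv] at h5
    rw [hE, h4, norm_smul, Real.norm_of_nonneg hh.1]
    exact (mul_le_mul hh.2 h5 (norm_nonneg _) hh₁.le).trans hh₁S

/-! ### Holomorphic approximation by polynomials in the sigmoid function -/

/-- The complex sigmoid function. -/
def csigmoid (z : ℂ) : ℂ := (1 + Complex.exp (-z))⁻¹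

theorem csigmoid_ofReal (x : ℝ) : csigmoid (x : ℂ) = (Real.sigmoid x : ℂ) := by
  rw [csigmoid, Real.sigmoid_def]
  push_cast
  rfl

/-- A region on which the complex sigmoid function is bounded. -/
def sigmoidRegion : Set ℂ := {z | |z.im| ≤ 1 ∨ 1 ≤ |z.re|}

/-- In the strip the cosine factor is nonnegative, so the real part is at least `1`. For `|Re z| ≥
1` the exponential has norm at most `1/2` or at least `2`. -/
theorem half_le_norm_one_add_exp {z : ℂ} (hz : z ∈ sigmoidRegion) :
    1 / 2 ≤ ‖1 + Complex.exp (-z)‖ := by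
  have hn : ‖Complex.exp (-z)‖ = Real.exp (-z.re) := by rw [Complex.norm_exp, Complex.neg_re]
  rcases hz with hz | hz
  · have h1 : 0 ≤ Real.cos (-z.im) := by
      rw [Real.cos_neg]
      have h2 := abs_le.1 hz
      exact Real.cos_nonneg_of_mem_Icc ⟨by linarith [Real.pi_gt_three], by
        linarith [Real.pi_gt_three]⟩
    have h2 : 1 ≤ (1 + Complex.exp (-z)).re := by
      rw [Complex.add_re, Complex.exp_re, Complex.one_re, Complex.neg_re, Complex.neg_im]
      linarith [mul_nonneg (Real.exp_pos (-z.re)).le h1]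
    linarith [(le_abs_self _).trans (Complex.abs_re_le_norm (1 + Complex.exp (-z)))]
  · rcases le_abs.1 hz with h | h
    · have h1 : Real.exp (-z.re) ≤ 1 / 2 := by
        have h2 : Real.exp (-z.re) * Real.exp z.re = 1 := by rw [← Real.exp_add]; simp
        have h3 : 2 ≤ Real.exp z.re := by linarith [Real.add_one_le_exp z.re]
        nlinarith [Real.exp_pos (-z.re)]
      have h2 := norm_sub_le (1 + Complex.exp (-z)) (Complex.exp (-z))
      rw [add_sub_cancel_right, norm_one, hn] at h2
      linarith
    · have h1 : 2 ≤ Real.exp (-z.re) := by linarith [Real.add_one_le_exp (-z.re)]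
      have h2 := norm_sub_le (1 + Complex.exp (-z)) 1
      rw [add_sub_cancel_left, norm_one, hn] at h2
      linarith

theorem one_add_exp_ne_zero {z : ℂ} (hz : z ∈ sigmoidRegion) : 1 + Complex.exp (-z) ≠ 0 :=
  norm_pos_iff.1 (lt_of_lt_of_le (by norm_num) (half_le_norm_one_add_exp hz))

theorem norm_csigmoid_le {z : ℂ} (hz : z ∈ sigmoidRegion) : ‖csigmoid z‖ ≤ 2 := by
  rw [csigmoid, norm_inv]
  have h := inv_anti₀ (by norm_num) (half_le_norm_one_add_exp hz)
  simpa using h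

theorem csigmoid_sub_one {z : ℂ} (hz : z ∈ sigmoidRegion) :
    csigmoid z - 1 = -(Complex.exp (-z) * csigmoid z) := by
  have := one_add_exp_ne_zero hz
  rw [csigmoid]
  field_simp
  ring

theorem hasDerivAt_csigmoid {z : ℂ} (hz : z ∈ sigmoidRegion) :
    HasDerivAt csigmoid (csigmoid z * (1 - csigmoid z)) z := by
  have h0 := one_add_exp_ne_zero hz
  have h1 : HasDerivAt (fun z : ℂ => 1 + Complex.exp (-z)) (Complex.exp (-z) * -1) z :=
    ((hasDerivAt_neg z).cexp).const_add 1
  refine (h1.inv h0).congr_deriv ?_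
  have h2 : 1 - csigmoid z = Complex.exp (-z) * csigmoid z := by
    rw [← neg_sub, csigmoid_sub_one hz, neg_neg]
  rw [h2, csigmoid]
  field_simp

namespace BddSmooth

theorem of_hasDerivAt {n : ℕ} {w : ℂ → ℝ} {Ω : Set ℂ} (hΩ : UniqueDiffOn ℂ Ω) {f f' : ℂ → ℂ}
    (hw : ∀ z, 0 ≤ w z) (hb : ∃ C, ∀ z ∈ Ω, ‖f z‖ ≤ C * w z)
    (hf : ∀ z ∈ Ω, HasDerivAt f (f' z) z) (h : BddSmooth ℂ n w Ω (fun _ : Unit => f')) :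
    BddSmooth ℂ (n + 1) w Ω (fun _ : Unit => f) := by
  obtain ⟨C, hC⟩ := hb
  refine succ_of_hasFDerivWithinAt hΩ (F' := fun _ z => ContinuousLinearMap.mul ℂ ℂ (f' z))
    (fun z _ => hw z) ⟨C, fun _ => hC⟩ (fun _ z hz => ?_)
    (h.clm hΩ (ContinuousLinearMap.mul ℂ ℂ))
  refine ((hf z hz).hasFDerivAt.congr_fderiv ?_).hasFDerivWithinAt
  ext
  simp

theorem mul {n : ℕ} {w : ℂ → ℝ} {Ω : Set ℂ} (hΩ : UniqueDiffOn ℂ Ω) {f g : ℂ → ℂ}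
    (hf : BddSmooth ℂ n w Ω (fun _ : Unit => f))
    (hg : BddSmooth ℂ n (fun _ => 1) Ω (fun _ : Unit => g)) :
    BddSmooth ℂ n w Ω (fun _ : Unit => fun z => f z * g z) :=
  hf.bilin hΩ (ContinuousLinearMap.mul ℂ ℂ) hg

end BddSmooth

/-- By the logistic equation each derivative is a polynomial in the bounded function itself. -/
theorem bddSmooth_csigmoid (n : ℕ) {Ω : Set ℂ} (hΩ : UniqueDiffOn ℂ Ω) (hs : Ω ⊆ sigmoidRegion) :
    BddSmooth ℂ n (fun _ => 1) Ω (fun _ : Unit => csigmoid) := by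
  have hb : ∀ z ∈ Ω, ‖csigmoid z‖ ≤ 2 * 1 := fun z hz => by
    rw [mul_one]; exact norm_csigmoid_le (hs hz)
  induction n with
  | zero => exact BddSmooth.zero_iff.2 ⟨fun _ z hz =>
      (hasDerivAt_csigmoid (hs hz)).continuousAt.continuousWithinAt, 2, fun _ => hb⟩
  | succ n ih =>
    refine BddSmooth.of_hasDerivAt hΩ (fun _ => zero_le_one) ⟨2, hb⟩
      (fun z hz => hasDerivAt_csigmoid (hs hz)) ?_
    exact ih.mul hΩ ((BddSmooth.const hΩ (c := fun _ => 1) fun _ => le_rfl).sub hΩ ih)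

open IntervalFlow in
-- The deviation from the limit solves a linear equation with a bounded smooth coefficient, so its
-- derivatives decay with it. The rate is that of `e^{-|Re z|}`, whence `η ≤ 1`.
theorem bddSmooth_csigmoid_sub_limit (n : ℕ) {Ω : Set ℂ} (hΩ : UniqueDiffOn ℂ Ω)
    (hs : Ω ⊆ sigmoidRegion) {η : ℝ} (hη : 0 < η) (hη1 : η ≤ 1) (e : Bool) :
    BddSmooth ℂ n (weight η e) Ω (fun _ : Unit => fun z => csigmoid z - if e then 1 else 0) := by
  set c : ℂ := if e then 1 else 0
  have hone : ∀ z ∈ Ω, sgn e * z.re ≤ 0 → 1 ≤ weight η e z := by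
    intro z _ hz
    rw [weight, Real.one_le_exp_iff, neg_nonneg]
    exact mul_nonpos_of_nonneg_of_nonpos hη.le (by simpa using hz)
  have hw : ∀ z : ℂ, 0 ≤ sgn e * z.re → Real.exp (-(sgn e * z.re)) ≤ weight η e z := by
    intro z hz
    refine Real.exp_le_exp.2 (neg_le_neg ?_)
    have h1 : η * (sgn e * z.re) ≤ 1 * (sgn e * z.re) := mul_le_mul_of_nonneg_right hη1 hz
    simpa using h1
  have hsmall : ∀ z ∈ Ω, 0 ≤ sgn e * z.re →
      ‖csigmoid z - c‖ ≤ 3 * Real.exp (-(sgn e * z.re)) := by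
    intro z hz h0
    have hzs := hs hz
    have h2 := norm_csigmoid_le hzs
    cases e
    · have h3 : csigmoid z = Complex.exp z * (1 - csigmoid z) := by
        rw [← neg_sub, csigmoid_sub_one hzs, neg_neg, ← mul_assoc, ← Complex.exp_add]
        simp
      have h4 : ‖1 - csigmoid z‖ ≤ 3 := (norm_sub_le _ _).trans (by rw [norm_one]; linarith)
      simp only [c, Bool.false_eq_true, if_false, sub_zero, sgn, neg_one_mul, neg_neg]
      rw [h3, norm_mul, Complex.norm_exp, mul_comm]
      exact mul_le_mul_of_nonneg_right h4 (Real.exp_pos _).le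
    · simp only [c, if_true, sgn, one_mul]
      rw [csigmoid_sub_one hzs, norm_neg, norm_mul, Complex.norm_exp, Complex.neg_re, mul_comm]
      exact mul_le_mul_of_nonneg_right (h2.trans (by norm_num)) (Real.exp_pos _).le
  have hc1 : ‖c‖ ≤ 1 := by simp only [c]; split_ifs <;> simp
  have hb : ∀ z ∈ Ω, ‖csigmoid z - c‖ ≤ 3 * weight η e z := by
    intro z hz
    rcases le_total 0 (sgn e * z.re) with h0 | h0
    · exact (hsmall z hz h0).trans (mul_le_mul_of_nonneg_left (hw z h0) (by norm_num))
    · have h1 := (norm_sub_le (csigmoid z) c).trans (add_le_add (norm_csigmoid_le (hs hz)) hc1)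
      linarith [hone z hz h0]
  have hd : ∀ z ∈ Ω, HasDerivAt (fun z => csigmoid z - c)
      ((csigmoid z - c) * (if e then -csigmoid z else 1 - csigmoid z)) z := by
    intro z hz
    refine ((hasDerivAt_csigmoid (hs hz)).sub_const c).congr_deriv ?_
    cases e <;> simp [c]
    ring
  induction n with
  | zero => exact BddSmooth.zero_iff.2 ⟨fun _ z hz =>
      (hd z hz).continuousAt.continuousWithinAt, 3, fun _ => hb⟩
  | succ n ih =>
    refine BddSmooth.of_hasDerivAt hΩ (fun _ => (Real.exp_pos _).le) ⟨3, hb⟩ hd (ih.mul hΩ ?_)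
    have h1 := bddSmooth_csigmoid n hΩ hs
    cases e
    · exact (BddSmooth.const hΩ (c := fun _ => 1) fun _ => le_rfl).sub hΩ h1
    · exact h1.neg hΩ

namespace Frame

theorem Cls.csigmoid {s n : ℕ} {a b : EReal} {Φ : IntervalFlow a b} {p : Bool → Prop}
    {h₁ : ℝ} {Ω : ℕ → Set ℂ} {D : IntervalFlow.FrameData ℂ a b Φ p h₁ Ω} {σ : ℕ} {η : ℝ}
    (hη : 0 < η) (hη1 : η ≤ 1) (hs : Ω s ⊆ sigmoidRegion) :
    (D.frame σ hη).Cls s False n (fun z _ => csigmoid z) := by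
  have hΩ : UniqueDiffOn ℂ (Ω s) := (D.uniq s).mono_field
  refine ⟨((bddSmooth_csigmoid n hΩ hs).restrictScalars (D.uniq s)).comp_fst D.h₁_pos (D.uniq s),
    (bddSmooth_csigmoid _ hΩ hs).reindex fun _ => (), fun e => ⟨fun _ => if e.1 then 1 else 0,
    False.elim, (bddSmooth_csigmoid_sub_limit _ hΩ hs hη hη1 e.1).reindex fun _ => ()⟩⟩

variable {P : Frame ℂ} {s n : ℕ}

theorem Cls.polynomial_eval {f : ℂ → ℝ → ℂ} (hf : P.Cls s False n f) (p : Polynomial ℂ) :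
    P.Cls s False n (fun z h => p.eval (f z h)) := by
  have hpow : ∀ k : ℕ, P.Cls s False n (fun z h => f z h ^ k) := by
    intro k
    induction k with
    | zero => simpa using Cls.const (1 : ℂ)
    | succ k ih =>
      refine ((Cls.bilin (ContinuousLinearMap.mul ℂ ℂ) ih hf).weaken False.elim).congr ?_
      intro z _ h _
      simp [pow_succ]
  simp only [Polynomial.eval_eq_sum_range]
  exact Cls.sum _ fun k _ => (hpow k).clm (ContinuousLinearMap.mul ℂ ℂ (p.coeff k))

theorem Cls.matrix_of {l m : Type} [Fintype l] [Fintype m] [DecidableEq l] [DecidableEq m]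
    {f : l → m → ℂ → ℝ → ℂ} (hf : ∀ i j, P.Cls s False n (f i j)) :
    P.Cls s False n (fun z h => Matrix.of fun i j => f i j z h) := by
  have h1 : P.Cls s False n (fun z h => ∑ i, ∑ j,
      (ContinuousLinearMap.toSpanSingleton ℂ (Matrix.single i j (1 : ℂ))) (f i j z h)) :=
    Cls.sum _ fun i _ => Cls.sum _ fun j _ => (hf i j).clm _
  refine h1.congr fun z _ h _ => ?_
  rw [Matrix.matrix_eq_sum_single (Matrix.of fun i j => f i j z h)]
  simp [Matrix.smul_single]

end Frame

/-- A continuous function that is constant near the infinite ends is approximated by a polynomial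
in the sigmoid function. -/
theorem exists_polynomial_sigmoid_near {f : ℝ → ℂ} (hf : Continuous f)
    (ht : ∃ X V, ∀ x ≥ X, f x = V) (hb : ∃ X V, ∀ x ≤ X, f x = V) {ε : ℝ} (hε : 0 < ε) :
    ∃ p : Polynomial ℂ, ∀ x : ℝ, ‖f x - p.eval (csigmoid x)‖ ≤ ε := by
  obtain ⟨X, V, hX⟩ := ht
  obtain ⟨X', V', hX'⟩ := hb
  set Y := max X X'
  have hY : X' ≤ Y := le_max_right _ _
  -- Clamping to `[sigmoid X', sigmoid Y]`, a compact part of `(0, 1)`, keeps the inverse of the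
  -- sigmoid continuous and loses nothing, since `f` is constant outside `[X', Y]`. The function `g`
  -- is then `f` in the sigmoid variable, to which the Weierstrass theorem applies.
  let c : ℝ → ℝ := fun s => max (Real.sigmoid X') (min s (Real.sigmoid Y))
  have hc0 : ∀ s, 0 < c s := fun s => (Real.sigmoid_pos X').trans_le (le_max_left _ _)
  have hc1 : ∀ s, c s < 1 := fun s => max_lt (Real.sigmoid_lt_one _)
    ((min_le_right _ _).trans_lt (Real.sigmoid_lt_one _))
  have hcc : Continuous c := continuous_const.max (continuous_id.min continuous_const)
  let g : ℝ → ℂ := fun s => f (-Real.log ((c s)⁻¹ - 1))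
  have hinv : ∀ s, 0 < (c s)⁻¹ - 1 := fun s => sub_pos.2 ((one_lt_inv₀ (hc0 s)).2 (hc1 s))
  have hg : Continuous g := by
    refine hf.comp (Continuous.neg (Continuous.log ?_ fun s => (hinv s).ne'))
    exact (hcc.inv₀ fun s => (hc0 s).ne').sub continuous_const
  have hlog : ∀ x : ℝ, -Real.log ((Real.sigmoid x)⁻¹ - 1) = x := by
    intro x
    rw [Real.sigmoid_def, inv_inv, add_sub_cancel_left, Real.log_exp, neg_neg]
  have hgf : ∀ x, g (Real.sigmoid x) = f x := by
    intro x
    simp only [g, c]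
    rcases le_total x X' with h | h
    · rw [min_eq_left (Real.sigmoid_le (h.trans hY)), max_eq_left (Real.sigmoid_le h), hlog,
        hX' x h, hX' X' le_rfl]
    rcases le_total x Y with h' | h'
    · rw [min_eq_left (Real.sigmoid_le h'), max_eq_right (Real.sigmoid_le h), hlog]
    · rw [min_eq_right (Real.sigmoid_le h'), max_eq_right (Real.sigmoid_le hY), hlog,
        hX Y (le_max_left _ _), hX x ((le_max_left _ _).trans h')]
  obtain ⟨p, hp⟩ := exists_polynomial_near_of_continuousOn 0 1 (fun s => (g s).re)
    (Complex.continuous_re.comp hg).continuousOn (ε / 2) (half_pos hε)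
  obtain ⟨q, hq⟩ := exists_polynomial_near_of_continuousOn 0 1 (fun s => (g s).im)
    (Complex.continuous_im.comp hg).continuousOn (ε / 2) (half_pos hε)
  refine ⟨p.map Complex.ofRealHom + Polynomial.C Complex.I * q.map Complex.ofRealHom, fun x => ?_⟩
  have hx : Real.sigmoid x ∈ Icc (0 : ℝ) 1 := ⟨Real.sigmoid_nonneg x, Real.sigmoid_le_one x⟩
  have h1 := hp _ hx
  have h2 := hq _ hx
  rw [hgf] at h1 h2
  have e : ∀ r : Polynomial ℝ, (r.map Complex.ofRealHom).eval (csigmoid x) =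
      ((r.eval (Real.sigmoid x) : ℝ) : ℂ) := by
    intro r
    rw [csigmoid_ofReal, Polynomial.eval_map]
    exact (Polynomial.hom_eval₂ r (RingHom.id ℝ) Complex.ofRealHom _).symm
  rw [Polynomial.eval_add, Polynomial.eval_mul, Polynomial.eval_C, e, e]
  refine (Complex.norm_le_abs_re_add_abs_im _).trans ?_
  simp only [Complex.sub_re, Complex.add_re, Complex.ofReal_re, Complex.mul_re, Complex.I_re,
    Complex.I_im, Complex.ofReal_im, Complex.sub_im, Complex.add_im, Complex.mul_im]
  rw [abs_sub_comm] at h1 h2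
  ring_nf at h1 h2 ⊢
  linarith

namespace Matrix

theorem exists_polynomial_sigmoid_near {l : Type} [Fintype l] [DecidableEq l]
    {S : ℝ → Matrix l l ℂ} (hS : Continuous S) (ht : ∃ X V, ∀ x ≥ X, S x = V)
    (hb : ∃ X V, ∀ x ≤ X, S x = V) {ε : ℝ} (hε : 0 < ε) : ∃ p : l → l → Polynomial ℂ,
      ∀ x : ℝ, ‖S x - of fun i j => (p i j).eval (csigmoid x)‖ ≤ ε := by
  set N : ℝ := ((Fintype.card l : ℕ) : ℝ)
  have hN : 0 ≤ N := Nat.cast_nonneg _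
  obtain ⟨X, V, hX⟩ := ht
  obtain ⟨X', V', hX'⟩ := hb
  have hδ : 0 < ε / (N + 1) := by positivity
  have h : ∀ i j, ∃ p : Polynomial ℂ, ∀ x : ℝ, ‖S x i j - p.eval (csigmoid x)‖ ≤ ε / (N + 1) :=
    fun i j => _root_.exists_polynomial_sigmoid_near (hS.matrix_elem i j)
      ⟨X, V i j, fun x hx => by rw [hX x hx]⟩ ⟨X', V' i j, fun x hx => by rw [hX' x hx]⟩ hδ
  choose p hp using h
  refine ⟨p, fun x => ?_⟩
  have h1 : ‖(((ε / (N + 1))⁻¹ : ℝ) : ℂ) • (S x - of fun i j => (p i j).eval (csigmoid x))‖ ≤ N := by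
    refine norm_le_card_of_entry_le fun i j => ?_
    rw [smul_apply, smul_eq_mul, norm_mul, Complex.norm_real, Real.norm_of_nonneg (by positivity)]
    rw [inv_mul_le_iff₀ hδ, mul_one]
    exact hp i j x
  rw [norm_smul, Complex.norm_real, Real.norm_of_nonneg (by positivity), inv_mul_le_iff₀ hδ] at h1
  calc _ ≤ ε / (N + 1) * N := h1
    _ ≤ ε / (N + 1) * (N + 1) := by gcongr; linarith
    _ = ε := by field_simp

end Matrix

/-! ### Strips with wedges, and the construction on them -/

open IntervalFlow (sgn weight)

theorem mem_stripWedge_iff {a b : EReal} {δ β M : ℝ} {z : ℂ} : z ∈ stripWedge a b δ β M ↔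
    (∃ x ∈ realInterval a b, ‖z - (x : ℂ)‖ < δ) ∨
      ∃ e, IsInfiniteEnd a b e ∧ |z.im| < β * (sgn e * z.re - M) := by
  simp only [stripWedge, mem_union, mem_ofPred_eq, Bool.exists_bool, IsInfiniteEnd,
    IntervalFlow.sgn, Bool.false_eq_true, if_false, if_true, one_mul, neg_one_mul, or_assoc]
  exact or_congr_right or_comm

theorem ofReal_mem_stripWedge {a b : EReal} {δ β M : ℝ} (hδ : 0 < δ) {x : ℝ}
    (hx : x ∈ realInterval a b) : (x : ℂ) ∈ stripWedge a b δ β M :=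
  mem_stripWedge_iff.2 (Or.inl ⟨x, hx, by simpa using hδ⟩)

theorem lt_of_abs_im_lt {β M y t : ℝ} (hβ : 0 < β) (h : |y| < β * (t - M)) : M < t := by
  by_contra hc
  have h1 : β * (t - M) ≤ 0 := mul_nonpos_of_nonneg_of_nonpos hβ.le (by linarith)
  linarith [abs_nonneg y]

theorem stripWedge_subset {a b : EReal} {δ β M δ' β' M' : ℝ} (hδ : δ' ≤ δ) (hβ' : 0 < β')
    (hβ : β' ≤ β) (hM : M ≤ M') : stripWedge a b δ' β' M' ⊆ stripWedge a b δ β M := by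
  intro z hz
  rw [mem_stripWedge_iff] at hz ⊢
  rcases hz with ⟨x, hx, h⟩ | ⟨e, he, h⟩
  · exact Or.inl ⟨x, hx, h.trans_le hδ⟩
  · refine Or.inr ⟨e, he, h.trans_le ?_⟩
    have h1 := lt_of_abs_im_lt hβ' h
    nlinarith

theorem isOpen_stripWedge (a b : EReal) (δ β M : ℝ) : IsOpen (stripWedge a b δ β M) := by
  have h : stripWedge a b δ β M = (⋃ x ∈ realInterval a b, Metric.ball (x : ℂ) δ) ∪
      ⋃ e, ⋃ (_ : IsInfiniteEnd a b e), {z : ℂ | |z.im| < β * (sgn e * z.re - M)} := by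
    ext z
    rw [mem_stripWedge_iff]
    simp [mem_iUnion, mem_ofPred_eq, Metric.mem_ball, dist_eq_norm]
  rw [h]
  refine (isOpen_biUnion fun x _ => Metric.isOpen_ball).union (isOpen_iUnion fun e =>
    isOpen_iUnion fun _ => isOpen_lt (by fun_prop) (by fun_prop))

/-- In a wedge, a displacement by `ρ` changes `|Im z| - β |Re z|` by at most `ρ (1 + β)`. Shifting
the wedge by `1` leaves room `β`, whence `ρ ≤ β / (1 + β)`. -/
theorem exists_closedBall_subset_stripWedge {a b : EReal} {δ β M δ' β' M' : ℝ} (hδ : 0 < δ)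
    (hδ' : δ' ≤ δ / 2) (hβ' : 0 < β') (hβ : β' ≤ β) (hM : M + 1 ≤ M') : ∃ ρ > 0,
      ∀ z ∈ stripWedge a b δ' β' M', Metric.closedBall z ρ ⊆ stripWedge a b δ β M := by
  have hβ0 : 0 < β := hβ'.trans_le hβ
  set ρ := min (δ / 2) (β / (1 + β))
  have hρ : 0 < ρ := by positivity
  have hρβ : ρ * (1 + β) ≤ β := by
    rw [← le_div_iff₀ (by positivity)]
    exact min_le_right _ _
  refine ⟨ρ, hρ, fun z hz w hw => ?_⟩
  rw [Metric.mem_closedBall, dist_eq_norm] at hw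
  rw [mem_stripWedge_iff] at hz ⊢
  rcases hz with ⟨x, hx, h⟩ | ⟨e, he, h⟩
  · refine Or.inl ⟨x, hx, ?_⟩
    have h1 := norm_add_le (w - z) (z - x)
    rw [sub_add_sub_cancel] at h1
    linarith [min_le_left (δ / 2) (β / (1 + β))]
  · refine Or.inr ⟨e, he, ?_⟩
    have h1 := lt_of_abs_im_lt hβ' h
    have h2 : |w.im| ≤ |z.im| + ρ := by
      have h3 := abs_add_le (w - z).im z.im
      have h4 := (Complex.abs_im_le_norm (w - z)).trans hw
      rw [Complex.sub_im, sub_add_cancel] at h3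
      rw [Complex.sub_im] at h4
      linarith
    have h3 : sgn e * z.re ≤ sgn e * w.re + ρ := by
      have h4 : sgn e * (z.re - w.re) ≤ ρ := by
        refine (le_abs_self _).trans ?_
        rw [abs_mul, IntervalFlow.abs_sgn, one_mul, abs_sub_comm]
        exact (Complex.abs_re_le_norm (w - z)).trans hw
      linarith
    nlinarith

theorem stripWedge_subset_sigmoidRegion {a b : EReal} {δ β M : ℝ} (hδ : δ ≤ 1) (hβ : 0 < β)
    (hM : 1 ≤ M) : stripWedge a b δ β M ⊆ sigmoidRegion := by
  intro z hz
  rw [mem_stripWedge_iff] at hz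
  rcases hz with ⟨x, hx, h⟩ | ⟨e, he, h⟩
  · left
    have h1 := Complex.abs_im_le_norm (z - x)
    simp only [Complex.sub_im, Complex.ofReal_im, sub_zero] at h1
    linarith
  · right
    have h1 := lt_of_abs_im_lt hβ h
    have h2 := le_abs_self (sgn e * z.re)
    rw [abs_mul, IntervalFlow.abs_sgn, one_mul] at h2
    linarith

/-- A translation away from an end pushes points back towards the tip of that wedge by at most `h₁`,
so the wedges must recede by this amount. Contractions occur only without wedges and preserve the
strip by convexity. -/
theorem flow_mem_stripWedge {a b : EReal} {Φ : IntervalFlow a b} (l : Φ.Λ) {δ β M τ h₁ : ℝ}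
    (hβ : 0 < β) (hτ : 0 ≤ τ) (hτ₁ : τ ≤ h₁) {z : ℂ} (hz : z ∈ stripWedge a b δ β (M + h₁)) :
    (Φ.φ l).flow τ z ∈ stripWedge a b δ β M := by
  rw [mem_stripWedge_iff] at hz ⊢
  rcases Φ.flow_cases (𝕜 := ℂ) l with ⟨rfl, h⟩ | ⟨rfl, hb, h⟩ | ⟨ha, hb, y, hy, h⟩ <;> rw [h]
  · rcases hz with ⟨x, hx, hz⟩ | ⟨e, he, hz⟩
    · exact Or.inl ⟨x + τ, mem_realInterval_of_le_top hx (by linarith), by simpa using hz⟩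
    · refine Or.inr ⟨e, he, ?_⟩
      simp only [RCLike.ofReal_eq_complex_ofReal, Complex.add_im, Complex.ofReal_im, add_zero,
        Complex.add_re, Complex.ofReal_re]
      refine hz.trans_le (mul_le_mul_of_nonneg_left ?_ hβ.le)
      cases e <;> simp [IntervalFlow.sgn] <;> linarith
  · rcases hz with ⟨x, hx, hz⟩ | ⟨e, he, hz⟩
    · refine Or.inl ⟨x - τ, mem_realInterval_of_bot_le hx (by linarith), ?_⟩
      simpa using hz
    · refine Or.inr ⟨e, he, ?_⟩
      simp only [RCLike.ofReal_eq_complex_ofReal, Complex.sub_im, Complex.ofReal_im, sub_zero,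
        Complex.sub_re, Complex.ofReal_re]
      refine hz.trans_le (mul_le_mul_of_nonneg_left ?_ hβ.le)
      cases e <;> simp [IntervalFlow.sgn] <;> linarith
  · rcases hz with ⟨x, hx, hz⟩ | ⟨e, he, hz⟩
    · have h1 : Real.exp (-τ) ≤ 1 := Real.exp_le_one_iff.2 (neg_nonpos.2 hτ)
      refine Or.inl ⟨Real.exp (-τ) * x + (1 - Real.exp (-τ)) * y, (convex_realInterval a b) hx hy
        (Real.exp_pos _).le (sub_nonneg.2 h1) (add_sub_cancel _ _), ?_⟩
      have h2 : ((Real.exp (-τ) : ℝ) : ℂ) * z + ((1 - Real.exp (-τ) : ℝ) : ℂ) * y -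
          ((Real.exp (-τ) * x + (1 - Real.exp (-τ)) * y : ℝ) : ℂ) =
          ((Real.exp (-τ) : ℝ) : ℂ) * (z - x) := by
        push_cast
        ring
      refine lt_of_le_of_lt (le_of_eq (congrArg norm h2)) ?_
      rw [norm_mul, Complex.norm_real, Real.norm_of_nonneg (Real.exp_pos _).le]
      exact (mul_le_of_le_one_left (norm_nonneg _) h1).trans_lt hz
    · cases e
      · exact absurd (by simpa [IsInfiniteEnd] using he) ha
      · exact absurd (by simpa [IsInfiniteEnd] using he) hb

theorem frameData_complex {a b : EReal} (hab : a < b) (Φ : IntervalFlow a b) {δ β M h₁ : ℝ}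
    (hδ : 0 < δ) (hβ : 0 < β) (hh₁ : 0 < h₁) :
    IntervalFlow.FrameData ℂ a b Φ (IsInfiniteEnd a b) h₁
      (fun s => stripWedge a b δ β (M + s * h₁)) where
  h₁_pos := hh₁
  top h := by simpa [IsInfiniteEnd] using h
  bot h := by simpa [IsInfiniteEnd] using h
  uniq _ := (isOpen_stripWedge _ _ _ _ _).uniqueDiffOn
  locConvex s z hz := by
    obtain ⟨ε, hε, h⟩ := Metric.isOpen_iff.1 (isOpen_stripWedge a b δ β (M + s * h₁)) z hz
    refine ⟨ε, hε, ?_⟩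
    rw [inter_eq_right.2 h]
    exact convex_ball z ε
  anti s := stripWedge_subset le_rfl hβ le_rfl (by push_cast; linarith)
  nhds s z hz := by
    have h0 : z ∈ stripWedge a b δ β (M + (0 : ℕ) * h₁) := by
      refine stripWedge_subset le_rfl hβ le_rfl ?_ hz
      have : 0 ≤ (s : ℝ) * h₁ := by positivity
      push_cast
      linarith
    rw [(isOpen_stripWedge _ _ _ _ _).nhdsWithin_eq hz,
      (isOpen_stripWedge _ _ _ _ _).nhdsWithin_eq h0]
  real s x hx := ofReal_mem_stripWedge hδ hx
  ends e he s X := by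
    obtain ⟨x, hx, hX⟩ := IsInfiniteEnd.exists_mem hab he X
    exact ⟨x, ofReal_mem_stripWedge hδ hx, by simpa using hX⟩
  bounded ha hb := by
    lift a to ℝ using ⟨fun h => (h ▸ hab).not_ge le_top, ha⟩
    lift b to ℝ using ⟨hb, fun h => (h ▸ hab).not_ge bot_le⟩
    refine ⟨max |a| |b| + δ, fun z hz => ?_⟩
    rw [mem_stripWedge_iff] at hz
    rcases hz with ⟨x, hx, hz⟩ | ⟨e, he, -⟩
    · have h1 : |x| ≤ max |a| |b| :=
        abs_le_max_abs_abs (EReal.coe_le_coe_iff.1 hx.1) (EReal.coe_le_coe_iff.1 hx.2)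
      have h2 := norm_add_le ((x : ℝ) : ℂ) (z - x)
      rw [add_sub_cancel, Complex.norm_real, Real.norm_eq_abs] at h2
      linarith
    · cases e <;> simp [IsInfiniteEnd] at he
  maps l s τ hτ z hz := by
    refine flow_mem_stripWedge l hβ hτ.1 hτ.2 ?_
    refine stripWedge_subset le_rfl hβ le_rfl (le_of_eq ?_) hz
    push_cast
    ring

/-- Cauchy's estimates for a family of holomorphic functions. -/
theorem BddSmooth.of_differentiableOn {ι E : Type*} [NormedAddCommGroup E] [NormedSpace ℂ E]
    [CompleteSpace E] (n : ℕ) {w : ℂ → ℝ} {U Ω : Set ℂ} (hU : IsOpen U) (hΩ : IsOpen Ω) {F : ι → ℂ → E}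
    (hF : ∀ i, DifferentiableOn ℂ (F i) U) (hb : ∃ C, ∀ i, ∀ z ∈ U, ‖F i z‖ ≤ C * w z)
    (hw0 : ∀ z, 0 ≤ w z) {ρ c : ℝ} (hρ : 0 < ρ) (hw : ∀ z z', ‖z' - z‖ ≤ ρ → w z' ≤ c * w z)
    (hs : ∀ z ∈ Ω, Metric.closedBall z ρ ⊆ U) : BddSmooth ℂ n w Ω F := by
  obtain ⟨C, hC⟩ := hb
  have hΩU : Ω ⊆ U := fun z hz => hs z hz (Metric.mem_closedBall_self hρ.le)
  refine ⟨fun i => ((hF i).contDiffOn hU).mono hΩU,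
    ∑ j ∈ Finset.range (n + 1), (j.factorial : ℝ) * (|C| * c) / ρ ^ j, fun i j hj z hz => ?_⟩
  rw [norm_iteratedFDerivWithin_eq_norm_iteratedDerivWithin, iteratedDerivWithin_of_isOpen hΩ hz]
  have hc : ∀ z, 0 ≤ c * w z := fun z => (hw0 z).trans (hw z z (by simpa using hρ.le))
  have h1 := Complex.norm_iteratedDeriv_le_of_forall_mem_sphere_norm_le (n := j) (f := F i) (c := z)
    (C := |C| * (c * w z)) hρ (((hF i).mono (hs z hz)).diffContOnCl_ball subset_rfl)
    (fun z' hz' => by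
      have h2 : ‖z' - z‖ = ρ := by simpa [dist_eq_norm] using hz'
      refine (hC i z' (hs z hz (Metric.sphere_subset_closedBall hz'))).trans ?_
      exact (mul_le_mul_of_nonneg_right (le_abs_self C) (hw0 _)).trans
        (mul_le_mul_of_nonneg_left (hw z z' h2.le) (abs_nonneg C)))
  refine h1.trans ?_
  have h2 : (j.factorial : ℝ) * (|C| * (c * w z)) / ρ ^ j =
      (j.factorial : ℝ) * (|C| * 1) / ρ ^ j * (c * w z) := by ring
  have h3 : ∑ j ∈ Finset.range (n + 1), (j.factorial : ℝ) * (|C| * c) / ρ ^ j * w z =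
      ∑ j ∈ Finset.range (n + 1), (j.factorial : ℝ) * (|C| * 1) / ρ ^ j * (c * w z) :=
    Finset.sum_congr rfl fun _ _ => by ring
  rw [Finset.sum_mul, h3, h2]
  refine Finset.single_le_sum (f := fun j : ℕ => (j.factorial : ℝ) * (|C| * 1) / ρ ^ j * (c * w z))
    (fun i _ => ?_) (Finset.mem_range.2 (by omega))
  exact mul_nonneg (by positivity) (hc z)

theorem weight_le_mul_weight {η : ℝ} (hη : 0 ≤ η) (e : Bool) {ρ : ℝ} (z z' : ℂ)
    (h : ‖z' - z‖ ≤ ρ) : weight η e z' ≤ Real.exp (η * ρ) * weight η e z := by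
  rw [weight, weight, ← Real.exp_add]
  refine Real.exp_le_exp.2 ?_
  have h4 : sgn e * (z.re - z'.re) ≤ ρ := by
    refine (le_abs_self _).trans ?_
    rw [abs_mul, IntervalFlow.abs_sgn, one_mul, abs_sub_comm]
    exact (Complex.abs_re_le_norm (z' - z)).trans h
  have h5 := mul_le_mul_of_nonneg_left h4 hη
  simp only [RCLike.re_eq_complex_re]
  nlinarith

/-- The hypothesis bounds the decay of `G` only, not of its derivatives. Cauchy estimates on discs
of fixed radius, over which the weight varies by a bounded factor, give it for all derivatives in
`z`. -/
theorem IsAnalyticExtension.cls {a b : EReal} (hab : a < b) {Φ : IntervalFlow a b} {E : Type}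
    [NormedAddCommGroup E] [NormedSpace ℝ E] [NormedSpace ℂ E] [IsScalarTower ℝ ℂ E]
    [CompleteSpace E] {n : ℕ} {U : Set ℂ} {h₀ : ℝ} (hh₀ : 0 < h₀) {F : ℝ → ℝ → E} {G : ℂ → ℝ → E}
    {Lp Lm : ℝ → E} (hG : IsAnalyticExtension n a b U h₀ F G Lp Lm) (hU : IsOpen U)
    (hUI : ∀ x ∈ realInterval a b, (x : ℂ) ∈ U) : ∃ η₀ > 0, ∀ η (hη : 0 < η), η ≤ η₀ →
      ∀ h₁ Ω (D : IntervalFlow.FrameData ℂ a b Φ (IsInfiniteEnd a b) h₁ Ω), h₁ ≤ h₀ →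
      IsOpen (Ω 0) → (∃ ρ > 0, ∀ z ∈ Ω 0, Metric.closedBall z ρ ⊆ U) →
      (D.frame 1 hη).Cls 0 False n G := by
  obtain ⟨-, hdiff, hC, C, η₀, hη₀, htail⟩ := hG
  refine ⟨η₀, hη₀, fun η hη hηη₀ h₁ Ω D hh₁ hΩ ⟨ρ, hρ, hball⟩ => ?_⟩
  obtain ⟨C₀, hC₀0, hC₀⟩ := hC.bddSmooth.bound_one
  have hsub : Icc 0 h₁ ⊆ Icc 0 h₀ := Icc_subset_Icc_right hh₁
  have hΩU : Ω 0 ⊆ U := fun z hz => hball z hz (Metric.mem_closedBall_self hρ.le)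
  have hd : ∀ h : Icc 0 h₁, DifferentiableOn ℂ (fun z => G z h) U := fun h => hdiff h (hsub h.2)
  refine ⟨hC.bddSmooth.mono_set (hU.uniqueDiffOn.prod (uniqueDiffOn_Icc hh₀))
      ((D.frame 1 hη).uniq_dom 0) (prod_mono hΩU hsub), ?_, fun e => ?_⟩
  · exact BddSmooth.of_differentiableOn (c := 1) _ hU hΩ hd ⟨C₀, fun h z hz => by
      simpa using hC₀ () (z, h) ⟨hz, hsub h.2⟩⟩ (fun _ => zero_le_one) hρ (by simp) hball
  obtain ⟨e, he⟩ := e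
  have ht : ∀ h ∈ Icc 0 h₀, ∀ z ∈ U, 0 ≤ sgn e * z.re →
      ‖G z h - (if e then Lp h else Lm h)‖ ≤ |C| * weight η e z := by
    intro h hh z hz h0
    have h1 : ‖G z h - (if e then Lp h else Lm h)‖ ≤ C * Real.exp (-(η₀ * (sgn e * z.re))) := by
      cases e
      · have := (htail h hh z hz).2 (by simpa [IsInfiniteEnd] using he)
          (by simpa [IntervalFlow.sgn] using h0)
        simpa [IntervalFlow.sgn] using this
      · have := (htail h hh z hz).1 (by simpa [IsInfiniteEnd] using he)
          (by simpa [IntervalFlow.sgn] using h0)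
        simpa [IntervalFlow.sgn] using this
    refine h1.trans (mul_le_mul (le_abs_self C) (Real.exp_le_exp.2 (neg_le_neg ?_))
      (Real.exp_pos _).le (abs_nonneg C))
    exact mul_le_mul_of_nonneg_right hηη₀ h0
  obtain ⟨x, hx, hx0⟩ := he.exists_mem hab 0
  have hw1 : ∀ z : ℂ, 0 ≤ sgn e * z.re → weight η e z ≤ 1 := fun z hz => by
    rw [weight, Real.exp_le_one_iff, neg_nonpos]
    exact mul_nonneg hη.le hz
  have hw2 : ∀ z : ℂ, sgn e * z.re ≤ 0 → 1 ≤ weight η e z := fun z hz => by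
    rw [weight, Real.one_le_exp_iff, neg_nonneg]
    exact mul_nonpos_of_nonneg_of_nonpos hη.le hz
  have hL : ∀ h ∈ Icc 0 h₀, ‖(if e then Lp h else Lm h)‖ ≤ C₀ + |C| := by
    intro h hh
    have h1 := ht h hh x (hUI x hx) (by simpa using hx0)
    have h2 := hC₀ () ((x : ℂ), h) ⟨hUI x hx, hh⟩
    have h3 := norm_sub_le (G x h) (G x h - (if e then Lp h else Lm h))
    rw [sub_sub_cancel] at h3
    refine h3.trans (add_le_add h2 (h1.trans ?_))
    exact mul_le_of_le_one_right (abs_nonneg C) (hw1 x (by simpa using hx0))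
  refine ⟨fun h => if e then Lp h else Lm h, False.elim, ?_⟩
  refine BddSmooth.of_differentiableOn (c := Real.exp (η * ρ)) _ hU hΩ
    (fun h => (hd h).sub (differentiableOn_const _)) ⟨2 * C₀ + |C|, fun h z hz => ?_⟩
    (fun z => (Real.exp_pos _).le) hρ (weight_le_mul_weight hη.le e) hball
  have hpos : 0 < weight η e z := Real.exp_pos _
  rcases le_total 0 (sgn e * z.re) with h0 | h0
  · refine (ht h (hsub h.2) z hz h0).trans (mul_le_mul_of_nonneg_right ?_ hpos.le)
    linarith
  · have h1 := hC₀ () (z, (h : ℝ)) ⟨hz, hsub h.2⟩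
    have h2 := (norm_sub_le (G z h) (if e then Lp h else Lm h)).trans
      (add_le_add h1 (hL h (hsub h.2)))
    calc _ ≤ (2 * C₀ + |C|) * 1 := by linarith
      _ ≤ _ := mul_le_mul_of_nonneg_left (hw2 z h0) (by positivity)

/-- Close to the real interval by a Lipschitz bound; far out in a wedge because the values at `z`
and at its real part are both near the limit. Estimates on the interval thus extend to a complex
region. -/
theorem Frame.Cls.exists_near {a b : EReal} {Φ : IntervalFlow a b} {E : Type}
    [NormedAddCommGroup E] [NormedSpace ℝ E] [NormedSpace ℂ E] [IsScalarTower ℝ ℂ E]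
    {n : ℕ} (hn : 1 ≤ n) {h₁ : ℝ} {Ω : ℕ → Set ℂ}
    {D : IntervalFlow.FrameData ℂ a b Φ (IsInfiniteEnd a b) h₁ Ω} {σ : ℕ} {η : ℝ} (hη : 0 < η)
    {f : ℂ → ℝ → E} (hf : (D.frame σ hη).Cls 0 False n f) {δ : ℝ} (hδ : 0 < δ)
    (hball : ∀ x ∈ realInterval a b, Metric.ball (x : ℂ) δ ⊆ Ω 0) {κ : ℝ} (hκ : 0 < κ) :
    ∃ δ₀ > 0, ∃ M₀, ∀ h ∈ Icc 0 h₁, ∀ z ∈ Ω 0, ∀ x ∈ realInterval a b,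
      (‖z - x‖ < δ₀ ∨ ∃ e, IsInfiniteEnd a b e ∧ M₀ ≤ sgn e * z.re ∧ x = z.re) →
      ‖f z h - f x h‖ ≤ κ := by
  obtain ⟨C, hC0, hC⟩ := hf.joint.exists_lipschitz hn ((D.frame σ hη).uniq_dom 0)
  have ht : ∀ e, ∃ M₀, IsInfiniteEnd a b e → ∀ h ∈ Icc 0 h₁, ∀ z ∈ Ω 0, ∀ x ∈ realInterval a b,
      M₀ ≤ sgn e * z.re → x = z.re → ‖f z h - f x h‖ ≤ κ := by
    intro e
    by_cases he : IsInfiniteEnd a b e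
    · obtain ⟨L, -, hL⟩ := hf.tail ⟨e, he⟩
      obtain ⟨C', hC'⟩ := hL.bound
      have h1 : Tendsto (fun t : ℝ => 2 * |C'| * Real.exp (-(η * t))) atTop (𝓝 (2 * |C'| * 0)) :=
        (Real.tendsto_exp_neg_atTop_nhds_zero.comp (tendsto_id.const_mul_atTop hη)).const_mul _
      rw [mul_zero] at h1
      obtain ⟨M₀, hM₀⟩ := eventually_atTop.1 (h1.eventually_le_const hκ)
      refine ⟨M₀, fun _ h hh z hz x hx hM hxz => ?_⟩
      have h2 := hC' ⟨h, hh⟩ z hz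
      have h3 := hC' ⟨h, hh⟩ x (D.real 0 x hx)
      have h4 : (D.frame σ hη).w ⟨e, he⟩ z = Real.exp (-(η * (sgn e * z.re))) := rfl
      have h5 : (D.frame σ hη).w ⟨e, he⟩ (x : ℂ) = Real.exp (-(η * (sgn e * z.re))) := by
        rw [hxz]; rfl
      rw [h4] at h2
      rw [h5] at h3
      have h6 := norm_sub_le (f z h - L h) (f x h - L h)
      rw [sub_sub_sub_cancel_right] at h6
      have h7 := hM₀ _ hM
      have h8 := mul_le_mul_of_nonneg_right (le_abs_self C')
        (Real.exp_pos (-(η * (sgn e * z.re)))).le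
      linarith
    · exact ⟨0, fun h => absurd h he⟩
  choose M₀ hM₀ using ht
  refine ⟨min δ (κ / (C + 1)), by positivity, max (M₀ true) (M₀ false), fun h hh z hz x hx hzx => ?_⟩
  rcases hzx with hzx | ⟨e, he, hM, hxz⟩
  · have h1 := hC (Metric.ball (x : ℂ) δ ×ˢ Icc 0 h₁) (prod_mono (hball x hx) subset_rfl)
      ((convex_ball _ _).prod (convex_Icc _ _)) () (z, h)
      ⟨by simpa [dist_eq_norm] using hzx.trans_le (min_le_left _ _), hh⟩ ((x : ℂ), h)
      ⟨Metric.mem_ball_self hδ, hh⟩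
    have h2 : ‖((z, h) : ℂ × ℝ) - ((x : ℂ), h)‖ = ‖z - x‖ := by
      simp [Prod.norm_def]
    rw [h2] at h1
    have h3 := hzx.le.trans (min_le_right _ _)
    rw [le_div_iff₀ (by positivity)] at h3
    refine h1.trans (le_trans ?_ h3)
    nlinarith [norm_nonneg (z - x)]
  · refine hM₀ e he h hh z hz x hx (le_trans ?_ hM) hxz
    cases e
    · exact le_max_right _ _
    · exact le_max_left _ _

theorem exists_real_near {a b : EReal} (hab : a < b) : ∃ M₀ : ℝ, ∀ δ β M : ℝ, 0 < β → M₀ ≤ M →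
    ∀ z ∈ stripWedge a b δ β M, ∃ x ∈ realInterval a b,
      ‖z - x‖ < δ ∨ ∃ e, IsInfiniteEnd a b e ∧ M ≤ sgn e * z.re ∧ x = z.re := by
  obtain ⟨p, q, hpq, hs⟩ := exists_lt_subset_realInterval hab
  have hp := hs (left_mem_Icc.2 hpq.le)
  refine ⟨|p|, fun δ β M hβ hM z hz => ?_⟩
  rcases mem_stripWedge_iff.1 hz with ⟨x, hx, h⟩ | ⟨e, he, h⟩
  · exact ⟨x, hx, Or.inl h⟩
  · have h1 := lt_of_abs_im_lt hβ h
    refine ⟨z.re, ?_, Or.inr ⟨e, he, h1.le, rfl⟩⟩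
    have h2 := abs_le.1 hM
    cases e
    · obtain rfl : a = ⊥ := by simpa [IsInfiniteEnd] using he
      simp only [IntervalFlow.sgn, Bool.false_eq_true, if_false] at h1
      exact mem_realInterval_of_bot_le hp (by linarith)
    · obtain rfl : b = ⊤ := by simpa [IsInfiniteEnd] using he
      simp only [IntervalFlow.sgn, if_true] at h1
      exact mem_realInterval_of_le_top hp (by linarith)

theorem norm_deriv_le_of_norm_fderivWithin_le {𝕜 E : Type*} [NontriviallyNormedField 𝕜]
    [NormedAddCommGroup E] [NormedSpace 𝕜 E] {f : 𝕜 → E} {U : Set 𝕜} {z : 𝕜} (hU : U ∈ 𝓝 z) {C : ℝ}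
    (h : ‖fderivWithin 𝕜 f U z‖ ≤ C) : ‖deriv f z‖ ≤ C := by
  rwa [norm_deriv_eq_norm_fderiv, ← fderivWithin_of_mem_nhds hU]

/-- Block-diagonalization on a strip with wedges. -/
theorem exists_complex_blockDiag {n₁ n₂ r : ℕ} (hr : 1 ≤ r) {a b : EReal} (hab : a < b)
    {h₀ : ℝ} (hh₀ : 0 < h₀) {A : ℝ → ℝ → Matrix (Fin n₁ ⊕ Fin n₂) (Fin n₁ ⊕ Fin n₂) ℂ}
    (hA : UniformCOn r A (realInterval a b) h₀) {lam : Fin n₁ → ℝ → ℂ} {mu : Fin n₂ → ℝ → ℂ}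
    (hlam : ∀ i, ContinuousOn (lam i) (realInterval a b))
    (hmu : ∀ j, ContinuousOn (mu j) (realInterval a b))
    (hchar : ∀ x ∈ realInterval a b, (A x 0).charpoly =
      (∏ i, (Polynomial.X - Polynomial.C (lam i x))) *
        ∏ j, (Polynomial.X - Polynomial.C (mu j x)))
    {d : ℝ} (hd : 0 < d) (hsep : ∀ x ∈ realInterval a b, ∀ i j, d ≤ ‖lam i x - mu j x‖)
    (Φ : IntervalFlow a b) {δ β M : ℝ} (hδ : 0 < δ) (hβ : 0 < β)
    {G : ℂ → ℝ → Matrix (Fin n₁ ⊕ Fin n₂) (Fin n₁ ⊕ Fin n₂) ℂ}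
    {Lp Lm : ℝ → Matrix (Fin n₁ ⊕ Fin n₂) (Fin n₁ ⊕ Fin n₂) ℂ}
    (hG : IsAnalyticExtension r a b (stripWedge a b δ β M) h₀ A G Lp Lm) :
    ∃ h₁, h₁ ≤ h₀ ∧ ∃ δ' M', 0 < δ' ∧
      ∃ (D : IntervalFlow.FrameData ℂ a b Φ (IsInfiniteEnd a b) h₁
        (fun s => stripWedge a b δ' β (M' + s * h₁))) (η : ℝ) (hη : 0 < η),
      ∃ s T T' Tinv A₁₁ A₂₂ θ₁ θ₂,
      (D.frame 1 hη).BlockDiag s r G T T' Tinv A₁₁ A₂₂ θ₁ θ₂ := by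
  have hI := uniqueDiffOn_realInterval hab
  have h0 : (0 : ℝ) ∈ Icc 0 h₀ := ⟨le_rfl, hh₀.le⟩
  obtain ⟨R, hR0, hR⟩ := hA.bddSmooth.bound_one
  obtain ⟨K, q, ε', ε, C, hK, hq, hε', hsmall, hε, htol⟩ :=
    Matrix.exists_triangularization_tolerance (Fin n₁) (Fin n₂) hR0 hd
  obtain ⟨S, hS, hSV, hSt, hSb⟩ := exists_interval_triangularizer hr hab hh₀ hA hlam hmu hchar hd
    hsep (ε := ε / 4) (by positivity)
  obtain ⟨CA, hCA0, hCA⟩ := hA.bddSmooth.exists_lipschitz hr (hI.prod (uniqueDiffOn_Icc hh₀))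
  obtain ⟨η₀, hη₀, hGc⟩ := IsAnalyticExtension.cls hab (Φ := Φ) hh₀ hG
    (isOpen_stripWedge a b δ β M) fun x hx => ofReal_mem_stripWedge hδ hx
  -- The bound `1` is the decay rate of the sigmoid function.
  set η := min η₀ 1
  have hη : 0 < η := by positivity
  set δ₁ := min (δ / 2) 1
  have hδ₁ : 0 < δ₁ := by positivity
  set M₁ := max (M + 1) 1
  have hGc' : ∀ {h₁ δ' M'} (D : IntervalFlow.FrameData ℂ a b Φ (IsInfiniteEnd a b) h₁
      (fun s => stripWedge a b δ' β (M' + s * h₁))), h₁ ≤ h₀ → δ' ≤ δ₁ → M₁ ≤ M' →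
      (D.frame 1 hη).Cls 0 False r G := fun {h₁ δ' M'} D hh hδ' hM' =>
    hGc η hη (min_le_left _ _) _ _ D hh (isOpen_stripWedge _ _ _ _ _) <| by
      refine exists_closedBall_subset_stripWedge hδ (hδ'.trans (min_le_left _ _)) hβ le_rfl ?_
      simpa using (le_max_left _ _).trans hM'
  -- The limits of `A` on the real line, read off from the extension, make the real triangularizer
  -- constant near the infinite ends. This is required for its approximation by polynomials in the
  -- sigmoid function.
  have hlim : ∀ e, IsInfiniteEnd a b e → ∃ L, ∀ {l : Filter ℝ}, (∀ᶠ x in l, x ∈ realInterval a b) →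
      Tendsto (fun x => IntervalFlow.sgn e * x) l atTop → Tendsto (fun x => A x 0) l (𝓝 L) := by
    intro e he
    have D₁ := frameData_complex hab Φ (M := M₁) hδ₁ hβ hh₀
    obtain ⟨L, -, hL⟩ := (hGc' D₁ le_rfl le_rfl le_rfl).tail ⟨e, he⟩
    obtain ⟨C', hC'⟩ := hL.bound
    refine ⟨L 0, fun {l} hl ht => ?_⟩
    refine tendsto_iff_norm_sub_tendsto_zero.2 ?_
    have h1 : Tendsto (fun x : ℝ => C' * Real.exp (-(η * (IntervalFlow.sgn e * x)))) l
        (𝓝 (C' * 0)) :=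
      (Real.tendsto_exp_neg_atTop_nhds_zero.comp (ht.const_mul_atTop hη)).const_mul _
    rw [mul_zero] at h1
    refine squeeze_zero' (Eventually.of_forall fun _ => norm_nonneg _) ?_ h1
    filter_upwards [hl] with x hx
    rw [← hG.1 x hx 0 h0]
    exact hC' ⟨0, h0⟩ x (D₁.real 0 x hx)
  obtain ⟨p, hp⟩ := Matrix.exists_polynomial_sigmoid_near (ε := ε / 4)
    (contDiffOn_univ.1 ((hS 1).1 ())).continuous
    (hSt fun hb => by
      have he : IsInfiniteEnd a b true := by simpa [IsInfiniteEnd] using hb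
      obtain ⟨L, hL⟩ := hlim true he
      obtain ⟨x, hx, -⟩ := he.exists_mem hab 0
      subst hb
      refine ⟨L, hL ?_ ?_⟩
      · filter_upwards [eventually_ge_atTop x] with y hy
        exact mem_realInterval_of_le_top hx hy
      · simp only [IntervalFlow.sgn, if_true, one_mul]
        exact tendsto_id)
    (hSb fun ha => by
      have he : IsInfiniteEnd a b false := by simpa [IsInfiniteEnd] using ha
      obtain ⟨L, hL⟩ := hlim false he
      obtain ⟨x, hx, -⟩ := he.exists_mem hab 0
      subst ha
      refine ⟨L, hL ?_ ?_⟩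
      · filter_upwards [eventually_le_atBot x] with y hy
        exact mem_realInterval_of_bot_le hx hy
      · simpa [IntervalFlow.sgn] using tendsto_neg_atBot_atTop) (by positivity)
  set Sp : ℂ → Matrix (Fin n₁ ⊕ Fin n₂) (Fin n₁ ⊕ Fin n₂) ℂ :=
    fun z => Matrix.of fun i j => (p i j).eval (csigmoid z)
  have hSc : ∀ {h₁ δ' M'} (D : IntervalFlow.FrameData ℂ a b Φ (IsInfiniteEnd a b) h₁
      (fun s => stripWedge a b δ' β (M' + s * h₁))), δ' ≤ δ₁ → M₁ ≤ M' →
      (D.frame 1 hη).Cls 0 False (r + 1) (fun z _ => Sp z) := fun {h₁ δ' M'} D hδ' hM' => by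
    refine Frame.Cls.matrix_of fun i j => Frame.Cls.polynomial_eval
      (Frame.Cls.csigmoid hη (min_le_right _ _) ?_) (p i j)
    refine stripWedge_subset_sigmoidRegion (hδ'.trans (min_le_right _ _)) hβ ?_
    simpa using (le_max_right _ _).trans hM'
  -- A provisional region: the constants for `G` and for the holomorphic triangularizer are fixed
  -- here, before `h₁` and the final region are chosen in terms of them.
  have D₁ := frameData_complex hab Φ (M := M₁) hδ₁ hβ hh₀
  have hball : ∀ x ∈ realInterval a b, Metric.ball (x : ℂ) δ₁ ⊆
      stripWedge a b δ₁ β (M₁ + (0 : ℕ) * h₀) := fun x hx z hz =>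
    mem_stripWedge_iff.2 (Or.inl ⟨x, hx, by simpa [dist_eq_norm] using hz⟩)
  have hS₁ := hSc D₁ le_rfl le_rfl
  obtain ⟨δG, hδG, MG, hGn⟩ := (hGc' D₁ le_rfl le_rfl le_rfl).exists_near hr hη hδ₁ hball
    (κ := ε / 4) (by positivity)
  obtain ⟨δS, hδS, MS, hSn⟩ := hS₁.exists_near (by omega) hη hδ₁ hball
    (κ := ε / 4) (by positivity)
  obtain ⟨MI, hMI⟩ := exists_real_near hab
  obtain ⟨CS, hCS0, hCS⟩ := ((hS₁.slice.of_le (m := 0 + 1) (by omega)).fderivWithin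
    (D₁.uniq 0).mono_field).bound_one
  set h₁ := min h₀ (min (ε / 4 / (CA + 1)) (ε / (CS + 1)))
  have hh₁ : 0 < h₁ := by positivity
  have hh₁₀ : h₁ ≤ h₀ := min_le_left _ _
  have hh₁A : CA * h₁ ≤ ε / 4 := by
    have h1 : h₁ ≤ ε / 4 / (CA + 1) := (min_le_right _ _).trans (min_le_left _ _)
    rw [le_div_iff₀ (by positivity)] at h1
    nlinarith
  have hh₁S : h₁ * CS ≤ ε := by
    have h1 : h₁ ≤ ε / (CS + 1) := (min_le_right _ _).trans (min_le_right _ _)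
    rw [le_div_iff₀ (by positivity)] at h1
    nlinarith
  have hsub : Icc 0 h₁ ⊆ Icc 0 h₀ := Icc_subset_Icc_right hh₁₀
  -- Every point of the final region is compared with a real point: in the strip it is closer than
  -- `δ'`, and in a wedge its real part is beyond `M'`. The deviation from the triangular form then
  -- consists of three terms of size `ε / 4`, both for `A` and for `S`.
  set δ' := min δ₁ (min δG δS)
  have hδ' : 0 < δ' := by positivity
  set M' := max M₁ (max (max MG MS) MI)
  have hM'G : MG ≤ M' := (le_max_left _ _).trans ((le_max_left _ _).trans (le_max_right _ _))
  have hM'S : MS ≤ M' := (le_max_right _ _).trans ((le_max_left _ _).trans (le_max_right _ _))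
  have hM'I : MI ≤ M' := (le_max_right _ _).trans (le_max_right _ _)
  have hM'1 : M₁ ≤ M' := le_max_left _ _
  have D := frameData_complex hab Φ (M := M') hδ' hβ hh₁
  refine ⟨h₁, hh₁₀, δ', M', hδ', D, η, hη, ?_⟩
  refine Frame.exists_blockDiag_of_tolerance hr (hGc' D hh₁₀ (min_le_left _ _) hM'1)
    (hSc D (min_le_left _ _) hM'1) hK hq hε' hsmall (C := C) fun z hz h hh E hE => ?_
  have hz' : z ∈ stripWedge a b δ' β M' := by
    have h : z ∈ stripWedge a b δ' β (M' + (0 : ℕ) * h₁) := hz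
    simpa using h
  have hz₁ : z ∈ stripWedge a b δ₁ β (M₁ + (0 : ℕ) * h₀) := by
    simpa using stripWedge_subset (min_le_left _ _) hβ le_rfl hM'1 hz'
  obtain ⟨x, hx, hzx⟩ := hMI δ' β M' hβ hM'I z hz'
  obtain ⟨y, hy, V, hV, h1, h2⟩ := hSV x hx
  have h3 := hGn h (hsub hh) z hz₁ x hx (hzx.imp
    (fun h => h.trans_le ((min_le_right _ _).trans (min_le_left _ _)))
    fun ⟨e, he, hM, hxz⟩ => ⟨e, he, hM'G.trans hM, hxz⟩)
  have h4 := hSn h (hsub hh) z hz₁ x hx (hzx.imp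
    (fun h => h.trans_le ((min_le_right _ _).trans (min_le_right _ _)))
    fun ⟨e, he, hM, hxz⟩ => ⟨e, he, hM'S.trans hM, hxz⟩)
  rw [hG.1 x hx h (hsub hh)] at h3
  refine htol (G z h) (A y 0) (Sp z) V E _ _ (hR () (y, 0) ⟨hy, h0⟩) hV (hsep y hy) ?_ ?_ ?_
  · have h5 := hCA _ subset_rfl ((convex_realInterval a b).prod (convex_Icc 0 h₀)) () (x, h)
      ⟨hx, hsub hh⟩ (x, 0) ⟨hx, h0⟩
    have h6 : ‖((x, h) : ℝ × ℝ) - (x, 0)‖ ≤ h₁ := by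
      simp only [Prod.mk_sub_mk, sub_self, sub_zero, Prod.norm_def, norm_zero]
      rw [max_eq_right (norm_nonneg _), Real.norm_of_nonneg hh.1]
      exact hh.2
    have h7 : ‖A x h - A x 0‖ ≤ ε / 4 :=
      h5.trans ((mul_le_mul_of_nonneg_left h6 hCA0).trans hh₁A)
    have h8 : G z h - A y 0 = (G z h - A x h) + (A x h - A x 0) + (A x 0 - A y 0) := by abel
    rw [h8]
    linarith [norm_add₃_le (a := G z h - A x h) (b := A x h - A x 0) (c := A x 0 - A y 0)]
  · have h5 := hp x
    rw [norm_sub_rev] at h5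
    have h8 : Sp z - V = (Sp z - Sp x) + (Sp x - S x) + (S x - V) := by abel
    rw [h8]
    linarith [norm_add₃_le (a := Sp z - Sp x) (b := Sp x - S x) (c := S x - V)]
  · have hn : stripWedge a b δ₁ β (M₁ + (0 : ℕ) * h₀) ∈ 𝓝 z :=
      (isOpen_stripWedge _ _ _ _ _).mem_nhds hz₁
    have h3 : HasDerivAt Sp (deriv Sp z) z :=
      ((((hS₁.slice.1 ⟨0, h0⟩).differentiableOn (by simp)) z hz₁).differentiableAt hn).hasDerivAt
    have h4 : (D.frame 1 hη).der (fun v _ => Sp v) z h = deriv Sp z :=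
      Frame.der_eq_of_hasDerivWithinAt (s := 0) (P := D.frame 1 hη) (f := fun v _ => Sp v) hz
        h3.hasDerivWithinAt
    have h7 := norm_deriv_le_of_norm_fderivWithin_le hn (hCS ⟨0, h0⟩ z hz₁)
    rw [hE, h4, norm_smul, Real.norm_of_nonneg hh.1]
    exact (mul_le_mul hh.2 h7 (norm_nonneg _) hh₁.le).trans hh₁S

theorem IsAnalyticExtension.mono {E : Type} [NormedAddCommGroup E] [NormedSpace ℝ E]
    [NormedSpace ℂ E] {n : ℕ} {a b : EReal} {U U' : Set ℂ} {h₀ : ℝ} (hh₀ : 0 < h₀) {F : ℝ → ℝ → E}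
    {G : ℂ → ℝ → E} {Lp Lm : ℝ → E} (hG : IsAnalyticExtension n a b U h₀ F G Lp Lm)
    (hU : IsOpen U) (hU' : IsOpen U') (hs : U' ⊆ U) : IsAnalyticExtension n a b U' h₀ F G Lp Lm := by
  obtain ⟨h1, h2, h3, C, η, hη, h4⟩ := hG
  refine ⟨h1, fun h hh => (h2 h hh).mono hs, ?_, C, η, hη, fun h hh z hz => h4 h hh z (hs hz)⟩
  exact (h3.bddSmooth.mono_set (hU.uniqueDiffOn.prod (uniqueDiffOn_Icc hh₀))
    (hU'.uniqueDiffOn.prod (uniqueDiffOn_Icc hh₀)) (prod_mono hs subset_rfl)).uniformCOn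

end

/-! ### Assembly -/

theorem theorem1p1
    (n₁ n₂ r : ℕ) (a b : EReal) (hab : a < b) (h₀ : ℝ) (hh₀ : 0 < h₀)
    (A : ℝ → ℝ → Matrix (Fin n₁ ⊕ Fin n₂) (Fin n₁ ⊕ Fin n₂) ℂ)
    (hA : UniformCOn r A (realInterval a b) h₀)
    -- the two groups of eigenvalues of `A(x, 0)`, listed with multiplicity
    (lam : Fin n₁ → ℝ → ℂ) (mu : Fin n₂ → ℝ → ℂ)
    (hlam : ∀ i, ContinuousOn (lam i) (realInterval a b))
    (hmu : ∀ j, ContinuousOn (mu j) (realInterval a b))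
    (hchar : ∀ x ∈ realInterval a b, (A x 0).charpoly =
      (∏ i, (Polynomial.X - Polynomial.C (lam i x))) *
        ∏ j, (Polynomial.X - Polynomial.C (mu j x)))
    (d : ℝ) (hd : 0 < d)
    (hsep : ∀ x ∈ realInterval a b, ∀ i j, d ≤ ‖lam i x - mu j x‖) :
    ∃ h₁ : ℝ, 0 < h₁ ∧ h₁ ≤ h₀ ∧
    ∃ (T : ℕ → ℝ → ℝ → Matrix (Fin n₁ ⊕ Fin n₂) (Fin n₁ ⊕ Fin n₂) ℂ)
      (A₁₁ : ℕ → ℝ → ℝ → Matrix (Fin n₁) (Fin n₁) ℂ)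
      (A₂₂ : ℕ → ℝ → ℝ → Matrix (Fin n₂) (Fin n₂) ℂ)
      (θ₁ : ℕ → ℝ → ℝ → Matrix (Fin n₁) (Fin n₂) ℂ)
      (θ₂ : ℕ → ℝ → ℝ → Matrix (Fin n₂) (Fin n₁) ℂ),
      -- approximate block-diagonalization, for each `1 ≤ k ≤ r`
      (∀ k, 1 ≤ k → k ≤ r →
        UniformCOn r (T k) (realInterval a b) h₁ ∧
        UniformlyInvertibleOn (T k) (realInterval a b) h₁ ∧
        UniformCOn (r - k) (A₁₁ k) (realInterval a b) h₁ ∧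
        UniformCOn (r - k) (A₂₂ k) (realInterval a b) h₁ ∧
        UniformCOn (r - k) (θ₁ k) (realInterval a b) h₁ ∧
        UniformCOn (r - k) (θ₂ k) (realInterval a b) h₁ ∧
        ∀ h ∈ Set.Ioc (0 : ℝ) h₁, ∀ V : ℝ → (Fin n₁ ⊕ Fin n₂) → ℂ,
          SolvesOn (realInterval a b) h (fun x => A x h) (fun x => (T k x h).mulVec (V x)) ↔
          SolvesOn (realInterval a b) h
            (fun x => blockSystem k h (A₁₁ k x h) (A₂₂ k x h) (θ₁ k x h) (θ₂ k x h)) V) ∧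
      -- successive transformations agree to order `h^{s+1}`
      (∀ s, 1 ≤ s → s + 1 ≤ r → ∃ C : ℝ, ∀ x ∈ realInterval a b, ∀ h ∈ Set.Icc (0 : ℝ) h₁,
        ‖T (s + 1) x h - T s x h‖ ≤ C * h ^ (s + 1)) ∧
      -- exponential convergence at `+∞`
      (b = ⊤ → (∃ L, ExpConvTop r A L (realInterval a b) h₀) → ∀ k, 1 ≤ k → k ≤ r →
        (∃ L, ExpConvTop (r - k) (A₁₁ k) L (realInterval a b) h₁) ∧
        (∃ L, ExpConvTop (r - k) (A₂₂ k) L (realInterval a b) h₁) ∧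
        ExpConvTop (r - k) (θ₁ k) (fun _ => 0) (realInterval a b) h₁ ∧
        ExpConvTop (r - k) (θ₂ k) (fun _ => 0) (realInterval a b) h₁) ∧
      -- exponential convergence at `-∞`
      (a = ⊥ → (∃ L, ExpConvBot r A L (realInterval a b) h₀) → ∀ k, 1 ≤ k → k ≤ r →
        (∃ L, ExpConvBot (r - k) (A₁₁ k) L (realInterval a b) h₁) ∧
        (∃ L, ExpConvBot (r - k) (A₂₂ k) L (realInterval a b) h₁) ∧
        ExpConvBot (r - k) (θ₁ k) (fun _ => 0) (realInterval a b) h₁ ∧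
        ExpConvBot (r - k) (θ₂ k) (fun _ => 0) (realInterval a b) h₁) ∧
      -- analyticity on a strip and wedges, with exponential convergence there
      (∀ δ β M : ℝ, 0 < δ → 0 < β →
        (∃ G Lp Lm, IsAnalyticExtension r a b (stripWedge a b δ β M) h₀ A G Lp Lm) →
        ∃ δ' β' M' : ℝ, 0 < δ' ∧ 0 < β' ∧ stripWedge a b δ' β' M' ⊆ stripWedge a b δ β M ∧
          ∀ k, 1 ≤ k → k ≤ r →
            (∃ G Lp Lm,
              IsAnalyticExtension r a b (stripWedge a b δ' β' M') h₁ (T k) G Lp Lm ∧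
              UniformlyInvertibleOn G (stripWedge a b δ' β' M') h₁) ∧
            (∃ G Lp Lm,
              IsAnalyticExtension (r - k) a b (stripWedge a b δ' β' M') h₁ (A₁₁ k) G Lp Lm) ∧
            (∃ G Lp Lm,
              IsAnalyticExtension (r - k) a b (stripWedge a b δ' β' M') h₁ (A₂₂ k) G Lp Lm) ∧
            (∃ G, IsAnalyticExtension (r - k) a b (stripWedge a b δ' β' M') h₁ (θ₁ k) G
              (fun _ => 0) (fun _ => 0)) ∧
            (∃ G, IsAnalyticExtension (r - k) a b (stripWedge a b δ' β' M') h₁ (θ₂ k) G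
              (fun _ => 0) (fun _ => 0))) := by
  rcases Nat.eq_zero_or_pos r with rfl | hr
  · refine ⟨h₀, hh₀, le_rfl, 0, 0, 0, 0, 0, fun k h1 h2 => by omega, fun s h1 h2 => by omega,
      fun _ _ k h1 h2 => by omega, fun _ _ k h1 h2 => by omega, fun δ β M hδ hβ _ =>
      ⟨δ, β, M, hδ, hβ, subset_rfl, fun k h1 h2 => by omega⟩⟩
  obtain ⟨Φ⟩ := exists_intervalFlow hab
  -- With an analytic extension on some region, the complex construction also yields all real
  -- conclusions. Without one, the assertion about analyticity is void and the real construction is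
  -- used.
  by_cases han : ∃ δ β M : ℝ, 0 < δ ∧ 0 < β ∧
      ∃ G Lp Lm, IsAnalyticExtension r a b (stripWedge a b δ β M) h₀ A G Lp Lm
  · obtain ⟨δ, β, M, hδ, hβ, G, Lp, Lm, hG⟩ := han
    obtain ⟨h₁, hh₁₀, δ', M', hδ', D, η, hη, s, T, T', Tinv, A₁₁, A₂₂, θ₁, θ₂, B⟩ :=
      exists_complex_blockDiag hr hab hh₀ hA hlam hmu hchar hd hsep Φ hδ hβ hG
    have hGA : ∀ x ∈ realInterval a b, ∀ h ∈ Set.Icc 0 h₁, G (x : ℂ) h = A x h :=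
      fun x hx h hh => hG.1 x hx h ⟨hh.1, hh.2.trans hh₁₀⟩
    have hcon := fun k hk hkr => B.real_conclusion hab D hη hGA (k := k) hk hkr
    have hpt : b = ⊤ → IsInfiniteEnd a b true := fun h => by simpa [IsInfiniteEnd] using h
    have hpb : a = ⊥ → IsInfiniteEnd a b false := fun h => by simpa [IsInfiniteEnd] using h
    -- The transformation and the diagonal blocks do not depend on `k`, so consecutive
    -- transformations have difference `0`.
    refine ⟨h₁, D.h₁_pos, hh₁₀, fun _ x h => T x h, fun _ x h => A₁₁ x h, fun _ x h => A₂₂ x h,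
      fun k x h => θ₁ k x h, fun k x h => θ₂ k x h, fun k hk hkr => (hcon k hk hkr).1,
      fun s _ _ => ⟨0, fun x _ h _ => by simp⟩, fun hb _ k hk hkr => ?_, fun ha _ k hk hkr => ?_,
      fun δ₂ β₂ M₂ hδ₂ hβ₂ _ => ?_⟩
    · have h := (hcon k hk hkr).2 true (hpt hb)
      simp only [expConv_true] at h
      exact h
    · have h := (hcon k hk hkr).2 false (hpb ha)
      simp only [expConv_false] at h
      exact h
    -- The functions are fixed once, from one region. For any other region their extensions are
    -- restricted to a region contained in both.
    · refine ⟨min δ₂ δ', min β₂ β, max M₂ (M' + s * h₁), lt_min hδ₂ hδ', lt_min hβ₂ hβ,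
        stripWedge_subset (min_le_left _ _) (lt_min hβ₂ hβ) (min_le_left _ _) (le_max_left _ _),
        fun k hk hkr => ?_⟩
      have hsub : stripWedge a b (min δ₂ δ') (min β₂ β) (max M₂ (M' + s * h₁)) ⊆
          stripWedge a b δ' β (M' + s * h₁) := stripWedge_subset (min_le_right _ _)
        (lt_min hβ₂ hβ) (min_le_right _ _) (le_max_right _ _)
      have hle : r - k ≤ r - 1 := by omega
      obtain ⟨Lp₁, Lm₁, -, -, e₁⟩ := B.cls.isAnalyticExtension D hη hpt hpb
      obtain ⟨Lp₂, Lm₂, -, -, e₂⟩ := (B.cls₁₁.of_le hle).isAnalyticExtension D hη hpt hpb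
      obtain ⟨Lp₃, Lm₃, -, -, e₃⟩ := (B.cls₂₂.of_le hle).isAnalyticExtension D hη hpt hpb
      obtain ⟨Lp₄, Lm₄, hp₄, hm₄, e₄⟩ := (B.cls₁ k hk hkr).isAnalyticExtension D hη hpt hpb
      obtain ⟨Lp₅, Lm₅, hp₅, hm₅, e₅⟩ := (B.cls₂ k hk hkr).isAnalyticExtension D hη hpt hpb
      obtain rfl := hp₄ trivial
      obtain rfl := hm₄ trivial
      obtain rfl := hp₅ trivial
      obtain rfl := hm₅ trivial
      obtain ⟨C, hC⟩ := B.norm_inv_le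
      have ho := isOpen_stripWedge a b δ' β (M' + s * h₁)
      have ho' := isOpen_stripWedge a b (min δ₂ δ') (min β₂ β) (max M₂ (M' + s * h₁))
      exact ⟨⟨T, Lp₁, Lm₁, e₁.mono D.h₁_pos ho ho' hsub, C, fun z hz => hC z (hsub hz)⟩,
        ⟨A₁₁, Lp₂, Lm₂, e₂.mono D.h₁_pos ho ho' hsub⟩,
        ⟨A₂₂, Lp₃, Lm₃, e₃.mono D.h₁_pos ho ho' hsub⟩,
        ⟨θ₁ k, e₄.mono D.h₁_pos ho ho' hsub⟩, ⟨θ₂ k, e₅.mono D.h₁_pos ho ho' hsub⟩⟩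
  · obtain ⟨h₁, hh₁₀, D, η, hη, s, T, T', Tinv, A₁₁, A₂₂, θ₁, θ₂, B⟩ :=
      -- Only those infinite ends at which `A` converges are treated as ends of the frame, so
      -- convergence at one end is not needed for the other.
      exists_real_blockDiag (p := fun e => IsInfiniteEnd a b e ∧
        ∃ L, ExpConv e r A L (realInterval a b) h₀) hr hab hh₀ hA hlam hmu hchar hd hsep Φ
        (fun e he => he.1) fun e he => he.2
    have hcon := fun k hk hkr => B.real_conclusion hab D hη (AR := A)
      (fun x _ h _ => rfl) (k := k) hk hkr
    refine ⟨h₁, D.h₁_pos, hh₁₀, fun _ => T, fun _ => A₁₁, fun _ => A₂₂, θ₁, θ₂,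
      fun k hk hkr => (hcon k hk hkr).1, fun s _ _ => ⟨0, fun x _ h _ => by simp⟩,
      fun hb hL k hk hkr => ?_, fun ha hL k hk hkr => ?_, fun δ β M hδ hβ hG =>
      absurd ⟨δ, β, M, hδ, hβ, hG⟩ han⟩
    · have h := (hcon k hk hkr).2 true ⟨by simpa [IsInfiniteEnd] using hb, by
        simpa only [expConv_true] using hL⟩
      simpa only [expConv_true] using! h
    · have h := (hcon k hk hkr).2 false ⟨by simpa [IsInfiniteEnd] using ha, by
        simpa only [expConv_false] using hL⟩
      simpa only [expConv_false] using! h
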